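/- **Setting.** Let $r_\infty\ge 1$, $n\ge 0$, $r_1,\dots,r_n\ge 1$ be integers with $g:=r_\infty-3+\sum_{s=1}^n r_s>0$, and let $\hbar\in\mathbb C\setminus\{0\}$. Poles are $\infty$ (order $r_\infty$) and $X_1,\dots,X_n$ (orders $r_s$); put $r_{X_s}:=r_s$. The monodromies $t_{p^{(i)},0}$ ($p\in\{\infty,X_1,\dots,X_n\}$, $i=1,2$) are fixed complex numbers with $\sum_{p,i}t_{p^{(i)},0}=0$. The deformation parameters ("times") $\mathbf t$ are the irregular times $t_{p^{(i)},k}$ ($i=1,2$, $1\le k\le r_p-1$) and the positions $X_s$. Write $\hat t_{p,k}:=t_{p^{(1)},k}-t_{p^{(2)},k}$, $T_{p,k}:=t_{p^{(1)},k}+t_{p^{(2)},k}$. Let $U$ be an open set of times where the $X_s$ are distinct and $\hat t_{p,r_p-1}\neq0$ whenever $r_p\ge2$. The phase space consists of $(q,p,\mathbf t)$ with $q,p\in\mathbb C^g$, $\mathbf t\in U$, the $q_j$ distinct and different from all $X_s$. Put $$P_1(\lambda)=-\sum_{k=1}^{r_\infty-1}T_{\infty,k}\lambda^{k-1}+\sum_{s}\sum_{k=0}^{r_s-1}\frac{T_{X_s,k}}{(\lambda-X_s)^{k+1}},$$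 $$\tilde P_2(\lambda)=\sum_{\substack{0\le a,b\le r_\infty-1\\ a+b\ge \max(2,r_\infty-1)}}t_{\infty^{(1)},a}t_{\infty^{(2)},b}\lambda^{a+b-2}+\sum_s\sum_{\substack{0\le a,b\le r_s-1\\ a+b\ge r_s-1}}\frac{t_{X_s^{(1)},a}t_{X_s^{(2)},b}}{(\lambda-X_s)^{a+b+2}}.$$ **Coefficients $H$.** $H_{\infty,k}$ ($0\le k\le r_\infty-4$) and $H_{X_s,k}$ ($1\le k\le r_s$) are the unique solution of the linear system: for all $j$, $$\sum_{k}H_{\infty,k}q_j^k+\sum_{s,k}\frac{H_{X_s,k}}{(q_j-X_s)^k}=p_j^2-P_1(q_j)p_j+p_j\sum_s\frac{\hbar r_s}{q_j-X_s}+\tilde P_2(q_j)+\hbar\sum_{i\ne j}\frac{p_i-p_j}{q_j-q_i}+\hbar t_{\infty^{(1)},r_\infty-1}q_j^{r_\infty-3}\delta_{r_\infty\ge3},$$ together with, if $r_\infty=2$, $\sum_sH_{X_s,1}=\hbar\sum_jp_j-(t_{\infty^{(1)},1}t_{\infty^{(2)},0}+t_{\infty^{(2)},1}t_{\infty^{(1)},0}+\hbar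 t_{\infty^{(1)},1})$, and, if $r_\infty=1$, $\sum_sH_{X_s,1}=\hbar\sum_jp_j$ and $\sum_s(X_sH_{X_s,1}+H_{X_s,2}\delta_{r_s\ge2})=\hbar\sum_jq_jp_j+\sum_{s:\,r_s=1}t_{X_s^{(1)},0}t_{X_s^{(2)},0}-t_{\infty^{(1)},0}(t_{\infty^{(2)},0}+\hbar)$. **Hamiltonians.** For a deformation vector $\alpha$ (one component per time) let $\hat\alpha_{p,k}:=\alpha_{p^{(1)},k}-\alpha_{p^{(2)},k}$, and let $M_p$ be the lower triangular Toeplitz matrix of size $r_p-1$ with $(a,b)$ entry $\hat t_{p,r_p-1-(a-b)}$, $a\ge b$. Define $\nu,c$ by $$M_\infty(\nu_{\infty,-1},\nu_{\infty,0},\dots,\nu_{\infty,r_\infty-3})^{T}=\Big(\tfrac{\hat\alpha_{\infty,r_\infty-1-m}}{r_\infty-1-m}\Big)_{m=0}^{r_\infty-2},\qquad M_{X_s}(\nu_{X_s,1},\dots,\nu_{X_s,r_s-1})^{T}=-\Big(\tfrac{\hat\alpha_{X_s,r_s-1-m}}{r_s-1-m}\Big)_{m=0}^{r_s-2},$$ $$M_p(c_{p,r_p-1},\dots,c_{p,1})^T=\Big(\sum_{k=i}^{r_p-1}\tfrac1k\big(t_{p^{(2)},r_p-1+i-k}\,\alpha_{p^{(1)},k}-t_{p^{(1)},r_p-1+i-k}\,\alpha_{p^{(2)},k}\big)\Big)_{i=r_p-1,\dots,1}$$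 ($\nu_{\infty,-1},\nu_{\infty,0}$ are set to $0$ when they are not determined, i.e. for $r_\infty\leq1$, resp. $r_\infty\le2$), and, with a further coefficient $c_{\infty,0}$ which is a free function of the times only, $$\begin{aligned}\mathrm{Ham}^{(\alpha)}={}&\sum_{k=0}^{r_\infty-4}\nu_{\infty,k+1}H_{\infty,k}-\sum_s\sum_{k=2}^{r_s}\nu_{X_s,k-1}H_{X_s,k}+\sum_s\alpha_{X_s}H_{X_s,1}-\hbar\sum_{j=1}^g\Big[\sum_{k=0}^{r_\infty-1}c_{\infty,k}q_j^k+\sum_s\sum_{k=1}^{r_s-1}\tfrac{c_{X_s,k}}{(q_j-X_s)^k}\Big]\\&+\nu_{\infty,-1}\Big(A-\hbar\sum_jq_jp_j\Big)(1-\delta_{r_\infty=1})+\nu_{\infty,0}\Big(B-\hbar\sum_jp_j\Big)(1-\delta_{r_\infty\in\{1,2\}}),\end{aligned}$$ where $A=\sum_s(X_sH_{X_s,1}+H_{X_s,2}\delta_{r_s\ge2})$, $B=\sum_sH_{X_s,1}$. Let $\mathcal L_\alpha$ be the vector field with $\mathcal L_\alpha[q_j]=\partial_{p_j}\mathrm{Ham}^{(\alpha)}$,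 $\mathcal L_\alpha[p_j]=-\partial_{q_j}\mathrm{Ham}^{(\alpha)}$, $\mathcal L_\alpha[\mathbf t]=\hbar\alpha$. The fundamental two-form, over all irregular times and pole positions, is $$\Omega=\hbar\sum_{j}dq_j\wedge dp_j-\sum_{t\in\{t_{p^{(i)},k}\}\cup\{X_s\}}dt\wedge d\,\mathrm{Ham}^{(\mathbf e_t)}.$$ **Trivial and isomonodromic times.** Let $T_2$ be a holomorphic function on $U$ with $T_2^{r_\infty-1}=\frac12\hat t_{\infty,r_\infty-1}$ if $r_\infty\ge2$; $T_2=(X_2-X_1)^{-1}$ if $r_\infty=1$, $n\ge2$; $(T_2^{-1})^{r_1-1}=\frac12\hat t_{X_1,r_1-1}$ if $r_\infty=n=1$. Put $T_1=\frac{\hat t_{\infty,r_\infty-2}}{2(r_\infty-2)T_2^{r_\infty-2}}$ if $r_\infty\ge3$ and $T_1=-X_1T_2$ if $r_\infty\le2$. The set $\mathcal T_{\rm iso}$ consists of * for $1\le j\le r_\infty-3$ (with $r=r_\infty$), $$\tau_{\infty,j}=\sum_{i=0}^{r-j-3}\frac{(-1)^i(j+i-1)!}{i!(j-1)!(r-2)^i}\frac{\hat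 t_{\infty,r-2}^{\,i}\,\hat t_{\infty,j+i}}{(2T_2^{r-1})^iT_2^j}+\frac{(-1)^{r-j-2}(r-3)!}{(r-1-j)(r-j-3)!(j-1)!(r-2)^{r-j-2}}\frac{\hat t_{\infty,r-2}^{\,r-1-j}}{2^{r-2-j}T_2^{(r-2)(r-1-j)}};$$ * $\tau_{X_s,k}=\hat t_{X_s,k}T_2^k$ for $1\le k\le r_s-1$ (without $k=r_1-1$ if $r_\infty=n=1$); * $\tilde X_s=T_2X_s+T_1$ for all $s$ if $r_\infty\ge3$, for $s\ge2$ if $r_\infty=2$, for $s\ge3$ if $r_\infty=1$. Their dual vectors are: $(\alpha_{\tau_{\infty,m}})_{\infty^{(i)},k}=\frac{(-1)^{i+1}}2\binom{m-1}{k-1}T_2^kT_1^{m-k}$ for $k\le m$; $\alpha_{\tau_{X_s,k}}=\frac12T_2^{-k}(\mathbf e_{X_s^{(1)},k}-\mathbf e_{X_s^{(2)},k})$; $\alpha_{\tilde X_s}=T_2^{-1}\mathbf e_{X_s}$ (all other components $0$). The shifted Darboux coordinates are $$\check q_j=T_2q_j+T_1,\qquad \check p_j=T_2^{-1}\big(p_j-\tfrac12P_1(q_j)\big).$$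 For $\tau\in\mathcal T_{\rm iso}$, the Hamiltonian $\mathrm{Ham}^{(\alpha_\tau)}(\check q,\check p,\mathcal T_{\rm iso})$ in the shifted coordinates is the function obtained from the above formula for $\mathrm{Ham}^{(\alpha_\tau)}$, with $c_{\infty,0}=0$, by putting $(q,p)=(\check q,\check p)$ and giving the trivial times their canonical values: all $T_{p,k}=0$ (for $k=0$ too, i.e. each monodromy $t_{p^{(i)},0}$ is replaced by $\frac{(-1)^{i+1}}2(t_{p^{(1)},0}-t_{p^{(2)},0})$), $T_1=0$, $T_2=1$, the isomonodromic times being kept (so $t_{\infty^{(i)},r_\infty-1}=(-1)^{i+1}$ if $r_\infty\ge2$, $t_{\infty^{(i)},r_\infty-2}=0$ if $r_\infty\geq3$, $t_{\infty^{(i)},k}=\frac{(-1)^{i+1}}2\tau_{\infty,k}$ for $k\le r_\infty-3$, $t_{X_s^{(i)},k}=\frac{(-1)^{i+1}}2\tau_{X_s,k}$, $t_{X_1^{(i)},r_1-1}=(-1)^{i+1}$ if $r_\infty=n=1$, $X_s=\tilde X_s$, where $X_1=0$ if $r_\infty\le2$ and $X_2=1$ if $r_\infty=1$). **Theorem.**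 (i) $\mathcal T_{\rm iso}$ has exactly $g$ elements, and $\sum_t(\alpha_\tau)_t\,\partial_t\tau'=\delta_{\tau,\tau'}$ for $\tau,\tau'\in\mathcal T_{\rm iso}$. The linear system for $H$ has a unique solution at every point of the phase space. (ii) There are holomorphic functions $c_{\infty,0}^{(\mathbf e_t)}$ on $U$, one for each irregular time or pole position $t$, such that with this choice of the free coefficients (extended linearly in $\alpha$) all Hamiltonians, the $\check q_j,\check p_j$ and the isomonodromic times are differentiable and, on the whole phase space, $$\Omega=\hbar\sum_{j=1}^gd\check q_j\wedge d\check p_j-\sum_{\tau\in\mathcal T_{\rm iso}}d\tau\wedge d\,\mathrm{Ham}^{(\alpha_\tau)}(\check q,\check p,\mathcal T_{\rm iso}).$$ (iii) The deformation space reduces to $g$ non-trivial directions: for every deformation vector $\alpha$ and every $j$, $$\mathcal L_\alpha[\check q_j]=\sum_{\tau\in\mathcal T_{\rm iso}}d\tau(\alpha)\,\frac{\partial\mathrm{Ham}^{(\alpha_\tau)}}{\partial\check p_j}(\check q,\check p,\mathcal T_{\rm iso}),\qquad \mathcal L_\alpha[\check p_j]=-\sum_{\tau\in\mathcal T_{\rm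 iso}}d\tau(\alpha)\,\frac{\partial\mathrm{Ham}^{(\alpha_\tau)}}{\partial\check q_j}(\check q,\check p,\mathcal T_{\rm iso}).$$ -/

import Mathlib

open scoped BigOperators

noncomputable section

namespace Isomono

/-- Pole data of a meromorphic `gl₂` connection with unramified poles: a pole at infinity of order
`rInf` and `n` finite poles of orders `r s`, with `g = rInf - 3 + ∑ r s > 0`. -/
structure PoleData where
  rInf : ℕ
  n : ℕ
  r : Fin n → ℕ
  rInf_pos : 1 ≤ rInf
  r_pos : ∀ s, 1 ≤ r s
  genus_pos : 3 < rInf + ∑ s, r s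

/-- Sign of the two sheets: `+1` for the sheet `(1)` (index `0`), `-1` for the sheet `(2)`
(index `1`). -/
def sgn (i : Fin 2) : ℂ := if i = 0 then 1 else -1

namespace PoleData

variable (S : PoleData)

/-- The genus of the spectral curve. -/
def g : ℕ := S.rInf + (∑ s, S.r s) - 3

/-- A pole: `none` is infinity, `some s` is the finite pole `X_s`. -/
abbrev Pole : Type := Option (Fin S.n)

/-- The order of a pole. -/
def ord : S.Pole → ℕ
  | none => S.rInf
  | some s => S.r s

/-- Index set of the deformation parameters. `Sum.inl ⟨p, i, k⟩` is the irregular time of the pole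
`p` on sheet `i` with (one-based) index `k + 1`, for `1 ≤ k + 1 ≤ ord p - 1`; `Sum.inr s` is the
position of the `s`-th finite pole. -/
abbrev TimeIdx : Type := (Σ p : S.Pole, Fin 2 × Fin (S.ord p - 1)) ⊕ Fin S.n

/-- Values of all irregular times and pole positions; also the type of deformation vectors `α`. -/
abbrev Times : Type := S.TimeIdx → ℂ

/-- Monodromies `t_{p^{(i)}, 0}`, kept fixed. -/
abbrev Mono : Type := S.Pole → Fin 2 → ℂ

/-- Points `(q, p, t)` of the total space. -/
abbrev Phase : Type := (Fin S.g → ℂ) × (Fin S.g → ℂ) × S.Times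

/-- `t_{p^{(i)}, k}`, for `0 ≤ k ≤ ord p - 1`, the index `0` being the monodromy. -/
def time (m : S.Mono) (t : S.Times) (p : S.Pole) (i : Fin 2) (k : ℕ) : ℂ :=
  if k = 0 then m p i
  else if h : k - 1 < S.ord p - 1 then t (Sum.inl ⟨p, i, ⟨k - 1, h⟩⟩) else 0

/-- The position of the `s`-th finite pole. -/
def pos (t : S.Times) (s : Fin S.n) : ℂ := t (Sum.inr s)

/-- The difference `t_{p^{(1)}, k} - t_{p^{(2)}, k}` for `k ≥ 1` (it does not involve the
monodromies). -/
def dtime (t : S.Times) (p : S.Pole) (k : ℕ) : ℂ := S.time 0 t p 0 k - S.time 0 t p 1 k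

/-- Admissible times: distinct finite poles, and distinct leading coefficients at every pole of
order at least two. -/
def Admissible (t : S.Times) : Prop :=
  Function.Injective (S.pos t) ∧ ∀ p, 2 ≤ S.ord p → S.dtime t p (S.ord p - 1) ≠ 0

/-- Admissible points: the `q_j` are distinct and avoid the finite poles. -/
def phaseDomain (U : Set S.Times) : Set S.Phase :=
  {x | x.2.2 ∈ U ∧ Function.Injective x.1 ∧ ∀ j s, x.1 j ≠ S.pos x.2.2 s}

/-! ### The spectral curve -/

/-- The trace coefficient `P₁(λ)` of the spectral curve. -/
def P1 (m : S.Mono) (t : S.Times) (z : ℂ) : ℂ :=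
  -∑ k ∈ Finset.Icc 1 (S.rInf - 1), (S.time m t none 0 k + S.time m t none 1 k) * z ^ (k - 1)
    + ∑ s, ∑ k ∈ Finset.range (S.r s),
        (S.time m t (some s) 0 k + S.time m t (some s) 1 k) / (z - S.pos t s) ^ (k + 1)

/-- The part `P̃₂(λ)` of the determinant coefficient that is determined by the times and the
monodromies. -/
def P2 (m : S.Mono) (t : S.Times) (z : ℂ) : ℂ :=
  (∑ a ∈ Finset.range S.rInf, ∑ b ∈ Finset.range S.rInf,
      if S.rInf ≤ a + b + 1 ∧ 2 ≤ a + b then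
        S.time m t none 0 a * S.time m t none 1 b * z ^ (a + b - 2) else 0)
    + ∑ s, ∑ a ∈ Finset.range (S.r s), ∑ b ∈ Finset.range (S.r s),
        if S.r s ≤ a + b + 1 then
          S.time m t (some s) 0 a * S.time m t (some s) 1 b / (z - S.pos t s) ^ (a + b + 2) else 0

/-! ### The coefficients `H` -/

/-- `Sum.inl k` indexes `H_{∞, k}` for `0 ≤ k ≤ rInf - 4`; `Sum.inr ⟨s, k⟩` indexes
`H_{X_s, k + 1}` for `1 ≤ k + 1 ≤ r s`. -/
abbrev HIdx : Type := Fin (S.rInf - 3) ⊕ (Σ s : Fin S.n, Fin (S.r s))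

/-- `H_{X_s, k}` for `1 ≤ k ≤ r s`, and `0` for larger `k`. -/
def HX (H : S.HIdx → ℂ) (s : Fin S.n) (k : ℕ) : ℂ :=
  if h : k - 1 < S.r s then H (Sum.inr ⟨s, ⟨k - 1, h⟩⟩) else 0

/-- `∑ₛ H_{X_s, 1}`. -/
def sumH1 (H : S.HIdx → ℂ) : ℂ := ∑ s, S.HX H s 1

/-- `∑ₛ (X_s H_{X_s, 1} + H_{X_s, 2} δ_{r_s ≥ 2})`. -/
def sumH2 (t : S.Times) (H : S.HIdx → ℂ) : ℂ := ∑ s, (S.pos t s * S.HX H s 1 + S.HX H s 2)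

/-- The linear system that determines the coefficients `H` from `(q, p, t)`: `g` equations, plus
one equation if `rInf = 2`, plus two equations if `rInf = 1`. -/
def IsHSolution (ħ : ℂ) (m : S.Mono) (x : S.Phase) (H : S.HIdx → ℂ) : Prop :=
  (∀ j : Fin S.g,
    (∑ k : Fin (S.rInf - 3), H (Sum.inl k) * x.1 j ^ (k : ℕ))
      + ∑ s, ∑ k : Fin (S.r s), H (Sum.inr ⟨s, k⟩) / (x.1 j - S.pos x.2.2 s) ^ ((k : ℕ) + 1)
    = x.2.1 j ^ 2 - S.P1 m x.2.2 (x.1 j) * x.2.1 j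
      + x.2.1 j * ∑ s, ħ * (S.r s : ℂ) / (x.1 j - S.pos x.2.2 s)
      + S.P2 m x.2.2 (x.1 j)
      + ħ * ∑ i ∈ Finset.univ.erase j, (x.2.1 i - x.2.1 j) / (x.1 j - x.1 i)
      + if 3 ≤ S.rInf then
          ħ * S.time m x.2.2 none 0 (S.rInf - 1) * x.1 j ^ (S.rInf - 3) else 0) ∧
  (S.rInf = 2 →
    S.sumH1 H = ħ * (∑ j, x.2.1 j)
      - (S.time m x.2.2 none 0 1 * m none 1 + S.time m x.2.2 none 1 1 * m none 0
          + ħ * S.time m x.2.2 none 0 1)) ∧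
  (S.rInf = 1 →
    S.sumH1 H = ħ * (∑ j, x.2.1 j) ∧
    S.sumH2 x.2.2 H = ħ * (∑ j, x.1 j * x.2.1 j)
      + (∑ s, if S.r s = 1 then m (some s) 0 * m (some s) 1 else 0)
      - m none 0 * (m none 1 + ħ))

/-- The solution of the linear system (unique at admissible points). -/
def Hsol (ħ : ℂ) (m : S.Mono) (x : S.Phase) : S.HIdx → ℂ :=
  Classical.epsilon (S.IsHSolution ħ m x)

/-! ### The coefficients `ν` and `c` of a deformation `α` -/

/-- The lower triangular Toeplitz matrix attached to a pole; its entry on the `d`-th lower diagonal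
is `t_{p^{(1)}, ord p - 1 - d} - t_{p^{(2)}, ord p - 1 - d}`. -/
def toep (t : S.Times) (p : S.Pole) : Matrix (Fin (S.ord p - 1)) (Fin (S.ord p - 1)) ℂ :=
  Matrix.of fun a b => if b ≤ a then S.dtime t p (S.ord p - 1 - ((a : ℕ) - (b : ℕ))) else 0

/-- The vector `(ν_{∞, -1}, ν_{∞, 0}, …)` for `p = none` and `(ν_{X_s, 1}, ν_{X_s, 2}, …)` for
`p = some s`, extended by zero. -/
def nuVec (t α : S.Times) (p : S.Pole) (a : ℕ) : ℂ :=
  if h : a < S.ord p - 1 then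
    ((S.toep t p)⁻¹.mulVec fun b =>
      (if p = none then 1 else -1) * S.dtime α p (S.ord p - 1 - (b : ℕ))
        / ((S.ord p - 1 - (b : ℕ) : ℕ) : ℂ)) ⟨a, h⟩
  else 0

/-- `ν_{∞, k}^{(α)}`, with the index shifted by one: `nuInf (k + 1) = ν_{∞, k}`. -/
def nuInf (t α : S.Times) (a : ℕ) : ℂ := S.nuVec t α none a

/-- `ν_{X_s, k}^{(α)}` for `k ≥ 1`. -/
def nuX (t α : S.Times) (s : Fin S.n) (k : ℕ) : ℂ := S.nuVec t α (some s) (k - 1)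

/-- The coefficients `c_{p, k}^{(α)}` for `1 ≤ k ≤ ord p - 1`: the vector
`(c_{p, ord p - 1}, …, c_{p, 1})` solves the Toeplitz system whose right-hand side has, in the row
of `c_{p, i}`, the entry
`∑_{k = i}^{ord p - 1} (t_{p^{(2)}, ord p - 1 + i - k} α_{p^{(1)}, k}
  - t_{p^{(1)}, ord p - 1 + i - k} α_{p^{(2)}, k}) / k`. -/
def cCoef (t α : S.Times) (p : S.Pole) (k : ℕ) : ℂ :=
  if h : S.ord p - 1 - k < S.ord p - 1 then
    ((S.toep t p)⁻¹.mulVec fun b =>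
      ∑ l ∈ Finset.Icc (S.ord p - 1 - (b : ℕ)) (S.ord p - 1),
        (S.time 0 t p 1 (S.ord p - 1 + (S.ord p - 1 - (b : ℕ)) - l) * S.time 0 α p 0 l
          - S.time 0 t p 0 (S.ord p - 1 + (S.ord p - 1 - (b : ℕ)) - l) * S.time 0 α p 1 l)
          / (l : ℂ)) ⟨S.ord p - 1 - k, h⟩
  else 0

/-! ### The Hamiltonians -/

/-- The Hamiltonian `Ham^{(α)}(q, p, t)`. The function `c0` is the coefficient `c_{∞, 0}^{(α)}`,
which is a free function of the times. -/
def Ham (ħ : ℂ) (m : S.Mono) (c0 : S.Times → ℂ) (α : S.Times) (x : S.Phase) : ℂ :=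
  (∑ k : Fin (S.rInf - 3), S.nuInf x.2.2 α ((k : ℕ) + 2) * S.Hsol ħ m x (Sum.inl k))
    - (∑ s, ∑ k ∈ Finset.Icc 2 (S.r s), S.nuX x.2.2 α s (k - 1) * S.HX (S.Hsol ħ m x) s k)
    + (∑ s, S.pos α s * S.HX (S.Hsol ħ m x) s 1)
    - ħ * (∑ j, (c0 x.2.2
        + (∑ k ∈ Finset.Icc 1 (S.rInf - 1), S.cCoef x.2.2 α none k * x.1 j ^ k)
        + ∑ s, ∑ k ∈ Finset.Icc 1 (S.r s - 1),
            S.cCoef x.2.2 α (some s) k / (x.1 j - S.pos x.2.2 s) ^ k))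
    + S.nuInf x.2.2 α 0 * S.sumH2 x.2.2 (S.Hsol ħ m x)
    + S.nuInf x.2.2 α 1 * S.sumH1 (S.Hsol ħ m x)
    - (if S.rInf ≤ 2 then
        (S.sumH1 (S.Hsol ħ m x) - ħ * ∑ j, x.2.1 j) * S.nuInf x.2.2 α 1 else 0)
    - (if S.rInf = 1 then
        (S.sumH2 x.2.2 (S.Hsol ħ m x) - ħ * ∑ j, x.1 j * x.2.1 j) * S.nuInf x.2.2 α 0 else 0)
    - ħ * S.nuInf x.2.2 α 1 * (∑ j, x.2.1 j)
    - ħ * S.nuInf x.2.2 α 0 * (∑ j, x.1 j * x.2.1 j)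

/-- The elementary deformation vector `e_i`. -/
def basisVec (i : S.TimeIdx) : S.Times := Pi.single i 1

end PoleData

/-- The two-form `df ∧ dh` at `x`, evaluated on the tangent vectors `u` and `v`. -/
def wedge {E : Type*} [NormedAddCommGroup E] [NormedSpace ℂ E] (f h : E → ℂ) (x u v : E) : ℂ :=
  fderiv ℂ f x u * fderiv ℂ h x v - fderiv ℂ f x v * fderiv ℂ h x u

namespace PoleData

variable (S : PoleData)

/-- The fundamental two-form
`Ω = ħ ∑ dq_j ∧ dp_j - ∑ dt ∧ dHam^{(e_t)}`, the second sum running over all irregular times and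
pole positions; `c0 i` is the free coefficient `c_{∞, 0}` of the Hamiltonian of the `i`-th
deformation. -/
def Omega (ħ : ℂ) (m : S.Mono) (c0 : S.TimeIdx → S.Times → ℂ) (x u v : S.Phase) : ℂ :=
  ħ * (∑ j : Fin S.g,
      wedge (fun y : S.Phase => y.1 j) (fun y : S.Phase => y.2.1 j) x u v)
    - ∑ i : S.TimeIdx,
        wedge (fun y : S.Phase => y.2.2 i) (S.Ham ħ m (c0 i) (S.basisVec i)) x u v

/-- The Hamiltonian vector field of the deformation `α`:
`L_α[q_j] = ∂Ham/∂p_j`, `L_α[p_j] = -∂Ham/∂q_j`, `L_α[t] = ħ α`. -/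
def evolution (ħ : ℂ) (m : S.Mono) (c0 : S.Times → ℂ) (α : S.Times) (x : S.Phase) : S.Phase :=
  (fun j => fderiv ℂ (S.Ham ħ m c0 α) x (0, Pi.single j 1, 0),
    fun j => -fderiv ℂ (S.Ham ħ m c0 α) x (Pi.single j 1, 0, 0),
    ħ • α)

/-! ### Trivial times `T₁`, `T₂` and isomonodromic times -/

/-- `T₂` on `U`: a branch of the root that defines it if `rInf ≥ 2` or `n = 1`. -/
def IsT2 (T2 : S.Times → ℂ) (U : Set S.Times) : Prop :=
  DifferentiableOn ℂ T2 U ∧ ∀ t ∈ U,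
    (2 ≤ S.rInf → T2 t ^ (S.rInf - 1) = S.dtime t none (S.rInf - 1) / 2) ∧
    (S.rInf = 1 → ∀ a b : Fin S.n, (a : ℕ) = 0 → (b : ℕ) = 1 →
      T2 t = (S.pos t b - S.pos t a)⁻¹) ∧
    (S.rInf = 1 → S.n = 1 → ∀ s : Fin S.n,
      ((T2 t)⁻¹) ^ (S.r s - 1) = S.dtime t (some s) (S.r s - 1) / 2)

/-- `T₁`, for a given value of `T₂`. For `rInf ≤ 2` it is `-X₁ T₂` (the first finite pole has
index `0`). -/
def T1 (T2 : S.Times → ℂ) (t : S.Times) : ℂ :=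
  if 3 ≤ S.rInf then
    S.dtime t none (S.rInf - 2) / (2 * ((S.rInf - 2 : ℕ) : ℂ) * T2 t ^ (S.rInf - 2))
  else -(∑ s : Fin S.n, if (s : ℕ) = 0 then S.pos t s else 0) * T2 t

/-- The leading index of the finite pole is trivial if `rInf = 1` and `n = 1`. -/
def IsTrivialIdx (a : Σ s : Fin S.n, Fin (S.r s - 1)) : Prop :=
  S.rInf = 1 ∧ S.n = 1 ∧ (a.2 : ℕ) + 2 = S.r a.1

instance : DecidablePred S.IsTrivialIdx := fun a => by
  unfold IsTrivialIdx; infer_instance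

/-- Index set of the isomonodromic times: `Sum.inl j` is `τ_{∞, j + 1}`
(`1 ≤ j + 1 ≤ rInf - 3`); `Sum.inr (Sum.inl ⟨s, k⟩)` is `τ_{X_s, k + 1}`
(`1 ≤ k + 1 ≤ r s - 1`, without the leading one if `rInf = 1` and `n = 1`);
`Sum.inr (Sum.inr s)` is `X̃_s`, for all finite poles if `rInf ≥ 3`, all but the first one if
`rInf = 2`, all but the first two if `rInf = 1`. -/
abbrev IsoIdx : Type :=
  Fin (S.rInf - 3) ⊕ ({a : Σ s : Fin S.n, Fin (S.r s - 1) // ¬S.IsTrivialIdx a}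
    ⊕ {s : Fin S.n // 3 - S.rInf ≤ (s : ℕ)})

/-- The time `τ_{∞, j}` for `1 ≤ j ≤ rInf - 3`. -/
def tauInf (T2 : S.Times → ℂ) (t : S.Times) (j : ℕ) : ℂ :=
  (∑ i ∈ Finset.range (S.rInf - j - 2),
      ((-1) ^ i * (Nat.factorial (j + i - 1) : ℂ)
          / ((Nat.factorial i : ℂ) * (Nat.factorial (j - 1) : ℂ) * ((S.rInf - 2 : ℕ) : ℂ) ^ i))
        * (S.dtime t none (S.rInf - 2) ^ i * S.dtime t none (j + i)
            / ((2 * T2 t ^ (S.rInf - 1)) ^ i * T2 t ^ j)))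
    + ((-1) ^ (S.rInf - j - 2) * (Nat.factorial (S.rInf - 3) : ℂ)
        / (((S.rInf - 1 - j : ℕ) : ℂ) * (Nat.factorial (S.rInf - j - 3) : ℂ)
            * (Nat.factorial (j - 1) : ℂ) * ((S.rInf - 2 : ℕ) : ℂ) ^ (S.rInf - j - 2)))
      * (S.dtime t none (S.rInf - 2) ^ (S.rInf - 1 - j)
          / (2 ^ (S.rInf - 2 - j) * T2 t ^ ((S.rInf - 2) * (S.rInf - 1 - j))))

/-- The isomonodromic times as functions of the irregular times and pole positions. -/
def isoTime (T2 : S.Times → ℂ) (I : S.IsoIdx) (t : S.Times) : ℂ :=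
  match I with
  | Sum.inl j => S.tauInf T2 t ((j : ℕ) + 1)
  | Sum.inr (Sum.inl a) => S.dtime t (some a.1.1) ((a.1.2 : ℕ) + 1) * T2 t ^ ((a.1.2 : ℕ) + 1)
  | Sum.inr (Sum.inr s) => T2 t * S.pos t s.1 + S.T1 T2 t

/-- The deformation vector `α_τ` dual to the isomonodromic time `τ`, that is
`∂_τ = ∑ α_τ ∂_t`, for given values `T1`, `T2` of the trivial times. -/
def isoVec (T1 T2 : ℂ) (I : S.IsoIdx) (i : S.TimeIdx) : ℂ :=
  match I, i with
  | Sum.inl j, Sum.inl ⟨none, e, k⟩ =>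
      sgn e / 2 * T2 ^ ((k : ℕ) + 1) * ((j : ℕ).choose (k : ℕ) : ℂ) * T1 ^ ((j : ℕ) - (k : ℕ))
  | Sum.inr (Sum.inl a), Sum.inl ⟨some s, e, k⟩ =>
      if s = a.1.1 ∧ (k : ℕ) = (a.1.2 : ℕ) then sgn e / 2 * (T2 ^ ((k : ℕ) + 1))⁻¹ else 0
  | Sum.inr (Sum.inr s), Sum.inr s' => if s' = s.1 then T2⁻¹ else 0
  | _, _ => 0

/-! ### The canonical choice of the trivial times -/

/-- The irregular times and pole positions with isomonodromic times `τ` and canonical trivial times: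
`t_{p^{(1)}, k} + t_{p^{(2)}, k} = 0`, `T₁ = 0`, `T₂ = 1`. -/
def canonTimes (τ : S.IsoIdx → ℂ) (i : S.TimeIdx) : ℂ :=
  match i with
  | Sum.inl ⟨none, e, k⟩ =>
      sgn e * (if (k : ℕ) + 2 = S.rInf then 1
        else if h : (k : ℕ) < S.rInf - 3 then τ (Sum.inl ⟨k, h⟩) / 2 else 0)
  | Sum.inl ⟨some s, e, k⟩ =>
      sgn e * (if h : S.IsTrivialIdx ⟨s, k⟩ then 1 else τ (Sum.inr (Sum.inl ⟨⟨s, k⟩, h⟩)) / 2)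
  | Sum.inr s =>
      if h : 3 - S.rInf ≤ (s : ℕ) then τ (Sum.inr (Sum.inr ⟨s, h⟩)) else ((s : ℕ) : ℂ)

/-- The monodromies with the same differences and with `t_{p^{(1)}, 0} + t_{p^{(2)}, 0} = 0`. -/
def canonMono (m : S.Mono) : S.Mono := fun p e => sgn e * ((m p 0 - m p 1) / 2)

/-! ### Shifted Darboux coordinates -/

/-- `q̌_j = T₂ q_j + T₁`. -/
def qCheck (T2 : S.Times → ℂ) (j : Fin S.g) (x : S.Phase) : ℂ :=
  T2 x.2.2 * x.1 j + S.T1 T2 x.2.2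

/-- `p̌_j = T₂⁻¹ (p_j - P₁(q_j) / 2)`. -/
def pCheck (m : S.Mono) (T2 : S.Times → ℂ) (j : Fin S.g) (x : S.Phase) : ℂ :=
  (T2 x.2.2)⁻¹ * (x.2.1 j - S.P1 m x.2.2 (x.1 j) / 2)

/-- Points `(q̌, p̌, τ)` of the reduced space. -/
abbrev Reduced : Type := (Fin S.g → ℂ) × (Fin S.g → ℂ) × (S.IsoIdx → ℂ)

/-- The map `(q, p, t) ↦ (q̌, p̌, τ)`. -/
def reduce (m : S.Mono) (T2 : S.Times → ℂ) (x : S.Phase) : S.Reduced :=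
  (fun j => S.qCheck T2 j x, fun j => S.pCheck m T2 j x, fun I => S.isoTime T2 I x.2.2)

/-- The Hamiltonian `Ham^{(α_τ)}(q̌, p̌, τ)` of the isomonodromic time with index `I` in the shifted
Darboux coordinates: the Hamiltonian of the deformation `α_τ` for the canonical choice of the
trivial times, where the shifted coordinates are the Darboux coordinates. -/
def HamIso (ħ : ℂ) (m : S.Mono) (I : S.IsoIdx) (y : S.Reduced) : ℂ :=
  S.Ham ħ (S.canonMono m) (fun _ => 0) (S.isoVec 0 1 I) (y.1, y.2.1, S.canonTimes y.2.2)

/-- The reduced two-form `ħ ∑ dq̌_j ∧ dp̌_j - ∑ dτ ∧ dHam^{(α_τ)}` over the isomonodromic times. -/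
def OmegaIso (ħ : ℂ) (m : S.Mono) (T2 : S.Times → ℂ) (x u v : S.Phase) : ℂ :=
  ħ * (∑ j : Fin S.g, wedge (S.qCheck T2 j) (S.pCheck m T2 j) x u v)
    - ∑ I : S.IsoIdx,
        wedge (fun y : S.Phase => S.isoTime T2 I y.2.2)
          (fun y : S.Phase => S.HamIso ħ m I (S.reduce m T2 y)) x u v

end PoleData

end Isomono

end

/-!
The isomonodromic deformations reduce to `g` directions because shifting a connection by a scalar
one-form and changing the variable affinely, `λ ↦ T₂ λ + T₁`, brings the times to the canonical
values, and the Hamiltonians follow this reduction up to total differentials.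

**The coefficients `H`.** A rational function with poles of orders at most `r s` at the `X_s`, with
a prescribed decay at infinity and with `g` distinct zeros off the `X_s` vanishes: divided by
`∏ (z - q_j)` and multiplied by `∏ (z - X_s) ^ r s` it becomes an entire function that tends to zero at infinity
(`eq_zero_of_interpolation`). So the homogeneous linear system for `H` has only the zero solution,
which gives existence, uniqueness (`existsUnique_isHSolution`) and, by Cramer's rule, holomorphy of
the coefficients.

**Their reduction.** The structure `Reduces` records the relations between times `t` and reduced
times `t'` under removal of half the trace `P₁` and the change of variable `z ↦ a z + b`. Consider
the spectral polynomial with the solution `H` at `(q, p, t)`, minus the transported one at the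
reduced point. The difference, corrected by the divided differences `(P₁ z - P₁ q_j) / (z - q_j)`,
vanishes at all `q_j` and satisfies the growth conditions, so the same interpolation argument shows
that it is zero (`Reduces.redErr_eq_zero`, `Reduces.restCoef_eq`).

**The Hamiltonians.** The coefficients `ν` of a deformation are the expansion coefficients of a
vector field in the variable `λ`, and `Ham` pairs it with `H`. Under the reduction this vector field
is transported with the tangent map, up to the affine field coming from the variation of `a` and
`b` (`ReducesDir`). Pairing it with the previous identity gives `Reduces.hamDefect_eq`: the
Hamiltonian of `α` is the reduced Hamiltonian of the image of `α`, plus `ħ` times explicit terms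
summed over the `q_j`, plus a function of the times only. As `∑_j 1 = g ≠ 0`, the last one is
absorbed in the free coefficient `c_{∞,0}` (`freeCoef`).

**The two-forms.** The explicit terms are those by which `∑ p̌_j dq̌_j` differs from `∑ p_j dq_j`,
up to the differential of a primitive of `P₁ / 2` and logarithmic terms. Therefore the
Poincaré–Cartan one-forms before and after the reduction differ by a closed form
(`IsT2.cartan_eq`), and the exterior derivative gives the equality of the two-forms
(`IsT2.Omega_eq_OmegaIso`).

**The isomonodromic times.** The `τ_{∞,j}` are the coefficients of the polynomial with coefficients
`t̂_{∞,k}`, recentred so that its second coefficient vanishes (`tauInf_eq`). This identifies the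
canonical times as a reduction of `t` (`IsT2.reduces`) and gives the duality with the vectors `α_τ`
(`IsT2.fderiv_isoTime_isoVec`).

**The vector fields.** The pairing of `ℒ_α` with any vector that leaves the times fixed is zero for
the two-form (`Omega_evolution`). Written in the shifted coordinates, this statement is the reduced
Hamiltonian system.
-/

open Filter Topology Asymptotics Bornology
noncomputable section
namespace Isomono

/-! ### Orders of growth at a point and at infinity -/

/-- `f` is `O(w ^ n)` along `l`; here `w` is a local parameter, `z - c` at a point `c` or `z⁻¹` at
infinity, so that `-n` bounds the pole order. -/
def OrdAt (l : Filter ℂ) (w f : ℂ → ℂ) (n : ℤ) : Prop := f =O[l] fun z => w z ^ n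

namespace OrdAt

variable {l : Filter ℂ} {w f g : ℂ → ℂ} {n k : ℤ}

theorem eventually_ne (hw : Tendsto w l (𝓝[≠] 0)) : ∀ᶠ z in l, w z ≠ 0 :=
  hw.eventually self_mem_nhdsWithin

theorem zpow_self (n : ℤ) : OrdAt l w (fun z => w z ^ n) n := isBigO_refl _ _

theorem add (hf : OrdAt l w f n) (hg : OrdAt l w g n) : OrdAt l w (fun z => f z + g z) n :=
  IsBigO.add hf hg

theorem sub (hf : OrdAt l w f n) (hg : OrdAt l w g n) : OrdAt l w (fun z => f z - g z) n :=
  IsBigO.sub hf hg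

theorem neg (hf : OrdAt l w f n) : OrdAt l w (fun z => -f z) n := IsBigO.neg_left hf

theorem const_mul (c : ℂ) (hf : OrdAt l w f n) : OrdAt l w (fun z => c * f z) n :=
  IsBigO.const_mul_left hf c

theorem mul_const (c : ℂ) (hf : OrdAt l w f n) : OrdAt l w (fun z => f z * c) n := by
  simpa [mul_comm] using hf.const_mul c

theorem zero : OrdAt l w (fun _ => 0) n := isBigO_zero _ _

theorem sum {ι : Type*} {s : Finset ι} {F : ι → ℂ → ℂ} (h : ∀ i ∈ s, OrdAt l w (F i) n) :
    OrdAt l w (fun z => ∑ i ∈ s, F i z) n := IsBigO.fun_sum h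

theorem congr' (hf : OrdAt l w f n) (h : f =ᶠ[l] g) : OrdAt l w g n :=
  IsBigO.congr' hf h EventuallyEq.rfl

theorem congr (hf : OrdAt l w f n) (h : ∀ z, f z = g z) : OrdAt l w g n :=
  hf.congr' (Eventually.of_forall h)

theorem mul (hw : Tendsto w l (𝓝[≠] 0)) (hf : OrdAt l w f n) (hg : OrdAt l w g k) :
    OrdAt l w (fun z => f z * g z) (n + k) := by
  refine (IsBigO.mul hf hg).congr' EventuallyEq.rfl ?_
  filter_upwards [eventually_ne hw] with z hz
  rw [zpow_add₀ hz]

theorem mono (hw : Tendsto w l (𝓝[≠] 0)) (hf : OrdAt l w f n) (h : k ≤ n) : OrdAt l w f k := by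
  refine hf.trans ?_
  have h0 : Tendsto (fun z => ‖w z‖) l (𝓝 0) := by
    simpa using (hw.mono_right nhdsWithin_le_nhds).norm
  refine IsBigO.of_bound 1 ?_
  filter_upwards [eventually_ne hw, h0.eventually (Iio_mem_nhds zero_lt_one)] with z hz hz1
  rw [one_mul, norm_zpow, norm_zpow]
  exact zpow_le_zpow_right_of_le_one₀ (norm_pos_iff.2 hz) (le_of_lt hz1) h

theorem zpow_of_le (hw : Tendsto w l (𝓝[≠] 0)) (h : k ≤ n) : OrdAt l w (fun z => w z ^ n) k :=
  (zpow_self n).mono hw h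

theorem const (c : ℂ) : OrdAt l w (fun _ => c) 0 := by
  simp only [OrdAt, zpow_zero]; exact isBigO_const_const _ one_ne_zero _

theorem of_tendsto {a : ℂ} (h : Tendsto f l (𝓝 a)) : OrdAt l w f 0 := by
  simp only [OrdAt, zpow_zero]; exact h.isBigO_one ℂ

theorem pow (hw : Tendsto w l (𝓝[≠] 0)) (hf : OrdAt l w f n) (j : ℕ) :
    OrdAt l w (fun z => f z ^ j) (j * n) := by
  induction j with
  | zero => simpa using const (l := l) (w := w) 1
  | succ j ih =>
    have := ih.mul hw hf
    simp only [pow_succ]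
    convert this using 1
    push_cast; ring

theorem tendsto_zero (hw : Tendsto w l (𝓝[≠] 0)) (hf : OrdAt l w f 1) : Tendsto f l (𝓝 0) := by
  refine IsBigO.trans_tendsto hf ?_
  simpa using hw.mono_right nhdsWithin_le_nhds

theorem const_eq_zero [l.NeBot] (hw : Tendsto w l (𝓝[≠] 0)) {c : ℂ}
    (hf : OrdAt l w (fun _ => c) 1) : c = 0 :=
  tendsto_nhds_unique tendsto_const_nhds (hf.tendsto_zero hw)

/-- A Laurent polynomial in the local parameter without terms of positive order that is of positive
order vanishes. -/
theorem coeff_eq_zero [l.NeBot] (hw : Tendsto w l (𝓝[≠] 0)) (r : ℕ) (d : ℕ → ℂ)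
    (h : OrdAt l w (fun z => ∑ j ∈ Finset.range r, d j * w z ^ (-(j : ℤ))) 1) :
    ∀ j < r, d j = 0 := by
  induction r with
  | zero => intro j hj; omega
  | succ r ih =>
    have key : d r = 0 := by
      refine const_eq_zero (l := l) (w := w) hw ?_
      have h1 : OrdAt l w (fun z => w z ^ (r : ℤ) *
          ∑ j ∈ Finset.range (r + 1), d j * w z ^ (-(j : ℤ))) 1 :=
        ((zpow_self (r : ℤ)).mul hw h).mono hw (by omega)
      have h2 : OrdAt l w (fun z => w z ^ (r : ℤ) *
          ∑ j ∈ Finset.range r, d j * w z ^ (-(j : ℤ))) 1 := by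
        simp only [Finset.mul_sum]
        refine sum fun j hj => ?_
        have hj := Finset.mem_range.1 hj
        have : OrdAt l w (fun z => w z ^ (r : ℤ) * (d j * w z ^ (-(j : ℤ)))) (r + -j) :=
          (zpow_self (r : ℤ)).mul hw ((zpow_self _).const_mul _)
        exact this.mono hw (by omega)
      refine (h1.sub h2).congr' ?_
      filter_upwards [eventually_ne hw] with z hz
      rw [Finset.sum_range_succ, mul_add, add_sub_cancel_left, zpow_neg, mul_left_comm,
        mul_inv_cancel₀ (zpow_ne_zero _ hz), mul_one]
    intro j hj
    rcases Nat.lt_succ_iff_lt_or_eq.1 hj with hj | rfl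
    · exact ih (by simpa [Finset.sum_range_succ, key] using h) j hj
    · exact key

/-- Truncating the product of two principal parts at order `2 e - (r - 1)` costs only terms of
higher order. -/
theorem trunc_mul (hw : Tendsto w l (𝓝[≠] 0)) (e : ℤ) (r : ℕ) (u v : ℕ → ℂ) :
    OrdAt l w (fun z => (∑ a ∈ Finset.range r, ∑ b ∈ Finset.range r,
        if r ≤ a + b + 1 then u a * v b * w z ^ (2 * e - (a + b : ℕ)) else 0)
      - (∑ a ∈ Finset.range r, u a * w z ^ (e - a)) * ∑ b ∈ Finset.range r, v b * w z ^ (e - b))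
      (2 * e + 2 - r) := by
  have h : OrdAt l w (fun z => ∑ a ∈ Finset.range r, ∑ b ∈ Finset.range r,
      ((if r ≤ a + b + 1 then 0 else -(u a * v b)) * w z ^ (2 * e - (a + b : ℕ))))
      (2 * e + 2 - r) := by
    refine sum fun a ha => sum fun b hb => ?_
    split_ifs with h
    · simpa using zero
    · exact ((zpow_of_le hw (by push_cast; omega)).const_mul _)
  refine h.congr' ?_
  filter_upwards [eventually_ne hw] with z hz
  rw [Finset.sum_mul_sum, ← Finset.sum_sub_distrib]
  refine Finset.sum_congr rfl fun a _ => ?_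
  rw [← Finset.sum_sub_distrib]
  refine Finset.sum_congr rfl fun b _ => ?_
  have : w z ^ (2 * e - (a + b : ℕ)) = w z ^ (e - a) * w z ^ (e - b) := by
    rw [← zpow_add₀ hz]; congr 1; push_cast; ring
  rw [this]
  split_ifs <;> ring

theorem comp {l' : Filter ℂ} {w' : ℂ → ℂ} {φ : ℂ → ℂ} (hf : OrdAt l' w' f n)
    (hφ : Tendsto φ l l') (hw' : (fun z => w' (φ z) ^ n) =O[l] fun z => w z ^ n) :
    OrdAt l w (fun z => f (φ z)) n :=
  (IsBigO.comp_tendsto hf hφ).trans hw'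

end OrdAt

theorem tendsto_sub_punctured (c : ℂ) : Tendsto (fun z => z - c) (𝓝[≠] c) (𝓝[≠] 0) := by
  refine tendsto_nhdsWithin_iff.2 ⟨?_, ?_⟩
  · have : Tendsto (fun z : ℂ => z - c) (𝓝 c) (𝓝 (c - c)) := by
      exact (continuous_id.sub continuous_const).tendsto c
    rw [sub_self] at this
    exact this.mono_left nhdsWithin_le_nhds
  · filter_upwards [self_mem_nhdsWithin] with z hz
    simpa [sub_eq_zero] using hz

theorem tendsto_inv_cobounded' : Tendsto (fun z : ℂ => z⁻¹) (cobounded ℂ) (𝓝[≠] 0) := by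
  exact tendsto_inv₀_cobounded'

/-- `f = O((z - c) ^ n)` near `c`. -/
abbrev OX (c : ℂ) (f : ℂ → ℂ) (n : ℤ) : Prop := OrdAt (𝓝[≠] c) (fun z => z - c) f n

/-- `f = O(z ^ (-n))` near infinity. -/
abbrev OI (f : ℂ → ℂ) (n : ℤ) : Prop := OrdAt (cobounded ℂ) (fun z => z⁻¹) f n

theorem OX.of_continuousAt {c : ℂ} {f : ℂ → ℂ} (h : ContinuousAt f c) : OX c f 0 :=
  OrdAt.of_tendsto (h.tendsto.mono_left nhdsWithin_le_nhds)

theorem OX.inv_pow {c d : ℂ} (h : c ≠ d) (k : ℕ) : OX c (fun z => ((z - d) ^ k)⁻¹) 0 := by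
  refine OX.of_continuousAt ?_
  refine ContinuousAt.inv₀ (by fun_prop) (pow_ne_zero _ (sub_ne_zero.2 h))

theorem OX.inv_pow_self (c : ℂ) (k : ℕ) : OX c (fun z => ((z - c) ^ k)⁻¹) (-k) :=
  (OrdAt.zpow_self _).congr fun z => by simp

theorem OI.monomial (k : ℕ) : OI (fun z => z ^ k) (-k) :=
  (OrdAt.zpow_self _).congr fun z => by simp

theorem OI.sub_const (c : ℂ) : OI (fun z => z - c) (-1) :=
  (by simpa using OI.monomial 1 : OI (fun z => z) (-1)).sub
    ((OrdAt.const c).mono tendsto_inv_cobounded' (by omega))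

theorem isEquivalent_sub_const (a c : ℂ) (ha : a ≠ 0) :
    Tendsto (fun z : ℂ => (a * z + c)⁻¹ * z) (cobounded ℂ) (𝓝 a⁻¹) := by
  have h0 : Tendsto (fun z : ℂ => z⁻¹) (cobounded ℂ) (𝓝 0) :=
    tendsto_inv_cobounded'.mono_right nhdsWithin_le_nhds
  have h : Tendsto (fun z : ℂ => (a + c * z⁻¹)⁻¹) (cobounded ℂ) (𝓝 (a + c * 0)⁻¹) := by
    refine Tendsto.inv₀ ((h0.const_mul c).const_add a) (by simpa using ha)
  rw [mul_zero, add_zero] at h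
  refine h.congr' ?_
  filter_upwards [tendsto_inv_cobounded'.eventually self_mem_nhdsWithin] with z hz
  have hz : z ≠ 0 := by simpa using hz
  have h1 : a + c * z⁻¹ = (a * z + c) * z⁻¹ := by field_simp
  rw [h1, mul_inv, inv_inv]

theorem affine_tendsto_cobounded {a : ℂ} (ha : a ≠ 0) (c : ℂ) :
    Tendsto (fun z : ℂ => a * z + c) (cobounded ℂ) (cobounded ℂ) := by
  have h := isEquivalent_sub_const a c ha
  rw [← tendsto_norm_atTop_iff_cobounded]
  have h1 : Tendsto (fun z : ℂ => ‖a‖ * ‖z‖ - ‖c‖) (cobounded ℂ) atTop := by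
    refine tendsto_atTop_add_const_right _ _ ?_
    exact (tendsto_norm_cobounded_atTop).const_mul_atTop (norm_pos_iff.2 ha)
  refine tendsto_atTop_mono (fun z => ?_) h1
  have := norm_sub_le (a * z + c) c
  rw [add_sub_cancel_right, norm_mul] at this
  linarith

theorem OI.inv_affine {a : ℂ} (ha : a ≠ 0) (c : ℂ) : OI (fun z => (a * z + c)⁻¹) 1 := by
  have h : OI (fun z => (a * z + c)⁻¹ * z) 0 := OrdAt.of_tendsto (isEquivalent_sub_const a c ha)
  refine ((h.mul tendsto_inv_cobounded' (OrdAt.zpow_self 1)).mono tendsto_inv_cobounded'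
    (by omega)).congr' ?_
  filter_upwards [tendsto_inv_cobounded'.eventually self_mem_nhdsWithin] with z hz
  have hz : z ≠ 0 := by simpa using hz
  rw [zpow_one, mul_assoc, mul_inv_cancel₀ hz, mul_one]

theorem OI.affine {a : ℂ} (c : ℂ) : OI (fun z => a * z + c) (-1) := by
  have h : OI (fun z => a * z) (-1) := (by simpa using OI.monomial 1 : OI (fun z => z) (-1)).const_mul a
  exact h.add ((OrdAt.const c).mono tendsto_inv_cobounded' (by omega))

theorem OI.zpow_affine {a : ℂ} (ha : a ≠ 0) (c : ℂ) (n : ℤ) :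
    OI (fun z => ((a * z + c)⁻¹) ^ n) n := by
  obtain ⟨k, rfl | rfl⟩ := n.eq_nat_or_neg
  · have := (OI.inv_affine ha c).pow tendsto_inv_cobounded' k
    simpa using this
  · have := (OI.affine (a := a) c).pow tendsto_inv_cobounded' k
    simpa using this

theorem OI.comp_affine {f : ℂ → ℂ} {n : ℤ} (hf : OI f n) {a : ℂ} (ha : a ≠ 0) (c : ℂ) :
    OI (fun z => f (a * z + c)) n :=
  OrdAt.comp hf (affine_tendsto_cobounded ha c) (OI.zpow_affine ha c n)

theorem OX.comp_affine {f : ℂ → ℂ} {n : ℤ} {a b X : ℂ} (hf : OX (a * X + b) f n) (ha : a ≠ 0) :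
    OX X (fun z => f (a * z + b)) n := by
  refine OrdAt.comp hf (tendsto_nhdsWithin_iff.2 ⟨?_, ?_⟩) ?_
  · refine Tendsto.mono_left ?_ nhdsWithin_le_nhds
    exact Continuous.tendsto (f := fun z : ℂ => a * z + b) (by fun_prop) X
  · filter_upwards [self_mem_nhdsWithin] with z hz
    simpa [ha] using hz
  · refine IsBigO.of_bound ‖a ^ n‖ (Eventually.of_forall fun z => ?_)
    rw [← norm_mul, ← mul_zpow]
    exact le_of_eq (by congr 2; ring)

theorem eventually_cobounded_ne (c : ℂ) : ∀ᶠ z in cobounded ℂ, z ≠ c := by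
  have h := (tendsto_norm_cobounded_atTop (E := ℂ)).eventually (eventually_gt_atTop ‖c‖)
  filter_upwards [h] with z hz h
  rw [h] at hz; exact lt_irrefl _ hz

theorem OI.inv_sub (c : ℂ) : OI (fun z => (z - c)⁻¹) 1 := by
  simpa [sub_eq_add_neg] using OI.inv_affine one_ne_zero (-c)

theorem OI.inv_sub_pow (c : ℂ) (k : ℕ) : OI (fun z => ((z - c) ^ k)⁻¹) k := by
  simpa using (OI.inv_sub c).pow tendsto_inv_cobounded' k

theorem OI.inv_sub_sub_inv (c : ℂ) : OI (fun z => (z - c)⁻¹ - z⁻¹) 2 := by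
  have h : OI (fun z => c * ((z - c)⁻¹ * z⁻¹ ^ (1 : ℤ))) 2 :=
    ((OI.inv_sub c).mul tendsto_inv_cobounded' (OrdAt.zpow_self 1)).const_mul c
  refine h.congr' ?_
  filter_upwards [eventually_cobounded_ne c, eventually_cobounded_ne 0] with z h1 h2
  have := sub_ne_zero.2 h1
  rw [zpow_one]; field_simp; ring

theorem OI.inv_sub_expand (c : ℂ) : OI (fun z => (z - c)⁻¹ - z⁻¹ - c * z⁻¹ ^ 2) 3 := by
  have h : OI (fun z => c * (((z - c)⁻¹ - z⁻¹) * z⁻¹ ^ (1 : ℤ))) 3 :=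
    ((OI.inv_sub_sub_inv c).mul tendsto_inv_cobounded' (OrdAt.zpow_self 1)).const_mul c
  refine h.congr' ?_
  filter_upwards [eventually_cobounded_ne c, eventually_cobounded_ne 0] with z h1 h2
  have := sub_ne_zero.2 h1
  rw [zpow_one]; field_simp; ring

theorem OI.inv_sub_sq_expand (c : ℂ) : OI (fun z => ((z - c) ^ 2)⁻¹ - z⁻¹ ^ 2) 3 := by
  have h : OI (fun z => ((z - c)⁻¹ - z⁻¹) * ((z - c)⁻¹ + z⁻¹ ^ (1 : ℤ))) 3 :=
    (OI.inv_sub_sub_inv c).mul tendsto_inv_cobounded' ((OI.inv_sub c).add (OrdAt.zpow_self 1))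
  refine h.congr fun z => ?_
  rw [zpow_one, ← inv_pow]; ring

/-! ### Liouville's theorem with removable singularities -/

/-- A function that is holomorphic off a finite set, bounded near the points of that set and tends
to zero at infinity vanishes. -/
theorem eq_zero_of_finite_singularities (F : Finset ℂ) : ∀ f : ℂ → ℂ,
    DifferentiableOn ℂ f (↑F)ᶜ → (∀ c ∈ F, OX c f 0) → Tendsto f (cobounded ℂ) (𝓝 0) →
    ∀ z ∉ F, f z = 0 := by
  classical
  induction F using Finset.induction_on with
  | empty =>
    intro f hd _ ht z _
    have hd : Differentiable ℂ f := by simpa [differentiableOn_univ] using hd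
    exact hd.apply_eq_of_tendsto_cocompact z (by rwa [← Metric.cobounded_eq_cocompact])
  | insert c F hc ih =>
    intro f hd hb ht z hz
    have hs : ((↑F)ᶜ : Set ℂ) ∈ 𝓝 c := F.finite_toSet.isClosed.isOpen_compl.mem_nhds (by simpa)
    have hlit : (fun z => f z - f c) =o[𝓝[≠] c] fun z => (z - c)⁻¹ := by
      have h1 := hb c (by simp)
      simp only [OX, OrdAt, zpow_zero] at h1
      refine Asymptotics.IsBigO.trans_isLittleO
        (h1.sub (isBigO_const_const (f c) (one_ne_zero (α := ℂ)) _)) ?_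
      refine isLittleO_const_left.2 (Or.inr ?_)
      have := tendsto_norm_inv_nhdsNE_zero_atTop (α := ℂ) |>.comp (tendsto_sub_punctured c)
      exact this
    have hd' : DifferentiableOn ℂ f ((↑F)ᶜ \ {c}) := hd.mono (by intro x; simp; tauto)
    -- the singularity at `c` is removable; the extended function has one singularity less
    have hg := Complex.differentiableOn_update_limUnder_of_isLittleO hs hd' hlit
    have := ih _ hg (fun a ha => ?_) ?_ z (fun h => hz (by simp [h]))
    · rwa [Function.update_of_ne (by rintro rfl; simp at hz)] at this
    · have hac : a ≠ c := by rintro rfl; exact hc ha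
      refine (hb a (by simp [ha])).congr' ?_
      have : ∀ᶠ z in 𝓝[≠] a, z ≠ c := nhdsWithin_le_nhds (isOpen_ne.mem_nhds hac)
      filter_upwards [this] with z hz
      rw [Function.update_of_ne hz]
    · refine ht.congr' ?_
      filter_upwards [eventually_cobounded_ne c] with z hz
      rw [Function.update_of_ne hz]

/-! ### Calculus lemmas -/

section Calculus

variable {E : Type*} [NormedAddCommGroup E] [NormedSpace ℂ E]

theorem differentiableAt_det {ι : Type*} [Fintype ι] [DecidableEq ι] {A : E → Matrix ι ι ℂ} {x : E}
    (h : ∀ i j, DifferentiableAt ℂ (fun y => A y i j) x) :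
    DifferentiableAt ℂ (fun y => (A y).det) x := by
  simp only [Matrix.det_apply']
  fun_prop

theorem differentiableAt_matrix_inv {ι : Type*} [Fintype ι] [DecidableEq ι] {A : E → Matrix ι ι ℂ}
    {x : E} (h : ∀ i j, DifferentiableAt ℂ (fun y => A y i j) x) (hx : (A x).det ≠ 0) (i j : ι) :
    DifferentiableAt ℂ (fun y => (A y)⁻¹ i j) x := by
  simp only [Matrix.inv_def, Ring.inverse_eq_inv', Matrix.smul_apply, smul_eq_mul,
    Matrix.adjugate_apply]
  refine ((differentiableAt_det h).inv hx).mul (differentiableAt_det fun a b => ?_)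
  simp only [Matrix.updateRow_apply]
  split_ifs
  · exact differentiableAt_const _
  · exact h a b

/-- A holomorphic branch of a root of a smooth non-vanishing function is smooth. -/
theorem contDiffOn_of_pow_eq {U : Set E} (hU : IsOpen U) {T f : E → ℂ} {k : ℕ} (hk : k ≠ 0)
    (hT : DifferentiableOn ℂ T U) (hf : ContDiff ℂ 3 f) (h : ∀ t ∈ U, T t ^ k = f t)
    (hf0 : ∀ t ∈ U, f t ≠ 0) : ContDiffOn ℂ 2 T U := by
  -- `dT = T / (k f) df` expresses the derivative in terms of `T`, which allows a bootstrap
  have hd : ∀ t ∈ U, fderiv ℂ T t = (T t / (k * f t)) • fderiv ℂ f t := by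
    intro t ht
    have h1 : fderiv ℂ (fun y => T y ^ k) t = fderiv ℂ f t :=
      Filter.EventuallyEq.fderiv_eq (by filter_upwards [hU.mem_nhds ht] with y hy using h y hy)
    have hTt := (hT t ht).differentiableAt (hU.mem_nhds ht)
    rw [fderiv_fun_pow k hTt] at h1
    rw [← h1, smul_smul, ← h t ht]
    have hT0 : T t ≠ 0 := by
      intro h0; apply hf0 t ht; rw [← h t ht, h0, zero_pow hk]
    have : T t / (k * T t ^ k) * (k * T t ^ (k - 1)) = 1 := by
      have hk' : (k : ℂ) ≠ 0 := by exact_mod_cast hk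
      obtain ⟨k, rfl⟩ := Nat.exists_eq_succ_of_ne_zero hk
      simp only [Nat.succ_eq_add_one, Nat.add_sub_cancel] at *
      field_simp
      ring
    simp only [nsmul_eq_mul] at *
    rw [this, one_smul]
  have step : ∀ n : ℕ, n ≤ 2 → ContDiffOn ℂ n T U → ContDiffOn ℂ (n + 1) T U := by
    intro n hn hc
    rw [contDiffOn_succ_iff_fderiv_of_isOpen hU]
    refine ⟨hT, by simp, ?_⟩
    have h3 : ContDiff ℂ n (fderiv ℂ f) :=
      (hf.fderiv_right (m := 2) (by norm_num)).of_le (by exact_mod_cast hn)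
    have hfc : ContDiff ℂ n f := hf.of_le (by exact_mod_cast (by omega : n ≤ 3))
    have : ContDiffOn ℂ n (fun t => (T t / (k * f t)) • fderiv ℂ f t) U := by
      refine ContDiffOn.smul (hc.div (contDiffOn_const.mul hfc.contDiffOn) fun t ht => ?_)
        h3.contDiffOn
      exact mul_ne_zero (by exact_mod_cast hk) (hf0 t ht)
    exact this.congr hd
  have h0 : ContDiffOn ℂ ((0 : ℕ) : ℕ∞) T U := by
    simpa [contDiffOn_zero] using hT.continuousOn
  exact (step 1 (by norm_num) (by simpa using step 0 (by norm_num) (by simpa using h0)))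

/-- If a one-form `∑ fₐ dhₐ` vanishes near `x`, so does its exterior derivative `∑ dfₐ ∧ dhₐ`
at `x`. -/
theorem sum_wedge_eq_zero {ι : Type*} [Fintype ι] {f h : ι → E → ℂ} {x : E}
    (hf : ∀ a, DifferentiableAt ℂ (f a) x) (hh : ∀ a, ContDiffAt ℂ 2 (h a) x)
    (H : ∀ᶠ y in 𝓝 x, ∀ w, ∑ a, f a y * fderiv ℂ (h a) y w = 0) (u v : E) :
    ∑ a, wedge (f a) (h a) x u v = 0 := by
  have hd : ∀ a, DifferentiableAt ℂ (fderiv ℂ (h a)) x := fun a =>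
    ((hh a).fderiv_right (m := 1) (by norm_num)).differentiableAt (by norm_num)
  have hsym : ∀ a, fderiv ℂ (fderiv ℂ (h a)) x u v = fderiv ℂ (fderiv ℂ (h a)) x v u := fun a =>
    ((hh a).isSymmSndFDerivAt (by simp)) u v
  -- the derivative of the one-form along `u`; antisymmetrizing in `u`, `v` removes the second
  -- derivatives of `h`
  have key : ∀ u v, ∑ a, (fderiv ℂ (f a) x u * fderiv ℂ (h a) x v
      + f a x * fderiv ℂ (fderiv ℂ (h a)) x u v) = 0 := by
    intro u v
    have h1 : HasFDerivAt (fun y => ∑ a, f a y * fderiv ℂ (h a) y v)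
        (∑ a, (f a x • ((fderiv ℂ (fderiv ℂ (h a)) x).flip v)
          + fderiv ℂ (h a) x v • fderiv ℂ (f a) x)) x := by
      refine HasFDerivAt.fun_sum fun a _ => ?_
      refine (hf a).hasFDerivAt.mul ?_
      have := (hd a).hasFDerivAt.clm_apply (hasFDerivAt_const v x)
      simpa using this
    have h2 : (fun y => ∑ a, f a y * fderiv ℂ (h a) y v) =ᶠ[𝓝 x] fun _ => 0 := by
      filter_upwards [H] with y hy using hy v
    have h3 := h1.unique ((hasFDerivAt_const (0 : ℂ) x).congr_of_eventuallyEq h2)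
    have h4 := congrArg (fun φ => φ u) h3
    simp only [sum_apply, add_apply,
      smul_apply, ContinuousLinearMap.flip_apply, smul_eq_mul,
      zero_apply] at h4
    rw [← h4]
    exact Finset.sum_congr rfl fun a _ => by ring
  have h1 := key u v
  have h2 := key v u
  rw [← sub_self (0 : ℂ)]
  nth_rewrite 1 [← h1]
  rw [← h2, ← Finset.sum_sub_distrib]
  refine Finset.sum_congr rfl fun a _ => ?_
  rw [wedge, hsym a]; ring

end Calculus

/-! ### Interpolation by rational functions -/

theorem OrdAt.prod {l : Filter ℂ} {w : ℂ → ℂ} (hw : Tendsto w l (𝓝[≠] 0)) {ι : Type*}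
    {s : Finset ι} {F : ι → ℂ → ℂ} {n : ι → ℤ} (h : ∀ i ∈ s, OrdAt l w (F i) (n i)) :
    OrdAt l w (fun z => ∏ i ∈ s, F i z) (∑ i ∈ s, n i) := by
  classical
  induction s using Finset.induction_on with
  | empty => simpa using OrdAt.const 1
  | insert a s ha ih =>
    simp only [Finset.prod_insert ha, Finset.sum_insert ha]
    exact (h a (by simp)).mul hw (ih fun i hi => h i (by simp [hi]))

namespace PoleData

variable (S : PoleData)

theorem g_pos : 0 < S.g := by have := S.genus_pos; unfold g; omega

/-- A function with at most the poles of the coefficient system, of the decay of that system at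
infinity and with zeros at `g` distinct points vanishes. -/
theorem eq_zero_of_interpolation {X : Fin S.n → ℂ}
    {q : Fin S.g → ℂ} (hq : Function.Injective q) (hqX : ∀ j s, q j ≠ X s) {E : ℂ → ℂ}
    (hd : ∀ z, (∀ s, z ≠ X s) → DifferentiableAt ℂ E z)
    (hord : ∀ s, OX (X s) E (-(S.r s : ℤ))) (hinf : OI E (4 - S.rInf)) (h0 : ∀ j, E (q j) = 0)
    (z : ℂ) (hz : ∀ s, z ≠ X s) : E z = 0 := by
  classical
  -- multiplying by `∏ (z - X_s) ^ r_s` and dividing by `∏ (z - q_j)` removes all poles; as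
  -- `g = rInf + ∑ r_s - 3`, the result still tends to zero at infinity
  set f : ℂ → ℂ := fun z => E z * (∏ s, (z - X s) ^ S.r s) * ∏ j, (z - q j)⁻¹ with hf
  have hfz : ∀ z ∉ (Finset.univ.image X ∪ Finset.univ.image q), f z = 0 := by
    refine eq_zero_of_finite_singularities _ f ?_ ?_ ?_
    · intro z hz
      simp only [Finset.coe_union, Finset.coe_image, Finset.coe_univ, Set.image_univ,
        Set.mem_compl_iff, Set.mem_union, Set.mem_range, not_or, not_exists] at hz
      have hzq : ∀ j, z - q j ≠ 0 := fun j => sub_ne_zero.2 (Ne.symm (hz.2 j))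
      have hE := hd z fun s => Ne.symm (hz.1 s)
      refine DifferentiableAt.differentiableWithinAt ?_
      have h1 : DifferentiableAt ℂ (fun z => ∏ j, (z - q j)⁻¹) z :=
        DifferentiableAt.fun_finsetProd fun j _ => DifferentiableAt.inv (by fun_prop) (hzq j)
      exact (hE.mul (by fun_prop)).mul h1
    · intro c hc
      have hw := tendsto_sub_punctured c
      rcases Finset.mem_union.1 hc with hc | hc
      · obtain ⟨s, -, rfl⟩ := Finset.mem_image.1 hc
        have h1 : OX (X s) (fun z => ∏ s', (z - X s') ^ S.r s') (S.r s) := by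
          have := OrdAt.prod (s := Finset.univ) hw (F := fun s' z => (z - X s') ^ S.r s')
            (n := fun s' => if s' = s then (S.r s : ℤ) else 0) (fun s' _ => ?_)
          · simpa using this
          · by_cases h : s' = s
            · subst h; simpa using OrdAt.zpow_self (l := 𝓝[≠] (X s'))
                (w := fun z => z - X s') (S.r s')
            · simp only [h, if_false]
              exact OX.of_continuousAt (by fun_prop)
        have h2 : OX (X s) (fun z => ∏ j, (z - q j)⁻¹) 0 := by
          have := OrdAt.prod (s := Finset.univ) hw (F := fun j z => (z - q j)⁻¹)
            (n := fun j => 0) (fun j _ => ?_)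
          · simpa using this
          · simpa using OX.inv_pow (Ne.symm (hqX j s)) 1
        exact (((hord s).mul hw h1).mul hw h2).mono hw (by omega)
      · obtain ⟨j, -, rfl⟩ := Finset.mem_image.1 hc
        have h1 : OX (q j) (fun z => ∏ s', (z - X s') ^ S.r s') 0 :=
          OX.of_continuousAt (by fun_prop)
        have h2 : OX (q j) (fun z => ∏ j, (z - q j)⁻¹) (-1) := by
          have := OrdAt.prod (s := Finset.univ) hw (F := fun j z => (z - q j)⁻¹)
            (n := fun i => if i = j then -1 else 0) (fun i _ => ?_)
          · simpa using this
          · by_cases h : i = j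
            · subst h; simpa using OX.inv_pow_self (q i) 1
            · simp only [h, if_false]
              simpa using OX.inv_pow (fun h' => h (hq h').symm : q j ≠ q i) 1
        have h3 : OX (q j) E 1 := by
          have := (hd (q j) (hqX j)).isBigO_sub
          simp only [h0, sub_zero] at this
          simpa [OX, OrdAt] using this.mono nhdsWithin_le_nhds
        exact ((h3.mul hw h1).mul hw h2).mono hw (by omega)
    · have hw := tendsto_inv_cobounded'
      refine OrdAt.tendsto_zero hw (w := fun z => z⁻¹) ?_
      have h1 : OI (fun z => ∏ s, (z - X s) ^ S.r s) (-∑ s, (S.r s : ℤ)) := by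
        have := OrdAt.prod (s := Finset.univ) hw (F := fun s z => (z - X s) ^ S.r s)
          (n := fun s => -(S.r s : ℤ))
          (fun s _ => by simpa using OrdAt.pow hw (OI.sub_const (X s)) (S.r s))
        simpa using this
      have h2 : OI (fun z => ∏ j, (z - q j)⁻¹) S.g := by
        have := OrdAt.prod (s := Finset.univ) hw (F := fun j z => (z - q j)⁻¹)
          (n := fun _ => 1) (fun j _ => OI.inv_sub (q j))
        simpa using this
      have h3 := (hinf.mul hw h1).mul hw h2
      refine h3.mono hw (le_of_eq ?_)
      have := S.genus_pos
      have hg : (S.g : ℤ) = S.rInf + (∑ s, (S.r s : ℤ)) - 3 := by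
        unfold g; push_cast [Nat.cast_sub (le_of_lt this)]; ring
      rw [hg]; ring
  by_cases hzq : ∃ j, z = q j
  · obtain ⟨j, rfl⟩ := hzq; exact h0 j
  · have h1 := hfz z (by
      simp only [Finset.mem_union, Finset.mem_image, Finset.mem_univ, true_and, not_or, not_exists]
      exact ⟨fun s h => hz s h.symm, fun j h => hzq ⟨j, h.symm⟩⟩)
    simp only [hf] at h1
    rcases mul_eq_zero.1 h1 with h1 | h1
    · rcases mul_eq_zero.1 h1 with h1 | h1
      · exact h1
      · obtain ⟨s, -, hs⟩ := Finset.prod_eq_zero_iff.1 h1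
        exact absurd (eq_zero_of_pow_eq_zero hs) (sub_ne_zero.2 (hz s))
    · obtain ⟨j, -, hj⟩ := Finset.prod_eq_zero_iff.1 h1
      exact absurd ⟨j, sub_eq_zero.1 (inv_eq_zero.1 hj)⟩ hzq

/-- The rational function `∑ H_{∞,k} z ^ k + ∑ H_{X_s,k} / (z - X_s) ^ k`. -/
def ratFun (t : S.Times) (H : S.HIdx → ℂ) (z : ℂ) : ℂ :=
  (∑ k : Fin (S.rInf - 3), H (Sum.inl k) * z ^ (k : ℕ))
    + ∑ s, ∑ k : Fin (S.r s), H (Sum.inr ⟨s, k⟩) / (z - S.pos t s) ^ ((k : ℕ) + 1)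

theorem HX_succ (H : S.HIdx → ℂ) (s : Fin S.n) (k : Fin (S.r s)) :
    S.HX H s (k + 1) = H (Sum.inr ⟨s, k⟩) := by
  simp [HX]

theorem HX_eq_zero (H : S.HIdx → ℂ) (s : Fin S.n) {k : ℕ} (h : S.r s < k) : S.HX H s k = 0 := by
  unfold HX; rw [dif_neg (by omega)]

theorem sum_HX (H : S.HIdx → ℂ) (s : Fin S.n) (f : ℕ → ℂ) :
    ∑ k : Fin (S.r s), H (Sum.inr ⟨s, k⟩) * f k
      = ∑ k ∈ Finset.range (S.r s), S.HX H s (k + 1) * f k := by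
  rw [← Fin.sum_univ_eq_sum_range (fun k => S.HX H s (k + 1) * f k)]
  exact Finset.sum_congr rfl fun k _ => by rw [HX_succ]

theorem ratFun_linear (t : S.Times) (a b : ℂ) (H H' : S.HIdx → ℂ) (z : ℂ) :
    S.ratFun t (fun i => a * H i + b * H' i) z = a * S.ratFun t H z + b * S.ratFun t H' z := by
  simp only [ratFun, mul_add, Finset.mul_sum]
  rw [add_add_add_comm, ← Finset.sum_add_distrib, ← Finset.sum_add_distrib]
  congr 1
  · exact Finset.sum_congr rfl fun k _ => by ring
  · refine Finset.sum_congr rfl fun k _ => ?_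
    rw [← Finset.sum_add_distrib]
    exact Finset.sum_congr rfl fun k _ => by ring

theorem differentiableAt_ratFun (t : S.Times) (H : S.HIdx → ℂ) {z : ℂ}
    (hz : ∀ s, z ≠ S.pos t s) : DifferentiableAt ℂ (S.ratFun t H) z := by
  unfold ratFun
  have h : ∀ s, z - S.pos t s ≠ 0 := fun s => sub_ne_zero.2 (hz s)
  refine DifferentiableAt.add (by fun_prop) ?_
  refine DifferentiableAt.fun_sum fun s _ => DifferentiableAt.fun_sum fun k _ => ?_
  exact DifferentiableAt.div (by fun_prop) (by fun_prop) (pow_ne_zero _ (h s))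

/-- Near `X_s` the rational function agrees with its principal part there up to a bounded term. -/
theorem ratFun_principal {t : S.Times} (ht : Function.Injective (S.pos t)) (H : S.HIdx → ℂ)
    (s : Fin S.n) :
    OX (S.pos t s) (fun z => S.ratFun t H z
      - ∑ k : Fin (S.r s), H (Sum.inr ⟨s, k⟩) / (z - S.pos t s) ^ ((k : ℕ) + 1)) 0 := by
  classical
  have h1 : OX (S.pos t s) (fun z => ∑ k : Fin (S.rInf - 3), H (Sum.inl k) * z ^ (k : ℕ)) 0 :=
    OX.of_continuousAt (by fun_prop)
  have h2 : OX (S.pos t s) (fun z => ∑ s' ∈ Finset.univ.erase s, ∑ k : Fin (S.r s'),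
      H (Sum.inr ⟨s', k⟩) / (z - S.pos t s') ^ ((k : ℕ) + 1)) 0 := by
    refine OrdAt.sum fun s' hs' => OrdAt.sum fun k _ => ?_
    simp only [div_eq_mul_inv]
    exact (OX.inv_pow (fun h => (Finset.ne_of_mem_erase hs') (ht h).symm) _).const_mul _
  refine (h1.add h2).congr fun z => ?_
  rw [ratFun, ← Finset.add_sum_erase _ _ (Finset.mem_univ s)]
  ring

theorem ratFun_OX {t : S.Times} (ht : Function.Injective (S.pos t)) (H : S.HIdx → ℂ)
    (s : Fin S.n) : OX (S.pos t s) (S.ratFun t H) (-(S.r s : ℤ)) := by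
  have hw := tendsto_sub_punctured (S.pos t s)
  have h1 : OX (S.pos t s) (fun z => ∑ k : Fin (S.r s), H (Sum.inr ⟨s, k⟩)
      / (z - S.pos t s) ^ ((k : ℕ) + 1)) (-(S.r s : ℤ)) := by
    refine OrdAt.sum fun k _ => ?_
    simp only [div_eq_mul_inv]
    exact ((OX.inv_pow_self _ _).const_mul _).mono hw (by have := k.2; push_cast; omega)
  exact (((S.ratFun_principal ht H s).mono hw (by omega)).add h1).congr fun z => by ring

/-- The expansion at infinity of the part of the rational function with finite poles. -/
theorem ratFun_OI_expand (t : S.Times) (H : S.HIdx → ℂ) :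
    OI (fun z => S.ratFun t H z - (∑ k : Fin (S.rInf - 3), H (Sum.inl k) * z ^ (k : ℕ))
      - S.sumH1 H * z⁻¹ - S.sumH2 t H * z⁻¹ ^ 2) 3 := by
  have hw := tendsto_inv_cobounded'
  have key : OI (fun z => ∑ s, ((∑ k ∈ Finset.range (S.r s), S.HX H s (k + 1)
      * ((z - S.pos t s) ^ (k + 1))⁻¹) - S.HX H s 1 * z⁻¹
      - (S.pos t s * S.HX H s 1 + S.HX H s 2) * z⁻¹ ^ 2)) 3 := by
    refine OrdAt.sum fun s _ => ?_
    have h1 := (OI.inv_sub_expand (S.pos t s)).const_mul (S.HX H s 1)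
    have h2 := (OI.inv_sub_sq_expand (S.pos t s)).const_mul (S.HX H s 2)
    have h3 : OI (fun z => ∑ k ∈ Finset.range (S.r s), if 2 ≤ k then S.HX H s (k + 1)
        * ((z - S.pos t s) ^ (k + 1))⁻¹ else 0) 3 := by
      refine OrdAt.sum fun k _ => ?_
      split_ifs with h
      · exact ((OI.inv_sub_pow _ _).const_mul _).mono hw (by push_cast; omega)
      · exact OrdAt.zero
    refine ((h1.add h2).add h3).congr fun z => ?_
    have hr := S.r_pos s
    rcases Nat.lt_or_ge (S.r s) 2 with h | h
    · have : S.r s = 1 := by omega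
      rw [S.HX_eq_zero H s (k := 2) (by omega), this]
      simp; ring
    · obtain ⟨r', hr'⟩ := Nat.exists_eq_add_of_le' h
      rw [hr', Finset.sum_range_succ', Finset.sum_range_succ', Finset.sum_range_succ',
        Finset.sum_range_succ']
      simp; ring
  refine key.congr fun z => ?_
  have h1 : ∀ s, ∑ k : Fin (S.r s), H (Sum.inr ⟨s, k⟩) * ((z - S.pos t s) ^ ((k : ℕ) + 1))⁻¹
      = ∑ k ∈ Finset.range (S.r s), S.HX H s (k + 1) * ((z - S.pos t s) ^ (k + 1))⁻¹ := fun s =>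
    S.sum_HX H s (fun k => ((z - S.pos t s) ^ (k + 1))⁻¹)
  simp only [ratFun, sumH1, sumH2, div_eq_mul_inv, h1]
  simp only [Finset.sum_sub_distrib, Finset.sum_mul]
  ring

theorem ratFun_OI {t : S.Times} (H : S.HIdx → ℂ) (h : 3 ≤ S.rInf) :
    OI (S.ratFun t H) (4 - S.rInf) := by
  have hw := tendsto_inv_cobounded'
  have h1 : OI (fun z => ∑ k : Fin (S.rInf - 3), H (Sum.inl k) * z ^ (k : ℕ)) (4 - S.rInf) :=
    OrdAt.sum fun k _ => ((OI.monomial k).const_mul _).mono hw (by have := k.2; omega)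
  have h2 : OI (fun z => S.sumH1 H * z⁻¹) 1 := by
    simpa using (OrdAt.zpow_self (l := cobounded ℂ) (w := fun z => z⁻¹) 1).const_mul (S.sumH1 H)
  have h3 : OI (fun z => S.sumH2 t H * z⁻¹ ^ 2) 2 :=
    (OrdAt.zpow_self (l := cobounded ℂ) (w := fun z => z⁻¹) 2).const_mul (S.sumH2 t H)
  refine (((((S.ratFun_OI_expand t H).mono hw (by omega)).add h1).add
    (h2.mono hw (by omega))).add (h3.mono hw (by omega))).congr fun z => by ring

theorem ratFun_OI_of_two {t : S.Times} (H : S.HIdx → ℂ) (h : S.rInf = 2) :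
    OI (fun z => S.ratFun t H z - S.sumH1 H * z⁻¹) 2 := by
  have hw := tendsto_inv_cobounded'
  have h3 : OI (fun z => S.sumH2 t H * z⁻¹ ^ 2) 2 :=
    (OrdAt.zpow_self (l := cobounded ℂ) (w := fun z => z⁻¹) 2).const_mul (S.sumH2 t H)
  have : IsEmpty (Fin (S.rInf - 3)) := by
    have : S.rInf - 3 = 0 := by omega
    rw [this]; infer_instance
  exact (((S.ratFun_OI_expand t H).mono hw (by omega)).add h3).congr fun z => by simp

theorem ratFun_OI_of_one {t : S.Times} (H : S.HIdx → ℂ) (h : S.rInf = 1) :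
    OI (fun z => S.ratFun t H z - S.sumH1 H * z⁻¹ - S.sumH2 t H * z⁻¹ ^ 2) 3 := by
  have : IsEmpty (Fin (S.rInf - 3)) := by
    have : S.rInf - 3 = 0 := by omega
    rw [this]; infer_instance
  exact (S.ratFun_OI_expand t H).congr fun z => by simp

/-- The partial fraction decomposition is unique. -/
theorem eq_zero_of_ratFun_eq_zero {t : S.Times} (ht : Function.Injective (S.pos t))
    {H : S.HIdx → ℂ} (h : ∀ z, (∀ s, z ≠ S.pos t s) → S.ratFun t H z = 0) : H = 0 := by
  have hX : ∀ (s : Fin S.n) (k : Fin (S.r s)), H (Sum.inr ⟨s, k⟩) = 0 := by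
    intro s k
    have hw := tendsto_sub_punctured (S.pos t s)
    have hev : ∀ᶠ z in 𝓝[≠] (S.pos t s), S.ratFun t H z = 0 := by
      have : ∀ᶠ z in 𝓝[≠] (S.pos t s), ∀ s', z ≠ S.pos t s' := by
        rw [eventually_all]
        intro s'
        by_cases hs : s' = s
        · subst hs; exact self_mem_nhdsWithin
        · exact nhdsWithin_le_nhds (isOpen_ne.mem_nhds fun e => hs (ht e).symm)
      filter_upwards [this] with z hz using h z hz
    have h1 : OX (S.pos t s) (fun z => (z - S.pos t s) ^ (1 : ℤ) * (S.ratFun t H z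
      - ∑ k : Fin (S.r s), H (Sum.inr ⟨s, k⟩) / (z - S.pos t s) ^ ((k : ℕ) + 1))) 1 := by
      simpa using (OrdAt.zpow_self 1).mul hw (S.ratFun_principal ht H s)
    have h2 := OrdAt.coeff_eq_zero hw (S.r s) (fun k => S.HX H s (k + 1)) (h1.neg.congr' ?_) k k.2
    · rwa [HX_succ] at h2
    · filter_upwards [hev, OrdAt.eventually_ne hw] with z hz hz0
      simp only [div_eq_mul_inv]
      rw [hz, zero_sub, zpow_one, mul_neg, neg_neg,
        S.sum_HX H s (fun k => ((z - S.pos t s) ^ (k + 1))⁻¹), Finset.mul_sum]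
      refine Finset.sum_congr rfl fun j _ => ?_
      rw [zpow_neg, zpow_natCast]
      field_simp
      ring
  have hI : ∀ k : Fin (S.rInf - 3), H (Sum.inl k) = 0 := by
    intro k
    have hw := tendsto_inv_cobounded'
    have hev : ∀ᶠ z in cobounded ℂ, ∀ s, z ≠ S.pos t s := by
      rw [eventually_all]; exact fun s => eventually_cobounded_ne _
    have := OrdAt.coeff_eq_zero hw (S.rInf - 3)
      (fun j => if hj : j < S.rInf - 3 then H (Sum.inl ⟨j, hj⟩) else 0)
      (OrdAt.zero.congr' ?_) k k.2
    · simpa using this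
    · filter_upwards [hev] with z hz
      have h1 := h z hz
      rw [ratFun] at h1
      simp only [hX, zero_div, Finset.sum_const_zero, add_zero] at h1
      refine h1.symm.trans ?_
      rw [← Fin.sum_univ_eq_sum_range (fun j => (if hj : j < S.rInf - 3 then
        H (Sum.inl ⟨j, hj⟩) else 0) * z⁻¹ ^ (-(j : ℤ)))]
      exact Finset.sum_congr rfl fun j _ => by simp
  funext i
  rcases i with k | ⟨s, k⟩
  · exact hI k
  · exact hX s k

end PoleData

/-! ### The linear system for the coefficients `H` -/

namespace PoleData

variable (S : PoleData)

/-- Points whose times are admissible and whose `q_j` are distinct and avoid the finite poles. -/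
abbrev regular : Set S.Phase := S.phaseDomain {t | S.Admissible t}

/-- The matrix of the linear system: one row for each `q_j`, then the rows for the coefficients of
`z⁻¹` and `z⁻²` at infinity, as far as these are prescribed. -/
def sysMat (x : S.Phase) : Matrix (Fin S.g ⊕ Fin (3 - S.rInf)) S.HIdx ℂ
  | Sum.inl j, Sum.inl k => x.1 j ^ (k : ℕ)
  | Sum.inl j, Sum.inr a => ((x.1 j - S.pos x.2.2 a.1) ^ ((a.2 : ℕ) + 1))⁻¹
  | Sum.inr _, Sum.inl _ => 0
  | Sum.inr e, Sum.inr a =>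
      if (e : ℕ) = 0 then (if (a.2 : ℕ) = 0 then 1 else 0)
      else if (a.2 : ℕ) = 0 then S.pos x.2.2 a.1 else if (a.2 : ℕ) = 1 then 1 else 0

/-- The right-hand side of the linear system. -/
def sysRhs (ħ : ℂ) (m : S.Mono) (x : S.Phase) : Fin S.g ⊕ Fin (3 - S.rInf) → ℂ
  | Sum.inl j => x.2.1 j ^ 2 - S.P1 m x.2.2 (x.1 j) * x.2.1 j
      + x.2.1 j * ∑ s, ħ * (S.r s : ℂ) / (x.1 j - S.pos x.2.2 s)
      + S.P2 m x.2.2 (x.1 j)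
      + ħ * ∑ i ∈ Finset.univ.erase j, (x.2.1 i - x.2.1 j) / (x.1 j - x.1 i)
      + if 3 ≤ S.rInf then
          ħ * S.time m x.2.2 none 0 (S.rInf - 1) * x.1 j ^ (S.rInf - 3) else 0
  | Sum.inr e =>
      if (e : ℕ) = 0 then
        ħ * (∑ j, x.2.1 j) - if S.rInf = 2 then
          (S.time m x.2.2 none 0 1 * m none 1 + S.time m x.2.2 none 1 1 * m none 0
            + ħ * S.time m x.2.2 none 0 1) else 0
      else ħ * (∑ j, x.1 j * x.2.1 j)
        + (∑ s, if S.r s = 1 then m (some s) 0 * m (some s) 1 else 0)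
        - m none 0 * (m none 1 + ħ)

theorem sysMat_mulVec_inl (x : S.Phase) (H : S.HIdx → ℂ) (j : Fin S.g) :
    (S.sysMat x).mulVec H (Sum.inl j) = S.ratFun x.2.2 H (x.1 j) := by
  simp only [Matrix.mulVec, dotProduct, Fintype.sum_sum_type, sysMat, ratFun, Fintype.sum_sigma,
    div_eq_mul_inv, mul_comm]

theorem sum_fin_eq_HX_one (H : S.HIdx → ℂ) (s : Fin S.n) :
    ∑ k : Fin (S.r s), (if (k : ℕ) = 0 then 1 else 0) * H (Sum.inr ⟨s, k⟩) = S.HX H s 1 := by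
  have h := S.sum_HX H s (fun k => if k = 0 then 1 else 0)
  have hr := S.r_pos s
  simp only [mul_comm] at h ⊢
  rw [h, Finset.sum_eq_single 0]
  · simp
  · intro b _ hb; simp [hb]
  · intro hb; simp only [Finset.mem_range, not_lt] at hb; omega

theorem sum_fin_eq_HX_two (H : S.HIdx → ℂ) (s : Fin S.n) :
    ∑ k : Fin (S.r s), (if (k : ℕ) = 1 then 1 else 0) * H (Sum.inr ⟨s, k⟩) = S.HX H s 2 := by
  have h := S.sum_HX H s (fun k => if k = 1 then 1 else 0)
  simp only [mul_comm] at h ⊢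
  rw [h, Finset.sum_eq_single 1]
  · simp
  · intro b _ hb; simp [hb]
  · intro hb; simp only [Finset.mem_range, not_lt] at hb; simp [S.HX_eq_zero H s (k := 2) (by omega)]

theorem sysMat_mulVec_zero (x : S.Phase) (H : S.HIdx → ℂ) (e : Fin (3 - S.rInf))
    (he : (e : ℕ) = 0) : (S.sysMat x).mulVec H (Sum.inr e) = S.sumH1 H := by
  simp only [Matrix.mulVec, dotProduct, Fintype.sum_sum_type, sysMat, Fintype.sum_sigma, he, if_true,
    zero_mul, Finset.sum_const_zero, zero_add, sumH1, sum_fin_eq_HX_one]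

theorem sysMat_mulVec_one (x : S.Phase) (H : S.HIdx → ℂ) (e : Fin (3 - S.rInf))
    (he : (e : ℕ) ≠ 0) : (S.sysMat x).mulVec H (Sum.inr e) = S.sumH2 x.2.2 H := by
  simp only [Matrix.mulVec, dotProduct, Fintype.sum_sum_type, sysMat, Fintype.sum_sigma, he, if_false,
    zero_mul, Finset.sum_const_zero, zero_add, sumH2]
  refine Finset.sum_congr rfl fun s _ => ?_
  rw [← sum_fin_eq_HX_one, ← sum_fin_eq_HX_two, Finset.mul_sum, ← Finset.sum_add_distrib]
  refine Finset.sum_congr rfl fun k _ => ?_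
  rcases Nat.eq_zero_or_pos (k : ℕ) with h | h
  · simp [h]
  · simp [h.ne']

theorem isHSolution_iff (ħ : ℂ) (m : S.Mono) (x : S.Phase) (H : S.HIdx → ℂ) :
    S.IsHSolution ħ m x H ↔ (S.sysMat x).mulVec H = S.sysRhs ħ m x := by
  have hr := S.rInf_pos
  constructor
  · rintro ⟨h1, h2, h3⟩
    funext i
    rcases i with j | e
    · rw [sysMat_mulVec_inl]; exact h1 j
    · have he := e.2
      rcases Nat.eq_zero_or_pos (e : ℕ) with h0 | h0
      · rw [sysMat_mulVec_zero _ _ _ _ h0, sysRhs, if_pos h0]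
        by_cases hr2 : S.rInf = 2
        · rw [if_pos hr2]; exact h2 hr2
        · rw [if_neg hr2, sub_zero]; exact (h3 (by omega)).1
      · rw [sysMat_mulVec_one _ _ _ _ h0.ne', sysRhs, if_neg h0.ne']
        exact (h3 (by omega)).2
  · intro h
    refine ⟨fun j => ?_, fun h2 => ?_, fun h1 => ⟨?_, ?_⟩⟩
    · have := congrFun h (Sum.inl j)
      rw [sysMat_mulVec_inl] at this; exact this
    · have := congrFun h (Sum.inr ⟨0, by omega⟩)
      rw [sysMat_mulVec_zero _ _ _ _ rfl] at this
      simpa [sysRhs, h2] using this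
    · have := congrFun h (Sum.inr ⟨0, by omega⟩)
      rw [sysMat_mulVec_zero _ _ _ _ rfl] at this
      simpa [sysRhs, h1] using this
    · have := congrFun h (Sum.inr ⟨1, by omega⟩)
      rw [sysMat_mulVec_one _ _ _ _ (by simp)] at this
      simpa [sysRhs] using this

theorem card_HIdx : Fintype.card S.HIdx = Fintype.card (Fin S.g ⊕ Fin (3 - S.rInf)) := by
  have := S.genus_pos
  have := S.rInf_pos
  simp only [HIdx, Fintype.card_sum, Fintype.card_fin, Fintype.card_sigma]
  unfold g
  omega

/-- An identification of the unknowns with the equations of the linear system. -/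
def sysEquiv : S.HIdx ≃ Fin S.g ⊕ Fin (3 - S.rInf) := Fintype.equivOfCardEq S.card_HIdx

/-- The kernel of the linear system is trivial: the rational function with coefficients in the kernel
has `g` zeros and the decay that the interpolation lemma asks for. -/
theorem eq_zero_of_sysMat_mulVec {x : S.Phase} (ht : Function.Injective (S.pos x.2.2))
    (hq : Function.Injective x.1) (hqX : ∀ j s, x.1 j ≠ S.pos x.2.2 s) {H : S.HIdx → ℂ}
    (h : (S.sysMat x).mulVec H = 0) : H = 0 := by
  have hr := S.rInf_pos
  refine S.eq_zero_of_ratFun_eq_zero ht fun z hz => ?_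
  refine S.eq_zero_of_interpolation hq hqX (fun z hz => S.differentiableAt_ratFun _ _ hz)
    (S.ratFun_OX ht H) ?_ (fun j => ?_) z hz
  · rcases (by omega : 3 ≤ S.rInf ∨ S.rInf = 2 ∨ S.rInf = 1) with h3 | h2 | h1
    · exact S.ratFun_OI H h3
    · have h0 : S.sumH1 H = 0 := by
        have := congrFun h (Sum.inr ⟨0, by omega⟩)
        rwa [sysMat_mulVec_zero _ _ _ _ rfl] at this
      have := S.ratFun_OI_of_two (t := x.2.2) H h2
      rw [h2]
      simpa [h0] using this
    · have h0 : S.sumH1 H = 0 := by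
        have := congrFun h (Sum.inr ⟨0, by omega⟩)
        rwa [sysMat_mulVec_zero _ _ _ _ rfl] at this
      have h0' : S.sumH2 x.2.2 H = 0 := by
        have := congrFun h (Sum.inr ⟨1, by omega⟩)
        rwa [sysMat_mulVec_one _ _ _ _ (by simp)] at this
      have := S.ratFun_OI_of_one (t := x.2.2) H h1
      rw [h1]
      simpa [h0, h0'] using this
  · have := congrFun h (Sum.inl j)
    rwa [sysMat_mulVec_inl] at this

theorem det_sysMat_ne_zero {x : S.Phase} (hx : x ∈ S.regular) :
    ((S.sysMat x).submatrix S.sysEquiv id).det ≠ 0 := by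
  intro h0
  obtain ⟨H, hH, h⟩ := Matrix.exists_mulVec_eq_zero_iff.2 h0
  refine hH (S.eq_zero_of_sysMat_mulVec hx.1.1 hx.2.1 hx.2.2 ?_)
  funext i
  have := congrFun h (S.sysEquiv.symm i)
  simpa [Matrix.mulVec, dotProduct] using this

theorem isHSolution_iff_eq_inv (ħ : ℂ) (m : S.Mono) {x : S.Phase} (hx : x ∈ S.regular)
    (H : S.HIdx → ℂ) : S.IsHSolution ħ m x H ↔
      H = ((S.sysMat x).submatrix S.sysEquiv id)⁻¹.mulVec (S.sysRhs ħ m x ∘ S.sysEquiv) := by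
  have hdet : IsUnit ((S.sysMat x).submatrix S.sysEquiv id).det :=
    isUnit_iff_ne_zero.2 (S.det_sysMat_ne_zero hx)
  have h1 : (S.sysMat x).mulVec H = S.sysRhs ħ m x ↔
      ((S.sysMat x).submatrix S.sysEquiv id).mulVec H = S.sysRhs ħ m x ∘ S.sysEquiv := by
    have : ((S.sysMat x).submatrix S.sysEquiv id).mulVec H
        = (S.sysMat x).mulVec H ∘ S.sysEquiv := by
      funext i; simp [Matrix.mulVec, dotProduct]
    rw [this]
    exact ⟨fun h => by rw [h], fun h => by
      funext i; simpa using congrFun h (S.sysEquiv.symm i)⟩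
  rw [isHSolution_iff, h1]
  constructor
  · intro h; rw [← h, Matrix.mulVec_mulVec, Matrix.nonsing_inv_mul _ hdet, Matrix.one_mulVec]
  · intro h; rw [h, Matrix.mulVec_mulVec, Matrix.mul_nonsing_inv _ hdet, Matrix.one_mulVec]

theorem existsUnique_isHSolution (ħ : ℂ) (m : S.Mono) {x : S.Phase} (hx : x ∈ S.regular) :
    ∃! H, S.IsHSolution ħ m x H := by
  simp only [S.isHSolution_iff_eq_inv ħ m hx]
  exact existsUnique_eq

theorem Hsol_spec (ħ : ℂ) (m : S.Mono) {x : S.Phase} (hx : x ∈ S.regular) :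
    S.IsHSolution ħ m x (S.Hsol ħ m x) :=
  Classical.epsilon_spec (S.existsUnique_isHSolution ħ m hx).exists

theorem Hsol_eq (ħ : ℂ) (m : S.Mono) {x : S.Phase} (hx : x ∈ S.regular) : S.Hsol ħ m x
    = ((S.sysMat x).submatrix S.sysEquiv id)⁻¹.mulVec (S.sysRhs ħ m x ∘ S.sysEquiv) :=
  (S.isHSolution_iff_eq_inv ħ m hx _).1 (S.Hsol_spec ħ m hx)

/-! ### Holomorphy of the coefficients -/

theorem _root_.Isomono.differentiableAt_div {E : Type*} [NormedAddCommGroup E] [NormedSpace ℂ E]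
    {f h : E → ℂ} {x : E} (hf : DifferentiableAt ℂ f x) (hh : DifferentiableAt ℂ h x)
    (h0 : h x ≠ 0) : DifferentiableAt ℂ (fun y => f y / h y) x := by
  simp only [div_eq_mul_inv]
  exact hf.mul (hh.inv h0)

theorem differentiableAt_comp_times {F : S.Times → ℂ} {x : S.Phase}
    (h : DifferentiableAt ℂ F x.2.2) : DifferentiableAt ℂ (fun x : S.Phase => F x.2.2) x :=
  DifferentiableAt.fun_comp' x h (by fun_prop)

theorem differentiableAt_time (m : S.Mono) (p : S.Pole) (i : Fin 2) (k : ℕ) (t : S.Times) :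
    DifferentiableAt ℂ (fun t => S.time m t p i k) t := by
  unfold time; split_ifs <;> fun_prop

theorem differentiableAt_pos (s : Fin S.n) (t : S.Times) :
    DifferentiableAt ℂ (fun t => S.pos t s) t := by
  unfold pos; fun_prop

theorem differentiableAt_dtime (p : S.Pole) (k : ℕ) (t : S.Times) :
    DifferentiableAt ℂ (fun t => S.dtime t p k) t :=
  (S.differentiableAt_time 0 p 0 k t).fun_sub (S.differentiableAt_time 0 p 1 k t)

theorem isOpen_regular_of {U : Set S.Times} (hU : IsOpen U) : IsOpen (S.phaseDomain U) := by
  have h1 : IsOpen {x : S.Phase | x.2.2 ∈ U} := hU.preimage (by fun_prop)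
  have h2 : IsOpen {x : S.Phase | Function.Injective x.1} := by
    have : {x : S.Phase | Function.Injective x.1} = ⋂ i, ⋂ j, {x | i ≠ j → x.1 i ≠ x.1 j} := by
      ext x
      simp only [Set.mem_ofPred_eq, Set.mem_iInter]
      exact ⟨fun h i j hij e => hij (h e), fun h i j e => by
        by_contra hij; exact h i j hij e⟩
    rw [this]
    refine isOpen_iInter_of_finite fun i => isOpen_iInter_of_finite fun j => ?_
    by_cases hij : i = j
    · simp [hij]
    · simp only [hij, ne_eq, not_false_eq_true, forall_const]
      exact isOpen_ne_fun (by fun_prop) (by fun_prop)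
  have h3 : IsOpen {x : S.Phase | ∀ j s, x.1 j ≠ S.pos x.2.2 s} := by
    simp only [Set.ofPred_forall]
    refine isOpen_iInter_of_finite fun i => isOpen_iInter_of_finite fun j => ?_
    exact isOpen_ne_fun (by fun_prop) (by unfold pos; fun_prop)
  exact h1.inter (h2.inter h3)

theorem isOpen_admissible : IsOpen {t | S.Admissible t} := by
  have h2 : IsOpen {t : S.Times | Function.Injective (S.pos t)} := by
    have : {t : S.Times | Function.Injective (S.pos t)}
        = ⋂ i, ⋂ j, {t | i ≠ j → S.pos t i ≠ S.pos t j} := by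
      ext x
      simp only [Set.mem_ofPred_eq, Set.mem_iInter]
      exact ⟨fun h i j hij e => hij (h e), fun h i j e => by
        by_contra hij; exact h i j hij e⟩
    rw [this]
    refine isOpen_iInter_of_finite fun i => isOpen_iInter_of_finite fun j => ?_
    by_cases hij : i = j
    · simp [hij]
    · simp only [hij, ne_eq, not_false_eq_true, forall_const]
      exact isOpen_ne_fun (by unfold pos; fun_prop) (by unfold pos; fun_prop)
  have h3 : IsOpen {t : S.Times | ∀ p, 2 ≤ S.ord p → S.dtime t p (S.ord p - 1) ≠ 0} := by
    simp only [Set.ofPred_forall]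
    refine isOpen_iInter_of_finite fun p => isOpen_iInter_of_finite fun hp => ?_
    exact isOpen_ne_fun (continuous_iff_continuousAt.2 fun t =>
      (S.differentiableAt_dtime p _ t).continuousAt) continuous_const
  exact h2.inter h3

theorem isOpen_regular : IsOpen S.regular := S.isOpen_regular_of S.isOpen_admissible

theorem differentiableAt_P1 (m : S.Mono) {x : S.Phase} {j : Fin S.g}
    (h : ∀ s, x.1 j ≠ S.pos x.2.2 s) :
    DifferentiableAt ℂ (fun x : S.Phase => S.P1 m x.2.2 (x.1 j)) x := by
  have ht := fun p i k => S.differentiableAt_comp_times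
    (S.differentiableAt_time m p i k x.2.2)
  have hX := fun s => S.differentiableAt_comp_times (S.differentiableAt_pos s x.2.2)
  have hq : DifferentiableAt ℂ (fun x : S.Phase => x.1 j) x := by fun_prop
  unfold P1
  refine DifferentiableAt.fun_add (DifferentiableAt.fun_neg (DifferentiableAt.fun_sum fun k _ => ?_))
    (DifferentiableAt.fun_sum fun s _ => DifferentiableAt.fun_sum fun k _ => ?_)
  · exact ((ht _ _ _).fun_add (ht _ _ _)).fun_mul (hq.fun_pow _)
  · exact differentiableAt_div ((ht _ _ _).fun_add (ht _ _ _)) ((hq.fun_sub (hX s)).fun_pow _)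
      (pow_ne_zero _ (sub_ne_zero.2 (h s)))

theorem differentiableAt_P2 (m : S.Mono) {x : S.Phase} {j : Fin S.g}
    (h : ∀ s, x.1 j ≠ S.pos x.2.2 s) :
    DifferentiableAt ℂ (fun x : S.Phase => S.P2 m x.2.2 (x.1 j)) x := by
  have ht := fun p i k => S.differentiableAt_comp_times
    (S.differentiableAt_time m p i k x.2.2)
  have hX := fun s => S.differentiableAt_comp_times (S.differentiableAt_pos s x.2.2)
  have hq : DifferentiableAt ℂ (fun x : S.Phase => x.1 j) x := by fun_prop
  unfold P2
  refine DifferentiableAt.fun_add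
    (DifferentiableAt.fun_sum fun a _ => DifferentiableAt.fun_sum fun b _ => ?_)
    (DifferentiableAt.fun_sum fun s _ => DifferentiableAt.fun_sum fun a _ =>
      DifferentiableAt.fun_sum fun b _ => ?_)
  · split_ifs
    · exact ((ht _ _ _).fun_mul (ht _ _ _)).fun_mul (hq.fun_pow _)
    · exact differentiableAt_const _
  · split_ifs
    · exact differentiableAt_div ((ht _ _ _).fun_mul (ht _ _ _)) ((hq.fun_sub (hX s)).fun_pow _)
        (pow_ne_zero _ (sub_ne_zero.2 (h s)))
    · exact differentiableAt_const _

theorem differentiableAt_sysRhs (ħ : ℂ) (m : S.Mono) {x : S.Phase} (hx : x ∈ S.regular)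
    (i : Fin S.g ⊕ Fin (3 - S.rInf)) :
    DifferentiableAt ℂ (fun x => S.sysRhs ħ m x i) x := by
  have ht := fun p i k => S.differentiableAt_comp_times
    (S.differentiableAt_time m p i k x.2.2)
  have hX := fun s => S.differentiableAt_comp_times (S.differentiableAt_pos s x.2.2)
  have hq : ∀ j, DifferentiableAt ℂ (fun x : S.Phase => x.1 j) x := by intro j; fun_prop
  have hp : ∀ j, DifferentiableAt ℂ (fun x : S.Phase => x.2.1 j) x := by intro j; fun_prop
  rcases i with j | e
  · have h1 := S.differentiableAt_P1 m (hx.2.2 j)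
    have h2 := S.differentiableAt_P2 m (hx.2.2 j)
    simp only [sysRhs]
    refine DifferentiableAt.fun_add (DifferentiableAt.fun_add (DifferentiableAt.fun_add (DifferentiableAt.fun_add
      (((hp j).fun_pow 2).fun_sub (h1.mul (hp j))) ((hp j).fun_mul (DifferentiableAt.fun_sum fun s _ => ?_)))
      h2) (DifferentiableAt.const_mul (DifferentiableAt.fun_sum fun i hi => ?_) _)) ?_
    · exact differentiableAt_div (differentiableAt_const _) ((hq j).fun_sub (hX s)) (sub_ne_zero.2 (hx.2.2 j s))
    · exact differentiableAt_div ((hp i).fun_sub (hp j)) ((hq j).fun_sub (hq i))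
        (sub_ne_zero.2 fun h => Finset.ne_of_mem_erase hi (hx.2.1 h).symm)
    · split_ifs
      · exact ((ht _ _ _).const_mul _).fun_mul ((hq j).fun_pow _)
      · exact differentiableAt_const _
  · simp only [sysRhs]
    split_ifs
    · exact ((DifferentiableAt.fun_sum fun j _ => hp j).const_mul _).fun_sub
        ((((ht none 0 1).mul_const _).fun_add ((ht none 1 1).mul_const _)).fun_add
          ((ht none 0 1).const_mul _))
    · fun_prop
    · fun_prop

theorem differentiableAt_sysMat {x : S.Phase} (hx : x ∈ S.regular)
    (i : Fin S.g ⊕ Fin (3 - S.rInf)) (k : S.HIdx) :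
    DifferentiableAt ℂ (fun x => S.sysMat x i k) x := by
  have hX := fun s => S.differentiableAt_comp_times (S.differentiableAt_pos s x.2.2)
  have hq : ∀ j, DifferentiableAt ℂ (fun x : S.Phase => x.1 j) x := by intro j; fun_prop
  rcases i with j | e <;> rcases k with k | a <;> simp only [sysMat]
  · fun_prop
  · exact (((hq j).fun_sub (hX a.1)).fun_pow _).fun_inv (pow_ne_zero _ (sub_ne_zero.2 (hx.2.2 j a.1)))
  · fun_prop
  · split_ifs
    · fun_prop
    · fun_prop
    · exact hX a.1
    · fun_prop
    · fun_prop

theorem differentiableAt_Hsol (ħ : ℂ) (m : S.Mono) {x : S.Phase} (hx : x ∈ S.regular)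
    (k : S.HIdx) : DifferentiableAt ℂ (fun x => S.Hsol ħ m x k) x := by
  have h : DifferentiableAt ℂ (fun x => ((S.sysMat x).submatrix S.sysEquiv id)⁻¹.mulVec
      (S.sysRhs ħ m x ∘ S.sysEquiv) k) x := by
    simp only [Matrix.mulVec, dotProduct]
    refine DifferentiableAt.fun_sum fun i _ => DifferentiableAt.fun_mul ?_
      (S.differentiableAt_sysRhs ħ m hx _)
    exact differentiableAt_matrix_inv (A := fun x => (S.sysMat x).submatrix S.sysEquiv id)
      (fun i j => S.differentiableAt_sysMat hx _ _) (S.det_sysMat_ne_zero hx) k i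
  refine h.congr_of_eventuallyEq ?_
  filter_upwards [S.isOpen_regular.mem_nhds hx] with y hy
  rw [S.Hsol_eq ħ m hy]

theorem det_toep (t : S.Times) (p : S.Pole) :
    (S.toep t p).det = S.dtime t p (S.ord p - 1) ^ (S.ord p - 1) := by
  rw [Matrix.det_of_isLowerTriangular]
  · simp [toep]
  · intro i j hij
    have hij : i < j := by simpa using hij
    simp [toep, not_le.2 hij]

theorem det_toep_ne_zero {t : S.Times} (ht : S.Admissible t) (p : S.Pole) :
    (S.toep t p).det ≠ 0 := by
  rw [det_toep]
  by_cases h : 2 ≤ S.ord p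
  · exact pow_ne_zero _ (ht.2 p h)
  · rw [show S.ord p - 1 = 0 by omega, pow_zero]; exact one_ne_zero

theorem differentiableAt_toep_inv {t : S.Times} (ht : S.Admissible t) (p : S.Pole)
    (i j : Fin (S.ord p - 1)) : DifferentiableAt ℂ (fun t => (S.toep t p)⁻¹ i j) t := by
  refine differentiableAt_matrix_inv (A := fun t => S.toep t p) (fun i j => ?_)
    (S.det_toep_ne_zero ht p) i j
  simp only [toep, Matrix.of_apply]
  split_ifs
  · exact S.differentiableAt_dtime p _ t
  · exact differentiableAt_const _

theorem differentiableAt_nuVec {t : S.Times} (ht : S.Admissible t) (α : S.Times) (p : S.Pole)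
    (a : ℕ) : DifferentiableAt ℂ (fun t => S.nuVec t α p a) t := by
  unfold nuVec
  by_cases h : a < S.ord p - 1
  · simp only [dif_pos h, Matrix.mulVec, dotProduct]
    exact DifferentiableAt.fun_sum fun i _ => (S.differentiableAt_toep_inv ht p _ i).mul_const _
  · simp only [dif_neg h]
    exact differentiableAt_const _

theorem differentiableAt_cCoef {t : S.Times} (ht : S.Admissible t) (α : S.Times) (p : S.Pole)
    (k : ℕ) : DifferentiableAt ℂ (fun t => S.cCoef t α p k) t := by
  unfold cCoef
  split_ifs
  · simp only [Matrix.mulVec, dotProduct, div_eq_mul_inv]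
    refine DifferentiableAt.fun_sum fun i _ => (S.differentiableAt_toep_inv ht p _ i).fun_mul ?_
    refine DifferentiableAt.fun_sum fun l _ => DifferentiableAt.fun_mul ?_ (differentiableAt_const _)
    exact ((S.differentiableAt_time 0 p 1 _ t).mul_const _).fun_sub
      ((S.differentiableAt_time 0 p 0 _ t).mul_const _)
  · exact differentiableAt_const _

theorem differentiableAt_Ham (ħ : ℂ) (m : S.Mono) {c0 : S.Times → ℂ} (α : S.Times) {x : S.Phase}
    (hx : x ∈ S.regular) (hc : DifferentiableAt ℂ c0 x.2.2) :
    DifferentiableAt ℂ (S.Ham ħ m c0 α) x := by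
  have hH := S.differentiableAt_Hsol ħ m hx
  have hHX : ∀ s k, DifferentiableAt ℂ (fun x => S.HX (S.Hsol ħ m x) s k) x := by
    intro s k; unfold HX; split_ifs
    · exact hH _
    · exact differentiableAt_const _
  have hX := fun s => S.differentiableAt_comp_times (S.differentiableAt_pos s x.2.2)
  have hq : ∀ j, DifferentiableAt ℂ (fun x : S.Phase => x.1 j) x := by intro j; fun_prop
  have hp : ∀ j, DifferentiableAt ℂ (fun x : S.Phase => x.2.1 j) x := by intro j; fun_prop
  have hν : ∀ p a, DifferentiableAt ℂ (fun x : S.Phase => S.nuVec x.2.2 α p a) x := fun p a =>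
    S.differentiableAt_comp_times (S.differentiableAt_nuVec hx.1 α p a)
  have hcc : ∀ p a, DifferentiableAt ℂ (fun x : S.Phase => S.cCoef x.2.2 α p a) x := fun p a =>
    S.differentiableAt_comp_times (S.differentiableAt_cCoef hx.1 α p a)
  have h0 : DifferentiableAt ℂ (fun x : S.Phase => c0 x.2.2) x := S.differentiableAt_comp_times hc
  have h1 : DifferentiableAt ℂ (fun x => S.sumH1 (S.Hsol ħ m x)) x :=
    DifferentiableAt.fun_sum fun s _ => hHX s 1
  have h2 : DifferentiableAt ℂ (fun x => S.sumH2 x.2.2 (S.Hsol ħ m x)) x :=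
    DifferentiableAt.fun_sum fun s _ => ((hX s).fun_mul (hHX s 1)).fun_add (hHX s 2)
  have h3 : DifferentiableAt ℂ (fun x : S.Phase => ∑ j, x.2.1 j) x := by fun_prop
  have h4 : DifferentiableAt ℂ (fun x : S.Phase => ∑ j, x.1 j * x.2.1 j) x := by fun_prop
  have h5 : DifferentiableAt ℂ (fun x : S.Phase => ∑ j, (c0 x.2.2
        + (∑ k ∈ Finset.Icc 1 (S.rInf - 1), S.cCoef x.2.2 α none k * x.1 j ^ k)
        + ∑ s, ∑ k ∈ Finset.Icc 1 (S.r s - 1),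
            S.cCoef x.2.2 α (some s) k / (x.1 j - S.pos x.2.2 s) ^ k)) x := by
    refine DifferentiableAt.fun_sum fun j _ => (h0.fun_add (DifferentiableAt.fun_sum fun k _ =>
      (hcc _ _).fun_mul ((hq j).fun_pow _))).fun_add (DifferentiableAt.fun_sum fun s _ =>
        DifferentiableAt.fun_sum fun k _ => ?_)
    exact differentiableAt_div (hcc _ _) (((hq j).fun_sub (hX s)).fun_pow _)
      (pow_ne_zero _ (sub_ne_zero.2 (hx.2.2 j s)))
  unfold Ham nuInf nuX
  refine (((((((((DifferentiableAt.fun_sum fun k _ => ?_).fun_sub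
    (DifferentiableAt.fun_sum fun s _ => DifferentiableAt.fun_sum fun k _ => ?_)).fun_add
    (DifferentiableAt.fun_sum fun s _ => ?_)).fun_sub (h5.const_mul ħ)).fun_add ?_).fun_add ?_).fun_sub ?_).fun_sub
    ?_).fun_sub ?_).fun_sub ?_
  · exact (hν _ _).fun_mul (hH _)
  · exact (hν _ _).fun_mul (hHX _ _)
  · exact (hHX _ _).const_mul _
  · exact (hν _ _).fun_mul h2
  · exact (hν _ _).fun_mul h1
  · split_ifs
    · exact (h1.sub (h3.const_mul ħ)).fun_mul (hν _ _)
    · exact differentiableAt_const _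
  · split_ifs
    · exact (h2.sub (h4.const_mul ħ)).fun_mul (hν _ _)
    · exact differentiableAt_const _
  · exact ((hν _ _).const_mul ħ).fun_mul h3
  · exact ((hν _ _).const_mul ħ).fun_mul h4

end PoleData

/-! ### Expansions of the spectral curve at its poles -/

namespace PoleData

variable (S : PoleData)

/-- The trace `t_{p^{(1)}, k} + t_{p^{(2)}, k}`. -/
def trTime (m : S.Mono) (t : S.Times) (p : S.Pole) (k : ℕ) : ℂ :=
  S.time m t p 0 k + S.time m t p 1 k

/-- The difference `t_{p^{(1)}, k} - t_{p^{(2)}, k}`, monodromies included. -/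
def dfTime (m : S.Mono) (t : S.Times) (p : S.Pole) (k : ℕ) : ℂ :=
  S.time m t p 0 k - S.time m t p 1 k

theorem time_zero (m : S.Mono) (t : S.Times) (p : S.Pole) (i : Fin 2) :
    S.time m t p i 0 = m p i := rfl

/-- The derivative of `P₁`. -/
def dP1 (m : S.Mono) (t : S.Times) (z : ℂ) : ℂ :=
  -∑ k ∈ Finset.Icc 1 (S.rInf - 1), S.trTime m t none k * (((k - 1 : ℕ) : ℂ) * z ^ (k - 2))
    - ∑ s, ∑ k ∈ Finset.range (S.r s),
        S.trTime m t (some s) k * ((k + 1 : ℂ) * ((z - S.pos t s) ^ (k + 2))⁻¹)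

theorem P1_principal (m : S.Mono) {t : S.Times} (ht : Function.Injective (S.pos t)) (s : Fin S.n) :
    OX (S.pos t s) (fun z => S.P1 m t z
      - ∑ k ∈ Finset.range (S.r s), S.trTime m t (some s) k * (z - S.pos t s) ^ (-1 - k : ℤ)) 0 := by
  have h1 : OX (S.pos t s) (fun z => -∑ k ∈ Finset.Icc 1 (S.rInf - 1),
      (S.time m t none 0 k + S.time m t none 1 k) * z ^ (k - 1)) 0 :=
    OX.of_continuousAt (by fun_prop)
  have h2 : OX (S.pos t s) (fun z => ∑ s' ∈ Finset.univ.erase s, ∑ k ∈ Finset.range (S.r s'),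
      (S.time m t (some s') 0 k + S.time m t (some s') 1 k) / (z - S.pos t s') ^ (k + 1)) 0 := by
    refine OrdAt.sum fun s' hs' => OrdAt.sum fun k _ => ?_
    simp only [div_eq_mul_inv]
    exact (OX.inv_pow (fun h => (Finset.ne_of_mem_erase hs') (ht h).symm) _).const_mul _
  refine (h1.add h2).congr fun z => ?_
  rw [P1, ← Finset.add_sum_erase _ _ (Finset.mem_univ s)]
  have : ∀ k ∈ Finset.range (S.r s), (S.time m t (some s) 0 k + S.time m t (some s) 1 k)
      / (z - S.pos t s) ^ (k + 1) = S.trTime m t (some s) k * (z - S.pos t s) ^ (-1 - k : ℤ) := by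
    intro k _
    rw [trTime, div_eq_mul_inv, ← zpow_natCast, ← zpow_neg]
    congr 2; push_cast; ring
  rw [Finset.sum_congr rfl this]
  ring

theorem dP1_principal (m : S.Mono) {t : S.Times} (ht : Function.Injective (S.pos t))
    (s : Fin S.n) :
    OX (S.pos t s) (fun z => S.dP1 m t z + ∑ k ∈ Finset.range (S.r s),
      S.trTime m t (some s) k * ((k + 1 : ℂ) * (z - S.pos t s) ^ (-2 - k : ℤ))) 0 := by
  have h1 : OX (S.pos t s) (fun z => -∑ k ∈ Finset.Icc 1 (S.rInf - 1),
      S.trTime m t none k * (((k - 1 : ℕ) : ℂ) * z ^ (k - 2))) 0 :=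
    OX.of_continuousAt (by fun_prop)
  have h2 : OX (S.pos t s) (fun z => ∑ s' ∈ Finset.univ.erase s, ∑ k ∈ Finset.range (S.r s'),
      S.trTime m t (some s') k * ((k + 1 : ℂ) * ((z - S.pos t s') ^ (k + 2))⁻¹)) 0 := by
    refine OrdAt.sum fun s' hs' => OrdAt.sum fun k _ => ?_
    exact ((OX.inv_pow (fun h => (Finset.ne_of_mem_erase hs') (ht h).symm) _).const_mul _).const_mul _
  refine (h1.sub h2).congr fun z => ?_
  rw [dP1, ← Finset.add_sum_erase _ _ (Finset.mem_univ s)]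
  have : ∀ k ∈ Finset.range (S.r s), S.trTime m t (some s) k
      * ((k + 1 : ℂ) * ((z - S.pos t s) ^ (k + 2))⁻¹)
      = S.trTime m t (some s) k * ((k + 1 : ℂ) * (z - S.pos t s) ^ (-2 - k : ℤ)) := by
    intro k _
    rw [← zpow_natCast, ← zpow_neg]
    congr 3; push_cast; ring
  rw [Finset.sum_congr rfl this]
  ring

/-- Near `X_s`, up to order `-r_s`, the function `P̃₂` is the product of the two principal parts. -/
theorem P2_principal (m : S.Mono) {t : S.Times} (ht : Function.Injective (S.pos t)) (s : Fin S.n) :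
    OX (S.pos t s) (fun z => S.P2 m t z
      - (∑ k ∈ Finset.range (S.r s), S.time m t (some s) 0 k * (z - S.pos t s) ^ (-1 - k : ℤ))
        * ∑ k ∈ Finset.range (S.r s), S.time m t (some s) 1 k * (z - S.pos t s) ^ (-1 - k : ℤ))
      (-(S.r s : ℤ)) := by
  have hw := tendsto_sub_punctured (S.pos t s)
  have h1 : OX (S.pos t s) (fun z => ∑ a ∈ Finset.range S.rInf, ∑ b ∈ Finset.range S.rInf,
      if S.rInf ≤ a + b + 1 ∧ 2 ≤ a + b then
        S.time m t none 0 a * S.time m t none 1 b * z ^ (a + b - 2) else 0) 0 := by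
    refine OrdAt.sum fun a _ => OrdAt.sum fun b _ => ?_
    split_ifs
    · exact OX.of_continuousAt (by fun_prop)
    · exact OrdAt.zero
  have h2 : OX (S.pos t s) (fun z => ∑ s' ∈ Finset.univ.erase s,
      ∑ a ∈ Finset.range (S.r s'), ∑ b ∈ Finset.range (S.r s'),
        if S.r s' ≤ a + b + 1 then
          S.time m t (some s') 0 a * S.time m t (some s') 1 b / (z - S.pos t s') ^ (a + b + 2)
        else 0) 0 := by
    refine OrdAt.sum fun s' hs' => OrdAt.sum fun a _ => OrdAt.sum fun b _ => ?_
    split_ifs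
    · simp only [div_eq_mul_inv]
      exact (OX.inv_pow (fun h => (Finset.ne_of_mem_erase hs') (ht h).symm) _).const_mul _
    · exact OrdAt.zero
  have h3 := (OrdAt.trunc_mul hw (-1) (S.r s) (S.time m t (some s) 0) (S.time m t (some s) 1)).mono
    hw (k := -(S.r s : ℤ)) (by omega)
  refine (((h1.add h2).mono hw (by omega)).add h3).congr fun z => ?_
  rw [P2, ← Finset.add_sum_erase _ _ (Finset.mem_univ s)]
  have : ∀ a ∈ Finset.range (S.r s), ∀ b ∈ Finset.range (S.r s),
      (if S.r s ≤ a + b + 1 then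
          S.time m t (some s) 0 a * S.time m t (some s) 1 b / (z - S.pos t s) ^ (a + b + 2)
        else 0) = if S.r s ≤ a + b + 1 then S.time m t (some s) 0 a * S.time m t (some s) 1 b
          * (z - S.pos t s) ^ (2 * -1 - (a + b : ℕ) : ℤ) else 0 := by
    intro a _ b _
    rw [div_eq_mul_inv, ← zpow_natCast, ← zpow_neg]
    congr 3; push_cast; ring
  rw [Finset.sum_congr rfl fun a ha => Finset.sum_congr rfl fun b hb => this a ha b hb]
  ring

/-- The Laurent polynomial `∑ₖ uₖ z ^ (k - 1)` with `0 ≤ k < rInf`. If `u` is the sequence of times of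
a sheet, it is the expansion of that sheet at infinity. The exponents are written as powers of the
local parameter `z⁻¹`. -/
def yInf (u : ℕ → ℂ) (z : ℂ) : ℂ := ∑ k ∈ Finset.range S.rInf, u k * z⁻¹ ^ (1 - k : ℤ)

theorem yInf_OI (u : ℕ → ℂ) : OI (S.yInf u) (2 - S.rInf) := by
  refine OrdAt.sum fun k hk => ?_
  have := Finset.mem_range.1 hk
  exact (OrdAt.zpow_of_le tendsto_inv_cobounded' (by omega)).const_mul _

theorem inv_zpow_eq_pow (z : ℂ) {n : ℤ} {k : ℕ} (h : n = -k) : z⁻¹ ^ n = z ^ k := by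
  rw [h, inv_zpow, zpow_neg, inv_inv, zpow_natCast]

theorem yInf_eq (u : ℕ → ℂ) (z : ℂ) : S.yInf u z
    = u 0 * z⁻¹ + ∑ k ∈ Finset.Icc 1 (S.rInf - 1), u k * z ^ (k - 1) := by
  obtain ⟨r', hr⟩ := Nat.exists_eq_add_of_le' S.rInf_pos
  rw [yInf, hr, Finset.sum_range_succ', Nat.add_sub_cancel, add_comm,
    ← Finset.sum_Ico_add' (fun k => u k * z ^ (k - 1)) 0 r' 1 |>.trans
      (Finset.sum_congr (by ext; simp) fun _ _ => rfl)]
  simp only [Nat.cast_zero, sub_zero, zpow_one, Finset.range_eq_Ico]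
  congr 1
  refine Finset.sum_congr rfl fun k _ => ?_
  rw [inv_zpow_eq_pow z (k := k) (by push_cast; ring_nf), Nat.add_sub_cancel]

theorem yInf_add (u v : ℕ → ℂ) (z : ℂ) :
    S.yInf (fun k => u k + v k) z = S.yInf u z + S.yInf v z := by
  simp only [yInf, add_mul, Finset.sum_add_distrib]

theorem yInf_sub (u v : ℕ → ℂ) (z : ℂ) :
    S.yInf (fun k => u k - v k) z = S.yInf u z - S.yInf v z := by
  simp only [yInf, sub_mul, Finset.sum_sub_distrib]

theorem sum_trTime_zero {m : S.Mono} (hm : ∑ p, ∑ i, m p i = 0) (t : S.Times) :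
    ∑ s, S.trTime m t (some s) 0 = -S.trTime m t none 0 := by
  simp only [Fintype.sum_option, Fin.sum_univ_two] at hm
  simp only [trTime, time, if_true]
  linear_combination hm

/-- Up to `O(z⁻²)` at infinity, the part of `P₁` with a pole at `X_s` is the monodromy term. -/
theorem P1_fin_OI (m : S.Mono) (t : S.Times) (s : Fin S.n) :
    OI (fun z => (∑ k ∈ Finset.range (S.r s), (S.time m t (some s) 0 k + S.time m t (some s) 1 k)
      / (z - S.pos t s) ^ (k + 1)) - S.trTime m t (some s) 0 * z⁻¹) 2 := by
  have hw := tendsto_inv_cobounded'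
  obtain ⟨r', hr⟩ := Nat.exists_eq_add_of_le' (S.r_pos s)
  have h1 := (OI.inv_sub_sub_inv (S.pos t s)).const_mul (S.trTime m t (some s) 0)
  have h2 : OI (fun z => ∑ k ∈ Finset.range r', S.trTime m t (some s) (k + 1)
      * ((z - S.pos t s) ^ (k + 2))⁻¹) 2 :=
    OrdAt.sum fun k _ => ((OI.inv_sub_pow _ _).const_mul _).mono hw (by push_cast; omega)
  refine (h1.add h2).congr fun z => ?_
  rw [hr, Finset.sum_range_succ']
  simp only [trTime, div_eq_mul_inv, zero_add, pow_one]
  ring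

/-- As the monodromies add up to zero, `-P₁` is given up to `O(z⁻²)` at infinity by the sum of the
expansions of the two sheets. -/
theorem P1_add_yInf {m : S.Mono} (hm : ∑ p, ∑ i, m p i = 0) (t : S.Times) :
    OI (fun z => S.P1 m t z + S.yInf (S.trTime m t none) z) 2 := by
  refine (OrdAt.sum fun s (_ : s ∈ Finset.univ) => S.P1_fin_OI m t s).congr fun z => ?_
  rw [yInf_eq, P1, Finset.sum_sub_distrib, ← Finset.sum_mul, S.sum_trTime_zero hm]
  simp only [trTime]
  ring

theorem P1_OI {m : S.Mono} (hm : ∑ p, ∑ i, m p i = 0) (t : S.Times) :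
    OI (S.P1 m t) (2 - S.rInf) :=
  (((S.P1_add_yInf hm t).mono tendsto_inv_cobounded' (by omega)).sub (S.yInf_OI _)).congr
    fun z => by ring

theorem P1_lead {m : S.Mono} (hm : ∑ p, ∑ i, m p i = 0) (t : S.Times) :
    OI (fun z => S.P1 m t z + S.trTime m t none (S.rInf - 1) * z⁻¹ ^ (2 - S.rInf : ℤ))
      (3 - S.rInf) := by
  have hw := tendsto_inv_cobounded'
  obtain ⟨r', hr⟩ := Nat.exists_eq_add_of_le' S.rInf_pos
  have h2 : OI (fun z => ∑ k ∈ Finset.range r', S.trTime m t none k * z⁻¹ ^ (1 - k : ℤ))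
      (3 - S.rInf) := by
    refine OrdAt.sum fun k hk => ?_
    have := Finset.mem_range.1 hk
    exact (OrdAt.zpow_of_le hw (by omega)).const_mul _
  refine (((S.P1_add_yInf hm t).mono hw (by omega)).sub h2).congr fun z => ?_
  rw [yInf, hr, Finset.sum_range_succ, Nat.add_sub_cancel]
  have : (2 - ((r' + 1 : ℕ) : ℤ)) = 1 - (r' : ℤ) := by push_cast; ring
  rw [this]; ring

theorem dP1_lead {m : S.Mono} (hm : ∑ p, ∑ i, m p i = 0) (t : S.Times) :
    OI (fun z => S.dP1 m t z
      + (S.rInf - 2 : ℂ) * S.trTime m t none (S.rInf - 1) * z⁻¹ ^ (3 - S.rInf : ℤ))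
      (4 - S.rInf) := by
  have hw := tendsto_inv_cobounded'
  rcases (by have := S.rInf_pos; omega : S.rInf = 1 ∨ 2 ≤ S.rInf) with h1 | h2
  · have key : OI (fun z => ∑ s, ((∑ k ∈ Finset.range (S.r s),
        S.trTime m t (some s) k * ((k + 1 : ℂ) * ((z - S.pos t s) ^ (k + 2))⁻¹))
        - S.trTime m t (some s) 0 * z⁻¹ ^ 2)) 3 := by
      refine OrdAt.sum fun s _ => ?_
      obtain ⟨r', hr⟩ := Nat.exists_eq_add_of_le' (S.r_pos s)
      have h1 := (OI.inv_sub_sq_expand (S.pos t s)).const_mul (S.trTime m t (some s) 0)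
      have h2 : OI (fun z => ∑ k ∈ Finset.range r', S.trTime m t (some s) (k + 1)
          * (((k + 1 : ℕ) + 1 : ℂ) * ((z - S.pos t s) ^ (k + 3))⁻¹)) 3 :=
        OrdAt.sum fun k _ =>
          (((OI.inv_sub_pow _ _).const_mul _).const_mul _).mono hw (by push_cast; omega)
      refine (h1.add h2).congr fun z => ?_
      rw [hr, Finset.sum_range_succ']
      simp only [Nat.cast_zero, zero_add, one_mul]
      ring
    rw [h1]
    refine (key.neg).congr fun z => ?_
    rw [dP1, Finset.sum_sub_distrib, ← Finset.sum_mul, S.sum_trTime_zero hm, h1]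
    have : ((3 : ℤ) - (1 : ℕ)) = 2 := by norm_num
    simp only [this, zpow_ofNat]
    simp
    ring
  · have hfin : OI (fun z => ∑ s, ∑ k ∈ Finset.range (S.r s),
        S.trTime m t (some s) k * ((k + 1 : ℂ) * ((z - S.pos t s) ^ (k + 2))⁻¹)) 2 :=
      OrdAt.sum fun s _ => OrdAt.sum fun k _ =>
        (((OI.inv_sub_pow _ _).const_mul _).const_mul _).mono hw (by push_cast; omega)
    obtain ⟨r', hr⟩ := Nat.exists_eq_add_of_le' h2
    have hpol : OI (fun z => ∑ k ∈ Finset.Icc 1 r',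
        S.trTime m t none k * (((k - 1 : ℕ) : ℂ) * z ^ (k - 2))) (4 - S.rInf) := by
      refine OrdAt.sum fun k hk => ?_
      have hk := Finset.mem_Icc.1 hk
      rcases Nat.lt_or_ge k 2 with h | h
      · have : k - 1 = 0 := by omega
        simpa [this] using OrdAt.zero
      · exact (((OI.monomial _).const_mul _).const_mul _).mono hw (by omega)
    refine (hpol.neg.sub (hfin.mono hw (by omega))).congr fun z => ?_
    rw [dP1, hr, show r' + 2 - 1 = r' + 1 by omega, Finset.sum_Icc_succ_top (by omega)]
    rcases Nat.eq_zero_or_pos r' with h0 | h0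
    · subst h0; simp
    · rw [inv_zpow_eq_pow z (k := r' + 1 - 2) (by omega)]
      push_cast [Nat.add_sub_cancel]
      ring

/-! ### The coefficient system at infinity -/

theorem P2_fin_OI (m : S.Mono) (t : S.Times) (s : Fin S.n) :
    OI (fun z => (∑ a ∈ Finset.range (S.r s), ∑ b ∈ Finset.range (S.r s),
        if S.r s ≤ a + b + 1 then
          S.time m t (some s) 0 a * S.time m t (some s) 1 b / (z - S.pos t s) ^ (a + b + 2) else 0)
        - (if S.r s = 1 then m (some s) 0 * m (some s) 1 else 0) * z⁻¹ ^ 2) 3 := by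
  have hw := tendsto_inv_cobounded'
  by_cases h : S.r s = 1
  · refine ((OI.inv_sub_sq_expand (S.pos t s)).const_mul (m (some s) 0 * m (some s) 1)).congr
      fun z => ?_
    simp [h, time]
    ring
  · simp only [h, if_false, zero_mul, sub_zero]
    have := S.r_pos s
    refine OrdAt.sum fun a _ => OrdAt.sum fun b _ => ?_
    split_ifs
    · simp only [div_eq_mul_inv]
      exact ((OI.inv_sub_pow _ _).const_mul _).mono hw (by push_cast; omega)
    · exact OrdAt.zero

/-- The asymptotic form of the linear system: prescribing the decay at infinity of the solution
amounts to prescribing the determinant of the connection there. -/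
theorem solution_OI (ħ : ℂ) (m : S.Mono) {x : S.Phase} {H : S.HIdx → ℂ}
    (hH : S.IsHSolution ħ m x H) :
    OI (fun z => S.ratFun x.2.2 H z
      - (if 3 ≤ S.rInf then
          ħ * S.time m x.2.2 none 0 (S.rInf - 1) * z ^ (S.rInf - 3) else 0)
      - S.P2 m x.2.2 z - ħ * ∑ i, x.2.1 i * (z - x.1 i)⁻¹
      + S.yInf (S.time m x.2.2 none 0) z * S.yInf (S.time m x.2.2 none 1) z
      + ħ * S.time m x.2.2 none 0 (S.rInf - 1) * z⁻¹ ^ (3 - S.rInf : ℤ)) (4 - S.rInf) := by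
  have hw := tendsto_inv_cobounded'
  have htr := OrdAt.trunc_mul hw 1 S.rInf (S.time m x.2.2 none 0) (S.time m x.2.2 none 1)
  have hfin := OrdAt.sum fun s (_ : s ∈ Finset.univ) => S.P2_fin_OI m x.2.2 s
  obtain ⟨-, hH2, hH1⟩ := hH
  have hr := S.rInf_pos
  have hw1 : OI (fun z => z⁻¹) 1 := by
    simpa using OrdAt.zpow_self (l := cobounded ℂ) (w := fun z => z⁻¹) 1
  have hw2 : OI (fun z => z⁻¹ ^ 2) 2 := OrdAt.zpow_self (l := cobounded ℂ) (w := fun z => z⁻¹) 2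
  have hfin2 := ((hfin.mono hw (k := 2) (by omega)).add
    (hw2.const_mul (∑ s, if S.r s = 1 then m (some s) 0 * m (some s) 1 else 0)))
  -- for `rInf = 2` and `rInf = 1` the expansion has to be controlled to one and two orders more; the
  -- additional equations of the system say that the coefficients of these orders cancel
  rcases (by omega : 3 ≤ S.rInf ∨ S.rInf = 2 ∨ S.rInf = 1) with h3 | h2 | h1
  · have hp : OI (fun z => ħ * ∑ i, x.2.1 i * (z - x.1 i)⁻¹) 1 :=
      (OrdAt.sum fun i _ => (OI.inv_sub _).const_mul _).const_mul _
    refine ((((S.ratFun_OI (t := x.2.2) H h3).sub (htr.mono hw (by omega))).sub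
      (hfin2.mono hw (by omega))).sub (hp.mono hw (by omega))).congr fun z => ?_
    -- the product of the two expansions, truncated at nonnegative powers of `z`, is `P̃₂`
    have hpol : ∀ a ∈ Finset.range S.rInf, ∀ b ∈ Finset.range S.rInf,
        (if S.rInf ≤ a + b + 1 then S.time m x.2.2 none 0 a * S.time m x.2.2 none 1 b
          * z⁻¹ ^ (2 * 1 - (a + b : ℕ) : ℤ) else 0)
        = if S.rInf ≤ a + b + 1 ∧ 2 ≤ a + b then
          S.time m x.2.2 none 0 a * S.time m x.2.2 none 1 b * z ^ (a + b - 2) else 0 := by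
      intro a _ b _
      by_cases h : S.rInf ≤ a + b + 1
      · rw [if_pos h, if_pos ⟨h, by omega⟩, inv_zpow_eq_pow z (k := a + b - 2) (by omega)]
      · rw [if_neg h, if_neg (fun h' => h h'.1)]
    rw [Finset.sum_congr rfl fun a ha => Finset.sum_congr rfl fun b hb => hpol a ha b hb,
      if_pos h3, inv_zpow_eq_pow z (k := S.rInf - 3) (by omega), P2, Finset.sum_sub_distrib,
      ← Finset.sum_mul, yInf, yInf]
    ring
  · have hp : OI (fun z => ħ * ∑ i, x.2.1 i * ((z - x.1 i)⁻¹ - z⁻¹)) 2 :=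
      (OrdAt.sum fun i _ => (OI.inv_sub_sub_inv _).const_mul _).const_mul _
    have hH := hH2 h2
    refine ((((S.ratFun_OI_of_two (t := x.2.2) H h2).sub (htr.mono hw (by omega))).sub
      (hfin2.mono hw (by omega))).sub (hp.mono hw (by omega))).mono hw (k := 4 - S.rInf)
      (by omega) |>.congr fun z => ?_
    rw [Finset.sum_sub_distrib, ← Finset.sum_mul, P2, yInf, yInf]
    simp only [mul_sub, Finset.sum_sub_distrib, ← Finset.sum_mul, hH]
    simp only [h2, Finset.sum_range_succ, Finset.sum_range_zero]
    simp [time_zero]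
    ring
  · have hp : OI (fun z => ħ * ∑ i, x.2.1 i * ((z - x.1 i)⁻¹ - z⁻¹ - x.1 i * z⁻¹ ^ 2)) 3 :=
      (OrdAt.sum fun i _ => (OI.inv_sub_expand _).const_mul _).const_mul _
    obtain ⟨hH, hH'⟩ := hH1 h1
    refine (((S.ratFun_OI_of_one (t := x.2.2) H h1).sub
      (hfin.mono hw (by omega))).sub (hp.mono hw (by omega))).mono hw (k := 4 - S.rInf)
      (by omega) |>.congr fun z => ?_
    rw [Finset.sum_sub_distrib, ← Finset.sum_mul, P2, yInf, yInf]
    have : ∑ i, x.2.1 i * (x.1 i * z⁻¹ ^ 2) = (∑ j, x.1 j * x.2.1 j) * z⁻¹ ^ 2 := by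
      rw [Finset.sum_mul]; exact Finset.sum_congr rfl fun i _ => by ring
    simp only [mul_sub, Finset.sum_sub_distrib, this, ← Finset.sum_mul, hH, hH']
    simp only [h1, Finset.sum_range_succ, Finset.sum_range_zero]
    simp [time_zero]
    norm_cast
    ring

end PoleData

/-! ### The divided difference of `P₁` -/

namespace PoleData

variable (S : PoleData)

/-- The coefficients of the rational function `z ↦ (P₁ z - P₁ q) / (z - q)`, except for its
coefficient of `z ^ (rInf - 3)`. -/
def ddCoef (m : S.Mono) (t : S.Times) (q : ℂ) : S.HIdx → ℂ
  | Sum.inl a => -∑ k ∈ Finset.Ico ((a : ℕ) + 2) S.rInf, S.trTime m t none k * q ^ (k - 2 - (a : ℕ))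
  | Sum.inr a => -∑ k ∈ Finset.Ico (a.2 : ℕ) (S.r a.1),
      S.trTime m t (some a.1) k * (q - S.pos t a.1)⁻¹ ^ (k + 1 - (a.2 : ℕ))

/-- The divided difference `(P₁ z - P₁ q) / (z - q)`. -/
def ddP1 (m : S.Mono) (t : S.Times) (z q : ℂ) : ℂ :=
  S.ratFun t (S.ddCoef m t q) z
    - if 3 ≤ S.rInf then S.trTime m t none (S.rInf - 1) * z ^ (S.rInf - 3) else 0

theorem ddP1_eq (m : S.Mono) (t : S.Times) (z q : ℂ) : S.ddP1 m t z q
    = -∑ k ∈ Finset.Icc 1 (S.rInf - 1), S.trTime m t none k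
        * ∑ a ∈ Finset.range (k - 1), z ^ a * q ^ (k - 1 - 1 - a)
      - ∑ s, ∑ k ∈ Finset.range (S.r s), S.trTime m t (some s) k
        * ((z - S.pos t s)⁻¹ * (q - S.pos t s)⁻¹ * ∑ a ∈ Finset.range (k + 1),
            (z - S.pos t s)⁻¹ ^ a * (q - S.pos t s)⁻¹ ^ (k + 1 - 1 - a)) := by
  have h1 : (∑ k : Fin (S.rInf - 3), S.ddCoef m t q (Sum.inl k) * z ^ (k : ℕ))
      - (if 3 ≤ S.rInf then S.trTime m t none (S.rInf - 1) * z ^ (S.rInf - 3) else 0)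
      = -∑ k ∈ Finset.Icc 1 (S.rInf - 1), S.trTime m t none k
        * ∑ a ∈ Finset.range (k - 1), z ^ a * q ^ (k - 1 - 1 - a) := by
    have e1 : ∑ k ∈ Finset.Icc 1 (S.rInf - 1), S.trTime m t none k
        * ∑ a ∈ Finset.range (k - 1), z ^ a * q ^ (k - 1 - 1 - a)
        = ∑ a ∈ Finset.range (S.rInf - 2), (∑ k ∈ Finset.Ico (a + 2) S.rInf,
            S.trTime m t none k * q ^ (k - 2 - a)) * z ^ a := by
      simp only [Finset.mul_sum, Finset.sum_mul]
      rw [Finset.sum_sigma', Finset.sum_sigma']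
      refine Finset.sum_bij' (fun x _ => ⟨x.2, x.1⟩) (fun x _ => ⟨x.2, x.1⟩) ?_ ?_ ?_ ?_ ?_
      · rintro ⟨k, a⟩ h
        simp only [Finset.mem_sigma, Finset.mem_Icc, Finset.mem_range, Finset.mem_Ico] at h ⊢
        omega
      · rintro ⟨k, a⟩ h
        simp only [Finset.mem_sigma, Finset.mem_Icc, Finset.mem_range, Finset.mem_Ico] at h ⊢
        omega
      · rintro ⟨k, a⟩ _; rfl
      · rintro ⟨k, a⟩ _; rfl
      · rintro ⟨k, a⟩ _
        rw [show k - 1 - 1 = k - 2 by omega]; ring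
    rw [e1]
    have e2 : ∑ k : Fin (S.rInf - 3), S.ddCoef m t q (Sum.inl k) * z ^ (k : ℕ)
        = -∑ a ∈ Finset.range (S.rInf - 3), (∑ k ∈ Finset.Ico (a + 2) S.rInf,
            S.trTime m t none k * q ^ (k - 2 - a)) * z ^ a := by
      rw [← Fin.sum_univ_eq_sum_range (fun a => (∑ k ∈ Finset.Ico (a + 2) S.rInf,
            S.trTime m t none k * q ^ (k - 2 - a)) * z ^ a), ← Finset.sum_neg_distrib]
      exact Finset.sum_congr rfl fun a _ => by simp only [ddCoef]; ring
    rw [e2]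
    by_cases h : 3 ≤ S.rInf
    · obtain ⟨r', hr⟩ := Nat.exists_eq_add_of_le' h
      rw [if_pos h, hr, show r' + 3 - 2 = r' + 1 by omega, Finset.sum_range_succ,
        show r' + 3 - 3 = r' by omega, show r' + 3 - 1 = r' + 2 by omega,
        Nat.Ico_succ_singleton, Finset.sum_singleton, show r' + 2 - 2 - r' = 0 by omega]
      ring
    · rw [if_neg h, show S.rInf - 3 = 0 by omega, show S.rInf - 2 = 0 by omega]; simp
  have h2 : ∀ s, ∑ k : Fin (S.r s), S.ddCoef m t q (Sum.inr ⟨s, k⟩)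
        / (z - S.pos t s) ^ ((k : ℕ) + 1)
      = -∑ k ∈ Finset.range (S.r s), S.trTime m t (some s) k
        * ((z - S.pos t s)⁻¹ * (q - S.pos t s)⁻¹ * ∑ a ∈ Finset.range (k + 1),
            (z - S.pos t s)⁻¹ ^ a * (q - S.pos t s)⁻¹ ^ (k + 1 - 1 - a)) := by
    intro s
    have e1 : ∑ k : Fin (S.r s), S.ddCoef m t q (Sum.inr ⟨s, k⟩) / (z - S.pos t s) ^ ((k : ℕ) + 1)
        = -∑ a ∈ Finset.range (S.r s), ∑ k ∈ Finset.Ico a (S.r s), S.trTime m t (some s) k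
          * ((q - S.pos t s)⁻¹ ^ (k + 1 - a) * (z - S.pos t s)⁻¹ ^ (a + 1)) := by
      rw [← Fin.sum_univ_eq_sum_range (fun a => ∑ k ∈ Finset.Ico a (S.r s),
          S.trTime m t (some s) k
          * ((q - S.pos t s)⁻¹ ^ (k + 1 - a) * (z - S.pos t s)⁻¹ ^ (a + 1))),
        ← Finset.sum_neg_distrib]
      refine Finset.sum_congr rfl fun a _ => ?_
      simp only [ddCoef, div_eq_mul_inv, neg_mul, Finset.sum_mul, inv_pow]
      exact congrArg _ (Finset.sum_congr rfl fun k _ => by ring)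
    rw [e1]
    simp only [Finset.mul_sum]
    rw [Finset.sum_sigma', Finset.sum_sigma']
    refine congrArg _ ?_
    refine Finset.sum_bij' (fun x _ => ⟨x.2, x.1⟩) (fun x _ => ⟨x.2, x.1⟩) ?_ ?_ ?_ ?_ ?_
    · rintro ⟨k, a⟩ h
      simp only [Finset.mem_sigma, Finset.mem_range, Finset.mem_Ico] at h ⊢
      omega
    · rintro ⟨k, a⟩ h
      simp only [Finset.mem_sigma, Finset.mem_range, Finset.mem_Ico] at h ⊢
      omega
    · rintro ⟨k, a⟩ _; rfl
    · rintro ⟨k, a⟩ _; rfl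
    · rintro ⟨a, k⟩ h
      simp only [Finset.mem_sigma, Finset.mem_range, Finset.mem_Ico] at h
      rw [show k + 1 - a = k + 1 - 1 - a + 1 by omega, pow_succ, pow_succ]
      ring
  rw [ddP1, ratFun, add_sub_right_comm, h1, Finset.sum_congr rfl fun s _ => h2 s,
    Finset.sum_neg_distrib]
  ring

theorem sub_mul_ddP1 (m : S.Mono) (t : S.Times) {z q : ℂ} (hz : ∀ s, z ≠ S.pos t s)
    (hq : ∀ s, q ≠ S.pos t s) : (z - q) * S.ddP1 m t z q = S.P1 m t z - S.P1 m t q := by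
  have h1 : ∀ k, (z - q) * (∑ a ∈ Finset.range (k - 1), z ^ a * q ^ (k - 1 - 1 - a))
      = z ^ (k - 1) - q ^ (k - 1) := fun k => by rw [mul_comm]; exact geom_sum₂_mul z q (k - 1)
  have h2 : ∀ s k, (z - q) * ((z - S.pos t s)⁻¹ * (q - S.pos t s)⁻¹ * ∑ a ∈ Finset.range (k + 1),
      (z - S.pos t s)⁻¹ ^ a * (q - S.pos t s)⁻¹ ^ (k + 1 - 1 - a))
      = (q - S.pos t s)⁻¹ ^ (k + 1) - (z - S.pos t s)⁻¹ ^ (k + 1) := by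
    intro s k
    have e := geom_sum₂_mul (z - S.pos t s)⁻¹ (q - S.pos t s)⁻¹ (k + 1)
    have h1 := sub_ne_zero.2 (hz s)
    have h2 := sub_ne_zero.2 (hq s)
    have e2 : (z - q) * ((z - S.pos t s)⁻¹ * (q - S.pos t s)⁻¹)
        = (q - S.pos t s)⁻¹ - (z - S.pos t s)⁻¹ := by field_simp; ring
    rw [← mul_assoc, e2]
    linear_combination -e
  have e1 : (z - q) * (∑ k ∈ Finset.Icc 1 (S.rInf - 1), S.trTime m t none k
      * ∑ a ∈ Finset.range (k - 1), z ^ a * q ^ (k - 1 - 1 - a))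
      = (∑ k ∈ Finset.Icc 1 (S.rInf - 1), S.trTime m t none k * z ^ (k - 1))
        - ∑ k ∈ Finset.Icc 1 (S.rInf - 1), S.trTime m t none k * q ^ (k - 1) := by
    rw [Finset.mul_sum, ← Finset.sum_sub_distrib]
    refine Finset.sum_congr rfl fun k _ => ?_
    rw [mul_left_comm, h1]; ring
  have e2 : (z - q) * (∑ s, ∑ k ∈ Finset.range (S.r s), S.trTime m t (some s) k
        * ((z - S.pos t s)⁻¹ * (q - S.pos t s)⁻¹ * ∑ a ∈ Finset.range (k + 1),
            (z - S.pos t s)⁻¹ ^ a * (q - S.pos t s)⁻¹ ^ (k + 1 - 1 - a)))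
      = (∑ s, ∑ k ∈ Finset.range (S.r s), S.trTime m t (some s) k / (q - S.pos t s) ^ (k + 1))
        - ∑ s, ∑ k ∈ Finset.range (S.r s),
            S.trTime m t (some s) k / (z - S.pos t s) ^ (k + 1) := by
    simp only [Finset.mul_sum (a := z - q), ← Finset.sum_sub_distrib]
    refine Finset.sum_congr rfl fun s _ => Finset.sum_congr rfl fun k _ => ?_
    rw [mul_left_comm, h2, div_eq_mul_inv, div_eq_mul_inv, inv_pow, inv_pow]; ring
  rw [ddP1_eq, mul_sub, mul_neg, e1, e2, P1, P1]
  simp only [trTime]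
  ring

theorem ddP1_self (m : S.Mono) (t : S.Times) (q : ℂ) : S.ddP1 m t q q = S.dP1 m t q := by
  have h : ∀ (x : ℂ) (k : ℕ), ∑ a ∈ Finset.range k, x ^ a * x ^ (k - 1 - a) = k * x ^ (k - 1) := by
    intro x k
    rw [Finset.sum_congr rfl (g := fun _ => x ^ (k - 1)), Finset.sum_const, Finset.card_range,
      nsmul_eq_mul]
    intro a ha
    have := Finset.mem_range.1 ha
    rw [← pow_add]; congr 1; omega
  rw [ddP1_eq, dP1]
  simp only [h]
  congr 1
  refine Finset.sum_congr rfl fun s _ => Finset.sum_congr rfl fun k _ => ?_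
  rw [Nat.add_sub_cancel, ← inv_pow]
  push_cast
  ring

/-! ### Reduction of the coefficient system -/

/-- The algebraic relations between the times `(m, t)` and the times `(m', t')` obtained from them
by subtracting half of the trace of the spectral curve and by the change of variable
`z ↦ a z + b`. -/
structure Reduces (m : S.Mono) (t : S.Times) (m' : S.Mono) (t' : S.Times) (a b : ℂ) : Prop where
  ne_zero : a ≠ 0
  pos_eq : ∀ s, S.pos t' s = a * S.pos t s + b
  trTime_eq : ∀ p k, S.trTime m' t' p k = 0
  dfTime_fin : ∀ s k, S.dfTime m' t' (some s) k = a ^ k * S.dfTime m t (some s) k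
  dfTime_zero : S.dfTime m' t' none 0 = S.dfTime m t none 0
  dfTime_inf : ∀ z, ∑ k ∈ Finset.Icc 1 (S.rInf - 1), S.dfTime m t none k * z ^ (k - 1)
    = a * ∑ k ∈ Finset.Icc 1 (S.rInf - 1), S.dfTime m' t' none k * (a * z + b) ^ (k - 1)
  dfTime_lead : S.dfTime m t none (S.rInf - 1)
    = a ^ (S.rInf - 1) * S.dfTime m' t' none (S.rInf - 1)

/-- The point with the reduced coordinates `a q + b`, `a⁻¹ (p - P₁(q) / 2)` and times `t'`. -/
def redPoint (m : S.Mono) (x : S.Phase) (t' : S.Times) (a b : ℂ) : S.Phase :=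
  (fun j => a * x.1 j + b, fun j => a⁻¹ * (x.2.1 j - S.P1 m x.2.2 (x.1 j) / 2), t')

section Reduces

variable {S} {m m' : S.Mono} {t' : S.Times} {a b : ℂ}

theorem Reduces.time_zero {t : S.Times} (h : S.Reduces m t m' t' a b) (p : S.Pole) (k : ℕ) :
    S.time m' t' p 0 k = S.dfTime m' t' p k / 2 := by
  have := h.trTime_eq p k
  unfold trTime at this; unfold dfTime
  linear_combination this / 2

theorem Reduces.time_one {t : S.Times} (h : S.Reduces m t m' t' a b) (p : S.Pole) (k : ℕ) :
    S.time m' t' p 1 k = -(S.dfTime m' t' p k / 2) := by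
  have := h.trTime_eq p k
  unfold trTime at this; unfold dfTime
  linear_combination this / 2

theorem Reduces.P1_eq_zero {t : S.Times} (h : S.Reduces m t m' t' a b) (z : ℂ) :
    S.P1 m' t' z = 0 := by
  have := h.trTime_eq
  simp only [trTime] at this
  simp [P1, this]

variable (S) in
/-- The terms in the comparison of the two systems that do not involve `q` and `p`. -/
def redPure (ħ : ℂ) (m : S.Mono) (t : S.Times) (m' : S.Mono) (t' : S.Times) (a b z : ℂ) : ℂ :=
  S.P2 m t z - a ^ 2 * S.P2 m' t' (a * z + b) - S.P1 m t z ^ 2 / 4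
    + ħ / 2 * (S.P1 m t z * ∑ s, (S.r s : ℂ) * (z - S.pos t s)⁻¹) + ħ / 2 * S.dP1 m t z
    + (if 3 ≤ S.rInf then ħ * S.time m t none 0 (S.rInf - 1) * z ^ (S.rInf - 3) else 0)
    - a ^ 2 * (if 3 ≤ S.rInf then
        ħ * S.time m' t' none 0 (S.rInf - 1) * (a * z + b) ^ (S.rInf - 3) else 0)

variable (S) in
/-- The error in the comparison of the two systems. -/
def redErr (ħ : ℂ) (m : S.Mono) (x : S.Phase) (m' : S.Mono) (t' : S.Times) (a b : ℂ)
    (H H' : S.HIdx → ℂ) (z : ℂ) : ℂ :=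
  S.ratFun x.2.2 H z - a ^ 2 * S.ratFun t' H' (a * z + b)
    + ħ / 2 * ∑ i, S.ddP1 m x.2.2 z (x.1 i) - S.redPure ħ m x.2.2 m' t' a b z

/-- The error has poles of order at most `r_s` at `X_s`: the more singular parts of `P̃₂`, of its
reduction and of `P₁² / 4` cancel by `u v = (u + v)² / 4 - (u - v)² / 4`, and the term of order
`r_s + 1` of `P₁ ∑ r_s / (z - X_s)` cancels the one of the derivative of `P₁`. -/
theorem Reduces.redErr_OX {ħ : ℂ} {x : S.Phase} (h : S.Reduces m x.2.2 m' t' a b)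
    (ht : Function.Injective (S.pos x.2.2)) (H H' : S.HIdx → ℂ) (s : Fin S.n) :
    OX (S.pos x.2.2 s) (S.redErr ħ m x m' t' a b H H') (-(S.r s : ℤ)) := by
  set t := x.2.2 with htdef
  set X := S.pos t s with hX
  have hw := tendsto_sub_punctured X
  have hr : (-(S.r s : ℤ)) ≤ 0 := by omega
  have ht' : Function.Injective (S.pos t') := by
    intro i j hij
    rw [h.pos_eq, h.pos_eq] at hij
    exact ht (mul_left_cancel₀ h.ne_zero (add_right_cancel hij))
  have c1 : OX X (fun z => S.ratFun t H z) (-(S.r s : ℤ)) := S.ratFun_OX ht H s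
  have c2 : OX X (fun z => a ^ 2 * S.ratFun t' H' (a * z + b)) (-(S.r s : ℤ)) := by
    have := S.ratFun_OX ht' H' s
    rw [h.pos_eq] at this
    exact (this.comp_affine h.ne_zero).const_mul _
  have c3 : OX X (fun z => ħ / 2 * ∑ i, S.ddP1 m t z (x.1 i)) (-(S.r s : ℤ)) := by
    refine (OrdAt.sum fun i _ => (S.ratFun_OX ht _ s).sub ?_).const_mul _
    refine OrdAt.mono hw (n := 0) ?_ hr
    split_ifs
    · exact OX.of_continuousAt (by fun_prop)
    · exact OrdAt.zero
  have c4 : OX X (fun z => (if 3 ≤ S.rInf then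
      ħ * S.time m t none 0 (S.rInf - 1) * z ^ (S.rInf - 3) else 0)
    - a ^ 2 * (if 3 ≤ S.rInf then
        ħ * S.time m' t' none 0 (S.rInf - 1) * (a * z + b) ^ (S.rInf - 3) else 0))
        (-(S.r s : ℤ)) := by
    refine OrdAt.mono hw (n := 0) ?_ hr
    split_ifs
    · exact OX.of_continuousAt (by fun_prop)
    · simpa using OrdAt.zero
  -- the principal parts of the two sheets, of the trace and of the difference
  set u : ℂ → ℂ := fun z => ∑ k ∈ Finset.range (S.r s),
    S.time m t (some s) 0 k * (z - X) ^ (-1 - k : ℤ) with hu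
  set v : ℂ → ℂ := fun z => ∑ k ∈ Finset.range (S.r s),
    S.time m t (some s) 1 k * (z - X) ^ (-1 - k : ℤ) with hv
  have hT : ∀ z, ∑ k ∈ Finset.range (S.r s), S.trTime m t (some s) k * (z - X) ^ (-1 - k : ℤ)
      = u z + v z := by
    intro z; simp only [hu, hv, trTime, add_mul, Finset.sum_add_distrib]
  have huv : OX X (fun z => u z + v z) (-(S.r s : ℤ)) := by
    simp only [← hT]
    refine OrdAt.sum fun k hk => ?_
    have := Finset.mem_range.1 hk
    exact (OrdAt.zpow_of_le hw (by omega)).const_mul _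
  have c5 : OX X (fun z => S.P2 m t z - u z * v z) (-(S.r s : ℤ)) := S.P2_principal m ht s
  have c6 : OX X (fun z => a ^ 2 * S.P2 m' t' (a * z + b) + (u z - v z) ^ 2 / 4)
      (-(S.r s : ℤ)) := by
    have h1 := S.P2_principal m' ht' s
    rw [h.pos_eq] at h1
    refine ((h1.comp_affine h.ne_zero).const_mul (a ^ 2)).congr fun z => ?_
    have e : ∀ k : ℕ, a ^ k * (a * z + b - (a * S.pos t s + b)) ^ (-1 - k : ℤ)
        = a⁻¹ * (z - X) ^ (-1 - k : ℤ) := by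
      intro k
      rw [show a * z + b - (a * S.pos t s + b) = a * (z - X) by ring, mul_zpow, ← mul_assoc,
        ← zpow_natCast, ← zpow_add₀ h.ne_zero, ← zpow_neg_one]
      congr 2; ring
    have e1 : ∑ k ∈ Finset.range (S.r s), S.time m' t' (some s) 0 k
        * (a * z + b - (a * S.pos t s + b)) ^ (-1 - k : ℤ) = a⁻¹ / 2 * (u z - v z) := by
      simp only [hu, hv, ← Finset.sum_sub_distrib, Finset.mul_sum]
      refine Finset.sum_congr rfl fun k _ => ?_
      rw [h.time_zero, h.dfTime_fin, dfTime]
      linear_combination (S.time m t (some s) 0 k - S.time m t (some s) 1 k) / 2 * e k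
    have e2 : ∑ k ∈ Finset.range (S.r s), S.time m' t' (some s) 1 k
        * (a * z + b - (a * S.pos t s + b)) ^ (-1 - k : ℤ) = -(a⁻¹ / 2 * (u z - v z)) := by
      rw [← e1, ← Finset.sum_neg_distrib]
      refine Finset.sum_congr rfl fun k _ => ?_
      rw [h.time_zero, h.time_one]; ring
    rw [e1, e2]
    have := h.ne_zero
    field_simp
    ring
  have hP : OX X (fun z => S.P1 m t z - (u z + v z)) 0 := by
    refine (S.P1_principal m ht s).congr fun z => ?_
    rw [← hT]
  have hP1 : OX X (fun z => S.P1 m t z) (-(S.r s : ℤ)) :=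
    ((hP.mono hw hr).add huv).congr fun z => by ring
  have c7 : OX X (fun z => S.P1 m t z ^ 2 / 4 - (u z + v z) ^ 2 / 4) (-(S.r s : ℤ)) := by
    refine ((hP.mul hw (hP1.add huv)).mul_const (1 / 4)).mono hw (by omega) |>.congr fun z => ?_
    ring
  have c8 : OX X (fun z => S.P1 m t z * (∑ s', (S.r s' : ℂ) * (z - S.pos t s')⁻¹) + S.dP1 m t z)
      (-(S.r s : ℤ)) := by
    have h1 : OX X (fun z => ∑ s' ∈ Finset.univ.erase s, (S.r s' : ℂ) * (z - S.pos t s')⁻¹) 0 := by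
      refine OrdAt.sum fun s' hs' => ?_
      simpa using (OX.inv_pow (fun h => (Finset.ne_of_mem_erase hs') (ht h).symm :
        S.pos t s ≠ S.pos t s') 1).const_mul (S.r s' : ℂ)
    have h2 : OX X (fun z => (S.r s : ℂ) * (z - X)⁻¹) (-1) := by
      simpa using (OX.inv_pow_self X 1).const_mul (S.r s : ℂ)
    have h3 : OX X (fun z => ∑ k ∈ Finset.range (S.r s),
        ((S.r s - k - 1 : ℂ) * S.trTime m t (some s) k) * (z - X) ^ (-2 - k : ℤ))
        (-(S.r s : ℤ)) := by
      refine OrdAt.sum fun k hk => ?_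
      have hk := Finset.mem_range.1 hk
      -- the coefficient `r_s - k - 1` vanishes for the most singular term
      rcases Nat.lt_or_ge (k + 1) (S.r s) with hlt | hge
      · exact (OrdAt.zpow_of_le hw (by omega)).const_mul _
      · have : (S.r s : ℂ) = k + 1 := by
          have : S.r s = k + 1 := by omega
          rw [this]; push_cast; ring
        rw [this]; simpa using OrdAt.zero
    have hr1 : (-(S.r s : ℤ)) ≤ -1 := by have := S.r_pos s; omega
    refine ((((hP1.mul hw h1).mono hw (by omega)).add ((hP.mul hw h2).mono hw (by omega))).add
      (((S.dP1_principal m ht s).mono hw hr).add h3)).congr' ?_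
    filter_upwards [OrdAt.eventually_ne hw] with z hz
    have e : (u z + v z) * (z - X)⁻¹ = ∑ k ∈ Finset.range (S.r s),
        S.trTime m t (some s) k * (z - X) ^ (-2 - k : ℤ) := by
      rw [← hT, Finset.sum_mul]
      refine Finset.sum_congr rfl fun k _ => ?_
      rw [mul_assoc, ← zpow_neg_one (z - X), ← zpow_add₀ hz]
      congr 2; ring
    have e' : ∑ k ∈ Finset.range (S.r s),
        ((S.r s - k - 1 : ℂ) * S.trTime m t (some s) k) * (z - X) ^ (-2 - k : ℤ)
        = S.r s * ((u z + v z) * (z - X)⁻¹) - ∑ k ∈ Finset.range (S.r s),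
          S.trTime m t (some s) k * ((k + 1 : ℂ) * (z - X) ^ (-2 - k : ℤ)) := by
      rw [e, Finset.mul_sum, ← Finset.sum_sub_distrib]
      exact Finset.sum_congr rfl fun k _ => by ring
    rw [e', ← Finset.add_sum_erase _ _ (Finset.mem_univ s)]
    ring
  refine ((((c1.sub c2).add c3).sub c4).sub (((c5.sub c6).sub c7).add
    (c8.const_mul (ħ / 2)))).congr fun z => ?_
  simp only [redErr, redPure]
  rw [← htdef]
  ring

end Reduces

end PoleData

theorem OI.affine_zpow_sub {a : ℂ} (ha : a ≠ 0) (b : ℂ) (n : ℤ) :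
    OI (fun z => ((a * z + b)⁻¹) ^ n - a ^ (-n) * z⁻¹ ^ n) (n + 1) := by
  have hw := tendsto_inv_cobounded'
  have hd : DifferentiableAt ℂ (fun w : ℂ => (a + b * w) ^ (-n)) 0 := by
    refine DifferentiableAt.zpow (by fun_prop) (Or.inl (by simpa using ha))
  have h1 : OI (fun z => (a + b * z⁻¹) ^ (-n) - a ^ (-n)) 1 := by
    have := hd.isBigO_sub
    simp only [mul_zero, add_zero, sub_zero] at this
    have h2 := this.comp_tendsto (hw.mono_right nhdsWithin_le_nhds)
    simpa [OI, OrdAt, Function.comp_def] using h2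
  refine ((OrdAt.zpow_self n).mul hw h1).congr' ?_
  filter_upwards [eventually_cobounded_ne 0] with z hz
  have : a + b * z⁻¹ = (a * z + b) * z⁻¹ := by field_simp
  rw [this, mul_zpow, inv_zpow z, inv_zpow (a * z + b), inv_zpow z (-n), zpow_neg z, inv_inv,
    zpow_neg (a * z + b)]
  have := zpow_ne_zero n hz
  field_simp

namespace PoleData

variable (S : PoleData)

section Reduces

variable {S} {m m' : S.Mono} {t' : S.Times} {a b : ℂ}

/-- The difference of the two sheets transforms like a one-form at infinity, up to `O(z⁻²)`. -/
theorem Reduces.dfTime_OI {t : S.Times} (h : S.Reduces m t m' t' a b) :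
    OI (fun z => S.yInf (S.dfTime m t none) z - a * S.yInf (S.dfTime m' t' none) (a * z + b)) 2 := by
  have h1 := ((OI.affine_zpow_sub h.ne_zero b 1).const_mul (-(a * S.dfTime m t none 0)))
  refine h1.congr fun z => ?_
  rw [yInf_eq, yInf_eq, h.dfTime_inf z, h.dfTime_zero, zpow_one, zpow_one, zpow_neg_one]
  have := h.ne_zero
  have e : a * a⁻¹ = 1 := mul_inv_cancel₀ this
  linear_combination (S.dfTime m t none 0 * z⁻¹) * e

/-- The error decays at infinity as fast as the interpolation lemma asks for. The determinants are
compared with the expansions of the sheets by `solution_OI`; in the terms linear in `ħ`, the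
coefficient `rInf - 3` of `z⁻¹` in `hG` accounts for the derivative of the leading term of `P₁`. -/
theorem Reduces.redErr_OI {ħ : ℂ} {x : S.Phase} (h : S.Reduces m x.2.2 m' t' a b)
    (hm : ∑ p, ∑ i, m p i = 0) {H H' : S.HIdx → ℂ} (hqX : ∀ j s, x.1 j ≠ S.pos x.2.2 s)
    (hH : S.IsHSolution ħ m x H) (hH' : S.IsHSolution ħ m' (S.redPoint m x t' a b) H') :
    OI (S.redErr ħ m x m' t' a b H H') (4 - S.rInf) := by
  have hw := tendsto_inv_cobounded'
  have ha := h.ne_zero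
  set t := x.2.2 with htdef
  have A1 := S.solution_OI ħ m hH
  have A2 := ((S.solution_OI ħ m' hH').comp_affine ha b).const_mul (a ^ 2)
  set Y : ℂ → ℂ := fun z => S.yInf (S.trTime m t none) z with hY
  set D : ℂ → ℂ := fun z => S.yInf (S.dfTime m t none) z with hD
  set D' : ℂ → ℂ := fun z => S.yInf (S.dfTime m' t' none) (a * z + b) with hD'
  set T := S.trTime m t none (S.rInf - 1) with hT
  have hP1 := S.P1_OI hm t
  have B1 : OI (fun z => S.P1 m t z ^ 2 / 4 - Y z ^ 2 / 4 + (D z ^ 2 / 4 - a ^ 2 * D' z ^ 2 / 4))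
      (4 - S.rInf) := by
    have h1 := ((S.P1_add_yInf hm t).mul hw (hP1.sub (S.yInf_OI (S.trTime m t none)))).mul_const
      (1 / 4)
    have h2 := (h.dfTime_OI.mul hw ((S.yInf_OI (S.dfTime m t none)).add
      (((S.yInf_OI (S.dfTime m' t' none)).comp_affine ha b).const_mul a))).mul_const (1 / 4)
    refine ((h1.mono hw (by omega)).add (h2.mono hw (by omega))).congr fun z => ?_
    simp only [hY, hD, hD']; ring
  have hG : OI (fun z => (∑ i, (z - x.1 i)⁻¹) - (∑ s, (S.r s : ℂ) * (z - S.pos t s)⁻¹)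
      - (S.rInf - 3 : ℂ) * z⁻¹) 2 := by
    have h1 := OrdAt.sum fun i (_ : i ∈ Finset.univ) => OI.inv_sub_sub_inv (x.1 i)
    have h2 := OrdAt.sum fun s (_ : s ∈ Finset.univ) =>
      (OI.inv_sub_sub_inv (S.pos t s)).const_mul (S.r s : ℂ)
    refine (h1.sub h2).congr fun z => ?_
    have hg : (S.g : ℂ) = S.rInf + (∑ s, (S.r s : ℂ)) - 3 := by
      have := S.genus_pos
      unfold g; push_cast [Nat.cast_sub (le_of_lt this)]; ring
    simp only [mul_sub, Finset.sum_sub_distrib, Finset.sum_const, Finset.card_univ,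
      Fintype.card_fin, nsmul_eq_mul, hg, ← Finset.sum_mul]
    ring
  have hlead : OI (fun z => S.dfTime m t none (S.rInf - 1) * z⁻¹ ^ (3 - S.rInf : ℤ)
      - a ^ 2 * S.dfTime m' t' none (S.rInf - 1) * (a * z + b)⁻¹ ^ (3 - S.rInf : ℤ))
      (4 - S.rInf) := by
    have h1 := ((OI.affine_zpow_sub ha b (3 - S.rInf)).const_mul
      (-(a ^ 2 * S.dfTime m' t' none (S.rInf - 1)))).mono hw (k := 4 - S.rInf) (by omega)
    refine h1.congr fun z => ?_
    have e : a ^ 2 * a ^ (-(3 - S.rInf : ℤ)) = a ^ (S.rInf - 1) := by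
      have := S.rInf_pos
      rw [← zpow_natCast, ← zpow_natCast, ← zpow_add₀ ha]
      congr 1; push_cast [Nat.cast_sub this]; ring
    rw [h.dfTime_lead, ← e]; ring
  have B2 : OI (fun z => S.P1 m t z * ((∑ i, (z - x.1 i)⁻¹)
        - (∑ s, (S.r s : ℂ) * (z - S.pos t s)⁻¹))
      - S.dP1 m t z - T * z⁻¹ ^ (3 - S.rInf : ℤ)) (4 - S.rInf) := by
    have h1 := ((hP1.mul hw hG).mono hw (k := 4 - S.rInf) (by omega))
    have h2 := (((S.P1_lead hm t).mul hw (OrdAt.zpow_self 1)).const_mul (S.rInf - 3 : ℂ)).mono hw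
      (k := 4 - S.rInf) (by omega)
    refine ((h1.add h2).sub (S.dP1_lead hm t)).congr' ?_
    filter_upwards [eventually_cobounded_ne 0] with z hz
    have e : z⁻¹ ^ (3 - S.rInf : ℤ) = z⁻¹ ^ (2 - S.rInf : ℤ) * z⁻¹ := by
      rw [← zpow_add_one₀ (inv_ne_zero hz)]; congr 1; ring
    rw [e, zpow_one]
    ring
  refine ((((A1.sub A2).add B1).add (B2.const_mul (ħ / 2))).sub (hlead.const_mul (ħ / 2))).congr' ?_
  have hev : ∀ᶠ z in cobounded ℂ, ∀ s, z ≠ S.pos t s := by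
    rw [eventually_all]; exact fun s => eventually_cobounded_ne _
  have hevq : ∀ᶠ z in cobounded ℂ, ∀ j, z ≠ x.1 j := by
    rw [eventually_all]; exact fun s => eventually_cobounded_ne _
  filter_upwards [hev, hevq] with z hz hzq
  have e1 : (∑ i, x.2.1 i * (z - x.1 i)⁻¹)
      - a ^ 2 * (∑ i, (S.redPoint m x t' a b).2.1 i * (a * z + b - (S.redPoint m x t' a b).1 i)⁻¹)
      + 1 / 2 * (∑ i, S.ddP1 m t z (x.1 i)) = S.P1 m t z / 2 * ∑ i, (z - x.1 i)⁻¹ := by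
    simp only [Finset.mul_sum, ← Finset.sum_sub_distrib, ← Finset.sum_add_distrib]
    refine Finset.sum_congr rfl fun i _ => ?_
    have h1 := S.sub_mul_ddP1 m t hz (hqX i)
    have h2 := sub_ne_zero.2 (hzq i)
    have h3 : S.ddP1 m t z (x.1 i) = (S.P1 m t z - S.P1 m t (x.1 i)) * (z - x.1 i)⁻¹ := by
      rw [← h1]; field_simp
    simp only [redPoint]
    rw [h3, show a * z + b - (a * x.1 i + b) = a * (z - x.1 i) by ring, ← htdef]
    field_simp
    ring
  have e2 : S.yInf (S.time m t none 0) z * S.yInf (S.time m t none 1) z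
      = Y z ^ 2 / 4 - D z ^ 2 / 4 := by
    have h1 : Y z = _ := S.yInf_add (S.time m t none 0) (S.time m t none 1) z
    have h2 : D z = _ := S.yInf_sub (S.time m t none 0) (S.time m t none 1) z
    rw [h1, h2]; ring
  have e3 : S.yInf (S.time m' t' none 0) (a * z + b) * S.yInf (S.time m' t' none 1) (a * z + b)
      = -(D' z ^ 2 / 4) := by
    have h1 : S.yInf (S.time m' t' none 0) (a * z + b) = D' z / 2 := by
      simp only [hD', yInf, h.time_zero, Finset.sum_div]
      exact Finset.sum_congr rfl fun k _ => by ring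
    have h2 : S.yInf (S.time m' t' none 1) (a * z + b) = -(D' z / 2) := by
      simp only [hD', yInf, h.time_one, Finset.sum_div, ← Finset.sum_neg_distrib]
      exact Finset.sum_congr rfl fun k _ => by ring
    rw [h1, h2]; ring
  have e4 : S.time m t none 0 (S.rInf - 1) = (T + S.dfTime m t none (S.rInf - 1)) / 2 := by
    simp only [hT, trTime, dfTime]; ring
  have e5 := h.time_zero none (S.rInf - 1)
  have e6 : (S.redPoint m x t' a b).2.2 = t' := rfl
  rw [e6, e2, e3]
  simp only [redErr, redPure]
  rw [← htdef]
  generalize (if 3 ≤ S.rInf then ħ * S.time m t none 0 (S.rInf - 1) * z ^ (S.rInf - 3) else 0) = c1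
  generalize (if 3 ≤ S.rInf then
    ħ * S.time m' t' none 0 (S.rInf - 1) * (a * z + b) ^ (S.rInf - 3) else 0) = c2
  rw [e4, e5]
  linear_combination (-ħ) * e1

variable (S) in
theorem differentiableAt_redErr (ħ : ℂ) (m m' : S.Mono) {x : S.Phase} {t' : S.Times} {a b : ℂ}
    (h : S.Reduces m x.2.2 m' t' a b) (H H' : S.HIdx → ℂ) {z : ℂ}
    (hz : ∀ s, z ≠ S.pos x.2.2 s) :
    DifferentiableAt ℂ (S.redErr ħ m x m' t' a b H H') z := by
  have hμ : DifferentiableAt ℂ (fun z : ℂ => a * z + b) z := by fun_prop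
  have hz' : ∀ s, a * z + b ≠ S.pos t' s := by
    intro s hs
    rw [h.pos_eq] at hs
    exact hz s (mul_left_cancel₀ h.ne_zero (add_right_cancel hs))
  have hi : ∀ s (k : ℕ), DifferentiableAt ℂ (fun z => ((z - S.pos x.2.2 s) ^ k)⁻¹) z := fun s k =>
    DifferentiableAt.fun_inv (by fun_prop) (pow_ne_zero _ (sub_ne_zero.2 (hz s)))
  have hi1 : ∀ s, DifferentiableAt ℂ (fun z => (z - S.pos x.2.2 s)⁻¹) z := fun s => by
    simpa using hi s 1
  have hP2 : ∀ (m : S.Mono) (t : S.Times) (z : ℂ), (∀ s, z ≠ S.pos t s) →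
      DifferentiableAt ℂ (S.P2 m t) z := by
    intro m t z hz
    unfold P2
    refine DifferentiableAt.fun_add
      (DifferentiableAt.fun_sum fun a _ => DifferentiableAt.fun_sum fun b _ => ?_)
      (DifferentiableAt.fun_sum fun s _ => DifferentiableAt.fun_sum fun a _ =>
        DifferentiableAt.fun_sum fun b _ => ?_)
    · split_ifs <;> fun_prop
    · split_ifs
      · exact differentiableAt_div (by fun_prop) (by fun_prop)
          (pow_ne_zero _ (sub_ne_zero.2 (hz s)))
      · fun_prop
  have hP1 : DifferentiableAt ℂ (S.P1 m x.2.2) z := by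
    unfold P1
    simp only [div_eq_mul_inv]
    fun_prop
  have hdP1 : DifferentiableAt ℂ (S.dP1 m x.2.2) z := by
    unfold dP1
    fun_prop
  have h1 := S.differentiableAt_ratFun x.2.2 H hz
  have h2 : DifferentiableAt ℂ (fun z => S.ratFun t' H' (a * z + b)) z :=
    DifferentiableAt.fun_comp' z (S.differentiableAt_ratFun t' H' hz') hμ
  have h3 : DifferentiableAt ℂ (fun z => S.P2 m' t' (a * z + b)) z :=
    DifferentiableAt.fun_comp' z (hP2 m' t' _ hz') hμ
  have h4 := hP2 m x.2.2 z hz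
  have h5 : DifferentiableAt ℂ (fun z => ∑ i, S.ddP1 m x.2.2 z (x.1 i)) z := by
    refine DifferentiableAt.fun_sum fun i _ => (S.differentiableAt_ratFun _ _ hz).fun_sub ?_
    split_ifs <;> fun_prop
  have h6 : DifferentiableAt ℂ (fun z => if 3 ≤ S.rInf then
      ħ * S.time m x.2.2 none 0 (S.rInf - 1) * z ^ (S.rInf - 3) else 0) z := by
    split_ifs <;> fun_prop
  have h7 : DifferentiableAt ℂ (fun z => if 3 ≤ S.rInf then
      ħ * S.time m' t' none 0 (S.rInf - 1) * (a * z + b) ^ (S.rInf - 3) else 0) z := by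
    split_ifs <;> fun_prop
  have h8 : DifferentiableAt ℂ (fun z => ∑ s, (S.r s : ℂ) * (z - S.pos x.2.2 s)⁻¹) z := by
    fun_prop
  unfold redErr redPure
  exact ((h1.fun_sub (h2.const_mul _)).fun_add (h5.const_mul _)).fun_sub
    ((((((h4.fun_sub (h3.const_mul _)).fun_sub ((hP1.fun_pow 2).div_const 4)).fun_add
      ((hP1.fun_mul h8).const_mul _)).fun_add (hdP1.const_mul _)).fun_add h6).fun_sub
        (h7.const_mul _))

/-- The error vanishes at the points `q_j`, by the equations of the two systems. -/
theorem Reduces.redErr_apply {ħ : ℂ} {x : S.Phase} (h : S.Reduces m x.2.2 m' t' a b)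
    {H H' : S.HIdx → ℂ} (hq : Function.Injective x.1) (hqX : ∀ j s, x.1 j ≠ S.pos x.2.2 s)
    (hH : S.IsHSolution ħ m x H) (hH' : S.IsHSolution ħ m' (S.redPoint m x t' a b) H')
    (j : Fin S.g) : S.redErr ħ m x m' t' a b H H' (x.1 j) = 0 := by
  have ha := h.ne_zero
  have h1 : S.ratFun x.2.2 H (x.1 j) = _ := hH.1 j
  have h2 : S.ratFun t' H' (a * x.1 j + b) = _ := hH'.1 j
  simp only [redPoint] at h2
  -- the diagonal term of the sum of the divided differences is a derivative
  have h3 : ∑ i, S.ddP1 m x.2.2 (x.1 j) (x.1 i) = S.dP1 m x.2.2 (x.1 j)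
      + ∑ i ∈ Finset.univ.erase j,
          (S.P1 m x.2.2 (x.1 j) - S.P1 m x.2.2 (x.1 i)) / (x.1 j - x.1 i) := by
    rw [← Finset.add_sum_erase _ _ (Finset.mem_univ j), ddP1_self]
    congr 1
    refine Finset.sum_congr rfl fun i hi => ?_
    have hij : x.1 j - x.1 i ≠ 0 :=
      sub_ne_zero.2 fun e => Finset.ne_of_mem_erase hi (hq e).symm
    rw [eq_div_iff hij, ← S.sub_mul_ddP1 m x.2.2 (hqX j) (hqX i), mul_comm]
  have h4 : ∑ s, ħ * (S.r s : ℂ) / (a * x.1 j + b - S.pos t' s)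
      = a⁻¹ * (ħ * ∑ s, (S.r s : ℂ) * (x.1 j - S.pos x.2.2 s)⁻¹) := by
    simp only [Finset.mul_sum]
    refine Finset.sum_congr rfl fun s _ => ?_
    rw [h.pos_eq, show a * x.1 j + b - (a * S.pos x.2.2 s + b) = a * (x.1 j - S.pos x.2.2 s) by ring,
      div_eq_mul_inv, mul_inv]
    ring
  have h5 : ∑ s, ħ * (S.r s : ℂ) / (x.1 j - S.pos x.2.2 s)
      = ħ * ∑ s, (S.r s : ℂ) * (x.1 j - S.pos x.2.2 s)⁻¹ := by
    simp only [Finset.mul_sum]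
    exact Finset.sum_congr rfl fun s _ => by ring
  have h6 : a ^ 2 * ∑ i ∈ Finset.univ.erase j, (a⁻¹ * (x.2.1 i - S.P1 m x.2.2 (x.1 i) / 2)
        - a⁻¹ * (x.2.1 j - S.P1 m x.2.2 (x.1 j) / 2)) / (a * x.1 j + b - (a * x.1 i + b))
      = (∑ i ∈ Finset.univ.erase j, (x.2.1 i - x.2.1 j) / (x.1 j - x.1 i))
        + 1 / 2 * ∑ i ∈ Finset.univ.erase j,
          (S.P1 m x.2.2 (x.1 j) - S.P1 m x.2.2 (x.1 i)) / (x.1 j - x.1 i) := by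
    simp only [Finset.mul_sum, ← Finset.sum_add_distrib]
    refine Finset.sum_congr rfl fun i hi => ?_
    have hij : x.1 j - x.1 i ≠ 0 :=
      sub_ne_zero.2 fun e => Finset.ne_of_mem_erase hi (hq e).symm
    rw [show a * x.1 j + b - (a * x.1 i + b) = a * (x.1 j - x.1 i) by ring]
    field_simp
    ring
  rw [h4, h.P1_eq_zero] at h2
  rw [h5] at h1
  simp only [redErr, redPure]
  rw [h1, h2, h3]
  have hai : a * a⁻¹ = 1 := mul_inv_cancel₀ ha
  generalize (if 3 ≤ S.rInf then
    ħ * S.time m x.2.2 none 0 (S.rInf - 1) * x.1 j ^ (S.rInf - 3) else 0) = c1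
  generalize (if 3 ≤ S.rInf then
    ħ * S.time m' t' none 0 (S.rInf - 1) * (a * x.1 j + b) ^ (S.rInf - 3) else 0) = c2
  have h7 : (a * a⁻¹) ^ 2 = 1 := by rw [hai, one_pow]
  linear_combination (-ħ) * h6 - (x.2.1 j - S.P1 m x.2.2 (x.1 j) / 2) ^ 2 * h7
    - (x.2.1 j - S.P1 m x.2.2 (x.1 j) / 2)
      * (ħ * ∑ s, (S.r s : ℂ) * (x.1 j - S.pos x.2.2 s)⁻¹) * h7

/-- The two coefficient systems agree up to terms that depend explicitly on `q` and the times. -/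
theorem Reduces.redErr_eq_zero {ħ : ℂ} {x : S.Phase} (h : S.Reduces m x.2.2 m' t' a b)
    (hm : ∑ p, ∑ i, m p i = 0) (hx : x ∈ S.regular) {H H' : S.HIdx → ℂ}
    (hH : S.IsHSolution ħ m x H) (hH' : S.IsHSolution ħ m' (S.redPoint m x t' a b) H')
    (z : ℂ) (hz : ∀ s, z ≠ S.pos x.2.2 s) : S.redErr ħ m x m' t' a b H H' z = 0 :=
  S.eq_zero_of_interpolation hx.2.1 hx.2.2
    (fun _ hz => S.differentiableAt_redErr ħ m m' h H H' hz) (h.redErr_OX hx.1.1 H H')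
    (h.redErr_OI hm hx.2.2 hH hH') (h.redErr_apply hx.2.1 hx.2.2 hH hH') z hz

variable (S) in
/-- The coefficients of the rational function `z ↦ a² R(a z + b)`, for `R` with coefficients `H`. -/
def affCoef (a b : ℂ) (H : S.HIdx → ℂ) : S.HIdx → ℂ
  | Sum.inl k => a ^ 2 * ∑ j : Fin (S.rInf - 3),
      H (Sum.inl j) * (((j : ℕ).choose (k : ℕ) : ℂ) * a ^ (k : ℕ) * b ^ ((j : ℕ) - (k : ℕ)))
  | Sum.inr c => a ^ 2 * ((a ^ ((c.2 : ℕ) + 1))⁻¹ * H (Sum.inr c))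

variable (S) in
theorem ratFun_affCoef {t : S.Times} (h : S.Reduces m t m' t' a b) (H : S.HIdx → ℂ) (z : ℂ) :
    S.ratFun t (S.affCoef a b H) z = a ^ 2 * S.ratFun t' H (a * z + b) := by
  rw [ratFun, ratFun, mul_add]
  congr 1
  · simp only [affCoef, Finset.mul_sum, Finset.sum_mul]
    rw [Finset.sum_comm]
    refine Finset.sum_congr rfl fun j _ => ?_
    rw [add_pow, ← Fin.sum_univ_eq_sum_range (fun k => (a * z) ^ k * b ^ ((j : ℕ) - k)
      * (((j : ℕ).choose k : ℕ) : ℂ)), Finset.mul_sum, Finset.mul_sum]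
    rw [Fin.sum_univ_eq_sum_range (fun k => a ^ 2 * (H (Sum.inl j) * (((j : ℕ).choose k : ℂ) * a ^ k
        * b ^ ((j : ℕ) - k))) * z ^ k),
      Fin.sum_univ_eq_sum_range (fun k => a ^ 2 * (H (Sum.inl j) * ((a * z) ^ k
        * b ^ ((j : ℕ) - k) * ((j : ℕ).choose k : ℂ))))]
    have hj := j.2
    rw [← Finset.sum_subset (Finset.range_subset_range.2 (by omega : (j : ℕ) + 1 ≤ S.rInf - 3))]
    · exact Finset.sum_congr rfl fun k _ => by rw [mul_pow]; ring
    · intro k _ hk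
      rw [Nat.choose_eq_zero_of_lt (by simpa using hk)]; simp
  · simp only [Finset.mul_sum]
    refine Finset.sum_congr rfl fun s _ => Finset.sum_congr rfl fun k _ => ?_
    rw [h.pos_eq, show a * z + b - (a * S.pos t s + b) = a * (z - S.pos t s) by ring, mul_pow,
      affCoef, div_eq_mul_inv, div_eq_mul_inv, mul_inv]
    ring

variable (S) in
/-- The part of the coefficients that remains after subtraction of the reduced coefficients and of
the contribution of the trace. -/
def restCoef (ħ : ℂ) (m : S.Mono) (x : S.Phase) (a b : ℂ) (H H' : S.HIdx → ℂ) : S.HIdx → ℂ :=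
  fun i => H i - S.affCoef a b H' i + ħ / 2 * ∑ j, S.ddCoef m x.2.2 (x.1 j) i

/-- The remaining part of the coefficients is a function of the times only. -/
theorem Reduces.restCoef_eq {ħ : ℂ} {x y : S.Phase} (hxy : x.2.2 = y.2.2)
    (h : S.Reduces m x.2.2 m' t' a b)
    (hm : ∑ p, ∑ i, m p i = 0) (hx : x ∈ S.regular) (hy : y ∈ S.regular) {H H' K K' : S.HIdx → ℂ}
    (hH : S.IsHSolution ħ m x H) (hH' : S.IsHSolution ħ m' (S.redPoint m x t' a b) H')
    (hK : S.IsHSolution ħ m y K) (hK' : S.IsHSolution ħ m' (S.redPoint m y t' a b) K') :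
    S.restCoef ħ m x a b H H' = S.restCoef ħ m y a b K K' := by
  have hsum : ∀ (F : Fin S.g → S.HIdx → ℂ) (z : ℂ),
      S.ratFun x.2.2 (fun i => ∑ j, F j i) z = ∑ j, S.ratFun x.2.2 (F j) z := by
    intro F z
    simp only [ratFun, Finset.sum_add_distrib, Finset.sum_mul, Finset.sum_div]
    congr 1
    · rw [Finset.sum_comm]
    · rw [Finset.sum_comm]
      rw [Finset.sum_congr rfl fun s _ => Finset.sum_comm, Finset.sum_comm]
  -- the rational function with the remaining coefficients does not involve `q` and `p`, because the
  -- error vanishes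
  have key : ∀ (x' : S.Phase) (hx' : x'.2.2 = x.2.2) (hr : x' ∈ S.regular) (H H' : S.HIdx → ℂ)
      (hH : S.IsHSolution ħ m x' H) (hH' : S.IsHSolution ħ m' (S.redPoint m x' t' a b) H') (z : ℂ)
      (hz : ∀ s, z ≠ S.pos x.2.2 s), S.ratFun x.2.2 (S.restCoef ħ m x' a b H H') z
        = S.redPure ħ m x.2.2 m' t' a b z
          + ħ / 2 * (S.g * if 3 ≤ S.rInf then
            S.trTime m x.2.2 none (S.rInf - 1) * z ^ (S.rInf - 3) else 0) := by
    intro x' hx' hr H H' hH hH' z hz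
    have h1 := Reduces.redErr_eq_zero (hx'.symm ▸ h) hm hr hH hH' z (by rwa [hx'])
    have e1 : S.restCoef ħ m x' a b H H' = fun i => 1 * (1 * H i + (-1) * S.affCoef a b H' i)
        + (ħ / 2) * ∑ j, S.ddCoef m x.2.2 (x'.1 j) i := by
      funext i; rw [restCoef, hx']; ring
    rw [e1, ratFun_linear, ratFun_linear, hsum, S.ratFun_affCoef h]
    simp only [redErr, ddP1, hx', Finset.sum_sub_distrib, Finset.sum_const, Finset.card_univ,
      Fintype.card_fin, nsmul_eq_mul] at h1
    linear_combination h1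
  have : (fun i => 1 * S.restCoef ħ m x a b H H' i + (-1) * S.restCoef ħ m y a b K K' i) = 0 := by
    refine S.eq_zero_of_ratFun_eq_zero hx.1.1 fun z hz => ?_
    rw [ratFun_linear, key x rfl hx H H' hH hH' z hz, key y hxy.symm hy K K' hK hK' z hz]
    ring
  funext i
  have := congrFun this i
  simp only [Pi.zero_apply] at this
  linear_combination this

end Reduces

end PoleData

/-! ### Residues at infinity -/

/-- `f` is the sum of a polynomial, of `c / z` and of a function that is `O(z⁻²)` at infinity. -/
def HasResInf (f : ℂ → ℂ) (c : ℂ) : Prop :=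
  ∃ P : Polynomial ℂ, OI (fun z => f z - P.eval z - c * z⁻¹) 2

namespace HasResInf

variable {f h : ℂ → ℂ} {c d : ℂ}

theorem sub (hf : HasResInf f c) (hh : HasResInf h d) : HasResInf (fun z => f z - h z) (c - d) := by
  obtain ⟨P, hP⟩ := hf
  obtain ⟨Q, hQ⟩ := hh
  exact ⟨P - Q, (hP.sub hQ).congr fun z => by rw [Polynomial.eval_sub]; ring⟩

theorem congr (hf : HasResInf f c) (hfh : ∀ z, f z = h z) : HasResInf h c :=
  (funext hfh : f = h) ▸ hf

theorem eq_zero (hf : HasResInf (fun _ => 0) c) : c = 0 := by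
  obtain ⟨P, hP⟩ := hf
  have hw := tendsto_inv_cobounded'
  have h1 := (hP.neg.mul hw (OrdAt.zpow_self (-1))).mono hw (k := 1) (by omega)
  have h2 := OrdAt.coeff_eq_zero hw (P * Polynomial.X + Polynomial.C c).natDegree.succ
    (P * Polynomial.X + Polynomial.C c).coeff (h1.congr' ?_) 0 (by omega)
  · simpa using h2
  · filter_upwards [eventually_cobounded_ne 0] with z hz
    have := Polynomial.eval_eq_sum_range (p := P * Polynomial.X + Polynomial.C c) z
    simp only [Polynomial.eval_add, Polynomial.eval_mul, Polynomial.eval_X, Polynomial.eval_C]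
      at this
    simp only [zpow_neg, inv_pow, inv_inv, zpow_natCast, zpow_one, Nat.succ_eq_add_one]
    rw [← this]
    field_simp
    ring

theorem unique (hf : HasResInf f c) (hf' : HasResInf f d) : c = d :=
  sub_eq_zero.1 (((hf.sub hf').congr fun _ => sub_self _).eq_zero)

theorem comp_affine (hf : HasResInf f c) {a : ℂ} (ha : a ≠ 0) (b : ℂ) :
    HasResInf (fun z => a * f (a * z + b)) c := by
  obtain ⟨P, hP⟩ := hf
  refine ⟨Polynomial.C a * P.comp (Polynomial.C a * Polynomial.X + Polynomial.C b), ?_⟩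
  have h1 := (hP.comp_affine ha b).const_mul a
  have h2 := (OI.affine_zpow_sub ha b 1).const_mul (a * c)
  refine (h1.add h2).congr fun z => ?_
  simp only [Polynomial.eval_mul, Polynomial.eval_C, Polynomial.eval_comp, Polynomial.eval_add,
    Polynomial.eval_X, zpow_one, zpow_neg_one]
  have e : a * a⁻¹ = 1 := mul_inv_cancel₀ ha
  linear_combination (-c * z⁻¹) * e

/-- The residue at infinity of the product of a polynomial with a Laurent polynomial. -/
theorem laurent_mul (R d : ℕ) (hd : ∀ k < d, k + 2 < R) (ν : ℕ → ℂ) (H : Fin d → ℂ) :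
    HasResInf (fun z => (∑ c ∈ Finset.range R, ν c * z⁻¹ ^ ((c : ℤ) - 1))
      * ∑ k : Fin d, H k * z ^ (k : ℕ)) (∑ k : Fin d, ν (k + 2) * H k) := by
  have hw := tendsto_inv_cobounded'
  refine ⟨∑ c ∈ Finset.range R, ∑ k : Fin d, if c ≤ k + 1 then
    Polynomial.C (ν c * H k) * Polynomial.X ^ ((k : ℕ) + 1 - c) else 0, ?_⟩
  have h1 : OI (fun z => ∑ c ∈ Finset.range R, ∑ k : Fin d,
      if (k : ℕ) + 3 ≤ c then ν c * H k * z⁻¹ ^ ((c : ℤ) - 1 - k) else 0) 2 := by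
    refine OrdAt.sum fun c _ => OrdAt.sum fun k _ => ?_
    split_ifs with h
    · exact (OrdAt.zpow_of_le hw (by omega)).const_mul _
    · exact OrdAt.zero
  refine h1.congr' ?_
  filter_upwards [eventually_cobounded_ne 0] with z hz
  -- split the product according to the sign of the exponent
  have h2 : (∑ k : Fin d, ν (k + 2) * H k) * z⁻¹
      = ∑ c ∈ Finset.range R, ∑ k : Fin d, if c = k + 2 then ν c * H k * z⁻¹ else 0 := by
    rw [Finset.sum_comm, Finset.sum_mul]
    refine Finset.sum_congr rfl fun k _ => ?_
    rw [Finset.sum_ite_eq' (Finset.range R), if_pos (Finset.mem_range.2 (hd k k.2))]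
  rw [h2, Polynomial.eval_finsetSum, Finset.sum_mul, ← Finset.sum_sub_distrib,
    ← Finset.sum_sub_distrib]
  refine Finset.sum_congr rfl fun c _ => ?_
  rw [Polynomial.eval_finsetSum, Finset.mul_sum, ← Finset.sum_sub_distrib,
    ← Finset.sum_sub_distrib]
  refine Finset.sum_congr rfl fun k _ => ?_
  have e : ν c * z⁻¹ ^ ((c : ℤ) - 1) * (H k * z ^ (k : ℕ))
      = ν c * H k * z⁻¹ ^ ((c : ℤ) - 1 - k) := by
    rw [zpow_sub₀ (inv_ne_zero hz) _ (k : ℤ), zpow_natCast, inv_pow]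
    field_simp
  rw [e]
  rcases lt_trichotomy c ((k : ℕ) + 2) with h | h | h
  · rw [if_neg (by omega), if_pos (by omega), if_neg (by omega)]
    rw [PoleData.inv_zpow_eq_pow z (k := k + 1 - c) (by omega)]
    simp
  · rw [if_neg (by omega), if_neg (by omega), if_pos h]
    rw [show ((c : ℤ) - 1 - k) = 1 by omega]; simp
  · rw [if_pos (by omega), if_neg (by omega), if_neg (by omega)]
    simp

end HasResInf

/-! ### The Toeplitz systems -/

namespace PoleData

variable (S : PoleData)

theorem dtime_eq_dfTime (m : S.Mono) (t : S.Times) (p : S.Pole) {k : ℕ} (hk : k ≠ 0) :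
    S.dtime t p k = S.dfTime m t p k := by
  simp only [dtime, dfTime, time, if_neg hk]

theorem trTime_eq_trTime_zero (m : S.Mono) (t : S.Times) (p : S.Pole) {k : ℕ} (hk : k ≠ 0) :
    S.trTime m t p k = S.trTime 0 t p k := by
  simp only [trTime, time, if_neg hk]

theorem toep_mulVec (t : S.Times) (p : S.Pole) (v : ℕ → ℂ) (a : Fin (S.ord p - 1)) :
    (S.toep t p).mulVec (fun b => v b) a = ∑ b ∈ Finset.range ((a : ℕ) + 1),
      S.dtime t p (S.ord p - 1 - ((a : ℕ) - b)) * v b := by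
  simp only [Matrix.mulVec, dotProduct, toep, Matrix.of_apply, Fin.le_def]
  rw [Fin.sum_univ_eq_sum_range (fun b => (if b ≤ (a : ℕ) then
    S.dtime t p (S.ord p - 1 - ((a : ℕ) - b)) else 0) * v b)]
  have ha := a.2
  rw [← Finset.sum_subset (Finset.range_subset_range.2 (by omega : (a : ℕ) + 1 ≤ S.ord p - 1))]
  · refine Finset.sum_congr rfl fun b hb => ?_
    rw [if_pos (by have := Finset.mem_range.1 hb; omega)]
  · intro b _ hb
    rw [if_neg (by simpa using hb), zero_mul]

theorem toep_inv_eq {t : S.Times} (ht : S.Admissible t) (p : S.Pole) {v w : ℕ → ℂ}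
    (h : ∀ a < S.ord p - 1, ∑ b ∈ Finset.range (a + 1),
      S.dtime t p (S.ord p - 1 - (a - b)) * v b = w a) (a : Fin (S.ord p - 1)) :
    (S.toep t p)⁻¹.mulVec (fun b => w b) a = v a := by
  have hdet : IsUnit (S.toep t p).det := isUnit_iff_ne_zero.2 (S.det_toep_ne_zero ht p)
  have h1 : (S.toep t p).mulVec (fun b => v b) = fun b : Fin (S.ord p - 1) => w b := by
    funext b; rw [toep_mulVec, h b b.2]
  rw [← h1, Matrix.mulVec_mulVec, Matrix.nonsing_inv_mul _ hdet, Matrix.one_mulVec]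

/-- The sign in the definition of `ν`. -/
def eps (p : S.Pole) : ℂ := if p = none then 1 else -1

theorem eps_none : S.eps none = 1 := rfl

theorem eps_some (s : Fin S.n) : S.eps (some s) = -1 := rfl

theorem nuVec_spec {t : S.Times} (ht : S.Admissible t) (α : S.Times) (p : S.Pole) {a : ℕ}
    (ha : a < S.ord p - 1) : ∑ b ∈ Finset.range (a + 1),
      S.dtime t p (S.ord p - 1 - (a - b)) * S.nuVec t α p b
      = S.eps p * S.dtime α p (S.ord p - 1 - a) / ((S.ord p - 1 - a : ℕ) : ℂ) := by
  have hdet : IsUnit (S.toep t p).det := isUnit_iff_ne_zero.2 (S.det_toep_ne_zero ht p)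
  have h1 := S.toep_mulVec t p (S.nuVec t α p) ⟨a, ha⟩
  simp only at h1
  rw [← h1]
  have h2 : (fun b : Fin (S.ord p - 1) => S.nuVec t α p b) = (S.toep t p)⁻¹.mulVec fun b =>
      (if p = none then 1 else -1) * S.dtime α p (S.ord p - 1 - (b : ℕ))
        / ((S.ord p - 1 - (b : ℕ) : ℕ) : ℂ) := by
    funext b; rw [nuVec, dif_pos b.2]
  rw [h2, Matrix.mulVec_mulVec, Matrix.mul_nonsing_inv _ hdet, Matrix.one_mulVec]
  rfl

theorem nuVec_eq {t : S.Times} (ht : S.Admissible t) (α : S.Times) (p : S.Pole) {v : ℕ → ℂ}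
    (h : ∀ a < S.ord p - 1, ∑ b ∈ Finset.range (a + 1),
      S.dtime t p (S.ord p - 1 - (a - b)) * v b
      = S.eps p * S.dtime α p (S.ord p - 1 - a) / ((S.ord p - 1 - a : ℕ) : ℂ))
    {a : ℕ} (ha : a < S.ord p - 1) : S.nuVec t α p a = v a := by
  rw [nuVec, dif_pos ha]
  exact S.toep_inv_eq ht p h ⟨a, ha⟩

theorem nuVec_of_le (t α : S.Times) (p : S.Pole) {a : ℕ} (ha : S.ord p - 1 ≤ a) :
    S.nuVec t α p a = 0 := by rw [nuVec, dif_neg (by omega)]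

/-- The coefficients `c` in terms of the traces and of `ν`: the generating function of `c` is, up to
regular terms, `-(P₁ N + A) / 2`, with `N` that of `ν` and `A` a primitive of the trace of `α`. -/
theorem cCoef_eq {t : S.Times} (ht : S.Admissible t) (α : S.Times) (p : S.Pole) {l : ℕ}
    (hl : 1 ≤ l) (hl' : l ≤ S.ord p - 1) : S.cCoef t α p l
      = S.eps p / 2 * (∑ b ∈ Finset.range (S.ord p - 1 - l + 1),
          S.trTime 0 t p (l + b) * S.nuVec t α p b) - S.trTime 0 α p l / (2 * l) := by
  set R := S.ord p - 1 with hR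
  have heps : S.eps p * S.eps p = 1 := by unfold eps; split_ifs <;> norm_num
  rw [cCoef, dif_pos (by omega)]
  have key := S.toep_inv_eq ht p (v := fun b => S.eps p / 2 * (∑ c ∈ Finset.range (b + 1),
      S.trTime 0 t p (R - b + c) * S.nuVec t α p c) - S.trTime 0 α p (R - b) / (2 * (R - b : ℕ)))
    (w := fun b => ∑ l ∈ Finset.Icc (S.ord p - 1 - b) (S.ord p - 1),
        (S.time 0 t p 1 (S.ord p - 1 + (S.ord p - 1 - b) - l) * S.time 0 α p 0 l
          - S.time 0 t p 0 (S.ord p - 1 + (S.ord p - 1 - b) - l) * S.time 0 α p 1 l)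
          / (l : ℂ)) ?_ ⟨R - l, by omega⟩
  · rw [key]
    simp only
    rw [show R - (R - l) = l by omega]
  · intro a ha
    simp only [← hR] at ha ⊢
    -- `t₂ α₁ - t₁ α₂ = (T α̂ - t̂ A) / 2`, with sums `T`, `A` and differences `t̂`, `α̂`
    have e1 : ∑ l ∈ Finset.Icc (R - a) R,
        (S.time 0 t p 1 (R + (R - a) - l) * S.time 0 α p 0 l
          - S.time 0 t p 0 (R + (R - a) - l) * S.time 0 α p 1 l) / (l : ℂ)
        = ∑ d ∈ Finset.range (a + 1), (1 / 2 * (S.trTime 0 t p (R - (a - d))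
            * (S.dtime α p (R - d) / ((R - d : ℕ) : ℂ)))
          - S.dtime t p (R - (a - d)) * (S.trTime 0 α p (R - d) / (2 * ((R - d : ℕ) : ℂ)))) := by
      refine Finset.sum_bij' (fun l _ => R - l) (fun d _ => R - d) ?_ ?_ ?_ ?_ ?_
      · intro l hl; simp only [Finset.mem_Icc, Finset.mem_range] at hl ⊢; omega
      · intro d hd; simp only [Finset.mem_Icc, Finset.mem_range] at hd ⊢; omega
      · intro l hl; simp only [Finset.mem_Icc] at hl; omega
      · intro d hd; simp only [Finset.mem_range] at hd; omega
      · intro l hl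
        simp only [Finset.mem_Icc] at hl
        rw [show R - (R - l) = l by omega, show R + (R - a) - l = R - (a - (R - l)) by omega]
        simp only [trTime, dtime]
        ring
    rw [e1]
    -- replace `α̂` by the Toeplitz product of `t̂` and `ν`, then use that Toeplitz products commute
    have e2 : ∀ d ∈ Finset.range (a + 1), S.dtime α p (R - d) / ((R - d : ℕ) : ℂ)
        = S.eps p * ∑ b ∈ Finset.range (d + 1), S.dtime t p (R - (d - b)) * S.nuVec t α p b := by
      intro d hd
      have hd := Finset.mem_range.1 hd
      rw [S.nuVec_spec ht α p (by omega)]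
      linear_combination (-(S.dtime α p (R - d) / ((R - d : ℕ) : ℂ))) * heps
    simp only [mul_sub, Finset.sum_sub_distrib]
    refine congrArg₂ _ ?_ rfl
    have e3 : ∑ d ∈ Finset.range (a + 1), 1 / 2 * (S.trTime 0 t p (R - (a - d))
        * (S.dtime α p (R - d) / ((R - d : ℕ) : ℂ)))
        = ∑ d ∈ Finset.range (a + 1), 1 / 2 * (S.trTime 0 t p (R - (a - d))
        * (S.eps p * ∑ b ∈ Finset.range (d + 1), S.dtime t p (R - (d - b)) * S.nuVec t α p b)) :=
      Finset.sum_congr rfl fun d hd => by rw [e2 d hd]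
    rw [e3]
    simp only [Finset.mul_sum]
    rw [Finset.sum_sigma', Finset.sum_sigma']
    refine Finset.sum_bij' (fun x _ => ⟨a - x.1 + x.2, x.2⟩) (fun x _ => ⟨a - x.1 + x.2, x.2⟩)
      ?_ ?_ ?_ ?_ ?_
    · rintro ⟨b, c⟩ h; simp only [Finset.mem_sigma, Finset.mem_range] at h ⊢; omega
    · rintro ⟨b, c⟩ h; simp only [Finset.mem_sigma, Finset.mem_range] at h ⊢; omega
    · rintro ⟨b, c⟩ h
      simp only [Finset.mem_sigma, Finset.mem_range] at h
      simp only [Sigma.mk.injEq, heq_eq_eq, and_true]; omega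
    · rintro ⟨b, c⟩ h
      simp only [Finset.mem_sigma, Finset.mem_range] at h
      simp only [Sigma.mk.injEq, heq_eq_eq, and_true]; omega
    · rintro ⟨b, c⟩ h
      simp only [Finset.mem_sigma, Finset.mem_range] at h
      simp only
      rw [show R - (a - (a - b + c)) = R - b + c by omega,
        show R - (a - b + c - c) = R - (a - b) by omega]
      ring

theorem cCoef_eq_zero {t α : S.Times} (ht : S.Admissible t) {p : S.Pole}
    (h : ∀ k, S.trTime 0 t p k = 0) (h' : ∀ k, S.trTime 0 α p k = 0) {l : ℕ}
    (hl : 1 ≤ l) (hl' : l ≤ S.ord p - 1) : S.cCoef t α p l = 0 := by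
  rw [S.cCoef_eq ht α p hl hl']
  simp [h, h']

/-! ### The generating function of `ν` at infinity -/

/-- The truncated vector field `∑ ν_{∞,k} z ^ (-k)`. -/
def nuField (t α : S.Times) (z : ℂ) : ℂ :=
  ∑ c ∈ Finset.range (S.rInf - 1), S.nuVec t α none c * z⁻¹ ^ ((c : ℤ) - 1)

/-- The polynomial `∑ₖ (t_{∞^{(1)},k} - t_{∞^{(2)},k}) z ^ (k - 1)`. -/
def dPol (t : S.Times) (z : ℂ) : ℂ :=
  ∑ k ∈ Finset.Icc 1 (S.rInf - 1), S.dtime t none k * z ^ (k - 1)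

/-- The polynomial `∑ₖ (α_{∞^{(1)},k} - α_{∞^{(2)},k}) z ^ k / k`. -/
def aPol (α : S.Times) (z : ℂ) : ℂ :=
  ∑ k ∈ Finset.Icc 1 (S.rInf - 1), S.dtime α none k / k * z ^ k

theorem sum_Icc_eq_sum_range_sub (R : ℕ) (f : ℕ → ℂ) :
    ∑ k ∈ Finset.Icc 1 R, f k = ∑ a ∈ Finset.range R, f (R - a) := by
  refine Finset.sum_bij' (fun l _ => R - l) (fun d _ => R - d) ?_ ?_ ?_ ?_ ?_
  · intro l hl; simp only [Finset.mem_Icc, Finset.mem_range] at hl ⊢; omega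
  · intro d hd; simp only [Finset.mem_Icc, Finset.mem_range] at hd ⊢; omega
  · intro l hl; simp only [Finset.mem_Icc] at hl; omega
  · intro d hd; simp only [Finset.mem_range] at hd; omega
  · intro l hl
    simp only [Finset.mem_Icc] at hl
    rw [show R - (R - l) = l by omega]

/-- The Toeplitz system for `ν` at infinity says that the product of the generating functions is the
primitive `aPol` up to bounded terms. -/
theorem dPol_mul_nuField {t : S.Times} (ht : S.Admissible t) (α : S.Times) :
    OI (fun z => S.dPol t z * S.nuField t α z - S.aPol α z) 0 := by
  have hw := tendsto_inv_cobounded'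
  set R := S.rInf - 1 with hR
  have h1 : OI (fun z => ∑ a ∈ Finset.range R, ∑ b ∈ Finset.range R,
      if R ≤ a + b then S.dtime t none (R - a) * S.nuVec t α none b
        * z⁻¹ ^ ((a : ℤ) + b - R) else 0) 0 := by
    refine OrdAt.sum fun a _ => OrdAt.sum fun b _ => ?_
    split_ifs with h
    · exact (OrdAt.zpow_of_le hw (by omega)).const_mul _
    · exact OrdAt.zero
  refine h1.congr' ?_
  filter_upwards [eventually_cobounded_ne 0] with z hz
  have e1 : S.aPol α z = ∑ a ∈ Finset.range R, ∑ b ∈ Finset.range R,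
      if R ≤ a + b then 0 else S.dtime t none (R - a) * S.nuVec t α none b
        * z⁻¹ ^ ((a : ℤ) + b - R) := by
    rw [aPol, ← hR, sum_Icc_eq_sum_range_sub]
    have e : ∀ i ∈ Finset.range R, S.dtime α none (R - i) / ((R - i : ℕ) : ℂ) * z ^ (R - i)
        = ∑ b ∈ Finset.range (i + 1), S.dtime t none (R - (i - b)) * S.nuVec t α none b
          * z⁻¹ ^ ((i : ℤ) - R) := by
      intro i hi
      have hi := Finset.mem_range.1 hi
      have := S.nuVec_spec ht α none (a := i) hi
      rw [← Finset.sum_mul, inv_zpow_eq_pow z (k := R - i) (by omega)]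
      congr 1
      rw [eps_none, one_mul] at this
      exact this.symm
    rw [Finset.sum_congr rfl e, Finset.sum_sigma', Finset.sum_sigma']
    have e3 : ∑ x ∈ (Finset.range R).sigma (fun _ => Finset.range R),
        (if R ≤ x.1 + x.2 then 0 else S.dtime t none (R - x.1) * S.nuVec t α none x.2
        * z⁻¹ ^ ((x.1 : ℤ) + x.2 - R))
        = ∑ x ∈ ((Finset.range R).sigma (fun _ => Finset.range R)).filter
            (fun x => x.1 + x.2 < R), S.dtime t none (R - x.1) * S.nuVec t α none x.2
        * z⁻¹ ^ ((x.1 : ℤ) + x.2 - R) := by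
      rw [Finset.sum_filter]
      refine Finset.sum_congr rfl fun x _ => ?_
      by_cases h : R ≤ x.1 + x.2
      · rw [if_pos h, if_neg (by omega)]
      · rw [if_neg h, if_pos (by omega)]
    rw [e3]
    refine Finset.sum_bij' (fun x _ => ⟨x.1 - x.2, x.2⟩) (fun x _ => ⟨x.1 + x.2, x.2⟩)
      ?_ ?_ ?_ ?_ ?_
    · rintro ⟨b, c⟩ h
      simp only [Finset.mem_sigma, Finset.mem_range, Finset.mem_filter] at h ⊢; omega
    · rintro ⟨b, c⟩ h
      simp only [Finset.mem_sigma, Finset.mem_range, Finset.mem_filter] at h ⊢; omega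
    · rintro ⟨b, c⟩ h
      simp only [Finset.mem_sigma, Finset.mem_range] at h
      simp only [Sigma.mk.injEq, heq_eq_eq, and_true]; omega
    · rintro ⟨b, c⟩ h
      simp only [Sigma.mk.injEq, heq_eq_eq, and_true]; omega
    · rintro ⟨b, c⟩ h
      simp only [Finset.mem_sigma, Finset.mem_range] at h
      simp only
      congr 2
      omega
  rw [e1, dPol, nuField, ← hR, sum_Icc_eq_sum_range_sub, Finset.sum_mul_sum,
    ← Finset.sum_sub_distrib]
  refine Finset.sum_congr rfl fun a ha => ?_
  rw [← Finset.sum_sub_distrib]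
  refine Finset.sum_congr rfl fun b _ => ?_
  have ha := Finset.mem_range.1 ha
  have e2 : S.dtime t none (R - a) * z ^ (R - a - 1) * (S.nuVec t α none b * z⁻¹ ^ ((b : ℤ) - 1))
      = S.dtime t none (R - a) * S.nuVec t α none b * z⁻¹ ^ ((a : ℤ) + b - R) := by
    rw [← inv_zpow_eq_pow z (n := (a : ℤ) + 1 - R) (by omega),
      show (a : ℤ) + b - R = (a + 1 - R) + (b - 1) by ring, zpow_add₀ (inv_ne_zero hz)]
    ring
  rw [e2]
  split_ifs <;> ring

theorem tendsto_dPol {t : S.Times} (h2 : 2 ≤ S.rInf) :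
    Tendsto (fun z => S.dPol t z * z⁻¹ ^ (S.rInf - 2 : ℤ)) (cobounded ℂ)
      (𝓝 (S.dtime t none (S.rInf - 1))) := by
  have hw := tendsto_inv_cobounded'
  obtain ⟨r', hr⟩ := Nat.exists_eq_add_of_le' h2
  have h1 : OI (fun z => ∑ k ∈ Finset.Icc 1 r', S.dtime t none k * z ^ (k - 1)) (1 - r') := by
    refine OrdAt.sum fun k hk => ?_
    have := Finset.mem_Icc.1 hk
    exact ((OI.monomial _).const_mul _).mono hw (by omega)
  have h3 : OI (fun z => S.dPol t z * z⁻¹ ^ (S.rInf - 2 : ℤ) - S.dtime t none (S.rInf - 1)) 1 := by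
    rw [show (S.rInf - 2 : ℤ) = r' by omega]
    refine ((h1.mul hw (OrdAt.zpow_self (r' : ℤ))).mono hw (by omega)).congr' ?_
    filter_upwards [eventually_cobounded_ne 0] with z hz
    rw [dPol, hr, show r' + 2 - 1 = r' + 1 by omega, Finset.sum_Icc_succ_top (by omega),
      Nat.add_sub_cancel, zpow_natCast, inv_pow]
    field_simp
    ring
  have := (h3.tendsto_zero hw).add_const (S.dtime t none (S.rInf - 1))
  simpa using this

theorem eventually_dPol_ne {t : S.Times} (h2 : 2 ≤ S.rInf)
    (ht : S.dtime t none (S.rInf - 1) ≠ 0) : ∀ᶠ z in cobounded ℂ, S.dPol t z ≠ 0 := by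
  filter_upwards [(S.tendsto_dPol h2).eventually_ne ht] with z hz
  exact left_ne_zero_of_mul hz

theorem inv_dPol_OI {t : S.Times} (h2 : 2 ≤ S.rInf) (ht : S.dtime t none (S.rInf - 1) ≠ 0) :
    OI (fun z => (S.dPol t z)⁻¹) (S.rInf - 2) := by
  have hw := tendsto_inv_cobounded'
  have h5 : OI (fun z => (S.dPol t z * z⁻¹ ^ (S.rInf - 2 : ℤ))⁻¹) 0 :=
    OrdAt.of_tendsto ((S.tendsto_dPol h2).inv₀ ht)
  refine ((h5.mul hw (OrdAt.zpow_self (S.rInf - 2 : ℤ))).mono hw (by omega)).congr' ?_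
  filter_upwards [eventually_cobounded_ne 0] with z hz
  have := zpow_ne_zero (S.rInf - 2 : ℤ) (inv_ne_zero hz)
  rw [mul_inv, mul_assoc, inv_mul_cancel₀ this, mul_one]

end PoleData

/-! ### Rearrangements of the pairing with a divided difference -/

theorem sum_Icc_sum_range_swap (R : ℕ) (T ν : ℕ → ℂ) (q : ℂ) :
    ∑ l ∈ Finset.Icc 1 R, (∑ b ∈ Finset.range (R - l + 1), T (l + b) * ν b) * q ^ l
      = ∑ b ∈ Finset.range R, ν b * ∑ l ∈ Finset.range (R - b), T (b + l + 1) * q ^ (l + 1) := by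
  simp only [Finset.sum_mul, Finset.mul_sum]
  rw [Finset.sum_sigma', Finset.sum_sigma']
  refine Finset.sum_bij' (fun x _ => ⟨x.2, x.1 - 1⟩) (fun x _ => ⟨x.2 + 1, x.1⟩) ?_ ?_ ?_ ?_ ?_
  · rintro ⟨l, b⟩ h
    simp only [Finset.mem_sigma, Finset.mem_range, Finset.mem_Icc] at h ⊢; omega
  · rintro ⟨b, l⟩ h
    simp only [Finset.mem_sigma, Finset.mem_range, Finset.mem_Icc] at h ⊢; omega
  · rintro ⟨l, b⟩ h
    simp only [Finset.mem_sigma, Finset.mem_range, Finset.mem_Icc] at h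
    simp only [Sigma.mk.injEq, heq_eq_eq, and_true]; omega
  · rintro ⟨b, l⟩ h
    simp
  · rintro ⟨l, b⟩ h
    simp only [Finset.mem_sigma, Finset.mem_range, Finset.mem_Icc] at h
    simp only
    rw [show b + (l - 1) + 1 = l + b by omega, show l - 1 + 1 = l by omega]; ring

theorem sum_Ico_eq_add (R a : ℕ) (ha : a ≤ R) (T : ℕ → ℂ) (q : ℂ) :
    ∑ k ∈ Finset.Ico a (R + 1), T k * q ^ (k - a)
      = T a + ∑ l ∈ Finset.range (R - a), T (a + l + 1) * q ^ (l + 1) := by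
  rw [Finset.sum_Ico_eq_sum_range, show R + 1 - a = (R - a) + 1 by omega, Finset.sum_range_succ']
  simp only [Nat.add_sub_cancel_left, Nat.sub_self, add_zero, pow_zero, mul_one, add_assoc]
  rw [add_comm]

/-- The contribution of infinity to the pairing of `ν` with a divided difference of a polynomial. -/
theorem pairing_comb_inf (R : ℕ) (T ν : ℕ → ℂ) (κ0 κ1 q : ℂ) (h0 : 1 ≤ R → ν 0 = κ0)
    (h1 : 2 ≤ R → ν 1 = κ1) :
    ∑ a ∈ Finset.range (R - 2), ν (a + 2) * (-∑ k ∈ Finset.Ico (a + 2) (R + 1),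
        T k * q ^ (k - 2 - a))
      + ∑ l ∈ Finset.Icc 1 R, (∑ b ∈ Finset.range (R - l + 1), T (l + b) * ν b) * q ^ l
      - (κ0 * q + κ1) * ∑ k ∈ Finset.Icc 1 R, T k * q ^ (k - 1)
    = -(if 1 ≤ R then κ1 * T 1 else 0) - ∑ a ∈ Finset.range (R - 2), ν (a + 2) * T (a + 2) := by
  rw [sum_Icc_sum_range_swap]
  have e1 : ∀ a ∈ Finset.range (R - 2), ν (a + 2) * (-∑ k ∈ Finset.Ico (a + 2) (R + 1),
      T k * q ^ (k - 2 - a)) = -(ν (a + 2) * T (a + 2)) - ν (a + 2) *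
        ∑ l ∈ Finset.range (R - (a + 2)), T (a + 2 + l + 1) * q ^ (l + 1) := by
    intro a ha
    have ha := Finset.mem_range.1 ha
    have := sum_Ico_eq_add R (a + 2) (by omega) T q
    rw [Finset.sum_congr rfl fun k _ => by rw [show k - 2 - a = k - (a + 2) by omega], this]
    ring
  rw [Finset.sum_congr rfl e1, Finset.sum_sub_distrib, Finset.sum_neg_distrib]
  have e2 : ∑ k ∈ Finset.Icc 1 R, T k * q ^ (k - 1) = ∑ l ∈ Finset.range R, T (l + 1) * q ^ l := by
    rw [Finset.range_eq_Ico]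
    exact (Finset.sum_Ico_add' (fun l => T l * q ^ (l - 1)) 0 R 1).symm
  rw [e2]
  obtain h | h | ⟨R', rfl⟩ : R = 0 ∨ R = 1 ∨ ∃ R', R = R' + 2 := by
    rcases R with _ | _ | R'
    · simp
    · simp
    · exact Or.inr (Or.inr ⟨R', rfl⟩)
  · subst h; simp
  · subst h; simp [h0]; ring
  · rw [if_pos (by omega), Finset.sum_range_succ', Finset.sum_range_succ', h0 (by omega),
      h1 (by omega)]
    simp only [Nat.add_sub_cancel, zero_add, Nat.sub_zero, show R' + 2 - 1 = R' + 1 by omega,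
      add_assoc, Nat.reduceAdd]
    have e3 : ∑ l ∈ Finset.range (R' + 2), T (l + 1) * q ^ l
        = T 1 + ∑ l ∈ Finset.range (R' + 1), T (1 + (l + 1)) * q ^ (l + 1) := by
      rw [Finset.sum_range_succ']
      simp only [zero_add, pow_zero, mul_one]
      rw [add_comm]
      simp only [add_comm, add_left_comm]
    have e4 : ∑ l ∈ Finset.range (R' + 2), T (l + 1) * q ^ (l + 1)
        = q * ∑ l ∈ Finset.range (R' + 2), T (l + 1) * q ^ l := by
      rw [Finset.mul_sum]
      exact Finset.sum_congr rfl fun l _ => by ring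
    rw [e4]
    linear_combination (-κ1) * e3

/-- The contribution of a finite pole to the pairing of `ν` with a divided difference. -/
theorem pairing_comb_fin (R : ℕ) (T ν : ℕ → ℂ) (κ W w u : ℂ) (hu : u * w = 1) :
    ∑ a ∈ Finset.range (R + 1), (if a = 0 then W else -ν (a - 1) + if a = 1 then κ else 0)
        * (-∑ k ∈ Finset.Ico a (R + 1), T k * w ^ (k + 1 - a))
      - ∑ l ∈ Finset.Icc 1 R, (∑ b ∈ Finset.range (R - l + 1), T (l + b) * ν b) * w ^ l
      + (W + κ * u) * ∑ k ∈ Finset.range (R + 1), T k * w ^ (k + 1)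
    = κ * T 0 := by
  rw [sum_Icc_sum_range_swap, Finset.sum_range_succ', if_pos rfl]
  have e1 : ∀ a ∈ Finset.range R, (if a + 1 = 0 then W else
      -ν (a + 1 - 1) + if a + 1 = 1 then κ else 0)
        * (-∑ k ∈ Finset.Ico (a + 1) (R + 1), T k * w ^ (k + 1 - (a + 1)))
      = ν a * (∑ l ∈ Finset.range (R - a), T (a + l + 1) * w ^ (l + 1))
        - if a = 0 then κ * ∑ l ∈ Finset.range (R - a), T (a + l + 1) * w ^ (l + 1) else 0 := by
    intro a _
    have e : ∑ k ∈ Finset.Ico (a + 1) (R + 1), T k * w ^ (k + 1 - (a + 1))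
        = ∑ l ∈ Finset.range (R - a), T (a + l + 1) * w ^ (l + 1) := by
      rw [Finset.sum_Ico_eq_sum_range, Nat.add_sub_add_right]
      refine Finset.sum_congr rfl fun l _ => ?_
      rw [show a + 1 + l + 1 - (a + 1) = l + 1 by omega, show a + 1 + l = a + l + 1 by ring]
    rw [e, if_neg (by omega), Nat.add_sub_cancel]
    by_cases h : a = 0
    · rw [if_pos (by omega), if_pos h]; ring
    · rw [if_neg (by omega), if_neg h]; ring
  rw [Finset.sum_congr rfl e1, Finset.sum_sub_distrib]
  have e2 : ∑ a ∈ Finset.range R, (if a = 0 then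
      κ * ∑ l ∈ Finset.range (R - a), T (a + l + 1) * w ^ (l + 1) else 0)
      = κ * ∑ l ∈ Finset.range R, T (l + 1) * w ^ (l + 1) := by
    rw [Finset.sum_ite_eq' (Finset.range R) 0]
    split_ifs with h
    · simp
    · rw [show R = 0 by simpa using h]; simp
  have e3 : u * ∑ k ∈ Finset.range (R + 1), T k * w ^ (k + 1)
      = T 0 + ∑ l ∈ Finset.range R, T (l + 1) * w ^ (l + 1) := by
    rw [Finset.mul_sum, Finset.sum_congr rfl (g := fun k => T k * w ^ k), Finset.sum_range_succ',
      pow_zero, mul_one, add_comm]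
    intro k _
    rw [pow_succ]
    linear_combination (T k * w ^ k) * hu
  rw [e2, ← Finset.range_eq_Ico]
  simp only [Nat.sub_zero]
  linear_combination κ * e3

/-! ### The pairing of a deformation with the coefficients -/

namespace PoleData

variable (S : PoleData)

/-- The weight of `H_{X_s, k + 1}` in the Hamiltonian, when the coefficients `ν_{∞,-1}` and
`ν_{∞,0}` are replaced by `κ0` and `κ1`. -/
def finWeight (t α : S.Times) (κ0 κ1 : ℂ) (s : Fin S.n) (k : ℕ) : ℂ :=
  if k = 0 then S.pos α s + κ0 * S.pos t s + κ1
  else -S.nuVec t α (some s) (k - 1) + if k = 1 then κ0 else 0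

/-- The part of the Hamiltonian that is linear in the coefficients `H`, when `ν_{∞,-1}` and
`ν_{∞,0}` are replaced by `κ0` and `κ1`. -/
def pairing (t α : S.Times) (κ0 κ1 : ℂ) (H : S.HIdx → ℂ) : ℂ :=
  (∑ k : Fin (S.rInf - 3), S.nuVec t α none ((k : ℕ) + 2) * H (Sum.inl k))
    + ∑ s, ∑ k : Fin (S.r s), S.finWeight t α κ0 κ1 s k * H (Sum.inr ⟨s, k⟩)

theorem pairing_add (t α : S.Times) (κ0 κ1 c : ℂ) (H H' : S.HIdx → ℂ) :
    S.pairing t α κ0 κ1 (fun i => H i + c * H' i)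
      = S.pairing t α κ0 κ1 H + c * S.pairing t α κ0 κ1 H' := by
  simp only [pairing, mul_add, Finset.sum_add_distrib, Finset.mul_sum]
  simp only [mul_left_comm c]
  ring

theorem pairing_sum (t α : S.Times) (κ0 κ1 : ℂ) {ι : Type*} (s : Finset ι)
    (F : ι → S.HIdx → ℂ) : S.pairing t α κ0 κ1 (fun i => ∑ j ∈ s, F j i)
      = ∑ j ∈ s, S.pairing t α κ0 κ1 (F j) := by
  simp only [pairing, Finset.mul_sum, Finset.sum_add_distrib]
  congr 1
  · exact Finset.sum_comm
  · rw [Finset.sum_congr rfl fun i _ => Finset.sum_comm, Finset.sum_comm]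

theorem pairing_eq (t α : S.Times) (κ0 κ1 : ℂ) (H : S.HIdx → ℂ) :
    S.pairing t α κ0 κ1 H
      = (∑ k : Fin (S.rInf - 3), S.nuInf t α ((k : ℕ) + 2) * H (Sum.inl k))
        - (∑ s, ∑ k ∈ Finset.Icc 2 (S.r s), S.nuX t α s (k - 1) * S.HX H s k)
        + (∑ s, S.pos α s * S.HX H s 1) + κ0 * S.sumH2 t H + κ1 * S.sumH1 H := by
  have h : ∀ s, ∑ k : Fin (S.r s), S.finWeight t α κ0 κ1 s k * H (Sum.inr ⟨s, k⟩)
      = -(∑ k ∈ Finset.Icc 2 (S.r s), S.nuX t α s (k - 1) * S.HX H s k)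
        + S.pos α s * S.HX H s 1 + κ0 * (S.pos t s * S.HX H s 1 + S.HX H s 2)
        + κ1 * S.HX H s 1 := by
    intro s
    have e1 : ∑ k : Fin (S.r s), S.finWeight t α κ0 κ1 s k * H (Sum.inr ⟨s, k⟩)
        = ∑ k ∈ Finset.range (S.r s), S.finWeight t α κ0 κ1 s k * S.HX H s (k + 1) := by
      rw [← Fin.sum_univ_eq_sum_range (fun k => S.finWeight t α κ0 κ1 s k * S.HX H s (k + 1))]
      exact Finset.sum_congr rfl fun k _ => by rw [HX_succ]
    obtain ⟨r', hr⟩ := Nat.exists_eq_add_of_le' (S.r_pos s)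
    rw [e1, hr, Finset.sum_range_succ']
    have e2 : ∑ k ∈ Finset.Icc 2 (r' + 1), S.nuX t α s (k - 1) * S.HX H s k
        = ∑ k ∈ Finset.range r', S.nuVec t α (some s) k * S.HX H s (k + 1 + 1) := by
      rw [Finset.range_eq_Ico]
      exact (Finset.sum_Ico_add' (fun k => S.nuX t α s (k - 1) * S.HX H s k) 0 r' 2).symm
    have e3 : ∑ k ∈ Finset.range r', S.finWeight t α κ0 κ1 s (k + 1) * S.HX H s (k + 1 + 1)
        = -(∑ k ∈ Finset.range r', S.nuVec t α (some s) k * S.HX H s (k + 1 + 1))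
          + κ0 * S.HX H s 2 := by
      have e4 : ∀ k ∈ Finset.range r', S.finWeight t α κ0 κ1 s (k + 1) * S.HX H s (k + 1 + 1)
          = -(S.nuVec t α (some s) k * S.HX H s (k + 1 + 1))
            + if k = 0 then κ0 * S.HX H s 2 else 0 := by
        intro k _
        rw [finWeight, if_neg (by omega), Nat.add_sub_cancel]
        by_cases hk : k = 0
        · rw [if_pos (by omega), if_pos hk, hk]; ring
        · rw [if_neg (by omega), if_neg hk]; ring
      rw [Finset.sum_congr rfl e4, Finset.sum_add_distrib, Finset.sum_neg_distrib,
        Finset.sum_ite_eq' (Finset.range r') 0]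
      split_ifs with h0
      · rfl
      · rw [S.HX_eq_zero H s (k := 2) (by simp at h0; omega)]; ring
    rw [e2, e3, finWeight, if_pos rfl]
    ring
  rw [pairing, Finset.sum_congr rfl fun s _ => h s]
  simp only [Finset.sum_add_distrib, Finset.sum_neg_distrib, sumH1, sumH2, Finset.mul_sum, nuInf,
    mul_add]
  ring

end PoleData

/-! ### Reduction of the deformation vectors -/

namespace PoleData

variable (S : PoleData)

/-- The relations between a deformation vector `α` at `t` and its image `α'` at `t'` under the
tangent map of the reduction `t ↦ t'`; here `da` and `db` are the derivatives of `a` and `b` along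
`α`, and `aPol_eq` is the derivative of the change of variable of a primitive of `dPol`. -/
structure ReducesDir (t t' : S.Times) (a b : ℂ) (α α' : S.Times) (da db : ℂ) : Prop where
  pos_eq : ∀ s, S.pos α' s = a * S.pos α s + da * S.pos t s + db
  trTime_eq : ∀ p k, S.trTime 0 α' p k = 0
  dtime_fin : ∀ s k, S.dtime α' (some s) k
    = a ^ k * S.dtime α (some s) k + k * a ^ (k - 1) * da * S.dtime t (some s) k
  aPol_eq : ∃ C, ∀ z, S.aPol α z = S.aPol α' (a * z + b) + S.dPol t' (a * z + b) * (da * z + db) + C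
  lead : 2 ≤ S.rInf → S.dtime α' none (S.rInf - 1) = 0
  sublead : 3 ≤ S.rInf → S.dtime α' none (S.rInf - 2) = 0

theorem nuField_eq (t α : S.Times) (z : ℂ) (h3 : 3 ≤ S.rInf) :
    S.nuField t α z = S.nuVec t α none 0 * z + S.nuVec t α none 1
      + ∑ c ∈ Finset.range (S.rInf - 3), S.nuVec t α none (c + 2) * z⁻¹ ^ ((c : ℤ) + 1) := by
  obtain ⟨r', hr⟩ := Nat.exists_eq_add_of_le' h3
  rw [nuField, hr, show r' + 3 - 1 = r' + 2 by omega, Finset.sum_range_succ',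
    Finset.sum_range_succ', Nat.add_sub_cancel]
  have e : ∀ c : ℕ, z⁻¹ ^ (((c + 1 + 1 : ℕ) : ℤ) - 1) = z⁻¹ ^ ((c : ℤ) + 1) := fun c => by
    congr 1; omega
  simp only [e]
  simp
  ring

theorem nuField_OI (t α : S.Times) (h3 : 3 ≤ S.rInf) :
    OI (fun z => S.nuField t α z - (S.nuVec t α none 0 * z + S.nuVec t α none 1)) 1 := by
  have hw := tendsto_inv_cobounded'
  have h1 : OI (fun z => ∑ c ∈ Finset.range (S.rInf - 3),
      S.nuVec t α none (c + 2) * z⁻¹ ^ ((c : ℤ) + 1)) 1 :=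
    OrdAt.sum fun c _ => (OrdAt.zpow_of_le hw (by omega)).const_mul _
  exact h1.congr fun z => by rw [S.nuField_eq t α z h3]; ring

theorem eq_zero_of_affine_OI {c d : ℂ} (h : OI (fun z => c * z + d) 1) : c = 0 ∧ d = 0 := by
  have hw := tendsto_inv_cobounded'
  have key := OrdAt.coeff_eq_zero hw 2 (fun k => if k = 0 then d else c) (h.congr' ?_)
  · exact ⟨by simpa using key 1 (by norm_num), by simpa using key 0 (by norm_num)⟩
  · filter_upwards with z
    simp [Finset.sum_range_succ, add_comm]

theorem nuVec_none_zero {t α : S.Times} (ht : S.Admissible t)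
    (h : 2 ≤ S.rInf → S.dtime α none (S.rInf - 1) = 0) : S.nuVec t α none 0 = 0 := by
  by_cases h2 : 2 ≤ S.rInf
  · have h1 := S.nuVec_spec ht α none (a := 0) (by simp only [ord]; omega)
    simp only [ord, zero_add, Finset.sum_range_one, Nat.sub_zero, h h2, mul_zero,
      zero_div] at h1
    exact (mul_eq_zero.1 h1).resolve_left (ht.2 none h2)
  · exact S.nuVec_of_le _ _ _ (by simp only [ord]; omega)

theorem nuVec_none_one {t α : S.Times} (ht : S.Admissible t)
    (h : 2 ≤ S.rInf → S.dtime α none (S.rInf - 1) = 0)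
    (h' : 3 ≤ S.rInf → S.dtime α none (S.rInf - 2) = 0) : S.nuVec t α none 1 = 0 := by
  by_cases h2 : 3 ≤ S.rInf
  · have h1 := S.nuVec_spec ht α none (a := 1) (by simp only [ord]; omega)
    simp only [ord, Finset.sum_range_succ, Finset.sum_range_zero, zero_add, Nat.sub_zero,
      Nat.sub_self, S.nuVec_none_zero ht h, show S.rInf - 1 - 1 = S.rInf - 2 by omega,
      h' h2, mul_zero, zero_div] at h1
    exact (mul_eq_zero.1 h1).resolve_left (ht.2 none (by simp only [ord]; omega))
  · exact S.nuVec_of_le _ _ _ (by simp only [ord]; omega)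

section Reduces

variable {S} {m m' : S.Mono} {t t' α α' : S.Times} {a b da db : ℂ}

theorem Reduces.dtime_fin (h : S.Reduces m t m' t' a b) (s : Fin S.n) (k : ℕ) :
    S.dtime t' (some s) k = a ^ k * S.dtime t (some s) k := by
  by_cases hk : k = 0
  · simp [hk, dtime, time]
  · rw [S.dtime_eq_dfTime m' t' _ hk, S.dtime_eq_dfTime m t _ hk, h.dfTime_fin]

theorem Reduces.dPol_eq (h : S.Reduces m t m' t' a b) (z : ℂ) :
    S.dPol t z = a * S.dPol t' (a * z + b) := by
  have := h.dfTime_inf z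
  have e : ∀ (m : S.Mono) (t : S.Times) (z : ℂ), S.dPol t z
      = ∑ k ∈ Finset.Icc 1 (S.rInf - 1), S.dfTime m t none k * z ^ (k - 1) := fun m t z =>
    Finset.sum_congr rfl fun k hk => by
      rw [S.dtime_eq_dfTime m t _ (by have := Finset.mem_Icc.1 hk; omega)]
  rw [e m t, e m' t', this]

theorem Reduces.lead_ne_zero (h : S.Reduces m t m' t' a b) (ht : S.Admissible t)
    (h2 : 2 ≤ S.rInf) : S.dtime t' none (S.rInf - 1) ≠ 0 := by
  intro h0
  have h1 := h.dfTime_lead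
  rw [← S.dtime_eq_dfTime m t _ (by omega), ← S.dtime_eq_dfTime m' t' _ (by omega), h0,
    mul_zero] at h1
  exact ht.2 none h2 h1

theorem Reduces.admissible (h : S.Reduces m t m' t' a b) (ht : S.Admissible t) :
    S.Admissible t' := by
  refine ⟨fun s s' hs => ht.1 ?_, fun p hp => ?_⟩
  · rw [h.pos_eq, h.pos_eq] at hs
    exact mul_left_cancel₀ h.ne_zero (add_right_cancel hs)
  · rcases p with _ | s
    · exact h.lead_ne_zero ht hp
    · rw [h.dtime_fin]
      exact mul_ne_zero (pow_ne_zero _ h.ne_zero) (ht.2 (some s) hp)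

/-- The coefficients `ν` of the finite poles transform like those of a vector field. -/
theorem ReducesDir.nuVec_fin (hd : S.ReducesDir t t' a b α α' da db)
    (h : S.Reduces m t m' t' a b) (ht : S.Admissible t) (s : Fin S.n) {k : ℕ}
    (hk : k < S.r s - 1) : S.nuVec t α (some s) k
      = a ^ k * S.nuVec t' α' (some s) k + if k = 0 then a⁻¹ * da else 0 := by
  have ha := h.ne_zero
  refine S.nuVec_eq ht α (some s)
    (v := fun k => a ^ k * S.nuVec t' α' (some s) k + if k = 0 then a⁻¹ * da else 0) ?_ hk
  intro i hi
  have hi' : i < S.r s - 1 := hi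
  have h1 := S.nuVec_spec (h.admissible ht) α' (some s) hi
  simp only [mul_add, Finset.sum_add_distrib]
  rw [Finset.sum_eq_single_of_mem (s := Finset.range (i + 1))
    (f := fun b => S.dtime t (some s) (S.ord (some s) - 1 - (i - b)) * if b = 0 then a⁻¹ * da else 0)
    0 (by simp) (fun b _ hb => by rw [if_neg hb, mul_zero]), if_pos rfl]
  simp only [ord, eps_some, Nat.sub_zero] at h1 ⊢
  have hR : S.r s - 1 - i ≠ 0 := by omega
  have hR' : ((S.r s - 1 - i : ℕ) : ℂ) ≠ 0 := Nat.cast_ne_zero.2 hR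
  have h2 : ∑ b ∈ Finset.range (i + 1), S.dtime t' (some s) (S.r s - 1 - (i - b))
        * S.nuVec t' α' (some s) b = a ^ (S.r s - 1 - i) * ∑ b ∈ Finset.range (i + 1),
        S.dtime t (some s) (S.r s - 1 - (i - b)) * (a ^ b * S.nuVec t' α' (some s) b) := by
    rw [Finset.mul_sum]
    refine Finset.sum_congr rfl fun b hb => ?_
    have := Finset.mem_range.1 hb
    rw [h.dtime_fin, show S.r s - 1 - (i - b) = (S.r s - 1 - i) + b by omega, pow_add]
    ring
  -- the term `k a ^ (k - 1) da` of the derivative of `a ^ k` produces the shift of `ν` of index `0`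
  rw [h2, hd.dtime_fin] at h1
  generalize S.r s - 1 - i = k at *
  obtain ⟨k', rfl⟩ := Nat.exists_eq_succ_of_ne_zero hR
  rw [Nat.succ_eq_add_one, Nat.add_sub_cancel] at h1
  have hak : a ^ (k' + 1) ≠ 0 := pow_ne_zero _ ha
  refine mul_left_cancel₀ hak ?_
  rw [mul_add, h1]
  field_simp
  ring

theorem ReducesDir.nuVec_zero' (hd : S.ReducesDir t t' a b α α' da db) (ht : S.Admissible t') :
    S.nuVec t' α' none 0 = 0 := S.nuVec_none_zero ht hd.lead

theorem ReducesDir.nuVec_one' (hd : S.ReducesDir t t' a b α α' da db) (ht : S.Admissible t') :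
    S.nuVec t' α' none 1 = 0 := S.nuVec_none_one ht hd.lead hd.sublead

/-- At infinity `ν` is the image of the reduced `ν` under the change of variable, up to the vector
field of the affine motion. -/
theorem ReducesDir.nuField_OI (hd : S.ReducesDir t t' a b α α' da db)
    (h : S.Reduces m t m' t' a b) (ht : S.Admissible t) (h2 : 2 ≤ S.rInf) :
    OI (fun z => S.nuField t α z - a⁻¹ * (S.nuField t' α' (a * z + b) + (da * z + db)))
      (S.rInf - 2) := by
  have hw := tendsto_inv_cobounded'
  have ha := h.ne_zero
  obtain ⟨C, hC⟩ := hd.aPol_eq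
  have h1 := S.dPol_mul_nuField ht α
  have h3 := (S.dPol_mul_nuField (h.admissible ht) α').comp_affine ha b
  have h4 : OI (fun _ => C) 0 := OrdAt.const C
  have h5 := ((h1.sub h3).add h4).mul hw (S.inv_dPol_OI h2 (ht.2 none h2))
  refine (h5.mono hw (by omega)).congr' ?_
  filter_upwards [S.eventually_dPol_ne h2 (ht.2 none h2)] with z hz
  have h6 := h.dPol_eq z
  rw [← div_eq_mul_inv, div_eq_iff hz, hC z, h6]
  field_simp
  ring

/-- The two highest coefficients of `ν` at infinity are those of the affine motion, since the reduced
ones vanish. -/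
theorem ReducesDir.nuVec_inf (hd : S.ReducesDir t t' a b α α' da db)
    (h : S.Reduces m t m' t' a b) (ht : S.Admissible t) (h3 : 3 ≤ S.rInf) :
    S.nuVec t α none 0 = a⁻¹ * da ∧ S.nuVec t α none 1 = a⁻¹ * db := by
  have hw := tendsto_inv_cobounded'
  have ht' := h.admissible ht
  have h1 := hd.nuField_OI h ht (by omega)
  have h4 := (S.nuField_OI t' α' h3).comp_affine h.ne_zero b
  rw [hd.nuVec_zero' ht', hd.nuVec_one' ht'] at h4
  have h5 := ((h1.mono hw (k := 1) (by omega)).sub (S.nuField_OI t α h3)).add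
    (h4.const_mul a⁻¹)
  have h6 := eq_zero_of_affine_OI (c := S.nuVec t α none 0 - a⁻¹ * da)
    (d := S.nuVec t α none 1 - a⁻¹ * db) (h5.congr fun z => by ring)
  exact ⟨sub_eq_zero.1 h6.1, sub_eq_zero.1 h6.2⟩

/-- The statement of `nuVec_inf` on the highest coefficient remains true for `rInf = 2`. -/
theorem ReducesDir.nuVec_inf_zero (hd : S.ReducesDir t t' a b α α' da db)
    (h : S.Reduces m t m' t' a b) (ht : S.Admissible t) (h2 : 2 ≤ S.rInf) :
    S.nuVec t α none 0 = a⁻¹ * da := by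
  have hw := tendsto_inv_cobounded'
  by_cases h3 : 3 ≤ S.rInf
  · exact (hd.nuVec_inf h ht h3).1
  have hr : S.rInf = 2 := by omega
  have h1 := hd.nuField_OI h ht h2
  have e : ∀ t α z, S.nuField t α z = S.nuVec t α none 0 * z := fun t α z => by
    simp [nuField, hr]
  simp only [e, hd.nuVec_zero' (h.admissible ht)] at h1
  have h5 : OI (fun _ => a⁻¹ * db) 0 := OrdAt.const _
  have h6 : OI (fun z : ℂ => (S.nuVec t α none 0 - a⁻¹ * da) * z) 0 :=
    ((h1.mono hw (k := 0) (by omega)).add h5).congr fun z => by ring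
  have h7 : OI (fun _ => S.nuVec t α none 0 - a⁻¹ * da) 1 := by
    refine (h6.mul hw (OrdAt.zpow_self 1)).congr' ?_
    filter_upwards [eventually_cobounded_ne 0] with z hz
    rw [zpow_one, mul_assoc, mul_inv_cancel₀ hz, mul_one]
  exact sub_eq_zero.1 (OrdAt.const_eq_zero hw h7)

theorem ReducesDir.pairing_affCoef_inf (hd : S.ReducesDir t t' a b α α' da db)
    (h : S.Reduces m t m' t' a b) (ht : S.Admissible t) (H : S.HIdx → ℂ) :
    ∑ k : Fin (S.rInf - 3), S.nuVec t α none ((k : ℕ) + 2) * S.affCoef a b H (Sum.inl k)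
      = ∑ k : Fin (S.rInf - 3), S.nuVec t' α' none ((k : ℕ) + 2) * H (Sum.inl k) := by
  have hw := tendsto_inv_cobounded'
  have ha := h.ne_zero
  by_cases h4 : 4 ≤ S.rInf
  swap
  · have : IsEmpty (Fin (S.rInf - 3)) := by
      rw [show S.rInf - 3 = 0 by omega]; infer_instance
    simp
  -- both sides are residues at infinity of products with the generating functions of `ν`
  have r1 : HasResInf (fun z => S.nuField t α z
      * ∑ k : Fin (S.rInf - 3), S.affCoef a b H (Sum.inl k) * z ^ (k : ℕ)) _ :=
    HasResInf.laurent_mul (S.rInf - 1) (S.rInf - 3) (fun k hk => by omega)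
      (S.nuVec t α none) (fun k => S.affCoef a b H (Sum.inl k))
  have r2 : HasResInf (fun z => S.nuField t' α' z
      * ∑ k : Fin (S.rInf - 3), H (Sum.inl k) * z ^ (k : ℕ)) _ :=
    HasResInf.laurent_mul (S.rInf - 1) (S.rInf - 3) (fun k hk => by omega)
      (S.nuVec t' α' none) (fun k => H (Sum.inl k))
  have e1 : ∀ z, ∑ k : Fin (S.rInf - 3), S.affCoef a b H (Sum.inl k) * z ^ (k : ℕ)
      = a ^ 2 * ∑ k : Fin (S.rInf - 3), H (Sum.inl k) * (a * z + b) ^ (k : ℕ) := by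
    intro z
    have := S.ratFun_affCoef h
      (fun i => match i with | Sum.inl k => H (Sum.inl k) | Sum.inr _ => 0) z
    simpa [ratFun, affCoef] using this
  refine r1.unique ?_
  -- the two products differ by a polynomial, up to `O(z⁻²)`
  obtain ⟨P, hP⟩ := r2.comp_affine ha b
  have h5 := hd.nuField_OI h ht (by omega)
  have h6 : OI (fun z => ∑ k : Fin (S.rInf - 3), H (Sum.inl k) * (a * z + b) ^ (k : ℕ))
      (4 - S.rInf) := by
    refine OI.comp_affine (f := fun z => ∑ k : Fin (S.rInf - 3), H (Sum.inl k) * z ^ (k : ℕ))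
      (OrdAt.sum fun k _ => ?_) ha b
    exact ((OI.monomial _).const_mul _).mono hw (by have := k.2; omega)
  have h7 := ((h5.mul hw h6).const_mul (a ^ 2)).mono hw (k := 2) (by omega)
  refine ⟨P + Polynomial.C a * (Polynomial.C da * Polynomial.X + Polynomial.C db)
    * ∑ k : Fin (S.rInf - 3), Polynomial.C (H (Sum.inl k))
      * (Polynomial.C a * Polynomial.X + Polynomial.C b) ^ (k : ℕ), ?_⟩
  refine (h7.add hP).congr fun z => ?_
  beta_reduce
  rw [e1]
  simp only [Polynomial.eval_add, Polynomial.eval_mul, Polynomial.eval_C, Polynomial.eval_X,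
    Polynomial.eval_finsetSum, Polynomial.eval_pow]
  generalize (∑ k : Fin (S.rInf - 3), H (Sum.inl k) * (a * z + b) ^ (k : ℕ)) = Q
  generalize (∑ k : Fin (S.rInf - 3), S.nuVec t' α' none ((k : ℕ) + 2) * H (Sum.inl k)) = Q'
  have e : a ^ 2 * a⁻¹ = a := by rw [pow_two, mul_assoc, mul_inv_cancel₀ ha, mul_one]
  linear_combination (-(S.nuField t' α' (a * z + b) + (da * z + db)) * Q) * e

/-- The weights of the finite poles scale like the inverse of the coefficients. -/
theorem ReducesDir.finWeight_mul (hd : S.ReducesDir t t' a b α α' da db)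
    (h : S.Reduces m t m' t' a b) (ht : S.Admissible t) (s : Fin S.n) {k : ℕ} (hk : k < S.r s) :
    S.finWeight t α (a⁻¹ * da) (a⁻¹ * db) s k * (a ^ 2 * (a ^ (k + 1))⁻¹)
      = S.finWeight t' α' 0 0 s k := by
  have ha := h.ne_zero
  rcases k with _ | k
  · simp only [finWeight, if_pos, hd.pos_eq]
    field_simp
    ring
  · simp only [finWeight, Nat.add_sub_cancel, if_neg (Nat.succ_ne_zero k)]
    rw [hd.nuVec_fin h ht s (by omega)]
    by_cases h0 : k = 0
    · subst h0
      field_simp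
      simp
    · rw [if_neg h0, if_neg (by omega), if_neg (by omega), add_zero, add_zero, add_zero]
      field_simp
      ring

/-- The pairing with the reduced coefficients is the reduced pairing. -/
theorem ReducesDir.pairing_affCoef (hd : S.ReducesDir t t' a b α α' da db)
    (h : S.Reduces m t m' t' a b) (ht : S.Admissible t) (H : S.HIdx → ℂ) :
    S.pairing t α (a⁻¹ * da) (a⁻¹ * db) (S.affCoef a b H) = S.pairing t' α' 0 0 H := by
  unfold pairing
  rw [hd.pairing_affCoef_inf h ht, add_right_inj]
  refine Finset.sum_congr rfl fun s _ => Finset.sum_congr rfl fun k _ => ?_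
  rw [← hd.finWeight_mul h ht s k.2, affCoef]
  ring

/-- The derivative along `α` of a primitive of `P₁`. -/
def _root_.Isomono.PoleData.primDir (S : PoleData) (m : S.Mono) (t α : S.Times) (z : ℂ) : ℂ :=
  -(∑ k ∈ Finset.Icc 1 (S.rInf - 1), S.trTime 0 α none k / k * z ^ k)
    - ∑ s, ((∑ k ∈ Finset.Icc 1 (S.r s - 1), S.trTime 0 α (some s) k / k * (z - S.pos t s)⁻¹ ^ k)
      + S.pos α s * ∑ k ∈ Finset.range (S.r s),
          S.trTime m t (some s) k * (z - S.pos t s)⁻¹ ^ (k + 1))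

/-- The part of the Hamiltonian that involves the coefficients `c`. -/
def _root_.Isomono.PoleData.cSum (S : PoleData) (t α : S.Times) (z : ℂ) : ℂ :=
  (∑ k ∈ Finset.Icc 1 (S.rInf - 1), S.cCoef t α none k * z ^ k)
    + ∑ s, ∑ k ∈ Finset.Icc 1 (S.r s - 1), S.cCoef t α (some s) k / (z - S.pos t s) ^ k

/-- The value of the pairing of `ν` with a divided difference of `P₁`, corrected by the
coefficients `c` and the motion of `P₁`, does not depend on the base point. -/
theorem _root_.Isomono.PoleData.pairing_ddCoef (S : PoleData) (m : S.Mono) {t : S.Times}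
    (ht : S.Admissible t) (α : S.Times) {κ0 κ1 : ℂ} (h0 : 2 ≤ S.rInf → S.nuVec t α none 0 = κ0)
    (h1 : 3 ≤ S.rInf → S.nuVec t α none 1 = κ1) {z : ℂ} (hz : ∀ s, z ≠ S.pos t s) :
    S.pairing t α κ0 κ1 (S.ddCoef m t z) + 2 * S.cSum t α z - S.primDir m t α z
      + (κ0 * z + κ1) * S.P1 m t z
    = -(if 1 ≤ S.rInf - 1 then κ1 * S.trTime m t none 1 else 0)
      - (∑ a ∈ Finset.range (S.rInf - 1 - 2), S.nuVec t α none (a + 2) * S.trTime m t none (a + 2))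
      + ∑ s, κ0 * S.trTime m t (some s) 0 := by
  have hr := S.rInf_pos
  -- the sum splits into the contributions of the poles, which are evaluated one by one
  have ki := pairing_comb_inf (S.rInf - 1) (S.trTime m t none) (S.nuVec t α none) κ0 κ1 z
    (fun h => h0 (by omega)) (fun h => h1 (by omega))
  have kf : ∀ s, _ := fun s => pairing_comb_fin (S.r s - 1) (S.trTime m t (some s))
    (S.nuVec t α (some s)) κ0 (S.pos α s + κ0 * S.pos t s + κ1) (z - S.pos t s)⁻¹ (z - S.pos t s)
    (mul_inv_cancel₀ (sub_ne_zero.2 (hz s)))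
  rw [← ki, ← Finset.sum_congr rfl fun s _ => kf s]
  have e1 : ∑ k : Fin (S.rInf - 3), S.nuVec t α none ((k : ℕ) + 2) * S.ddCoef m t z (Sum.inl k)
      = ∑ a ∈ Finset.range (S.rInf - 1 - 2), S.nuVec t α none (a + 2)
        * (-∑ k ∈ Finset.Ico (a + 2) (S.rInf - 1 + 1), S.trTime m t none k * z ^ (k - 2 - a)) := by
    rw [show S.rInf - 1 - 2 = S.rInf - 3 by omega, show S.rInf - 1 + 1 = S.rInf by omega,
      ← Fin.sum_univ_eq_sum_range (fun a => S.nuVec t α none (a + 2)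
        * (-∑ k ∈ Finset.Ico (a + 2) S.rInf, S.trTime m t none k * z ^ (k - 2 - a)))]
    rfl
  have e2 : ∀ s, ∑ k : Fin (S.r s), S.finWeight t α κ0 κ1 s k * S.ddCoef m t z (Sum.inr ⟨s, k⟩)
      = ∑ a ∈ Finset.range (S.r s - 1 + 1), (if a = 0 then S.pos α s + κ0 * S.pos t s + κ1
          else -S.nuVec t α (some s) (a - 1) + if a = 1 then κ0 else 0)
        * (-∑ k ∈ Finset.Ico a (S.r s - 1 + 1),
            S.trTime m t (some s) k * (z - S.pos t s)⁻¹ ^ (k + 1 - a)) := by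
    intro s
    have hs := S.r_pos s
    rw [show S.r s - 1 + 1 = S.r s by omega,
      ← Fin.sum_univ_eq_sum_range (fun a => (if a = 0 then S.pos α s + κ0 * S.pos t s + κ1
          else -S.nuVec t α (some s) (a - 1) + if a = 1 then κ0 else 0)
        * (-∑ k ∈ Finset.Ico a (S.r s),
            S.trTime m t (some s) k * (z - S.pos t s)⁻¹ ^ (k + 1 - a)))]
    rfl
  have e3 : ∀ p : S.Pole, ∀ w : ℂ, ∑ k ∈ Finset.Icc 1 (S.ord p - 1), S.cCoef t α p k * w ^ k
      = S.eps p / 2 * (∑ l ∈ Finset.Icc 1 (S.ord p - 1), (∑ b ∈ Finset.range (S.ord p - 1 - l + 1),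
          S.trTime m t p (l + b) * S.nuVec t α p b) * w ^ l)
        - 1 / 2 * ∑ k ∈ Finset.Icc 1 (S.ord p - 1), S.trTime 0 α p k / k * w ^ k := by
    intro p w
    rw [Finset.mul_sum, Finset.mul_sum, ← Finset.sum_sub_distrib]
    refine Finset.sum_congr rfl fun k hk => ?_
    have hk := Finset.mem_Icc.1 hk
    rw [S.cCoef_eq ht α p hk.1 hk.2, Finset.sum_congr rfl fun b _ => by
      rw [← S.trTime_eq_trTime_zero m t p (k := k + b) (by omega)]]
    have : (k : ℂ) ≠ 0 := Nat.cast_ne_zero.2 (by omega)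
    field_simp
  have e4 : ∀ s, ∑ k ∈ Finset.Icc 1 (S.r s - 1), S.cCoef t α (some s) k / (z - S.pos t s) ^ k
      = -1 / 2 * (∑ l ∈ Finset.Icc 1 (S.r s - 1), (∑ b ∈ Finset.range (S.r s - 1 - l + 1),
          S.trTime m t (some s) (l + b) * S.nuVec t α (some s) b) * (z - S.pos t s)⁻¹ ^ l)
        - 1 / 2 * ∑ k ∈ Finset.Icc 1 (S.r s - 1), S.trTime 0 α (some s) k / k
            * (z - S.pos t s)⁻¹ ^ k := by
    intro s
    have := e3 (some s) (z - S.pos t s)⁻¹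
    simp only [inv_pow, ← div_eq_mul_inv] at this ⊢
    exact this
  have e5 := e3 none z
  have e6 : S.P1 m t z = -(∑ k ∈ Finset.Icc 1 (S.rInf - 1), S.trTime m t none k * z ^ (k - 1))
      + ∑ s, ∑ k ∈ Finset.range (S.r s - 1 + 1),
        S.trTime m t (some s) k * (z - S.pos t s)⁻¹ ^ (k + 1) := by
    rw [P1]
    congr 1
    refine Finset.sum_congr rfl fun s _ => ?_
    rw [Nat.sub_add_cancel (S.r_pos s)]
    exact Finset.sum_congr rfl fun k _ => by rw [div_eq_mul_inv, inv_pow]; rfl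
  simp only [ord, eps_none] at e5
  obtain ⟨A, hA⟩ : ∃ A : Fin S.n → ℂ, ∀ s, A s = ∑ a ∈ Finset.range (S.r s - 1 + 1),
      (if a = 0 then S.pos α s + κ0 * S.pos t s + κ1
          else -S.nuVec t α (some s) (a - 1) + if a = 1 then κ0 else 0)
        * (-∑ k ∈ Finset.Ico a (S.r s - 1 + 1),
            S.trTime m t (some s) k * (z - S.pos t s)⁻¹ ^ (k + 1 - a)) := ⟨_, fun _ => rfl⟩
  obtain ⟨B, hB⟩ : ∃ B : Fin S.n → ℂ, ∀ s, B s = ∑ l ∈ Finset.Icc 1 (S.r s - 1),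
      (∑ b ∈ Finset.range (S.r s - 1 - l + 1),
        S.trTime m t (some s) (l + b) * S.nuVec t α (some s) b) * (z - S.pos t s)⁻¹ ^ l :=
    ⟨_, fun _ => rfl⟩
  obtain ⟨C, hC⟩ : ∃ C : Fin S.n → ℂ, ∀ s, C s = ∑ k ∈ Finset.Icc 1 (S.r s - 1),
      S.trTime 0 α (some s) k / k * (z - S.pos t s)⁻¹ ^ k := ⟨_, fun _ => rfl⟩
  obtain ⟨P, hP⟩ : ∃ P : Fin S.n → ℂ, ∀ s, P s = ∑ k ∈ Finset.range (S.r s - 1 + 1),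
      S.trTime m t (some s) k * (z - S.pos t s)⁻¹ ^ (k + 1) := ⟨_, fun _ => rfl⟩
  have hP' : ∀ s, ∑ k ∈ Finset.range (S.r s), S.trTime m t (some s) k
      * (z - S.pos t s)⁻¹ ^ (k + 1) = P s := fun s => by
    rw [hP, Nat.sub_add_cancel (S.r_pos s)]
  simp only [← hA, ← hB, ← hC, ← hP] at e2 e4 e6 ⊢
  rw [pairing, e1, Finset.sum_congr rfl fun s _ => e2 s, cSum, e5,
    Finset.sum_congr rfl fun s _ => e4 s, e6, primDir]
  simp only [hP', ← hC]
  have key : (∑ s, A s) + 2 * (∑ s, (-1 / 2 * B s - 1 / 2 * C s))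
      + (∑ s, (C s + S.pos α s * P s)) + (κ0 * z + κ1) * ∑ s, P s
      = ∑ s, (A s - B s + (S.pos α s + κ0 * S.pos t s + κ1 + κ0 * (z - S.pos t s)) * P s) := by
    rw [Finset.mul_sum, Finset.mul_sum, ← Finset.sum_add_distrib, ← Finset.sum_add_distrib,
      ← Finset.sum_add_distrib]
    exact Finset.sum_congr rfl fun s _ => by ring
  linear_combination key

end Reduces

end PoleData

/-! ### The Hamiltonian as a pairing -/

namespace PoleData

variable (S : PoleData)

/-- The change of the Hamiltonian when `ν_{∞,-1}` and `ν_{∞,0}` are replaced by `κ0` and `κ1` in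
the cases where they are not determined; by the additional equations of the coefficient system it is
a function of the times. -/
def hamShift (ħ : ℂ) (m : S.Mono) (t : S.Times) (κ0 κ1 : ℂ) : ℂ :=
  (if S.rInf = 2 then κ1 * -(S.time m t none 0 1 * m none 1 + S.time m t none 1 1 * m none 0
      + ħ * S.time m t none 0 1) else 0)
    + if S.rInf = 1 then κ0 * ((∑ s, if S.r s = 1 then m (some s) 0 * m (some s) 1 else 0)
      - m none 0 * (m none 1 + ħ)) else 0

/-- The Hamiltonian in a form in which `ν_{∞,-1}` and `ν_{∞,0}` are replaced, in the cases where they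
are not determined, by arbitrary values `κ0` and `κ1`. The reduction prescribes these values. -/
theorem Ham_eq (ħ : ℂ) (m : S.Mono) (c0 : S.Times → ℂ) (α : S.Times) {x : S.Phase}
    (hx : x ∈ S.regular) {κ0 κ1 : ℂ} (h0 : 2 ≤ S.rInf → S.nuVec x.2.2 α none 0 = κ0)
    (h1 : 3 ≤ S.rInf → S.nuVec x.2.2 α none 1 = κ1) :
    S.Ham ħ m c0 α x = S.pairing x.2.2 α κ0 κ1 (S.Hsol ħ m x)
      - ħ * (∑ j, (S.cSum x.2.2 α (x.1 j) + κ1 * x.2.1 j + κ0 * (x.1 j * x.2.1 j)))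
      - S.hamShift ħ m x.2.2 κ0 κ1 - ħ * S.g * c0 x.2.2 := by
  have hH := S.Hsol_spec ħ m hx
  have hr := S.rInf_pos
  have e : ∑ j, (c0 x.2.2
        + (∑ k ∈ Finset.Icc 1 (S.rInf - 1), S.cCoef x.2.2 α none k * x.1 j ^ k)
        + ∑ s, ∑ k ∈ Finset.Icc 1 (S.r s - 1),
            S.cCoef x.2.2 α (some s) k / (x.1 j - S.pos x.2.2 s) ^ k)
      = S.g * c0 x.2.2 + ∑ j, S.cSum x.2.2 α (x.1 j) := by
    simp only [cSum, Finset.sum_add_distrib, Finset.sum_const, Finset.card_univ, Fintype.card_fin,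
      nsmul_eq_mul]
    ring
  rw [Ham, e, pairing_eq, Finset.sum_add_distrib, Finset.sum_add_distrib, ← Finset.mul_sum,
    ← Finset.mul_sum]
  simp only [nuInf]
  generalize S.Hsol ħ m x = H at *
  obtain hr3 | hr2 | hr1 : 3 ≤ S.rInf ∨ S.rInf = 2 ∨ S.rInf = 1 := by omega
  · rw [if_neg (by omega), if_neg (by omega), hamShift, if_neg (by omega), if_neg (by omega),
      h0 (by omega), h1 hr3]
    ring
  · have hn : S.nuVec x.2.2 α none 1 = 0 := S.nuVec_of_le _ _ _ (by simp only [ord]; omega)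
    rw [if_pos (by omega), if_neg (by omega), hamShift, if_pos hr2, if_neg (by omega),
      h0 (by omega), hn, hH.2.1 hr2]
    ring
  · have hn : ∀ c, S.nuVec x.2.2 α none c = 0 :=
      fun c => S.nuVec_of_le _ _ _ (by simp only [ord]; omega)
    obtain ⟨h3, h4⟩ := hH.2.2 hr1
    rw [if_pos (by omega), if_pos hr1, hamShift, if_neg (by omega), if_pos hr1, hn, hn, h3, h4]
    ring

theorem Ham_eq_nu (ħ : ℂ) (m : S.Mono) (c0 : S.Times → ℂ) (α : S.Times) {x : S.Phase}
    (hx : x ∈ S.regular) :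
    S.Ham ħ m c0 α x = S.pairing x.2.2 α (S.nuVec x.2.2 α none 0) (S.nuVec x.2.2 α none 1)
        (S.Hsol ħ m x)
      - ħ * (∑ j, (S.cSum x.2.2 α (x.1 j) + S.nuVec x.2.2 α none 1 * x.2.1 j
        + S.nuVec x.2.2 α none 0 * (x.1 j * x.2.1 j))) - ħ * S.g * c0 x.2.2 := by
  rw [S.Ham_eq ħ m c0 α hx (fun _ => rfl) (fun _ => rfl), hamShift]
  have e1 : (if S.rInf = 2 then S.nuVec x.2.2 α none 1 * -(S.time m x.2.2 none 0 1 * m none 1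
      + S.time m x.2.2 none 1 1 * m none 0 + ħ * S.time m x.2.2 none 0 1) else 0) = 0 := by
    split_ifs with h
    · rw [S.nuVec_of_le _ _ _ (by simp only [ord]; omega), zero_mul]
    · rfl
  have e2 : (if S.rInf = 1 then S.nuVec x.2.2 α none 0 * ((∑ s, if S.r s = 1 then
      m (some s) 0 * m (some s) 1 else 0) - m none 0 * (m none 1 + ħ)) else 0) = 0 := by
    split_ifs with h
    · rw [S.nuVec_of_le _ _ _ (by simp only [ord]; omega), zero_mul]
    · rfl
  rw [e1, e2]
  ring

theorem Ham_eq_sub (ħ : ℂ) (m : S.Mono) (c0 : S.Times → ℂ) (α : S.Times) {x : S.Phase}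
    (hx : x ∈ S.regular) :
    S.Ham ħ m c0 α x = S.Ham ħ m (fun _ => 0) α x - ħ * S.g * c0 x.2.2 := by
  rw [S.Ham_eq_nu ħ m c0 α hx, S.Ham_eq_nu ħ m (fun _ => 0) α hx]
  ring

/-! ### Linearity in the deformation -/

theorem time_zero_add_smul (α β : S.Times) (c : ℂ) (p : S.Pole) (i : Fin 2) (k : ℕ) :
    S.time 0 (α + c • β) p i k = S.time 0 α p i k + c * S.time 0 β p i k := by
  unfold time
  split_ifs <;> simp

theorem dtime_add_smul (α β : S.Times) (c : ℂ) (p : S.Pole) (k : ℕ) :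
    S.dtime (α + c • β) p k = S.dtime α p k + c * S.dtime β p k := by
  simp only [dtime, time_zero_add_smul]; ring

theorem nuVec_add_smul (t α β : S.Times) (c : ℂ) (p : S.Pole) (a : ℕ) :
    S.nuVec t (α + c • β) p a = S.nuVec t α p a + c * S.nuVec t β p a := by
  by_cases h : a < S.ord p - 1
  · simp only [nuVec, dif_pos h]
    rw [← smul_eq_mul c, ← Pi.smul_apply, ← Matrix.mulVec_smul, ← Pi.add_apply,
      ← Matrix.mulVec_add]
    congr 2
    funext b
    simp only [dtime_add_smul, Pi.add_apply, Pi.smul_apply, smul_eq_mul]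
    ring
  · simp only [nuVec, dif_neg h, mul_zero, add_zero]

theorem cCoef_add_smul (t α β : S.Times) (c : ℂ) (p : S.Pole) (a : ℕ) :
    S.cCoef t (α + c • β) p a = S.cCoef t α p a + c * S.cCoef t β p a := by
  unfold cCoef
  split_ifs
  · rw [← smul_eq_mul c, ← Pi.smul_apply, ← Matrix.mulVec_smul, ← Pi.add_apply,
      ← Matrix.mulVec_add]
    congr 2
    funext b
    simp only [time_zero_add_smul, Pi.add_apply, Pi.smul_apply, smul_eq_mul, Finset.mul_sum]
    rw [← Finset.sum_add_distrib]
    exact Finset.sum_congr rfl fun _ _ => by ring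
  · simp

theorem cSum_add_smul (t α β : S.Times) (c z : ℂ) :
    S.cSum t (α + c • β) z = S.cSum t α z + c * S.cSum t β z := by
  simp only [cSum, cCoef_add_smul, add_mul, add_div, Finset.sum_add_distrib, mul_assoc,
    mul_div_assoc, ← Finset.mul_sum]
  ring

theorem pairing_add_smul (t α β : S.Times) (c κ0 κ1 κ0' κ1' : ℂ) (H : S.HIdx → ℂ) :
    S.pairing t (α + c • β) (κ0 + c * κ0') (κ1 + c * κ1') H
      = S.pairing t α κ0 κ1 H + c * S.pairing t β κ0' κ1' H := by
  have e : ∀ s k, S.finWeight t (α + c • β) (κ0 + c * κ0') (κ1 + c * κ1') s k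
      = S.finWeight t α κ0 κ1 s k + c * S.finWeight t β κ0' κ1' s k := by
    intro s k
    simp only [finWeight, nuVec_add_smul, pos, Pi.add_apply, Pi.smul_apply, smul_eq_mul]
    split_ifs <;> ring
  simp only [pairing, e, nuVec_add_smul, add_mul, Finset.sum_add_distrib, mul_assoc,
    ← Finset.mul_sum]
  ring

theorem Ham_add_smul (ħ : ℂ) (m : S.Mono) (c0 d0 : S.Times → ℂ) (α β : S.Times) (c : ℂ)
    {x : S.Phase} (hx : x ∈ S.regular) :
    S.Ham ħ m (fun t => c0 t + c * d0 t) (α + c • β) x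
      = S.Ham ħ m c0 α x + c * S.Ham ħ m d0 β x := by
  simp only [S.Ham_eq_nu ħ m _ _ hx, nuVec_add_smul, pairing_add_smul, cSum_add_smul]
  simp only [Finset.sum_add_distrib, add_mul, mul_assoc, ← Finset.mul_sum]
  ring

theorem Ham_sum (ħ : ℂ) (m : S.Mono) {ι : Type*} (s : Finset ι) (c0 : ι → S.Times → ℂ)
    (v : ι → S.Times) (β : ι → ℂ) {x : S.Phase} (hx : x ∈ S.regular) :
    S.Ham ħ m (fun t => ∑ i ∈ s, β i * c0 i t) (∑ i ∈ s, β i • v i) x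
      = ∑ i ∈ s, β i * S.Ham ħ m (c0 i) (v i) x := by
  classical
  induction s using Finset.induction_on with
  | empty =>
    have := S.Ham_add_smul ħ m (fun _ => 0) (fun _ => 0) 0 0 (-1) hx
    simpa using this
  | insert i s hi ih =>
    simp only [Finset.sum_insert hi]
    rw [← ih, ← add_comm (∑ i ∈ s, β i • v i),
      ← add_comm (S.Ham ħ m (fun t => ∑ i ∈ s, β i * c0 i t) (∑ i ∈ s, β i • v i) x),
      ← S.Ham_add_smul ħ m _ _ _ _ _ hx]
    simp only [add_comm]

/-! ### Comparison of the Hamiltonians -/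

section Reduces

variable {S} {m m' : S.Mono} {t' α α' : S.Times} {a b da db : ℂ}

theorem Reduces.redPoint_mem {x : S.Phase} (h : S.Reduces m x.2.2 m' t' a b)
    (hx : x ∈ S.regular) : S.redPoint m x t' a b ∈ S.regular := by
  refine ⟨h.admissible hx.1, fun i j hij => hx.2.1 ?_, fun j s hjs => hx.2.2 j s ?_⟩
  · exact mul_left_cancel₀ h.ne_zero (add_right_cancel hij)
  · simp only [redPoint, h.pos_eq] at hjs
    exact mul_left_cancel₀ h.ne_zero (add_right_cancel hjs)

/-- The difference of the Hamiltonian of `α` at `x` and of the Hamiltonian of `α'` at the reduced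
point, corrected by the terms that come from the motion of the change of coordinates. -/
def _root_.Isomono.PoleData.hamDefect (S : PoleData) (ħ : ℂ) (m m' : S.Mono) (t' : S.Times)
    (a b : ℂ) (α α' : S.Times) (da db : ℂ) (x : S.Phase) : ℂ :=
  S.Ham ħ m (fun _ => 0) α x - S.Ham ħ m' (fun _ => 0) α' (S.redPoint m x t' a b)
    + ħ * ∑ j, (S.primDir m x.2.2 α (x.1 j) / 2
      + a⁻¹ * (x.2.1 j - S.P1 m x.2.2 (x.1 j) / 2) * (da * x.1 j + db))

/-- The corrected difference of the Hamiltonians in terms of the remaining coefficients: the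
contributions of the divided differences add up to a constant by `pairing_ddCoef`. -/
theorem Reduces.hamDefect_eq_rest {ħ : ℂ} {x : S.Phase} (h : S.Reduces m x.2.2 m' t' a b)
    (hd : S.ReducesDir x.2.2 t' a b α α' da db) (hx : x ∈ S.regular) :
    S.hamDefect ħ m m' t' a b α α' da db x
      = S.pairing x.2.2 α (a⁻¹ * da) (a⁻¹ * db) (S.restCoef ħ m x a b (S.Hsol ħ m x)
          (S.Hsol ħ m' (S.redPoint m x t' a b)))
        - S.hamShift ħ m x.2.2 (a⁻¹ * da) (a⁻¹ * db)
        - ħ / 2 * (S.g * (-(if 1 ≤ S.rInf - 1 then a⁻¹ * db * S.trTime m x.2.2 none 1 else 0)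
          - (∑ c ∈ Finset.range (S.rInf - 1 - 2),
              S.nuVec x.2.2 α none (c + 2) * S.trTime m x.2.2 none (c + 2))
          + ∑ s, a⁻¹ * da * S.trTime m x.2.2 (some s) 0)) := by
  have h0 := hd.nuVec_inf_zero h hx.1
  have h1 : 3 ≤ S.rInf → S.nuVec x.2.2 α none 1 = a⁻¹ * db := fun h3 => (hd.nuVec_inf h hx.1 h3).2
  have hy := h.redPoint_mem hx
  have hΛ := fun j => S.pairing_ddCoef m hx.1 α h0 h1 (hx.2.2 j)
  have hc : ∀ z, S.cSum t' α' z = 0 := by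
    intro z
    have e : ∀ p, ∀ k ∈ Finset.Icc 1 (S.ord p - 1), S.cCoef t' α' p k = 0 := fun p k hk => by
      have hk := Finset.mem_Icc.1 hk
      refine S.cCoef_eq_zero (h.admissible hx.1) (fun k => ?_) (hd.trTime_eq p) hk.1 hk.2
      by_cases hk0 : k = 0
      · simp [hk0, trTime, time]
      · rw [← S.trTime_eq_trTime_zero m' t' p hk0, h.trTime_eq]
    rw [cSum, Finset.sum_eq_zero fun k hk => by rw [e none k hk, zero_mul],
      Finset.sum_eq_zero fun s _ => Finset.sum_eq_zero fun k hk => by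
        rw [e (some s) k hk, zero_div], add_zero]
  have hS' : S.hamShift ħ m' t' 0 0 = 0 := by simp [hamShift]
  have e1 := S.Ham_eq ħ m (fun _ => 0) α hx h0 h1
  have e2 := S.Ham_eq ħ m' (fun _ => 0) α' hy (κ0 := 0) (κ1 := 0)
    (fun _ => hd.nuVec_zero' (h.admissible hx.1)) (fun _ => hd.nuVec_one' (h.admissible hx.1))
  have e3 : S.pairing (S.redPoint m x t' a b).2.2 α' 0 0 (S.Hsol ħ m' (S.redPoint m x t' a b))
      = _ := (hd.pairing_affCoef h hx.1 (S.Hsol ħ m' (S.redPoint m x t' a b))).symm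
  rw [e3] at e2
  have e4 : S.restCoef ħ m x a b (S.Hsol ħ m x) (S.Hsol ħ m' (S.redPoint m x t' a b))
      = fun i => (S.Hsol ħ m x i
        + -1 * S.affCoef a b (S.Hsol ħ m' (S.redPoint m x t' a b)) i)
        + ħ / 2 * ∑ j, S.ddCoef m x.2.2 (x.1 j) i := by
    funext i; rw [restCoef]; ring
  rw [e4, pairing_add, pairing_add, pairing_sum]
  have e5 : (S.g : ℂ) * (-(if 1 ≤ S.rInf - 1 then a⁻¹ * db * S.trTime m x.2.2 none 1 else 0)
          - (∑ c ∈ Finset.range (S.rInf - 1 - 2),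
              S.nuVec x.2.2 α none (c + 2) * S.trTime m x.2.2 none (c + 2))
          + ∑ s, a⁻¹ * da * S.trTime m x.2.2 (some s) 0)
      = ∑ j, (S.pairing x.2.2 α (a⁻¹ * da) (a⁻¹ * db) (S.ddCoef m x.2.2 (x.1 j))
        + 2 * S.cSum x.2.2 α (x.1 j) - S.primDir m x.2.2 α (x.1 j)
        + (a⁻¹ * da * x.1 j + a⁻¹ * db) * S.P1 m x.2.2 (x.1 j)) := by
    rw [Finset.sum_congr rfl fun j _ => hΛ j, Finset.sum_const, Finset.card_univ,
      Fintype.card_fin, nsmul_eq_mul]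
  rw [e5, hamDefect, e1, e2]
  simp only [redPoint, hc, hS', zero_mul, mul_zero, add_zero, sub_zero, Finset.sum_const_zero]
  have e6 : ∑ j, (S.primDir m x.2.2 α (x.1 j) / 2
      + a⁻¹ * (x.2.1 j - S.P1 m x.2.2 (x.1 j) / 2) * (da * x.1 j + db))
      = (∑ j, (S.cSum x.2.2 α (x.1 j) + a⁻¹ * db * x.2.1 j + a⁻¹ * da * (x.1 j * x.2.1 j)))
        + 1 / 2 * (∑ j, S.pairing x.2.2 α (a⁻¹ * da) (a⁻¹ * db) (S.ddCoef m x.2.2 (x.1 j)))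
        - 1 / 2 * ∑ j, (S.pairing x.2.2 α (a⁻¹ * da) (a⁻¹ * db) (S.ddCoef m x.2.2 (x.1 j))
        + 2 * S.cSum x.2.2 α (x.1 j) - S.primDir m x.2.2 α (x.1 j)
        + (a⁻¹ * da * x.1 j + a⁻¹ * db) * S.P1 m x.2.2 (x.1 j)) := by
    rw [Finset.mul_sum, Finset.mul_sum, ← Finset.sum_add_distrib, ← Finset.sum_sub_distrib]
    exact Finset.sum_congr rfl fun j _ => by ring
  rw [e6]
  ring

/-- The corrected difference of the Hamiltonians is a function of the times only. -/
theorem Reduces.hamDefect_eq {ħ : ℂ} {x y : S.Phase} (hxy : x.2.2 = y.2.2)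
    (h : S.Reduces m x.2.2 m' t' a b) (hd : S.ReducesDir x.2.2 t' a b α α' da db)
    (hm : ∑ p, ∑ i, m p i = 0) (hx : x ∈ S.regular) (hy : y ∈ S.regular) :
    S.hamDefect ħ m m' t' a b α α' da db x = S.hamDefect ħ m m' t' a b α α' da db y := by
  have h' : S.Reduces m y.2.2 m' t' a b := hxy ▸ h
  have hd' : S.ReducesDir y.2.2 t' a b α α' da db := hxy ▸ hd
  rw [h.hamDefect_eq_rest hd hx, h'.hamDefect_eq_rest hd' hy,
    h.restCoef_eq hxy hm hx hy (S.Hsol_spec ħ m hx) (S.Hsol_spec ħ m' (h.redPoint_mem hx))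
      (S.Hsol_spec ħ m hy) (S.Hsol_spec ħ m' (h'.redPoint_mem hy)), hxy]

end Reduces

end PoleData

/-! ### The number of isomonodromic times -/

namespace PoleData

variable (S : PoleData)

theorem card_fin_ge (n c : ℕ) : Fintype.card {s : Fin n // c ≤ (s : ℕ)} = n - c := by
  rw [← Fintype.card_fin (n - c)]
  exact Fintype.card_congr
    { toFun := fun s => ⟨(s.1 : ℕ) - c, by have := s.1.2; have := s.2; omega⟩
      invFun := fun k => ⟨⟨(k : ℕ) + c, by have := k.2; omega⟩, by simp⟩
      left_inv := fun s => by
        have := s.2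
        apply Subtype.ext; apply Fin.ext
        simp only
        omega
      right_inv := fun k => by apply Fin.ext; simp }

theorem card_trivialIdx : Fintype.card {a : Σ s : Fin S.n, Fin (S.r s - 1) // S.IsTrivialIdx a}
    = if S.rInf = 1 ∧ S.n = 1 then 1 else 0 := by
  split_ifs with h
  · have hg := S.genus_pos
    have hn : ∀ s t : Fin S.n, s = t := fun s t => by
      apply Fin.ext; have := s.2; have := t.2; omega
    let s0 : Fin S.n := ⟨0, by omega⟩
    have hs : ∑ s, S.r s = S.r s0 := by
      rw [Finset.sum_eq_single_of_mem s0 (Finset.mem_univ _)]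
      exact fun s _ hs => absurd (hn s s0) hs
    have h3 : 2 < S.r s0 := by omega
    rw [Fintype.card_eq_one_iff]
    refine ⟨⟨⟨s0, ⟨S.r s0 - 2, by omega⟩⟩, h.1, h.2, by simp only; omega⟩, ?_⟩
    rintro ⟨⟨s, k⟩, h0⟩
    obtain ⟨h1, h2, h4⟩ := h0
    obtain rfl := hn s s0
    refine Subtype.ext (congrArg (Sigma.mk s0) (Fin.ext ?_))
    change (k : ℕ) = S.r s0 - 2
    change (k : ℕ) + 2 = S.r s0 at h4
    omega
  · rw [Fintype.card_eq_zero_iff]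
    exact ⟨fun a => h ⟨a.2.1, a.2.2.1⟩⟩

theorem card_isoIdx : Fintype.card S.IsoIdx = S.g := by
  have hr := S.rInf_pos
  have hg := S.genus_pos
  have h1 : ∑ s, (S.r s - 1) + S.n = ∑ s, S.r s := by
    have e : ∑ s, ((S.r s - 1) + 1) = ∑ s, S.r s :=
      Finset.sum_congr rfl fun s _ => Nat.sub_add_cancel (S.r_pos s)
    rw [Finset.sum_add_distrib] at e
    simpa using e
  have hn : S.n = 0 → ∑ s, S.r s = 0 := fun h =>
    Finset.sum_eq_zero fun s _ => absurd s.2 (by omega)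
  have h2 : S.n = 1 → 1 ≤ S.rInf := fun _ => hr
  simp only [IsoIdx, Fintype.card_sum, Fintype.card_fin, Fintype.card_subtype_compl,
    card_trivialIdx, Fintype.card_sigma, card_fin_ge]
  unfold g
  split_ifs with h
  · omega
  · omega

/-! ### The trivial times -/

section Trivial

variable {S} {T2 : S.Times → ℂ} {U : Set S.Times}

theorem one_le_n_of_rInf (h : S.rInf ≤ 2) : 1 ≤ S.n := by
  have hg := S.genus_pos
  by_contra hn
  have : ∑ s, S.r s = 0 := Finset.sum_eq_zero fun s _ => absurd s.2 (by omega)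
  omega

theorem IsT2.ne_zero (hT : S.IsT2 T2 U) (hadm : ∀ t ∈ U, S.Admissible t) {t : S.Times}
    (ht : t ∈ U) : T2 t ≠ 0 := by
  intro h0
  have hr := S.rInf_pos
  obtain ⟨h2, h1, h1'⟩ := hT.2 t ht
  by_cases hr2 : 2 ≤ S.rInf
  · have := h2 hr2
    rw [h0, zero_pow (by omega)] at this
    exact (hadm t ht).2 none hr2 (by simpa [ord] using this.symm)
  · have hn := S.one_le_n_of_rInf (by omega)
    by_cases hn1 : S.n = 1
    · let s0 : Fin S.n := ⟨0, by omega⟩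
      have hs : ∑ s, S.r s = S.r s0 := by
        rw [Finset.sum_eq_single_of_mem s0 (Finset.mem_univ _)]
        exact fun s _ hs => absurd (Fin.ext (by have := s.2; simp only [s0]; omega)) hs
      have hg := S.genus_pos
      have := h1' (by omega) hn1 s0
      rw [h0, inv_zero, zero_pow (by omega)] at this
      exact (hadm t ht).2 (some s0) (by simp only [ord]; omega) (by simpa [ord] using this.symm)
    · have := h1 (by omega) ⟨0, by omega⟩ ⟨1, by omega⟩ rfl rfl
      rw [h0, eq_comm, inv_eq_zero, sub_eq_zero] at this
      have := (hadm t ht).1 this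
      simp at this

theorem contDiff_dtime (p : S.Pole) (k : ℕ) {n : WithTop ℕ∞} :
    ContDiff ℂ n (fun t => S.dtime t p k) := by
  have h : ∀ i, ContDiff ℂ n (fun t => S.time 0 t p i k) := fun i => by
    unfold time; split_ifs <;> fun_prop
  exact (h 0).sub (h 1)

theorem contDiff_pos (s : Fin S.n) {n : WithTop ℕ∞} : ContDiff ℂ n (fun t => S.pos t s) := by
  unfold pos; fun_prop

/-- The branch `T₂` is twice continuously differentiable: it is a root, or explicit. -/
theorem IsT2.contDiffOn (hT : S.IsT2 T2 U) (hU : IsOpen U) (hadm : ∀ t ∈ U, S.Admissible t) :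
    ContDiffOn ℂ 2 T2 U := by
  have hr := S.rInf_pos
  by_cases hr2 : 2 ≤ S.rInf
  · exact contDiffOn_of_pow_eq hU (k := S.rInf - 1) (by omega) hT.1
      (f := fun t => S.dtime t none (S.rInf - 1) / 2) ((contDiff_dtime _ _).div_const _)
      (fun t ht => (hT.2 t ht).1 hr2)
      (fun t ht => div_ne_zero ((hadm t ht).2 none hr2) two_ne_zero)
  · have hn := S.one_le_n_of_rInf (by omega)
    by_cases hn1 : S.n = 1
    · let s0 : Fin S.n := ⟨0, by omega⟩
      have hs : ∑ s, S.r s = S.r s0 := by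
        rw [Finset.sum_eq_single_of_mem s0 (Finset.mem_univ _)]
        exact fun s _ hs => absurd (Fin.ext (by have := s.2; simp only [s0]; omega)) hs
      have hg := S.genus_pos
      have h1 : ContDiffOn ℂ 2 (fun t => (T2 t)⁻¹) U :=
        contDiffOn_of_pow_eq hU (k := S.r s0 - 1) (by omega)
          (hT.1.fun_inv fun t ht => hT.ne_zero hadm ht)
          (f := fun t => S.dtime t (some s0) (S.r s0 - 1) / 2)
          ((contDiff_dtime _ _).div_const _)
          (fun t ht => (hT.2 t ht).2.2 (by omega) hn1 s0)
          (fun t ht => div_ne_zero ((hadm t ht).2 (some s0) (by simp only [ord]; omega))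
            two_ne_zero)
      exact (h1.inv fun t ht => inv_ne_zero (hT.ne_zero hadm ht)).congr fun t _ => (inv_inv _).symm
    · let s0 : Fin S.n := ⟨0, by omega⟩
      let s1 : Fin S.n := ⟨1, by omega⟩
      have h1 : ContDiffOn ℂ 2 (fun t => (S.pos t s1 - S.pos t s0)⁻¹) U := by
        refine (((contDiff_pos s1).sub (contDiff_pos s0)).contDiffOn).inv fun t ht h0 => ?_
        have := (hadm t ht).1 (sub_eq_zero.1 h0)
        simp [s0, s1] at this
      exact h1.congr fun t ht => (hT.2 t ht).2.1 (by omega) s0 s1 rfl rfl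

theorem IsT2.contDiffAt (hT : S.IsT2 T2 U) (hU : IsOpen U) (hadm : ∀ t ∈ U, S.Admissible t)
    {t : S.Times} (ht : t ∈ U) : ContDiffAt ℂ 2 T2 t :=
  (hT.contDiffOn hU hadm).contDiffAt (hU.mem_nhds ht)

theorem IsT2.contDiffAt_T1 (hT : S.IsT2 T2 U) (hU : IsOpen U) (hadm : ∀ t ∈ U, S.Admissible t)
    {t : S.Times} (ht : t ∈ U) : ContDiffAt ℂ 2 (S.T1 T2) t := by
  have h2 := hT.contDiffAt hU hadm ht
  unfold T1
  split_ifs with h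
  · refine (contDiff_dtime _ _).contDiffAt.div (contDiffAt_const.mul (h2.pow _)) ?_
    exact mul_ne_zero (mul_ne_zero two_ne_zero (Nat.cast_ne_zero.2 (by omega)))
      (pow_ne_zero _ (hT.ne_zero hadm ht))
  · refine (ContDiffAt.neg (ContDiffAt.sum fun s _ => ?_)).mul h2
    split_ifs
    · exact (contDiff_pos s).contDiffAt
    · exact contDiffAt_const

theorem IsT2.contDiffAt_isoTime (hT : S.IsT2 T2 U) (hU : IsOpen U)
    (hadm : ∀ t ∈ U, S.Admissible t) (I : S.IsoIdx) {t : S.Times} (ht : t ∈ U) :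
    ContDiffAt ℂ 2 (S.isoTime T2 I) t := by
  have h2 := hT.contDiffAt hU hadm ht
  have h0 := hT.ne_zero hadm ht
  have hd : ∀ p k, ContDiffAt ℂ 2 (fun t => S.dtime t p k) t := fun p k =>
    (contDiff_dtime p k).contDiffAt
  rcases I with j | a | s
  · unfold isoTime tauInf
    refine (ContDiffAt.sum fun i _ => contDiffAt_const.mul ?_).add (contDiffAt_const.mul ?_)
    · exact (((hd _ _).pow _).mul (hd _ _)).div
        (((contDiffAt_const.mul (h2.pow _)).pow _).mul (h2.pow _))
        (mul_ne_zero (pow_ne_zero _ (mul_ne_zero two_ne_zero (pow_ne_zero _ h0)))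
          (pow_ne_zero _ h0))
    · exact ((hd _ _).pow _).div (contDiffAt_const.mul (h2.pow _))
        (mul_ne_zero (pow_ne_zero _ two_ne_zero) (pow_ne_zero _ h0))
  · exact (hd _ _).mul (h2.pow _)
  · exact (h2.mul (contDiff_pos _).contDiffAt).add (hT.contDiffAt_T1 hU hadm ht)

end Trivial

/-! ### The isomonodromic times at infinity as coefficients of a recentred polynomial -/

/-- The coefficient of `μ ^ (j - 1)` in the polynomial `dPol`, written in the variable
`μ = c z + u` and divided by `c`. -/
def recCoef (t : S.Times) (c u : ℂ) (j : ℕ) : ℂ :=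
  ∑ k ∈ Finset.Icc j (S.rInf - 1), S.dtime t none k * (c ^ k)⁻¹ * ((k - 1).choose (j - 1) : ℂ)
    * (-u) ^ (k - j)

/-- The expansion of `dPol` about the point where `c z + u` vanishes. -/
theorem dPol_recCoef (t : S.Times) {c : ℂ} (hc : c ≠ 0) (u z : ℂ) : S.dPol t z
    = c * ∑ j ∈ Finset.Icc 1 (S.rInf - 1), S.recCoef t c u j * (c * z + u) ^ (j - 1) := by
  simp only [recCoef, Finset.sum_mul]
  rw [Finset.sum_comm' (t' := Finset.Icc 1 (S.rInf - 1)) (s' := fun k => Finset.Icc 1 k)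
    (fun j k => by simp only [Finset.mem_Icc]; omega), Finset.mul_sum, dPol]
  refine Finset.sum_congr rfl fun k hk => ?_
  have hk := Finset.mem_Icc.1 hk
  obtain ⟨k', rfl⟩ : ∃ k', k = k' + 1 := ⟨k - 1, by omega⟩
  have e : ∑ j ∈ Finset.Icc 1 (k' + 1), S.dtime t none (k' + 1) * (c ^ (k' + 1))⁻¹
      * ((k' + 1 - 1).choose (j - 1) : ℂ) * (-u) ^ (k' + 1 - j) * (c * z + u) ^ (j - 1)
      = S.dtime t none (k' + 1) * (c ^ (k' + 1))⁻¹ * (c * z) ^ k' := by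
    have h1 := add_pow (c * z + u) (-u) k'
    rw [add_neg_cancel_right] at h1
    rw [h1, Finset.mul_sum, Finset.range_eq_Ico]
    refine (Finset.sum_Ico_add' (fun j => S.dtime t none (k' + 1) * (c ^ (k' + 1))⁻¹
      * ((k' + 1 - 1).choose (j - 1) : ℂ) * (-u) ^ (k' + 1 - j) * (c * z + u) ^ (j - 1))
      0 (k' + 1) 1).symm.trans (Finset.sum_congr rfl fun j _ => ?_)
    rw [Nat.add_sub_cancel, Nat.add_sub_cancel, Nat.add_sub_add_right]
    ring
  rw [e, Nat.add_sub_cancel, mul_pow]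
  field_simp
  ring

section Tau

variable {S} {T2 : S.Times → ℂ} {t : S.Times}

/-- The choice of `T₂` normalizes the leading coefficient. -/
theorem recCoef_lead (h0 : T2 t ≠ 0)
    (hl : T2 t ^ (S.rInf - 1) = S.dtime t none (S.rInf - 1) / 2) (u : ℂ) :
    S.recCoef t (T2 t) u (S.rInf - 1) = 2 := by
  have hl' : S.dtime t none (S.rInf - 1) = 2 * T2 t ^ (S.rInf - 1) := by rw [hl]; ring
  have := pow_ne_zero (S.rInf - 1) h0
  rw [recCoef, Finset.Icc_self, Finset.sum_singleton, hl', Nat.sub_self, Nat.choose_self]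
  field_simp
  simp

/-- The choice of `T₁` removes the subleading coefficient. -/
theorem recCoef_sublead (h3 : 3 ≤ S.rInf) (h0 : T2 t ≠ 0)
    (hl : T2 t ^ (S.rInf - 1) = S.dtime t none (S.rInf - 1) / 2) :
    S.recCoef t (T2 t) (S.T1 T2 t) (S.rInf - 2) = 0 := by
  have hl' : S.dtime t none (S.rInf - 1) = 2 * T2 t ^ (S.rInf - 1) := by rw [hl]; ring
  obtain ⟨r', hr⟩ := Nat.exists_eq_add_of_le' h3
  rw [hr, show r' + 3 - 1 = r' + 2 by omega] at hl'
  rw [recCoef, T1, if_pos h3, hr, show r' + 3 - 1 = r' + 2 by omega,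
    show r' + 3 - 2 = r' + 1 by omega, Finset.sum_Icc_succ_top (by omega), Finset.Icc_self,
    Finset.sum_singleton, hl', show r' + 2 - 1 = r' + 1 by omega, Nat.add_sub_cancel]
  have : ((r' + 1 : ℕ) : ℂ) ≠ 0 := Nat.cast_ne_zero.2 (by omega)
  simp only [Nat.choose_self, Nat.choose_succ_self_right, Nat.sub_self, pow_zero, pow_one,
    show r' + 2 - (r' + 1) = 1 by omega]
  field_simp
  simp

/-- The isomonodromic times at infinity are the lower coefficients of the recentred polynomial. In the
explicit formula the terms of the two highest times are merged, by the definitions of `T₁` and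
`T₂`. -/
theorem tauInf_eq {j : ℕ} (hj : 1 ≤ j) (hj' : j ≤ S.rInf - 3) (h0 : T2 t ≠ 0)
    (hl : T2 t ^ (S.rInf - 1) = S.dtime t none (S.rInf - 1) / 2) :
    S.tauInf T2 t j = S.recCoef t (T2 t) (S.T1 T2 t) j := by
  have hl' : S.dtime t none (S.rInf - 1) = 2 * T2 t ^ (S.rInf - 1) := by rw [hl]; ring
  obtain ⟨j, rfl⟩ := Nat.exists_eq_add_of_le' hj
  obtain ⟨N, hr⟩ : ∃ N, S.rInf = j + N + 4 := ⟨S.rInf - (j + 4), by omega⟩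
  have hR : ((j + N + 2 : ℕ) : ℂ) ≠ 0 := Nat.cast_ne_zero.2 (by omega)
  have hN : ((N + 2 : ℕ) : ℂ) ≠ 0 := Nat.cast_ne_zero.2 (by omega)
  have hN1 : ((N + 1 : ℕ) : ℂ) ≠ 0 := Nat.cast_ne_zero.2 (by omega)
  have hf : ∀ n : ℕ, (Nat.factorial n : ℂ) ≠ 0 := fun n =>
    Nat.cast_ne_zero.2 (Nat.factorial_ne_zero n)
  have e1 : S.recCoef t (T2 t) (S.T1 T2 t) (j + 1)
      = ∑ i ∈ Finset.range (N + 3), S.dtime t none (j + 1 + i) * (T2 t ^ (j + 1 + i))⁻¹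
        * ((j + i).choose j : ℂ) * (-S.T1 T2 t) ^ i := by
    rw [recCoef, hr, ← Finset.Ico_add_one_right_eq_Icc, Finset.sum_Ico_eq_sum_range,
      show j + N + 4 - 1 + 1 - (j + 1) = N + 3 by omega]
    refine Finset.sum_congr rfl fun i _ => ?_
    rw [show j + 1 + i - 1 = j + i by omega, Nat.add_sub_cancel, Nat.add_sub_cancel_left]
  have hT1 : S.T1 T2 t = S.dtime t none (S.rInf - 2)
      / (2 * ((j + N + 2 : ℕ) : ℂ) * T2 t ^ (j + N + 2)) := by
    rw [T1, if_pos (by omega), hr, show j + N + 4 - 2 = j + N + 2 by omega]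
  rw [e1, Finset.sum_range_succ, Finset.sum_range_succ, tauInf, add_assoc]
  rw [hr] at hl' hT1 ⊢
  rw [show j + N + 4 - (j + 1) - 2 = N + 1 by omega, show j + 1 - 1 = j by omega,
    show j + N + 4 - 2 = j + N + 2 by omega, show j + N + 4 - 1 = j + N + 3 by omega,
    show j + N + 4 - 3 = j + N + 1 by omega, show j + N + 3 - (j + 1) = N + 2 by omega,
    show j + N + 4 - (j + 1) - 3 = N by omega, show j + N + 2 - (j + 1) = N + 1 by omega,
    show j + 1 + (N + 1) = j + N + 2 by omega, show j + 1 + (N + 2) = j + N + 3 by omega]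
  rw [show j + N + 4 - 2 = j + N + 2 by omega] at hT1
  rw [show j + N + 4 - 1 = j + N + 3 by omega] at hl'
  generalize S.T1 T2 t = X at *
  generalize T2 t = T at *
  have hTR := pow_ne_zero (j + N + 2) h0
  have hK : ((j + (N + 2)).factorial : ℂ) = ((j + N + 2 : ℕ) : ℂ) * ((j + N + 1).factorial : ℂ) := by
    rw [← Nat.cast_mul, ← Nat.factorial_succ]; rfl
  rw [hl', show j + N + 3 = (j + N + 2) + 1 by ring, pow_succ T (j + N + 2), pow_mul]
  have hD : S.dtime t none (j + N + 2) = X * (2 * ((j + N + 2 : ℕ) : ℂ) * T ^ (j + N + 2)) := by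
    rw [hT1]; field_simp
  generalize ((j + N + 2 : ℕ) : ℂ) = K at *
  congr 1
  · refine Finset.sum_congr rfl fun i _ => ?_
    have hX : (-X) ^ i = (-1) ^ i * S.dtime t none (j + N + 2) ^ i
        / (2 ^ i * K ^ i * (T ^ (j + N + 2)) ^ i) := by
      rw [hT1, neg_pow (S.dtime t none (j + N + 2) / _), div_pow, mul_pow, mul_pow]; ring
    rw [show j + 1 + i - 1 = j + i by omega, Nat.cast_add_choose, hX, mul_pow, mul_pow,
      show j + 1 + i = j + (i + 1) by ring, pow_add T j (i + 1), pow_add T i,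
      pow_add T j, pow_one]
    generalize T ^ (j + N + 2) = Y at *
    have hi := hf i
    have hj := hf j
    field_simp
  · rw [hD, Nat.cast_add_choose, Nat.cast_add_choose, hK, Nat.factorial_succ N.succ,
      Nat.factorial_succ N, show j + (N + 1) = j + N + 1 by omega, mul_pow, mul_pow, mul_pow]
    generalize T ^ (j + N + 2) = Y at *
    have h1 := hf N
    have h2 := hf j
    have h3 := hf (j + N + 1)
    push_cast at hN hN1 ⊢
    have hN2 : (N : ℂ) + 1 + 1 ≠ 0 := by rwa [add_assoc, one_add_one_eq_two]
    rw [neg_pow X, neg_pow X]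
    field_simp
    ring

end Tau

end PoleData

/-! ### Derivatives of the reduction along a curve -/

namespace PoleData

variable (S : PoleData)

theorem dtime_succ (t : S.Times) (p : S.Pole) {k : ℕ} (hk : k < S.ord p - 1) :
    S.dtime t p (k + 1) = t (Sum.inl ⟨p, 0, ⟨k, hk⟩⟩) - t (Sum.inl ⟨p, 1, ⟨k, hk⟩⟩) := by
  simp [dtime, time, hk]

theorem dtime_of_lt (t : S.Times) (p : S.Pole) {k : ℕ} (hk : S.ord p - 1 < k) :
    S.dtime t p k = 0 := by
  simp [dtime, time, show k ≠ 0 by omega, show ¬k - 1 < S.ord p - 1 by omega]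

theorem dtime_zero (t : S.Times) (p : S.Pole) : S.dtime t p 0 = 0 := by simp [dtime, time]

theorem aPol_hasDerivAt_right (t : S.Times) (z : ℂ) :
    HasDerivAt (fun z => S.aPol t z) (S.dPol t z) z := by
  unfold aPol dPol
  refine HasDerivAt.fun_sum fun k hk => ?_
  have hk := Finset.mem_Icc.1 hk
  have h := (hasDerivAt_pow k z).const_mul (S.dtime t none k / k)
  have : (k : ℂ) ≠ 0 := Nat.cast_ne_zero.2 (by omega)
  refine h.congr_deriv ?_
  field_simp

section Curve

variable {S} {m m' : S.Mono} {v v' : ℂ → S.Times} {a b : ℂ → ℂ} {α α' : S.Times} {da db : ℂ}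

theorem hasDerivAt_dtime {s : ℂ} (hv : ∀ i, HasDerivAt (fun s => v s i) (α i) s) (p : S.Pole)
    (k : ℕ) : HasDerivAt (fun s => S.dtime (v s) p k) (S.dtime α p k) s := by
  rcases k with _ | k
  · simp only [dtime_zero]; exact hasDerivAt_const _ _
  · by_cases hk : k < S.ord p - 1
    · simp only [dtime_succ _ _ _ hk]
      exact (hv _).sub (hv _)
    · simp only [S.dtime_of_lt _ p (k := k + 1) (by omega)]
      exact hasDerivAt_const _ _

theorem hasDerivAt_aPol {s : ℂ} (hv : ∀ i, HasDerivAt (fun s => v s i) (α i) s) {f : ℂ → ℂ}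
    {f' : ℂ} (hf : HasDerivAt f f' s) : HasDerivAt (fun s => S.aPol (v s) (f s))
      (S.aPol α (f s) + S.dPol (v s) (f s) * f') s := by
  unfold aPol dPol
  rw [Finset.sum_mul, ← Finset.sum_add_distrib]
  refine HasDerivAt.fun_sum fun k hk => ?_
  have hk := Finset.mem_Icc.1 hk
  have h := ((hasDerivAt_dtime hv none k).div_const (k : ℂ)).mul (hf.pow k)
  have : (k : ℂ) ≠ 0 := Nat.cast_ne_zero.2 (by omega)
  refine h.congr_deriv ?_
  simp only [Pi.pow_apply]
  field_simp

/-- The reduction of `dPol`, integrated. -/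
theorem Reduces.aPol_eq {t t' : S.Times} {a b : ℂ} (h : S.Reduces m t m' t' a b) (z : ℂ) :
    S.aPol t z = S.aPol t' (a * z + b) + (S.aPol t 0 - S.aPol t' b) := by
  have hd : ∀ z, HasDerivAt (fun z => S.aPol t z - S.aPol t' (a * z + b)) 0 z := by
    intro z
    have h1 : HasDerivAt (fun z : ℂ => a * z + b) a z := by
      simpa using ((hasDerivAt_id z).const_mul a).add_const b
    have h2 := (S.aPol_hasDerivAt_right t z).sub
      ((S.aPol_hasDerivAt_right t' (a * z + b)).comp z h1)
    refine h2.congr_deriv ?_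
    rw [h.dPol_eq]; ring
  have := is_const_of_deriv_eq_zero (fun z => (hd z).differentiableAt) (fun z => (hd z).deriv) z 0
  simp only [mul_zero, zero_add] at this
  linear_combination this

/-- The tangent vectors of a family of reductions are related by `ReducesDir`. -/
theorem ReducesDir.of_curve {s : ℂ} (h : ∀ᶠ s in 𝓝 s, S.Reduces m (v s) m' (v' s) (a s) (b s))
    (hv : ∀ i, HasDerivAt (fun s => v s i) (α i) s)
    (hv' : ∀ i, HasDerivAt (fun s => v' s i) (α' i) s)
    (ha : HasDerivAt a da s) (hb : HasDerivAt b db s)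
    (htr : ∀ p k, S.trTime 0 α' p k = 0) (h2 : 2 ≤ S.rInf → S.dtime α' none (S.rInf - 1) = 0)
    (h3 : 3 ≤ S.rInf → S.dtime α' none (S.rInf - 2) = 0) :
    S.ReducesDir (v s) (v' s) (a s) (b s) α α' da db where
  pos_eq i := by
    have h1 := (ha.mul (hv (Sum.inr i))).add hb
    have h4 := h1.congr_of_eventuallyEq (f₁ := fun s => v' s (Sum.inr i))
      (by filter_upwards [h] with s hs; exact hs.pos_eq i)
    rw [show S.pos α' i = _ from (hv' (Sum.inr i)).unique h4]
    simp only [pos]; ring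
  trTime_eq := htr
  dtime_fin i k := by
    have h1 := (ha.pow k).mul (hasDerivAt_dtime hv (some i) k)
    have h4 := h1.congr_of_eventuallyEq (f₁ := fun s => S.dtime (v' s) (some i) k)
      (by filter_upwards [h] with s hs; exact hs.dtime_fin i k)
    rw [(hasDerivAt_dtime hv' (some i) k).unique h4]
    simp only [Pi.pow_apply]; ring
  aPol_eq := by
    refine ⟨S.aPol α 0 - (S.aPol α' (b s) + S.dPol (v' s) (b s) * db), fun z => ?_⟩
    have h1 : HasDerivAt (fun s => a s * z + b s) (da * z + db) s := (ha.mul_const z).add hb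
    have h4 := (hasDerivAt_aPol hv' h1).add
      ((hasDerivAt_aPol hv (hasDerivAt_const s (0 : ℂ))).sub (hasDerivAt_aPol hv' hb))
    have h5 := h4.congr_of_eventuallyEq (f₁ := fun s => S.aPol (v s) z)
      (by filter_upwards [h] with s hs; exact hs.aPol_eq z)
    have h6 := (hasDerivAt_aPol hv (hasDerivAt_const s z)).unique h5
    simp only [mul_zero, add_zero] at h6
    rw [h6]
  lead := h2
  sublead := h3

end Curve

/-! ### Canonical times -/

theorem _root_.Isomono.sgn_zero : sgn 0 = 1 := rfl

theorem _root_.Isomono.sgn_one : sgn 1 = -1 := rfl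

/-- The canonical times if `c = 1`, their linear part if `c = 0`. -/
def canonGen (c : ℂ) (τ : S.IsoIdx → ℂ) (i : S.TimeIdx) : ℂ :=
  match i with
  | Sum.inl ⟨none, e, k⟩ =>
      sgn e * (if (k : ℕ) + 2 = S.rInf then c
        else if h : (k : ℕ) < S.rInf - 3 then τ (Sum.inl ⟨k, h⟩) / 2 else 0)
  | Sum.inl ⟨some s, e, k⟩ =>
      sgn e * (if h : S.IsTrivialIdx ⟨s, k⟩ then c else τ (Sum.inr (Sum.inl ⟨⟨s, k⟩, h⟩)) / 2)
  | Sum.inr s =>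
      if h : 3 - S.rInf ≤ (s : ℕ) then τ (Sum.inr (Sum.inr ⟨s, h⟩)) else c * ((s : ℕ) : ℂ)

theorem canonTimes_eq (τ : S.IsoIdx → ℂ) : S.canonTimes τ = S.canonGen 1 τ := by
  funext i
  rcases i with ⟨_ | s, e, k⟩ | s <;> simp [canonTimes, canonGen]

section Canon

variable {S} (c : ℂ) (τ : S.IsoIdx → ℂ)

theorem hasDerivAt_canonGen {f : ℂ → S.IsoIdx → ℂ} {β : S.IsoIdx → ℂ} {s : ℂ}
    (hf : ∀ I, HasDerivAt (fun s => f s I) (β I) s) (i : S.TimeIdx) :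
    HasDerivAt (fun s => S.canonGen c (f s) i) (S.canonGen 0 β i) s := by
  rcases i with ⟨_ | s, e, k⟩ | s
  · simp only [canonGen]
    split_ifs
    · simpa using hasDerivAt_const _ _
    · exact ((hf _).div_const _).const_mul _
    · simpa using hasDerivAt_const _ _
  · simp only [canonGen]
    split_ifs
    · simpa using hasDerivAt_const _ _
    · exact ((hf _).div_const _).const_mul _
  · simp only [canonGen]
    split_ifs
    · exact hf _
    · simpa using hasDerivAt_const _ _

theorem canonGen_one (p : S.Pole) (k : Fin (S.ord p - 1)) :
    S.canonGen c τ (Sum.inl ⟨p, 1, k⟩) = -S.canonGen c τ (Sum.inl ⟨p, 0, k⟩) := by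
  rcases p with _ | s <;> simp only [canonGen, sgn_zero, sgn_one, one_mul, neg_mul]

theorem trTime_canonGen {m : S.Mono} (hm : ∀ p, m p 0 + m p 1 = 0) (p : S.Pole) (k : ℕ) :
    S.trTime m (S.canonGen c τ) p k = 0 := by
  unfold trTime time
  split_ifs
  · exact hm p
  · rw [canonGen_one, add_neg_cancel]
  · simp

theorem dtime_canonGen (p : S.Pole) {k : ℕ} (hk : k < S.ord p - 1) :
    S.dtime (S.canonGen c τ) p (k + 1) = 2 * S.canonGen c τ (Sum.inl ⟨p, 0, ⟨k, hk⟩⟩) := by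
  rw [S.dtime_succ _ p hk, canonGen_one]; ring

theorem dtime_canonGen_lead (h2 : 2 ≤ S.rInf) :
    S.dtime (S.canonGen c τ) none (S.rInf - 1) = 2 * c := by
  rw [show S.rInf - 1 = (S.rInf - 2) + 1 by omega,
    dtime_canonGen c τ none (by simp only [ord]; omega)]
  simp only [canonGen, sgn_zero]
  rw [if_pos (by omega), one_mul]

theorem dtime_canonGen_sublead (h3 : 3 ≤ S.rInf) :
    S.dtime (S.canonGen c τ) none (S.rInf - 2) = 0 := by
  rw [show S.rInf - 2 = (S.rInf - 3) + 1 by omega,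
    dtime_canonGen c τ none (by simp only [ord]; omega)]
  simp only [canonGen]
  rw [if_neg (by omega), dif_neg (by omega), mul_zero, mul_zero]

theorem dtime_canonGen_inf (j : Fin (S.rInf - 3)) :
    S.dtime (S.canonGen c τ) none ((j : ℕ) + 1) = τ (Sum.inl j) := by
  have hj := j.2
  rw [dtime_canonGen c τ none (by simp only [ord]; omega)]
  simp only [canonGen, sgn_zero]
  rw [if_neg (by omega), dif_pos hj]
  ring

theorem dtime_canonGen_fin (s : Fin S.n) (k : Fin (S.r s - 1)) (h : ¬S.IsTrivialIdx ⟨s, k⟩) :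
    S.dtime (S.canonGen c τ) (some s) ((k : ℕ) + 1) = τ (Sum.inr (Sum.inl ⟨⟨s, k⟩, h⟩)) := by
  have e : S.canonGen c τ (Sum.inl ⟨some s, 0, k⟩) = τ (Sum.inr (Sum.inl ⟨⟨s, k⟩, h⟩)) / 2 := by
    simp only [canonGen, sgn_zero]
    rw [dif_neg h, one_mul]
  refine (dtime_canonGen c τ (some s) k.2).trans ((congrArg (2 * ·) e).trans ?_)
  ring

theorem dtime_canonGen_trivial (s : Fin S.n) (k : Fin (S.r s - 1)) (h : S.IsTrivialIdx ⟨s, k⟩) :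
    S.dtime (S.canonGen c τ) (some s) ((k : ℕ) + 1) = 2 * c := by
  have e : S.canonGen c τ (Sum.inl ⟨some s, 0, k⟩) = c := by
    simp only [canonGen, sgn_zero]
    rw [dif_pos h, one_mul]
  exact (dtime_canonGen c τ (some s) k.2).trans (congrArg (2 * ·) e)

theorem sum_smul_isoVec (β : S.IsoIdx → ℂ) :
    ∑ I, β I • S.isoVec 0 1 I = S.canonGen 0 β := by
  funext i
  rw [Finset.sum_apply]
  simp only [Pi.smul_apply, smul_eq_mul, Fintype.sum_sum_type]
  rcases i with ⟨_ | s, e, k⟩ | s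
  · have h0 : ∀ j : Fin (S.rInf - 3), β (Sum.inl j)
        * S.isoVec 0 1 (Sum.inl j) (Sum.inl ⟨none, e, k⟩)
        = if (j : ℕ) = k then sgn e * (β (Sum.inl j) / 2) else 0 := by
      intro j
      simp only [isoVec, one_pow, mul_one]
      split_ifs with h
      · rw [h, Nat.choose_self, Nat.sub_self]; simp; ring
      · rcases Nat.lt_or_gt_of_ne h with h | h
        · rw [Nat.choose_eq_zero_of_lt h]; simp
        · rw [zero_pow (by omega)]; simp
    simp only [h0, canonGen]
    simp only [isoVec, mul_zero, Finset.sum_const_zero, add_zero]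
    have hk : (k : ℕ) < S.rInf - 1 := k.2
    by_cases h : (k : ℕ) < S.rInf - 3
    · rw [if_neg (by omega), dif_pos h, Finset.sum_eq_single_of_mem ⟨k, h⟩ (Finset.mem_univ _)]
      · simp
      · intro j _ hj
        exact if_neg fun e => hj (Fin.ext e)
    · rw [Finset.sum_eq_zero fun j _ => if_neg (by have := j.2; omega)]
      split_ifs <;> simp
  · simp only [isoVec, canonGen, mul_zero, Finset.sum_const_zero, add_zero, zero_add]
    by_cases h : S.IsTrivialIdx ⟨s, k⟩
    · rw [dif_pos h, mul_zero]
      refine Finset.sum_eq_zero fun a _ => ?_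
      rw [if_neg, mul_zero]
      rintro ⟨rfl, hk⟩
      exact a.2 (by
        have : a.1 = ⟨a.1.1, k⟩ := Sigma.ext rfl (heq_of_eq (Fin.ext hk.symm))
        rwa [this])
    · rw [dif_neg h, Finset.sum_eq_single_of_mem ⟨⟨s, k⟩, h⟩ (Finset.mem_univ _)]
      · simp; ring
      · rintro ⟨⟨s', k'⟩, ha⟩ _ hne
        rw [if_neg, mul_zero]
        rintro ⟨rfl, hk⟩
        exact hne (Subtype.ext (congrArg (Sigma.mk s) (Fin.ext hk.symm)))
  · simp only [isoVec, canonGen, mul_zero, Finset.sum_const_zero, zero_add, zero_mul]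
    by_cases h : 3 - S.rInf ≤ (s : ℕ)
    · rw [dif_pos h, Finset.sum_eq_single_of_mem ⟨s, h⟩ (Finset.mem_univ _)]
      · simp
      · intro s' _ hs
        rw [if_neg fun e => hs (Subtype.ext e.symm), mul_zero]
    · rw [dif_neg h]
      refine Finset.sum_eq_zero fun s' _ => ?_
      rw [if_neg, mul_zero]
      rintro rfl
      exact h s'.2

end Canon

end PoleData

/-! ### Reduction to the canonical times -/

namespace PoleData

variable {S : PoleData} {T2 : S.Times → ℂ} {U : Set S.Times} {t : S.Times}

theorem canonMono_add (m : S.Mono) (p : S.Pole) : S.canonMono m p 0 + S.canonMono m p 1 = 0 := by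
  simp only [canonMono, sgn_zero, sgn_one]; ring

theorem T1_of_le_two (h : S.rInf ≤ 2) (s : Fin S.n) (hs : (s : ℕ) = 0) :
    S.T1 T2 t = -S.pos t s * T2 t := by
  rw [T1, if_neg (by omega), Finset.sum_eq_single_of_mem s (Finset.mem_univ _), if_pos hs]
  exact fun s' _ h' => if_neg fun e => h' (Fin.ext (by omega))

theorem IsT2.dtime_canonTimes_inf (hT : S.IsT2 T2 U) (hadm : ∀ t ∈ U, S.Admissible t) (ht : t ∈ U)
    {j : ℕ} (hj : 1 ≤ j) (hj' : j ≤ S.rInf - 1) :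
    S.dtime (S.canonTimes fun I => S.isoTime T2 I t) none j
      = S.recCoef t (T2 t) (S.T1 T2 t) j := by
  have h0 := hT.ne_zero hadm ht
  have hl := (hT.2 t ht).1 (by omega)
  rw [canonTimes_eq]
  obtain rfl | rfl | h : j = S.rInf - 1 ∨ j = S.rInf - 2 ∨ j ≤ S.rInf - 3 := by omega
  · rw [dtime_canonGen_lead _ _ (by omega), recCoef_lead h0 hl, mul_one]
  · rw [dtime_canonGen_sublead _ _ (by omega), recCoef_sublead (by omega) h0 hl]
  · rw [← tauInf_eq hj h h0 hl]
    obtain ⟨j, rfl⟩ := Nat.exists_eq_add_of_le' hj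
    exact dtime_canonGen_inf 1 _ ⟨j, by omega⟩

theorem IsT2.pos_canonTimes (hT : S.IsT2 T2 U) (hadm : ∀ t ∈ U, S.Admissible t) (ht : t ∈ U)
    (s : Fin S.n) : S.pos (S.canonTimes fun I => S.isoTime T2 I t) s
      = T2 t * S.pos t s + S.T1 T2 t := by
  have hr := S.rInf_pos
  simp only [canonTimes, pos]
  split_ifs with h
  · rfl
  · have hn : 0 < S.n := by have := s.2; omega
    let s0 : Fin S.n := ⟨0, hn⟩
    rw [T1_of_le_two (by omega) s0 rfl]
    by_cases hs : (s : ℕ) = 0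
    · obtain rfl : s = s0 := Fin.ext hs
      rw [hs]
      simp only [pos]
      push_cast
      ring
    · have hs1 : (s : ℕ) = 1 := by omega
      have h2 := (hT.2 t ht).2.1 (by omega) s0 s rfl hs1
      have h3 := hT.ne_zero hadm ht
      have h4 : T2 t * (S.pos t s - S.pos t s0) = 1 := by
        rw [h2] at h3 ⊢
        exact inv_mul_cancel₀ fun h => h3 (by rw [h, inv_zero])
      rw [hs1]
      simp only [pos] at h4 ⊢
      push_cast
      linear_combination -h4

/-- Subtracting half of the trace and applying the affine change of variable `λ ↦ T₂ λ + T₁` brings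
the trivial times to their canonical values. -/
theorem IsT2.reduces (hT : S.IsT2 T2 U) (hadm : ∀ t ∈ U, S.Admissible t) (ht : t ∈ U)
    (m : S.Mono) : S.Reduces m t (S.canonMono m) (S.canonTimes fun I => S.isoTime T2 I t)
      (T2 t) (S.T1 T2 t) where
  ne_zero := hT.ne_zero hadm ht
  pos_eq := hT.pos_canonTimes hadm ht
  trTime_eq p k := by rw [canonTimes_eq]; exact trTime_canonGen _ _ (canonMono_add m) p k
  dfTime_fin s k := by
    have h0 := hT.ne_zero hadm ht
    rcases k with _ | k
    · simp only [dfTime, time, if_pos, canonMono, sgn_zero, sgn_one]; ring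
    · rw [← S.dtime_eq_dfTime _ _ _ (Nat.succ_ne_zero k),
        ← S.dtime_eq_dfTime _ _ _ (Nat.succ_ne_zero k)]
      by_cases hk : k < S.r s - 1
      · rw [canonTimes_eq]
        by_cases h : S.IsTrivialIdx ⟨s, ⟨k, hk⟩⟩
        · have h1 := dtime_canonGen_trivial 1 (fun I => S.isoTime T2 I t) s ⟨k, hk⟩ h
          have h2 := (hT.2 t ht).2.2 h.1 h.2.1 s
          have h3 : k + 2 = S.r s := h.2.2
          rw [show S.r s - 1 = k + 1 by omega] at h2
          simp only at h1
          have h4 : S.dtime t (some s) (k + 1) = 2 * (T2 t)⁻¹ ^ (k + 1) := by rw [h2]; ring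
          rw [h1, h4, inv_pow]
          have := pow_ne_zero (k + 1) h0
          field_simp
        · refine (dtime_canonGen_fin 1 (fun I => S.isoTime T2 I t) s ⟨k, hk⟩ h).trans ?_
          simp only [isoTime]; ring
      · rw [S.dtime_of_lt _ (some s) (by simp only [ord]; omega),
          S.dtime_of_lt _ (some s) (by simp only [ord]; omega), mul_zero]
  dfTime_zero := by simp only [dfTime, time, if_pos, canonMono, sgn_zero, sgn_one]; ring
  dfTime_inf z := by
    have e : ∀ (m : S.Mono) (t : S.Times) (z : ℂ), ∑ k ∈ Finset.Icc 1 (S.rInf - 1),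
        S.dfTime m t none k * z ^ (k - 1) = S.dPol t z := fun m t z =>
      Finset.sum_congr rfl fun k hk => by
        rw [S.dtime_eq_dfTime m t _ (by have := Finset.mem_Icc.1 hk; omega)]
    rw [e, e, S.dPol_recCoef t (hT.ne_zero hadm ht) (S.T1 T2 t) z, dPol]
    congr 1
    refine Finset.sum_congr rfl fun j hj => ?_
    have hj := Finset.mem_Icc.1 hj
    rw [hT.dtime_canonTimes_inf hadm ht hj.1 hj.2]
  dfTime_lead := by
    by_cases h2 : 2 ≤ S.rInf
    · rw [← S.dtime_eq_dfTime _ _ _ (by omega), ← S.dtime_eq_dfTime _ _ _ (by omega),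
        canonTimes_eq, dtime_canonGen_lead _ _ h2, (hT.2 t ht).1 h2]
      ring
    · have := S.rInf_pos
      rw [show S.rInf - 1 = 0 by omega]
      simp only [dfTime, time, if_pos, canonMono, sgn_zero, sgn_one]; ring

/-- The image of a deformation vector under the tangent map of the reduction. -/
def redVec (T2 : S.Times → ℂ) (t α : S.Times) : S.Times :=
  ∑ I, fderiv ℂ (S.isoTime T2 I) t α • S.isoVec 0 1 I

/-- The tangent map of the reduction, obtained by differentiating it along a line. -/
theorem IsT2.reducesDir (hT : S.IsT2 T2 U) (hU : IsOpen U) (hadm : ∀ t ∈ U, S.Admissible t)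
    (ht : t ∈ U) (α : S.Times) :
    S.ReducesDir t (S.canonTimes fun I => S.isoTime T2 I t) (T2 t) (S.T1 T2 t) α
      (redVec T2 t α) (fderiv ℂ T2 t α) (fderiv ℂ (S.T1 T2) t α) := by
  have hd : ∀ {f : S.Times → ℂ}, ContDiffAt ℂ 2 f t →
      HasDerivAt (fun s : ℂ => f (t + s • α)) (fderiv ℂ f t α) 0 := fun hf =>
    (hf.differentiableAt two_ne_zero).hasFDerivAt.hasLineDerivAt α
  have hv : ∀ i, HasDerivAt (fun s : ℂ => (t + s • α) i) (α i) 0 := fun i => by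
    simpa using ((hasDerivAt_id (0 : ℂ)).mul_const (α i)).const_add (t i)
  have hc : Continuous fun s : ℂ => t + s • α := by fun_prop
  have h0 : t + (0 : ℂ) • α = t := by simp
  have hev : ∀ᶠ s : ℂ in 𝓝 0, t + s • α ∈ U :=
    hc.continuousAt.eventually (by beta_reduce; rw [h0]; exact hU.mem_nhds ht)
  have hI : ∀ I, HasDerivAt (fun s : ℂ => S.isoTime T2 I (t + s • α))
      (fderiv ℂ (S.isoTime T2 I) t α) 0 := fun I => hd (hT.contDiffAt_isoTime hU hadm I ht)
  have hv' : ∀ i, HasDerivAt (fun s : ℂ => S.canonTimes (fun I => S.isoTime T2 I (t + s • α)) i)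
      (redVec T2 t α i) 0 := fun i => by
    rw [redVec, sum_smul_isoVec]
    simp only [canonTimes_eq]
    exact hasDerivAt_canonGen 1 hI i
  have := ReducesDir.of_curve (m := 0) (m' := S.canonMono 0)
    (v := fun s => t + s • α)
    (v' := fun s => S.canonTimes (fun I => S.isoTime T2 I (t + s • α)))
    (a := fun s => T2 (t + s • α)) (b := fun s => S.T1 T2 (t + s • α)) (s := 0)
    (by filter_upwards [hev] with s hs using hT.reduces hadm hs 0) hv hv'
    (hd (hT.contDiffAt hU hadm ht)) (hd (hT.contDiffAt_T1 hU hadm ht))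
    (fun p k => by rw [redVec, sum_smul_isoVec]; exact trTime_canonGen _ _ (fun _ => by simp) p k)
    (fun h2 => by rw [redVec, sum_smul_isoVec, dtime_canonGen_lead _ _ h2, mul_zero])
    (fun h3 => by rw [redVec, sum_smul_isoVec, dtime_canonGen_sublead _ _ h3])
  simpa only [h0] using this

/-! ### Duality of the isomonodromic times and of their vectors -/

theorem dtime_isoVec_inf (c u : ℂ) (j : Fin (S.rInf - 3)) {k : ℕ} (hk : k < S.rInf - 1) :
    S.dtime (S.isoVec u c (Sum.inl j)) none (k + 1)
      = c ^ (k + 1) * ((j : ℕ).choose k : ℂ) * u ^ ((j : ℕ) - k) := by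
  rw [S.dtime_succ _ none hk]
  simp only [isoVec, sgn_zero, sgn_one]; ring

theorem dtime_isoVec_inf_inr (c u : ℂ) (I) (k : ℕ) :
    S.dtime (S.isoVec u c (Sum.inr I)) none k = 0 := by
  rcases k with _ | k
  · exact S.dtime_zero _ _
  · by_cases hk : k < S.ord none - 1
    · rw [S.dtime_succ _ none hk]
      rcases I with a | s <;> simp [isoVec]
    · exact S.dtime_of_lt _ _ (by omega)

theorem dtime_isoVec_fin (c u : ℂ) (I : S.IsoIdx) (s : Fin S.n) (k : Fin (S.r s - 1)) :
    S.dtime (S.isoVec u c I) (some s) ((k : ℕ) + 1)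
      = if (∃ h, I = Sum.inr (Sum.inl ⟨⟨s, k⟩, h⟩)) then (c ^ ((k : ℕ) + 1))⁻¹ else 0 := by
  rw [S.dtime_succ _ (some s) k.2]
  rcases I with j | ⟨⟨s', k'⟩, h'⟩ | s'
  · simp [isoVec]
  · simp only [isoVec, sgn_zero, sgn_one]
    by_cases h : s = s' ∧ (k : ℕ) = (k' : ℕ)
    · obtain ⟨rfl, hk⟩ := h
      obtain rfl : k = k' := Fin.ext hk
      rw [if_pos ⟨rfl, rfl⟩, if_pos ⟨rfl, rfl⟩, if_pos ⟨h', rfl⟩]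
      ring
    · rw [if_neg h, if_neg h, if_neg, sub_zero]
      rintro ⟨h1, h2⟩
      simp only [Sum.inr.injEq, Sum.inl.injEq, Subtype.mk.injEq] at h2
      obtain ⟨rfl, h3⟩ := Sigma.mk.inj h2
      exact h ⟨rfl, congrArg Fin.val (eq_of_heq h3).symm⟩
  · simp [isoVec]

theorem pos_isoVec (c u : ℂ) (I : S.IsoIdx) (s : Fin S.n) :
    S.pos (S.isoVec u c I) s
      = if (∃ h, I = Sum.inr (Sum.inr ⟨s, h⟩)) then c⁻¹ else 0 := by
  rcases I with j | a | s'
  · simp [isoVec, pos]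
  · simp [isoVec, pos]
  · simp only [isoVec, pos]
    by_cases h : s = s'.1
    · subst h
      rw [if_pos rfl, if_pos ⟨s'.2, rfl⟩]
    · rw [if_neg h, if_neg]
      rintro ⟨h1, h2⟩
      simp only [Sum.inr.injEq] at h2
      exact h (by rw [h2])

theorem coeff_of_dPol_eq {α : S.Times} {Q : Polynomial ℂ} (h : ∀ z, S.dPol α z = Q.eval z) {k : ℕ}
    (hk : k < S.rInf - 1) : S.dtime α none (k + 1) = Q.coeff k := by
  have e : Q = ∑ k ∈ Finset.range (S.rInf - 1),
      Polynomial.C (S.dtime α none (k + 1)) * Polynomial.X ^ k := by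
    refine Polynomial.funext fun z => ?_
    rw [← h, dPol, Polynomial.eval_finsetSum, Finset.range_eq_Ico]
    refine (Finset.sum_Ico_add' (fun k => S.dtime α none k * z ^ (k - 1)) 0 (S.rInf - 1)
      1).symm.trans (Finset.sum_congr rfl fun k _ => ?_)
    simp
  rw [e, Polynomial.finsetSum_coeff]
  simp only [Polynomial.coeff_C_mul, Polynomial.coeff_X_pow]
  rw [Finset.sum_eq_single_of_mem k (Finset.mem_range.2 hk)]
  · simp
  · intro l _ hl
    rw [if_neg (Ne.symm hl), mul_zero]

/-- The polynomial `dPol` of the vector of an isomonodromic time, in the variable `T₂ z + T₁`. -/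
def isoPoly : S.IsoIdx → Polynomial ℂ
  | Sum.inl j => Polynomial.X ^ (j : ℕ)
  | Sum.inr _ => 0

theorem dPol_isoVec (c u z : ℂ) (I : S.IsoIdx) :
    S.dPol (S.isoVec u c I) z = c * (isoPoly I).eval (c * z + u) := by
  rcases I with j | I
  · simp only [isoPoly, Polynomial.eval_pow, Polynomial.eval_X]
    have hj := j.2
    rw [dPol, add_pow, Finset.mul_sum,
      Finset.sum_subset (Finset.range_subset_range.2 (by omega : (j : ℕ) + 1 ≤ S.rInf - 1)),
      Finset.range_eq_Ico]
    · refine (Finset.sum_Ico_add' (fun k => S.dtime (S.isoVec u c (Sum.inl j)) none k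
        * z ^ (k - 1)) 0 (S.rInf - 1) 1).symm.trans (Finset.sum_congr rfl fun k hk => ?_)
      rw [dtime_isoVec_inf c u j (Finset.mem_Ico.1 hk).2, Nat.add_sub_cancel]
      ring
    · intro k _ hk
      rw [Nat.choose_eq_zero_of_lt (by simpa using hk)]; simp
  · simp [dPol, dtime_isoVec_inf_inr, isoPoly]

/-- The trivial times are constant along the vectors of the isomonodromic times. -/
theorem IsT2.fderiv_trivial_isoVec (hT : S.IsT2 T2 U) (hU : IsOpen U)
    (hadm : ∀ t ∈ U, S.Admissible t) (ht : t ∈ U) (I : S.IsoIdx) :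
    fderiv ℂ T2 t (S.isoVec (S.T1 T2 t) (T2 t) I) = 0 ∧
      fderiv ℂ (S.T1 T2) t (S.isoVec (S.T1 T2 t) (T2 t) I) = 0 := by
  have hd := hT.reducesDir hU hadm ht (S.isoVec (S.T1 T2 t) (T2 t) I)
  have hR := hT.reduces hadm ht 0
  have h0 := hT.ne_zero hadm ht
  have hr := S.rInf_pos
  -- the two highest times at infinity are constant along the vector
  have htop : ∀ k, S.rInf - 2 ≤ k → S.dtime (S.isoVec (S.T1 T2 t) (T2 t) I) none k = 0 := by
    intro k hk
    rcases I with j | I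
    · have hj := j.2
      obtain ⟨k, rfl⟩ : ∃ k', k = k' + 1 := ⟨k - 1, by omega⟩
      by_cases hk' : k < S.rInf - 1
      · rw [dtime_isoVec_inf _ _ _ hk', Nat.choose_eq_zero_of_lt (by omega)]; simp
      · exact S.dtime_of_lt _ _ (by simp only [ord]; omega)
    · exact dtime_isoVec_inf_inr _ _ _ _
  -- the poles that are normalized to `0` and `1` give one linear relation each
  have hfix : ∀ s : Fin S.n, ¬3 - S.rInf ≤ (s : ℕ) →
      fderiv ℂ T2 t (S.isoVec (S.T1 T2 t) (T2 t) I) * S.pos t s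
        + fderiv ℂ (S.T1 T2) t (S.isoVec (S.T1 T2 t) (T2 t) I) = 0 := by
    intro s hs
    have h1 := hd.pos_eq s
    rw [redVec, sum_smul_isoVec, pos_isoVec, if_neg fun h => hs h.1] at h1
    simp only [pos, canonGen, dif_neg hs] at h1 ⊢
    linear_combination -h1
  -- if `rInf = n = 1`, then `T₂` is determined by the leading time of the finite pole
  have hfin : ∀ s (k : Fin (S.r s - 1)), S.IsTrivialIdx ⟨s, k⟩ →
      fderiv ℂ T2 t (S.isoVec (S.T1 T2 t) (T2 t) I) = 0 := by
    intro s k h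
    have h1 := hd.dtime_fin s ((k : ℕ) + 1)
    rw [redVec, sum_smul_isoVec, dtime_canonGen_trivial _ _ s k h, dtime_isoVec_fin,
      if_neg fun h' => h'.1 h] at h1
    have h2 : S.dtime t (some s) ((k : ℕ) + 1) ≠ 0 := by
      have h3 : (k : ℕ) + 2 = S.r s := h.2.2
      rw [show (k : ℕ) + 1 = S.ord (some s) - 1 by simp only [ord]; omega]
      exact (hadm t ht).2 _ (by simp only [ord]; omega)
    have h3 : (((k : ℕ) + 1 : ℕ) : ℂ) ≠ 0 := Nat.cast_ne_zero.2 (by omega)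
    have h4 := pow_ne_zero ((k : ℕ) + 1 - 1) h0
    simp only [mul_zero, zero_add] at h1
    exact (mul_eq_zero.1 ((mul_eq_zero.1 h1.symm).resolve_right h2)).resolve_left
      (mul_ne_zero h3 h4)
  generalize S.isoVec (S.T1 T2 t) (T2 t) I = α at *
  have hν0 : S.nuVec t α none 0 = 0 := S.nuVec_none_zero (hadm t ht) fun _ => htop _ (by omega)
  have hν1 : S.nuVec t α none 1 = 0 :=
    S.nuVec_none_one (hadm t ht) (fun _ => htop _ (by omega)) fun _ => htop _ (by omega)
  have hda : 2 ≤ S.rInf → fderiv ℂ T2 t α = 0 := fun h2 => by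
    have h1 := hd.nuVec_inf_zero hR (hadm t ht) h2
    rw [hν0] at h1
    exact (mul_eq_zero.1 h1.symm).resolve_left (inv_ne_zero h0)
  obtain hr3 | hr2 | hr1 : 3 ≤ S.rInf ∨ S.rInf = 2 ∨ S.rInf = 1 := by omega
  · have h1 := (hd.nuVec_inf hR (hadm t ht) hr3).2
    rw [hν1] at h1
    exact ⟨hda (by omega), (mul_eq_zero.1 h1.symm).resolve_left (inv_ne_zero h0)⟩
  · have hn := S.one_le_n_of_rInf (by omega)
    have h1 := hfix ⟨0, by omega⟩ (by simp only; omega)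
    rw [hda (by omega), zero_mul, zero_add] at h1
    exact ⟨hda (by omega), h1⟩
  · have hn := S.one_le_n_of_rInf (by omega)
    have h1 := hfix ⟨0, by omega⟩ (by simp only; omega)
    have h2 : fderiv ℂ T2 t α = 0 := by
      by_cases hn1 : S.n = 1
      · let s0 : Fin S.n := ⟨0, by omega⟩
        have hs : ∑ s, S.r s = S.r s0 := by
          rw [Finset.sum_eq_single_of_mem s0 (Finset.mem_univ _)]
          exact fun s _ hs => absurd (Fin.ext (by have := s.2; simp only [s0]; omega)) hs
        have hg := S.genus_pos
        exact hfin s0 ⟨S.r s0 - 2, by omega⟩ ⟨hr1, hn1, by simp only; omega⟩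
      · have h3 := hfix ⟨1, by omega⟩ (by simp only; omega)
        have h4 : fderiv ℂ T2 t α * (S.pos t ⟨1, by omega⟩ - S.pos t ⟨0, by omega⟩) = 0 := by
          linear_combination h3 - h1
        refine (mul_eq_zero.1 h4).resolve_right fun h5 => ?_
        have := (hadm t ht).1 (sub_eq_zero.1 h5)
        simp at this
    rw [h2, zero_mul, zero_add] at h1
    exact ⟨h2, h1⟩

/-- The vectors of the isomonodromic times are dual to the isomonodromic times. Since the trivial times
are constant along these vectors, the relations of `ReducesDir` determine all the derivatives. -/
theorem IsT2.fderiv_isoTime_isoVec (hT : S.IsT2 T2 U) (hU : IsOpen U)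
    (hadm : ∀ t ∈ U, S.Admissible t) (ht : t ∈ U) (I J : S.IsoIdx) :
    fderiv ℂ (S.isoTime T2 J) t (S.isoVec (S.T1 T2 t) (T2 t) I) = if I = J then 1 else 0 := by
  have hd := hT.reducesDir hU hadm ht (S.isoVec (S.T1 T2 t) (T2 t) I)
  have hR := hT.reduces hadm ht 0
  have h0 := hT.ne_zero hadm ht
  obtain ⟨hda, hdb⟩ := hT.fderiv_trivial_isoVec hU hadm ht I
  rw [hda, hdb] at hd
  rw [redVec, sum_smul_isoVec] at hd
  set β : S.IsoIdx → ℂ := fun J => fderiv ℂ (S.isoTime T2 J) t (S.isoVec (S.T1 T2 t) (T2 t) I)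
    with hβ
  change β J = _
  rcases J with j | ⟨⟨s, k⟩, h⟩ | ⟨s, hs⟩
  · have hj := j.2
    obtain ⟨C, hC⟩ := hd.aPol_eq
    simp only [zero_mul, mul_zero, add_zero] at hC
    rw [← dtime_canonGen_inf 0 β j, coeff_of_dPol_eq (Q := isoPoly I) (fun z => ?_) (by omega)]
    · rcases I with i | I
      · simp only [isoPoly, Polynomial.coeff_X_pow, Sum.inl.injEq]
        refine if_congr ⟨fun e => Fin.ext e.symm, fun e => by rw [e]⟩ rfl rfl
      · simp [isoPoly]
    · -- compare the derivatives of the two primitives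
      obtain ⟨w, rfl⟩ : ∃ w, z = T2 t * w + S.T1 T2 t :=
        ⟨(T2 t)⁻¹ * (z - S.T1 T2 t), by field_simp; ring⟩
      have h1 : HasDerivAt (fun w => T2 t * w + S.T1 T2 t) (T2 t) w := by
        simpa using ((hasDerivAt_id w).const_mul (T2 t)).add_const (S.T1 T2 t)
      have h2 := ((S.aPol_hasDerivAt_right (S.canonGen 0 β) (T2 t * w + S.T1 T2 t)).comp w
        h1).add_const C
      have h3 := S.aPol_hasDerivAt_right (S.isoVec (S.T1 T2 t) (T2 t) I) w
      have h4 : (fun w => S.aPol (S.isoVec (S.T1 T2 t) (T2 t) I) w) = _ := funext hC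
      rw [h4] at h3
      have h5 := h3.unique h2
      rw [dPol_isoVec, mul_comm] at h5
      exact (mul_right_cancel₀ h0 h5).symm
  · rw [← dtime_canonGen_fin 0 β s k h, hd.dtime_fin, dtime_isoVec_fin]
    simp only [mul_zero, zero_mul, add_zero]
    by_cases hI : I = Sum.inr (Sum.inl ⟨⟨s, k⟩, h⟩)
    · rw [if_pos ⟨h, hI⟩, if_pos hI, mul_inv_cancel₀ (pow_ne_zero _ h0)]
    · rw [if_neg fun h' => hI h'.2, if_neg hI, mul_zero]
  · have h1 := hd.pos_eq s
    rw [pos_isoVec] at h1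
    have h2 : S.pos (S.canonGen 0 β) s = β (Sum.inr (Sum.inr ⟨s, hs⟩)) := by
      simp only [pos, canonGen, dif_pos hs]
    rw [← h2, h1]
    simp only [zero_mul, add_zero]
    by_cases hI : I = Sum.inr (Sum.inr ⟨s, hs⟩)
    · rw [if_pos ⟨hs, hI⟩, if_pos hI, mul_inv_cancel₀ h0]
    · rw [if_neg fun h' => hI h'.2, if_neg hI, mul_zero]

end PoleData

theorem fderiv_apply_eq_of_line {E : Type*} [NormedAddCommGroup E] [NormedSpace ℂ E] {f : E → ℂ}
    {x u : E} {d : ℂ} (hf : DifferentiableAt ℂ f x)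
    (h : HasDerivAt (fun s : ℂ => f (x + s • u)) d 0) : fderiv ℂ f x u = d :=
  (hf.hasFDerivAt.hasLineDerivAt u).unique h

/-! ### A primitive of `P₁` up to logarithms -/

namespace PoleData

variable {S : PoleData} {T2 : S.Times → ℂ} {U : Set S.Times} {t : S.Times} {m : S.Mono}

theorem primDir_add_smul (t α β : S.Times) (c z : ℂ) :
    S.primDir m t (α + c • β) z = S.primDir m t α z + c * S.primDir m t β z := by
  have h : ∀ p k, S.trTime 0 (α + c • β) p k = S.trTime 0 α p k + c * S.trTime 0 β p k :=
    fun p k => by simp only [trTime, time_zero_add_smul]; ring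
  simp only [primDir, h, add_div, add_mul, pos, Pi.add_apply, Pi.smul_apply, smul_eq_mul,
    Finset.sum_add_distrib, mul_div_assoc, mul_assoc, ← Finset.mul_sum]
  ring

theorem primDir_sum {ι : Type*} (s : Finset ι) (t : S.Times) (v : ι → S.Times) (β : ι → ℂ) (z : ℂ) :
    S.primDir m t (∑ i ∈ s, β i • v i) z = ∑ i ∈ s, β i * S.primDir m t (v i) z := by
  classical
  induction s using Finset.induction_on with
  | empty => simpa using primDir_add_smul (m := m) t 0 0 (-1) z
  | insert i s hi ih =>
    rw [Finset.sum_insert hi, Finset.sum_insert hi, ← ih, add_comm, primDir_add_smul, add_comm]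

variable (S) in
/-- The rational part of a primitive of `P₁`: the logarithms are left out. -/
def ratPrim (m : S.Mono) (t : S.Times) (z : ℂ) : ℂ :=
  -(∑ k ∈ Finset.Icc 1 (S.rInf - 1), S.trTime m t none k / k * z ^ k)
    - ∑ s, ∑ k ∈ Finset.Icc 1 (S.r s - 1), S.trTime m t (some s) k / k * (z - S.pos t s)⁻¹ ^ k

theorem hasDerivAt_trTime {v : ℂ → S.Times} {α : S.Times} {s : ℂ}
    (hv : ∀ i, HasDerivAt (fun s => v s i) (α i) s) (p : S.Pole) (k : ℕ) :
    HasDerivAt (fun s => S.trTime m (v s) p k) (S.trTime 0 α p k) s := by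
  unfold trTime time
  split_ifs
  · simpa using hasDerivAt_const _ _
  · exact (hv _).add (hv _)
  · simpa using hasDerivAt_const _ _

/-- The derivative of the rational part of the primitive; the last sum is the contribution of the
logarithms. -/
theorem hasDerivAt_ratPrim {v : ℂ → S.Times} {α : S.Times} {q : ℂ → ℂ} {q' s : ℂ}
    (hv : ∀ i, HasDerivAt (fun s => v s i) (α i) s) (hq : HasDerivAt q q' s)
    (h0 : ∀ i, q s ≠ S.pos (v s) i) :
    HasDerivAt (fun s => S.ratPrim m (v s) (q s))
      (S.P1 m (v s) (q s) * q' + S.primDir m (v s) α (q s)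
        - ∑ i, S.trTime m (v s) (some i) 0 * (q s - S.pos (v s) i)⁻¹ * (q' - S.pos α i)) s := by
  have h1 : HasDerivAt (fun s => ∑ k ∈ Finset.Icc 1 (S.rInf - 1),
      S.trTime m (v s) none k / k * q s ^ k)
        (∑ k ∈ Finset.Icc 1 (S.rInf - 1), S.trTime 0 α none k / k * q s ^ k
        + (∑ k ∈ Finset.Icc 1 (S.rInf - 1), S.trTime m (v s) none k * q s ^ (k - 1)) * q') s := by
    rw [Finset.sum_mul, ← Finset.sum_add_distrib]
    refine HasDerivAt.fun_sum fun k hk => ?_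
    have : (k : ℂ) ≠ 0 := Nat.cast_ne_zero.2 (by have := Finset.mem_Icc.1 hk; omega)
    refine (((hasDerivAt_trTime hv none k).div_const (k : ℂ)).mul (hq.pow k)).congr_deriv ?_
    simp only [Pi.pow_apply]
    field_simp
  have h2 : ∀ i, HasDerivAt (fun s => ∑ k ∈ Finset.Icc 1 (S.r i - 1),
      S.trTime m (v s) (some i) k / k * (q s - S.pos (v s) i)⁻¹ ^ k)
        (∑ k ∈ Finset.Icc 1 (S.r i - 1),
        (S.trTime 0 α (some i) k / k * (q s - S.pos (v s) i)⁻¹ ^ k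
          - S.trTime m (v s) (some i) k * (q s - S.pos (v s) i)⁻¹ ^ (k + 1)
            * (q' - S.pos α i))) s := by
    intro i
    refine HasDerivAt.fun_sum fun k hk => ?_
    obtain ⟨k, rfl⟩ : ∃ k', k = k' + 1 := ⟨k - 1, by have := Finset.mem_Icc.1 hk; omega⟩
    have : ((k + 1 : ℕ) : ℂ) ≠ 0 := Nat.cast_ne_zero.2 (by omega)
    have h3 := ((hq.sub (hv (Sum.inr i))).inv (sub_ne_zero.2 (h0 i))).pow (k + 1)
    refine (((hasDerivAt_trTime hv (some i) (k + 1)).div_const ((k + 1 : ℕ) : ℂ)).mul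
      h3).congr_deriv ?_
    simp only [Pi.pow_apply, Pi.sub_apply, Pi.inv_apply, Nat.add_sub_cancel, pos]
    rw [div_eq_mul_inv (-_), ← inv_pow]
    generalize (q s - v s (Sum.inr i))⁻¹ = w
    field_simp
    ring
  refine (h1.neg.sub (HasDerivAt.fun_sum fun i _ => h2 i)).congr_deriv ?_
  have h3 : ∀ i, ∑ k ∈ Finset.range (S.r i), S.trTime m (v s) (some i) k
      * (q s - S.pos (v s) i)⁻¹ ^ (k + 1)
      = S.trTime m (v s) (some i) 0 * (q s - S.pos (v s) i)⁻¹
        + ∑ k ∈ Finset.Icc 1 (S.r i - 1), S.trTime m (v s) (some i) k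
          * (q s - S.pos (v s) i)⁻¹ ^ (k + 1) := by
    intro i
    obtain ⟨r', hr⟩ := Nat.exists_eq_add_of_le' (S.r_pos i)
    rw [hr, Finset.sum_range_succ', Nat.add_sub_cancel, zero_add, pow_one, add_comm,
      Finset.range_eq_Ico]
    congr 1
    exact Finset.sum_Ico_add' (fun k => S.trTime m (v s) (some i) k
      * (q s - S.pos (v s) i)⁻¹ ^ (k + 1)) 0 r' 1
  have h4 : S.P1 m (v s) (q s)
      = -(∑ k ∈ Finset.Icc 1 (S.rInf - 1), S.trTime m (v s) none k * q s ^ (k - 1))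
        + ∑ i, ∑ k ∈ Finset.range (S.r i), S.trTime m (v s) (some i) k
          * (q s - S.pos (v s) i)⁻¹ ^ (k + 1) := by
    rw [P1]
    congr 1
    exact Finset.sum_congr rfl fun i _ => Finset.sum_congr rfl fun k _ => by
      rw [div_eq_mul_inv, inv_pow]; rfl
  rw [h4, primDir]
  generalize ∑ k ∈ Finset.Icc 1 (S.rInf - 1), S.trTime m (v s) none k * q s ^ (k - 1) = A
  simp only [h3, Finset.sum_add_distrib, Finset.sum_sub_distrib, ← Finset.sum_mul, mul_add,
    add_mul, mul_sub]
  simp only [Finset.mul_sum, mul_comm]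
  ring

/-! ### Differentials of the shifted Darboux coordinates -/

section Frame

variable {x : S.Phase}

theorem hasDerivAt_line_times (x u : S.Phase) (i : S.TimeIdx) :
    HasDerivAt (fun s : ℂ => (x + s • u).2.2 i) (u.2.2 i) 0 := by
  simpa using ((hasDerivAt_id (0 : ℂ)).mul_const (u.2.2 i)).const_add (x.2.2 i)

theorem hasDerivAt_line_fst (x u : S.Phase) (j : Fin S.g) :
    HasDerivAt (fun s : ℂ => (x + s • u).1 j) (u.1 j) 0 := by
  simpa using ((hasDerivAt_id (0 : ℂ)).mul_const (u.1 j)).const_add (x.1 j)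

theorem hasDerivAt_line_snd (x u : S.Phase) (j : Fin S.g) :
    HasDerivAt (fun s : ℂ => (x + s • u).2.1 j) (u.2.1 j) 0 := by
  simpa using ((hasDerivAt_id (0 : ℂ)).mul_const (u.2.1 j)).const_add (x.2.1 j)

theorem fderiv_comp_times {F : S.Times → ℂ} (hF : DifferentiableAt ℂ F x.2.2) (u : S.Phase) :
    fderiv ℂ (fun y : S.Phase => F y.2.2) x u = fderiv ℂ F x.2.2 u.2.2 := by
  refine fderiv_apply_eq_of_line (S.differentiableAt_comp_times hF) ?_
  exact hF.hasFDerivAt.hasLineDerivAt u.2.2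

theorem contDiffAt_qCheck (h2 : ContDiffAt ℂ 2 T2 x.2.2) (h1 : ContDiffAt ℂ 2 (S.T1 T2) x.2.2)
    (j : Fin S.g) : ContDiffAt ℂ 2 (S.qCheck T2 j) x := by
  have ht : ContDiffAt ℂ 2 (fun y : S.Phase => y.2.2) x := by fun_prop
  have hq : ContDiffAt ℂ 2 (fun y : S.Phase => y.1 j) x := by fun_prop
  have e2 : ContDiffAt ℂ 2 (fun y : S.Phase => T2 y.2.2) x := ContDiffAt.comp x h2 ht
  have e1 : ContDiffAt ℂ 2 (fun y : S.Phase => S.T1 T2 y.2.2) x := ContDiffAt.comp x (g := S.T1 T2) h1 ht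
  exact (e2.mul hq).add e1

theorem fderiv_qCheck (h2 : ContDiffAt ℂ 2 T2 x.2.2) (h1 : ContDiffAt ℂ 2 (S.T1 T2) x.2.2)
    (j : Fin S.g) (u : S.Phase) : fderiv ℂ (S.qCheck T2 j) x u
      = T2 x.2.2 * u.1 j + fderiv ℂ T2 x.2.2 u.2.2 * x.1 j + fderiv ℂ (S.T1 T2) x.2.2 u.2.2 := by
  have hd := (contDiffAt_qCheck h2 h1 j).differentiableAt two_ne_zero
  refine fderiv_apply_eq_of_line hd ?_
  have e : ∀ {F : S.Times → ℂ}, ContDiffAt ℂ 2 F x.2.2 →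
      HasDerivAt (fun s : ℂ => F (x + s • u).2.2) (fderiv ℂ F x.2.2 u.2.2) 0 := fun hF =>
    (hF.differentiableAt two_ne_zero).hasFDerivAt.hasLineDerivAt u.2.2
  refine (((e h2).mul (hasDerivAt_line_fst x u j)).add (e h1)).congr_deriv ?_
  simp only [zero_smul, add_zero]
  ring

theorem differentiableAt_pCheck (h2 : DifferentiableAt ℂ T2 x.2.2) (h0 : T2 x.2.2 ≠ 0)
    (hX : ∀ j s, x.1 j ≠ S.pos x.2.2 s) (j : Fin S.g) :
    DifferentiableAt ℂ (S.pCheck m T2 j) x := by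
  have hp : DifferentiableAt ℂ (fun y : S.Phase => y.2.1 j) x := by fun_prop
  have hP : DifferentiableAt ℂ (fun y : S.Phase => S.P1 m y.2.2 (y.1 j) / 2) x := by
    simpa only [div_eq_mul_inv] using (S.differentiableAt_P1 m (hX j)).mul_const (2 : ℂ)⁻¹
  exact ((S.differentiableAt_comp_times h2).inv h0).mul (hp.sub hP)

theorem fderiv_pCheck_vertical (h2 : DifferentiableAt ℂ T2 x.2.2) (h0 : T2 x.2.2 ≠ 0)
    (hX : ∀ j s, x.1 j ≠ S.pos x.2.2 s) (j : Fin S.g) (w : Fin S.g → ℂ) :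
    fderiv ℂ (S.pCheck m T2 j) x (0, w, 0) = (T2 x.2.2)⁻¹ * w j := by
  refine fderiv_apply_eq_of_line (differentiableAt_pCheck h2 h0 hX j) ?_
  have h := ((hasDerivAt_line_snd x (0, w, 0) j).sub_const
    (S.P1 m x.2.2 (x.1 j) / 2)).const_mul (T2 x.2.2)⁻¹
  refine h.congr_of_eventuallyEq (Eventually.of_forall fun s => ?_)
  simp [pCheck]

end Frame

end PoleData

/-! ### The free coefficients of the Hamiltonians -/

namespace PoleData

variable {S : PoleData} {T2 : S.Times → ℂ} {U : Set S.Times} {t : S.Times} {m : S.Mono} {ħ : ℂ}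
  {x y : S.Phase}

theorem mem_regular (hadm : ∀ t ∈ U, S.Admissible t) (hx : x ∈ S.phaseDomain U) : x ∈ S.regular :=
  ⟨hadm _ hx.1, hx.2⟩

theorem eventually_mem_phaseDomain (hU : IsOpen U) (hx : x ∈ S.phaseDomain U) :
    ∀ᶠ y in 𝓝 x, y ∈ S.phaseDomain U :=
  (S.isOpen_regular_of hU).mem_nhds hx

variable (S) in
/-- The comparison of `Ham ħ m 0 α` at `x` with the Hamiltonian of the reduced deformation at the
reduced point. -/
def timeDefect (ħ : ℂ) (m : S.Mono) (T2 : S.Times → ℂ) (α : S.Times) (x : S.Phase) : ℂ :=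
  S.hamDefect ħ m (S.canonMono m) (S.canonTimes fun I => S.isoTime T2 I x.2.2) (T2 x.2.2)
    (S.T1 T2 x.2.2) α (redVec T2 x.2.2 α) (fderiv ℂ T2 x.2.2 α) (fderiv ℂ (S.T1 T2) x.2.2 α) x

theorem IsT2.timeDefect_congr (hT : S.IsT2 T2 U) (hU : IsOpen U) (hadm : ∀ t ∈ U, S.Admissible t)
    (hm : ∑ p, ∑ i, m p i = 0) (hx : x ∈ S.phaseDomain U) (hy : y ∈ S.phaseDomain U)
    (hxy : x.2.2 = y.2.2) (α : S.Times) :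
    S.timeDefect ħ m T2 α x = S.timeDefect ħ m T2 α y := by
  simp only [timeDefect, ← hxy]
  exact (hT.reduces hadm hx.1 m).hamDefect_eq hxy (hT.reducesDir hU hadm hx.1 α) hm
    (mem_regular hadm hx) (mem_regular hadm hy)

theorem IsT2.reduce_mem (hT : S.IsT2 T2 U) (hadm : ∀ t ∈ U, S.Admissible t)
    (hx : x ∈ S.phaseDomain U) :
    (((S.reduce m T2 x).1, (S.reduce m T2 x).2.1, S.canonTimes (S.reduce m T2 x).2.2) : S.Phase)
      ∈ S.regular :=
  (hT.reduces hadm hx.1 m).redPoint_mem (mem_regular hadm hx)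

theorem Ham_redVec (ħ : ℂ) (m : S.Mono) (T2 : S.Times → ℂ) (t α : S.Times) (hx : x ∈ S.regular) :
    S.Ham ħ m (fun _ => 0) (redVec T2 t α) x
      = ∑ I, fderiv ℂ (S.isoTime T2 I) t α * S.Ham ħ m (fun _ => 0) (S.isoVec 0 1 I) x := by
  have h := S.Ham_sum ħ m Finset.univ (fun _ _ => 0) (fun I => S.isoVec 0 1 I)
    (fun I => fderiv ℂ (S.isoTime T2 I) t α) hx
  simpa only [redVec, mul_zero, Finset.sum_const_zero] using h

theorem IsT2.timeDefect_eq (hT : S.IsT2 T2 U) (hadm : ∀ t ∈ U, S.Admissible t)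
    (hx : x ∈ S.phaseDomain U) (α : S.Times) :
    S.timeDefect ħ m T2 α x = S.Ham ħ m (fun _ => 0) α x
      - ∑ I, fderiv ℂ (S.isoTime T2 I) x.2.2 α * S.HamIso ħ m I (S.reduce m T2 x)
      + ħ * ∑ j, (S.primDir m x.2.2 α (x.1 j) / 2 + S.pCheck m T2 j x
        * (fderiv ℂ T2 x.2.2 α * x.1 j + fderiv ℂ (S.T1 T2) x.2.2 α)) := by
  rw [timeDefect, hamDefect, Ham_redVec ħ _ T2 _ _
    ((hT.reduces hadm hx.1 m).redPoint_mem (mem_regular hadm hx))]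
  rfl

theorem differentiableAt_trTime (m : S.Mono) (p : S.Pole) (k : ℕ) (t : S.Times) :
    DifferentiableAt ℂ (fun t => S.trTime m t p k) t :=
  (S.differentiableAt_time m p 0 k t).fun_add (S.differentiableAt_time m p 1 k t)

theorem differentiableAt_primDir (m : S.Mono) (α : S.Times) {j : Fin S.g}
    (h : ∀ s, x.1 j ≠ S.pos x.2.2 s) :
    DifferentiableAt ℂ (fun x : S.Phase => S.primDir m x.2.2 α (x.1 j)) x := by
  have ht := fun p k => S.differentiableAt_comp_times (differentiableAt_trTime m p k x.2.2)
  have hX := fun s => S.differentiableAt_comp_times (S.differentiableAt_pos s x.2.2)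
  have hq : DifferentiableAt ℂ (fun x : S.Phase => x.1 j) x := by fun_prop
  have hi := fun s => (hq.fun_sub (hX s)).fun_inv (sub_ne_zero.2 (h s))
  unfold primDir
  refine DifferentiableAt.fun_sub (DifferentiableAt.fun_neg (DifferentiableAt.fun_sum fun k _ =>
    (hq.fun_pow k).const_mul _)) (DifferentiableAt.fun_sum fun s _ => DifferentiableAt.fun_add
    (DifferentiableAt.fun_sum fun k _ => ((hi s).fun_pow k).const_mul _)
    (DifferentiableAt.const_mul (DifferentiableAt.fun_sum fun k _ =>
      (ht _ _).fun_mul ((hi s).fun_pow _)) _))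

theorem differentiableAt_fderiv_apply {F : S.Times → ℂ} (hF : ContDiffAt ℂ 2 F x.2.2)
    (α : S.Times) : DifferentiableAt ℂ (fun y : S.Phase => fderiv ℂ F y.2.2 α) x := by
  have h : DifferentiableAt ℂ (fderiv ℂ F) x.2.2 :=
    (hF.fderiv_right (m := 1) (by norm_num)).differentiableAt (by norm_num)
  exact S.differentiableAt_comp_times (F := fun t => fderiv ℂ F t α)
    (h.clm_apply (differentiableAt_const α))

theorem IsT2.differentiableAt_reduce (hT : S.IsT2 T2 U) (hU : IsOpen U)
    (hadm : ∀ t ∈ U, S.Admissible t) (hx : x ∈ S.phaseDomain U) :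
    DifferentiableAt ℂ (S.reduce m T2) x := by
  have h2 := hT.contDiffAt hU hadm hx.1
  refine DifferentiableAt.prodMk (differentiableAt_pi.2 fun j => ?_)
    (DifferentiableAt.prodMk (differentiableAt_pi.2 fun j => ?_) (differentiableAt_pi.2 fun I => ?_))
  · exact (contDiffAt_qCheck h2 (hT.contDiffAt_T1 hU hadm hx.1) j).differentiableAt two_ne_zero
  · exact differentiableAt_pCheck (h2.differentiableAt two_ne_zero) (hT.ne_zero hadm hx.1) hx.2.2 j
  · exact S.differentiableAt_comp_times
      ((hT.contDiffAt_isoTime hU hadm I hx.1).differentiableAt two_ne_zero)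

theorem differentiable_canonTimes : Differentiable ℂ S.canonTimes := by
  refine differentiable_pi.2 fun i => ?_
  rcases i with ⟨_ | s, e, k⟩ | s <;> simp only [canonTimes] <;> split_ifs <;> fun_prop

theorem IsT2.differentiableAt_HamIso (hT : S.IsT2 T2 U) (hadm : ∀ t ∈ U, S.Admissible t)
    (hx : x ∈ S.phaseDomain U) (I : S.IsoIdx) :
    DifferentiableAt ℂ (S.HamIso ħ m I) (S.reduce m T2 x) := by
  have h := S.differentiableAt_Ham ħ (S.canonMono m) (c0 := fun _ => 0) (S.isoVec 0 1 I)
    (hT.reduce_mem (m := m) hadm hx) (differentiableAt_const _)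
  refine DifferentiableAt.fun_comp' (S.reduce m T2 x)
    (g := S.Ham ħ (S.canonMono m) (fun _ => 0) (S.isoVec 0 1 I))
    (f := fun y : S.Reduced => ((y.1, y.2.1, S.canonTimes y.2.2) : S.Phase)) h ?_
  have hc : DifferentiableAt ℂ (fun y : S.Reduced => S.canonTimes y.2.2) (S.reduce m T2 x) :=
    DifferentiableAt.fun_comp' _ (differentiable_canonTimes _) (by fun_prop)
  exact differentiableAt_fst.prodMk (DifferentiableAt.prodMk (by fun_prop) hc)

theorem IsT2.differentiableAt_timeDefect (hT : S.IsT2 T2 U) (hU : IsOpen U)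
    (hadm : ∀ t ∈ U, S.Admissible t) (hx : x ∈ S.phaseDomain U) (α : S.Times) :
    DifferentiableAt ℂ (S.timeDefect ħ m T2 α) x := by
  have h2 := hT.contDiffAt hU hadm hx.1
  have h1 := hT.contDiffAt_T1 hU hadm hx.1
  refine DifferentiableAt.congr_of_eventuallyEq ?_
    ((eventually_mem_phaseDomain hU hx).mono fun y hy => hT.timeDefect_eq hadm hy α)
  refine DifferentiableAt.fun_add (DifferentiableAt.fun_sub
    (S.differentiableAt_Ham ħ m α (mem_regular hadm hx) (differentiableAt_const _))
    (DifferentiableAt.fun_sum fun I _ => DifferentiableAt.fun_mul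
      (differentiableAt_fderiv_apply (hT.contDiffAt_isoTime hU hadm I hx.1) α)
      (DifferentiableAt.fun_comp' x (hT.differentiableAt_HamIso hadm hx I)
        (hT.differentiableAt_reduce hU hadm hx))))
    (DifferentiableAt.const_mul (DifferentiableAt.fun_sum fun j _ => ?_) _)
  have hq : DifferentiableAt ℂ (fun x : S.Phase => x.1 j) x := by fun_prop
  refine DifferentiableAt.fun_add ?_ (DifferentiableAt.fun_mul
    (differentiableAt_pCheck (h2.differentiableAt two_ne_zero) (hT.ne_zero hadm hx.1) hx.2.2 j)
    (((differentiableAt_fderiv_apply h2 α).fun_mul hq).fun_add (differentiableAt_fderiv_apply h1 α)))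
  simpa only [div_eq_mul_inv] using (differentiableAt_primDir m α (hx.2.2 j)).mul_const (2 : ℂ)⁻¹

open Classical in
variable (S) in
/-- The free coefficient `c_{∞, 0}` of the `i`-th deformation for which the Hamiltonians agree with
the reduced ones: the comparison term, which depends on the times only, divided by `ħ g`. It is
evaluated at an arbitrary admissible point over `t`. -/
def freeCoef (ħ : ℂ) (m : S.Mono) (T2 : S.Times → ℂ) (U : Set S.Times) (i : S.TimeIdx)
    (t : S.Times) : ℂ :=
  if h : ∃ x ∈ S.phaseDomain U, x.2.2 = t then
    S.timeDefect ħ m T2 (S.basisVec i) h.choose / (ħ * S.g) else 0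

theorem IsT2.freeCoef_eq (hT : S.IsT2 T2 U) (hU : IsOpen U) (hadm : ∀ t ∈ U, S.Admissible t)
    (hm : ∑ p, ∑ i, m p i = 0) (hx : x ∈ S.phaseDomain U) (i : S.TimeIdx) :
    S.freeCoef ħ m T2 U i x.2.2 = S.timeDefect ħ m T2 (S.basisVec i) x / (ħ * S.g) := by
  have h : ∃ y ∈ S.phaseDomain U, y.2.2 = x.2.2 := ⟨x, hx, rfl⟩
  rw [freeCoef, dif_pos h, hT.timeDefect_congr hU hadm hm h.choose_spec.1 hx h.choose_spec.2]

theorem exists_mem_phaseDomain (ht : t ∈ U) :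
    ∃ q : Fin S.g → ℂ, ((q, 0, t) : S.Phase) ∈ S.phaseDomain U := by
  have h : (Set.range (S.pos t))ᶜ.Infinite := (Set.finite_range _).infinite_compl
  exact ⟨fun j => h.natEmbedding _ j, ht,
    fun i j hij => Fin.val_injective ((h.natEmbedding _).injective (Subtype.ext hij)),
    fun j s hjs => (h.natEmbedding _ j).2 ⟨s, hjs.symm⟩⟩

theorem IsT2.differentiableOn_freeCoef (hT : S.IsT2 T2 U) (hU : IsOpen U)
    (hadm : ∀ t ∈ U, S.Admissible t) (hm : ∑ p, ∑ i, m p i = 0) (i : S.TimeIdx) :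
    DifferentiableOn ℂ (S.freeCoef ħ m T2 U i) U := by
  intro t ht
  obtain ⟨q, hq⟩ := S.exists_mem_phaseDomain ht
  have hι : DifferentiableAt ℂ (fun t : S.Times => ((q, 0, t) : S.Phase)) t :=
    (differentiableAt_const q).prodMk ((differentiableAt_const 0).prodMk differentiableAt_id)
  have hev : ∀ᶠ t' in 𝓝 t, ((q, 0, t') : S.Phase) ∈ S.phaseDomain U :=
    hι.continuousAt.eventually (eventually_mem_phaseDomain hU hq)
  refine DifferentiableAt.differentiableWithinAt (DifferentiableAt.congr_of_eventuallyEq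
    (f := fun t => S.timeDefect ħ m T2 (S.basisVec i) (q, 0, t) * (ħ * S.g)⁻¹) ?_
    (hev.mono fun t' h' =>
      (hT.freeCoef_eq hU hadm hm h' i).trans (div_eq_mul_inv _ _)))
  exact (DifferentiableAt.fun_comp' t (hT.differentiableAt_timeDefect hU hadm hq _) hι).mul_const _

/-- The Hamiltonians in terms of the reduced ones. -/
theorem IsT2.Ham_freeCoef (hT : S.IsT2 T2 U) (hU : IsOpen U) (hadm : ∀ t ∈ U, S.Admissible t)
    (hħ : ħ ≠ 0) (hm : ∑ p, ∑ i, m p i = 0) (hx : x ∈ S.phaseDomain U) (i : S.TimeIdx) :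
    S.Ham ħ m (S.freeCoef ħ m T2 U i) (S.basisVec i) x
      = ∑ I, fderiv ℂ (S.isoTime T2 I) x.2.2 (S.basisVec i) * S.HamIso ħ m I (S.reduce m T2 x)
      - ħ * ∑ j, (S.primDir m x.2.2 (S.basisVec i) (x.1 j) / 2 + S.pCheck m T2 j x
        * (fderiv ℂ T2 x.2.2 (S.basisVec i) * x.1 j
          + fderiv ℂ (S.T1 T2) x.2.2 (S.basisVec i))) := by
  have hg : (S.g : ℂ) ≠ 0 := Nat.cast_ne_zero.2 S.g_pos.ne'
  rw [S.Ham_eq_sub ħ m _ _ (mem_regular hadm hx), hT.freeCoef_eq hU hadm hm hx,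
    mul_div_cancel₀ _ (mul_ne_zero hħ hg), hT.timeDefect_eq hadm hx]
  ring

end PoleData

/-! ### Wedge products -/

section Wedge

variable {E : Type*} [NormedAddCommGroup E] [NormedSpace ℂ E] {f h : E → ℂ} {x : E}

theorem wedge_swap (f h : E → ℂ) (x u v : E) : wedge f h x u v = -wedge h f x u v := by
  rw [wedge, wedge]; ring

theorem wedge_const_left (c : ℂ) (h : E → ℂ) (x u v : E) : wedge (fun _ => c) h x u v = 0 := by
  simp [wedge]

theorem wedge_const_mul (hf : DifferentiableAt ℂ f x) (c : ℂ) (h : E → ℂ) (u v : E) :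
    wedge (fun y => c * f y) h x u v = c * wedge f h x u v := by
  rw [wedge, wedge, fderiv_const_mul hf]
  simp only [smul_apply, smul_eq_mul]
  ring

theorem wedge_inv_self (hf : DifferentiableAt ℂ f x) (h0 : f x ≠ 0) (c : ℂ) (u v : E) :
    wedge (fun y => c * (f y)⁻¹) f x u v = 0 := by
  have h : HasFDerivAt (fun y => c * (f y)⁻¹) (c • (-(f x ^ 2)⁻¹ • fderiv ℂ f x)) x :=
    ((hasDerivAt_inv h0).comp_hasFDerivAt x hf.hasFDerivAt).const_mul c
  rw [wedge, h.fderiv]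
  simp only [smul_apply, smul_eq_mul]
  ring

end Wedge

namespace PoleData

variable {S : PoleData} {T2 : S.Times → ℂ} {U : Set S.Times} {t : S.Times} {m : S.Mono} {ħ : ℂ}
  {x y : S.Phase}

theorem sum_smul_basisVec (α : S.Times) : ∑ i, α i • S.basisVec i = α := by
  funext k
  simp [basisVec, Finset.sum_apply, Pi.single_apply]

theorem sum_mul_fderiv_basisVec (L : S.Times →L[ℂ] ℂ) (α : S.Times) :
    ∑ i, α i * L (S.basisVec i) = L α := by
  conv_rhs => rw [← sum_smul_basisVec α, map_sum]
  simp

theorem sum_mul_primDir_basisVec (m : S.Mono) (t α : S.Times) (z : ℂ) :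
    ∑ i, α i * S.primDir m t (S.basisVec i) z = S.primDir m t α z := by
  rw [← primDir_sum, sum_smul_basisVec]

theorem contDiffAt_trTime (m : S.Mono) (p : S.Pole) (k : ℕ) (x : S.Phase) :
    ContDiffAt ℂ 2 (fun y : S.Phase => S.trTime m y.2.2 p k) x := by
  unfold trTime time
  split_ifs <;> fun_prop

theorem contDiffAt_sub_pos (j : Fin S.g) (s : Fin S.n) (x : S.Phase) :
    ContDiffAt ℂ 2 (fun y : S.Phase => y.1 j - S.pos y.2.2 s) x := by
  unfold pos; fun_prop

theorem contDiffAt_ratPrim (m : S.Mono) {j : Fin S.g} (h : ∀ s, x.1 j ≠ S.pos x.2.2 s) :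
    ContDiffAt ℂ 2 (fun y : S.Phase => S.ratPrim m y.2.2 (y.1 j)) x := by
  have hq : ContDiffAt ℂ 2 (fun y : S.Phase => y.1 j) x := by fun_prop
  unfold ratPrim
  refine ContDiffAt.sub (ContDiffAt.neg (ContDiffAt.sum fun k _ =>
    ((contDiffAt_trTime m _ k x).div_const _).mul (hq.pow k))) (ContDiffAt.sum fun s _ =>
      ContDiffAt.sum fun k _ => ((contDiffAt_trTime m _ k x).div_const _).mul
        (((contDiffAt_sub_pos j s x).inv (sub_ne_zero.2 (h s))).pow k))

theorem fderiv_sub_pos (j : Fin S.g) (s : Fin S.n) (x u : S.Phase) :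
    fderiv ℂ (fun y : S.Phase => y.1 j - S.pos y.2.2 s) x u = u.1 j - S.pos u.2.2 s :=
  fderiv_apply_eq_of_line ((contDiffAt_sub_pos j s x).differentiableAt two_ne_zero)
    ((hasDerivAt_line_fst x u j).sub (hasDerivAt_line_times x u (Sum.inr s)))

theorem fderiv_ratPrim (m : S.Mono) {j : Fin S.g} (h : ∀ s, x.1 j ≠ S.pos x.2.2 s) (u : S.Phase) :
    fderiv ℂ (fun y : S.Phase => S.ratPrim m y.2.2 (y.1 j)) x u
      = S.P1 m x.2.2 (x.1 j) * u.1 j + S.primDir m x.2.2 u.2.2 (x.1 j)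
        - ∑ s, S.trTime m x.2.2 (some s) 0 * (x.1 j - S.pos x.2.2 s)⁻¹
          * (u.1 j - S.pos u.2.2 s) := by
  refine fderiv_apply_eq_of_line ((contDiffAt_ratPrim m h).differentiableAt two_ne_zero) ?_
  have := hasDerivAt_ratPrim (m := m) (v := fun s : ℂ => (x + s • u).2.2)
    (q := fun s : ℂ => (x + s • u).1 j) (s := 0) (hasDerivAt_line_times x u)
    (hasDerivAt_line_fst x u j) (by simpa using h)
  simpa only [zero_smul, add_zero] using this

theorem fderiv_coord_fst (j : Fin S.g) (x u : S.Phase) :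
    fderiv ℂ (fun y : S.Phase => y.1 j) x u = u.1 j :=
  fderiv_apply_eq_of_line (by fun_prop) (hasDerivAt_line_fst x u j)

theorem fderiv_coord_snd (j : Fin S.g) (x u : S.Phase) :
    fderiv ℂ (fun y : S.Phase => y.2.1 j) x u = u.2.1 j :=
  fderiv_apply_eq_of_line (by fun_prop) (hasDerivAt_line_snd x u j)

theorem fderiv_coord_times (i : S.TimeIdx) (x u : S.Phase) :
    fderiv ℂ (fun y : S.Phase => y.2.2 i) x u = u.2.2 i :=
  fderiv_apply_eq_of_line (by fun_prop) (hasDerivAt_line_times x u i)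

/-! ### Comparison of the two-forms -/

/-- The Poincaré–Cartan forms `∑ Ham dt - ħ ∑ p dq` before and after the reduction differ by
`-ħ/2` times the differential of the sum of the values at the `q_j` of a primitive of `P₁`: its
rational part is `ratPrim`, the last sum comes from its logarithms. -/
theorem IsT2.cartan_eq (hT : S.IsT2 T2 U) (hU : IsOpen U) (hadm : ∀ t ∈ U, S.Admissible t)
    (hħ : ħ ≠ 0) (hm : ∑ p, ∑ i, m p i = 0) (hx : x ∈ S.phaseDomain U) (w : S.Phase) :
    (∑ i, S.Ham ħ m (S.freeCoef ħ m T2 U i) (S.basisVec i) x * w.2.2 i)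
      + (∑ j, -ħ * x.2.1 j * w.1 j)
      + (∑ I, -1 * S.HamIso ħ m I (S.reduce m T2 x) * fderiv ℂ (S.isoTime T2 I) x.2.2 w.2.2)
      + (∑ j, ħ * S.pCheck m T2 j x * fderiv ℂ (S.qCheck T2 j) x w)
      + (∑ j, ħ / 2 * fderiv ℂ (fun y : S.Phase => S.ratPrim m y.2.2 (y.1 j)) x w)
      + (∑ j, ∑ s, ħ / 2 * S.trTime m x.2.2 (some s) 0 * (x.1 j - S.pos x.2.2 s)⁻¹
        * (w.1 j - S.pos w.2.2 s)) = 0 := by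
  have h2 := hT.contDiffAt hU hadm hx.1
  have h1 := hT.contDiffAt_T1 hU hadm hx.1
  have h0 := hT.ne_zero hadm hx.1
  have e1 : ∑ i, S.Ham ħ m (S.freeCoef ħ m T2 U i) (S.basisVec i) x * w.2.2 i
      = (∑ I, S.HamIso ħ m I (S.reduce m T2 x) * fderiv ℂ (S.isoTime T2 I) x.2.2 w.2.2)
        - ħ * ∑ j, (S.primDir m x.2.2 w.2.2 (x.1 j) / 2 + S.pCheck m T2 j x
          * (fderiv ℂ T2 x.2.2 w.2.2 * x.1 j + fderiv ℂ (S.T1 T2) x.2.2 w.2.2)) := by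
    simp only [hT.Ham_freeCoef hU hadm hħ hm hx, sub_mul, Finset.sum_sub_distrib]
    congr 1
    · simp only [← sum_mul_fderiv_basisVec _ w.2.2, Finset.mul_sum, Finset.sum_mul]
      rw [Finset.sum_comm]
      exact Finset.sum_congr rfl fun _ _ => Finset.sum_congr rfl fun _ _ => by ring
    · simp only [← sum_mul_fderiv_basisVec _ w.2.2, ← sum_mul_primDir_basisVec m _ w.2.2,
        Finset.mul_sum, Finset.sum_mul, Finset.sum_div, ← Finset.sum_add_distrib]
      rw [Finset.sum_comm]
      exact Finset.sum_congr rfl fun _ _ => Finset.sum_congr rfl fun _ _ => by ring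
  have e2 : ∀ j, ∑ s, ħ / 2 * S.trTime m x.2.2 (some s) 0 * (x.1 j - S.pos x.2.2 s)⁻¹
        * (w.1 j - S.pos w.2.2 s)
      = ħ / 2 * ∑ s, S.trTime m x.2.2 (some s) 0 * (x.1 j - S.pos x.2.2 s)⁻¹
        * (w.1 j - S.pos w.2.2 s) := fun j => by
    rw [Finset.mul_sum]
    exact Finset.sum_congr rfl fun _ _ => by ring
  simp only [e1, e2, fderiv_ratPrim m (hx.2.2 _), fderiv_qCheck h2 h1, neg_mul, one_mul,
    Finset.sum_neg_distrib, Finset.mul_sum (s := (Finset.univ : Finset (Fin S.g)))]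
  have key : ∀ (a b c d : Fin S.g → ℂ) (h : ℂ), (∀ j, -a j - b j + c j + d j = 0) →
      h - ∑ j, a j + -∑ j, b j + -h + ∑ j, c j + ∑ j, d j = 0 := fun a b c d h hj => by
    have := Finset.sum_congr rfl fun j (_ : j ∈ Finset.univ) => hj j
    simp only [Finset.sum_add_distrib, Finset.sum_sub_distrib, Finset.sum_neg_distrib,
      Finset.sum_const_zero] at this
    linear_combination this
  rw [add_assoc, ← Finset.sum_add_distrib]
  refine key _ _ _ _ _ fun j => ?_
  simp only [pCheck]
  field_simp
  ring

/-- The fundamental two-form descends to the reduced space. -/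
theorem IsT2.Omega_eq_OmegaIso (hT : S.IsT2 T2 U) (hU : IsOpen U)
    (hadm : ∀ t ∈ U, S.Admissible t) (hħ : ħ ≠ 0) (hm : ∑ p, ∑ i, m p i = 0)
    (hx : x ∈ S.phaseDomain U) (u v : S.Phase) :
    S.Omega ħ m (S.freeCoef ħ m T2 U) x u v = S.OmegaIso ħ m T2 x u v := by
  have h2 := fun {y : S.Phase} (hy : y ∈ S.phaseDomain U) => hT.contDiffAt hU hadm hy.1
  have h1 := fun {y : S.Phase} (hy : y ∈ S.phaseDomain U) => hT.contDiffAt_T1 hU hadm hy.1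
  have hiso := fun {y : S.Phase} (hy : y ∈ S.phaseDomain U) (I : S.IsoIdx) =>
    hT.contDiffAt_isoTime hU hadm I hy.1
  have hHam : ∀ i, DifferentiableAt ℂ (S.Ham ħ m (S.freeCoef ħ m T2 U i) (S.basisVec i)) x :=
    fun i => S.differentiableAt_Ham ħ m _ (mem_regular hadm hx)
      ((hT.differentiableOn_freeCoef hU hadm hm i).differentiableAt (hU.mem_nhds hx.1))
  have hp : ∀ j, DifferentiableAt ℂ (fun y : S.Phase => y.2.1 j) x := fun j => by fun_prop
  have hHI : ∀ I, DifferentiableAt ℂ (fun y => S.HamIso ħ m I (S.reduce m T2 y)) x := fun I =>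
    DifferentiableAt.fun_comp' x (hT.differentiableAt_HamIso hadm hx I)
      (hT.differentiableAt_reduce hU hadm hx)
  have hpc := differentiableAt_pCheck (m := m) ((h2 hx).differentiableAt two_ne_zero)
    (hT.ne_zero hadm hx.1) hx.2.2
  have hsub := fun j s => (contDiffAt_sub_pos j s x).differentiableAt two_ne_zero
  have hne := fun j s => sub_ne_zero.2 (hx.2.2 j s)
  -- differentiate `cartan_eq`; the terms of the primitive have a constant coefficient, those of the
  -- logarithms are of the form `c u⁻¹ du`, so that neither contributes
  have key := sum_wedge_eq_zero
    (ι := S.TimeIdx ⊕ Fin S.g ⊕ S.IsoIdx ⊕ Fin S.g ⊕ Fin S.g ⊕ (Fin S.g × Fin S.n)) (x := x)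
    (f := Sum.elim (fun i => S.Ham ħ m (S.freeCoef ħ m T2 U i) (S.basisVec i)) <|
      Sum.elim (fun j y => -ħ * y.2.1 j) <|
      Sum.elim (fun I y => -1 * S.HamIso ħ m I (S.reduce m T2 y)) <|
      Sum.elim (fun j y => ħ * S.pCheck m T2 j y) <| Sum.elim (fun _ _ => ħ / 2)
        fun a y => ħ / 2 * S.trTime m x.2.2 (some a.2) 0 * (y.1 a.1 - S.pos y.2.2 a.2)⁻¹)
    (h := Sum.elim (fun i y => y.2.2 i) <| Sum.elim (fun j y => y.1 j) <|
      Sum.elim (fun I y => S.isoTime T2 I y.2.2) <| Sum.elim (fun j => S.qCheck T2 j) <|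
      Sum.elim (fun j y => S.ratPrim m y.2.2 (y.1 j)) fun a y => y.1 a.1 - S.pos y.2.2 a.2)
    ?_ ?_ ?_ u v
  · simp only [Fintype.sum_sum_type, Sum.elim_inl, Sum.elim_inr, wedge_const_left,
      wedge_const_mul (hp _), wedge_const_mul (hHI _), wedge_const_mul (hpc _),
      wedge_inv_self (hsub _ _) (hne _ _), Finset.sum_const_zero, add_zero, ← Finset.mul_sum] at key
    rw [Omega, OmegaIso, Finset.sum_congr rfl fun j _ => wedge_swap (fun y : S.Phase => y.1 j) _ x u v,
      Finset.sum_congr rfl fun i _ => wedge_swap (fun y : S.Phase => y.2.2 i) _ x u v,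
      Finset.sum_congr rfl fun j _ => wedge_swap (S.qCheck T2 j) _ x u v,
      Finset.sum_congr rfl fun I _ => wedge_swap (fun y : S.Phase => S.isoTime T2 I y.2.2) _ x u v]
    simp only [Finset.sum_neg_distrib, Fintype.sum_sum_type]
    linear_combination key
  · rintro (i | j | I | j | j | a)
    · exact hHam i
    · exact (hp j).const_mul _
    · exact (hHI I).const_mul _
    · exact (hpc j).const_mul _
    · exact differentiableAt_const _
    · exact ((hsub a.1 a.2).fun_inv (hne _ _)).const_mul _
  · rintro (i | j | I | j | j | a)
    · exact (by fun_prop : ContDiffAt ℂ 2 (fun y : S.Phase => y.2.2 i) x)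
    · exact (by fun_prop : ContDiffAt ℂ 2 (fun y : S.Phase => y.1 j) x)
    · exact ContDiffAt.comp x (g := S.isoTime T2 I) (f := fun y : S.Phase => y.2.2) (hiso hx I)
        (by fun_prop)
    · exact contDiffAt_qCheck (h2 hx) (h1 hx) j
    · exact contDiffAt_ratPrim m (hx.2.2 j)
    · exact contDiffAt_sub_pos _ _ x
  · filter_upwards [eventually_mem_phaseDomain hU hx] with y hy w
    have htr : ∀ s, S.trTime m x.2.2 (some s) 0 = S.trTime m y.2.2 (some s) 0 := fun s => rfl
    simp only [Fintype.sum_sum_type, Sum.elim_inl, Sum.elim_inr, Fintype.sum_prod_type,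
      fderiv_coord_times, fderiv_coord_fst, fderiv_sub_pos, htr,
      fderiv_comp_times ((hiso hy _).differentiableAt two_ne_zero)]
    have := hT.cartan_eq hU hadm hħ hm hy w
    simp only [Fintype.sum_sum_type] at this
    linear_combination this

end PoleData

/-! ### Reduction of the Hamiltonian vector fields -/

namespace PoleData

variable {S : PoleData} {T2 : S.Times → ℂ} {U : Set S.Times} {t : S.Times} {m : S.Mono} {ħ : ℂ}
  {x y : S.Phase}

theorem IsT2.differentiableAt_Ham_freeCoef (hT : S.IsT2 T2 U) (hU : IsOpen U)
    (hadm : ∀ t ∈ U, S.Admissible t) (hm : ∑ p, ∑ i, m p i = 0) (hx : x ∈ S.phaseDomain U)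
    (i : S.TimeIdx) :
    DifferentiableAt ℂ (S.Ham ħ m (S.freeCoef ħ m T2 U i) (S.basisVec i)) x :=
  S.differentiableAt_Ham ħ m _ (mem_regular hadm hx)
    ((hT.differentiableOn_freeCoef hU hadm hm i).differentiableAt (hU.mem_nhds hx.1))

theorem fderiv_Ham_sum (hU : IsOpen U) (hadm : ∀ t ∈ U, S.Admissible t) (hx : x ∈ S.phaseDomain U)
    {c0 : S.TimeIdx → S.Times → ℂ}
    (hd : ∀ i, DifferentiableAt ℂ (S.Ham ħ m (c0 i) (S.basisVec i)) x) (α : S.Times) (w : S.Phase) :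
    fderiv ℂ (S.Ham ħ m (fun t => ∑ i, α i * c0 i t) α) x w
      = ∑ i, α i * fderiv ℂ (S.Ham ħ m (c0 i) (S.basisVec i)) x w := by
  have h : S.Ham ħ m (fun t => ∑ i, α i * c0 i t) α
      =ᶠ[𝓝 x] fun y => ∑ i, α i * S.Ham ħ m (c0 i) (S.basisVec i) y :=
    (eventually_mem_phaseDomain hU hx).mono fun y hy => by
      have := S.Ham_sum ħ m Finset.univ c0 S.basisVec α (mem_regular hadm hy)
      rwa [sum_smul_basisVec] at this
  rw [h.fderiv_eq, fderiv_fun_sum fun i _ => (hd i).const_mul _]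
  simp [fderiv_const_mul (hd _)]

theorem apply_vertical (L : S.Phase →L[ℂ] ℂ) (a b : Fin S.g → ℂ) :
    L (a, b, 0) = ∑ j, (a j * L (Pi.single j 1, 0, 0) + b j * L (0, Pi.single j 1, 0)) := by
  have h : ((a, b, 0) : S.Phase) = ∑ j, (a j • ((Pi.single j 1, 0, 0) : S.Phase)
      + b j • ((0, Pi.single j 1, 0) : S.Phase)) := by
    refine Prod.ext ?_ (Prod.ext ?_ ?_)
    · funext k; simp [Prod.fst_sum, Finset.sum_apply, Pi.single_apply]
    · funext k; simp [Prod.fst_sum, Prod.snd_sum, Finset.sum_apply, Pi.single_apply]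
    · simp [Prod.snd_sum]
  rw [h, map_sum]
  simp only [map_add, map_smul, smul_eq_mul]

/-- The Hamiltonian vector field of a deformation is in the kernel of the fundamental two-form, as
far as vertical vectors are concerned. -/
theorem Omega_evolution (hU : IsOpen U) (hadm : ∀ t ∈ U, S.Admissible t)
    (hx : x ∈ S.phaseDomain U) {c0 : S.TimeIdx → S.Times → ℂ}
    (hd : ∀ i, DifferentiableAt ℂ (S.Ham ħ m (c0 i) (S.basisVec i)) x) (α : S.Times)
    (a b : Fin S.g → ℂ) :
    S.Omega ħ m c0 x (a, b, 0) (S.evolution ħ m (fun t => ∑ i, α i * c0 i t) α x) = 0 := by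
  have h := fderiv_Ham_sum hU hadm hx hd α (a, b, 0)
  rw [apply_vertical] at h
  simp only [Omega, wedge, fderiv_coord_times, fderiv_coord_fst, fderiv_coord_snd, evolution,
    Pi.zero_apply, zero_mul, zero_sub, Pi.smul_apply, smul_eq_mul, Finset.sum_neg_distrib,
    sub_neg_eq_add, mul_assoc, ← Finset.mul_sum, ← h]
  rw [← mul_add, ← Finset.sum_add_distrib, Finset.sum_eq_zero fun j _ => ?_, mul_zero]
  ring

theorem IsT2.fderiv_reduce_vertical (hT : S.IsT2 T2 U) (hU : IsOpen U)
    (hadm : ∀ t ∈ U, S.Admissible t) (hx : x ∈ S.phaseDomain U) (a b : Fin S.g → ℂ) :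
    fderiv ℂ (S.reduce m T2) x (a, b, 0)
      = (fun j => fderiv ℂ (S.qCheck T2 j) x (a, b, 0),
        fun j => fderiv ℂ (S.pCheck m T2 j) x (a, b, 0), 0) := by
  have hr := (hT.differentiableAt_reduce (m := m) hU hadm hx).hasFDerivAt
  refine Prod.ext (funext fun j => ?_) (Prod.ext (funext fun j => ?_) (funext fun I => ?_))
  · have h := (hasFDerivAt_pi'.1 hr.fst j).fderiv
    exact (congrArg (fun L => L (a, b, 0)) h).symm
  · have h := (hasFDerivAt_pi'.1 hr.snd.fst j).fderiv
    exact (congrArg (fun L => L (a, b, 0)) h).symm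
  · have h := (hasFDerivAt_pi'.1 hr.snd.snd I).fderiv
    refine (congrArg (fun L => L (a, b, 0)) h).symm.trans ?_
    refine (fderiv_comp_times (F := S.isoTime T2 I)
      ((hT.contDiffAt_isoTime hU hadm I hx.1).differentiableAt two_ne_zero) (a, b, 0)).trans ?_
    simp

/-- The pairing of the reduced two-form with a vertical vector and a vector over `ħ α`. -/
theorem IsT2.OmegaIso_vertical (hT : S.IsT2 T2 U) (hU : IsOpen U)
    (hadm : ∀ t ∈ U, S.Admissible t) (hx : x ∈ S.phaseDomain U) (α : S.Times) {v : S.Phase}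
    (hv : v.2.2 = ħ • α) {a b a' b' : Fin S.g → ℂ}
    (ha : ∀ j, fderiv ℂ (S.qCheck T2 j) x (a, b, 0) = a' j)
    (hb : ∀ j, fderiv ℂ (S.pCheck m T2 j) x (a, b, 0) = b' j) :
    S.OmegaIso ħ m T2 x (a, b, 0) v
      = ħ * ((∑ j, (a' j * fderiv ℂ (S.pCheck m T2 j) x v - fderiv ℂ (S.qCheck T2 j) x v * b' j))
        + ∑ I, fderiv ℂ (S.isoTime T2 I) x.2.2 α
          * fderiv ℂ (S.HamIso ħ m I) (S.reduce m T2 x) (a', b', 0)) := by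
  have hH : ∀ I, fderiv ℂ (fun y => S.HamIso ħ m I (S.reduce m T2 y)) x (a, b, 0)
      = fderiv ℂ (S.HamIso ħ m I) (S.reduce m T2 x) (a', b', 0) := fun I => by
    rw [fderiv_fun_comp x (hT.differentiableAt_HamIso hadm hx I)
      (hT.differentiableAt_reduce hU hadm hx), ContinuousLinearMap.comp_apply,
      hT.fderiv_reduce_vertical hU hadm hx]
    simp only [ha, hb]
  have hτ : ∀ I u, fderiv ℂ (fun y : S.Phase => S.isoTime T2 I y.2.2) x u
      = fderiv ℂ (S.isoTime T2 I) x.2.2 u.2.2 := fun I u =>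
    fderiv_comp_times ((hT.contDiffAt_isoTime hU hadm I hx.1).differentiableAt two_ne_zero) u
  simp only [OmegaIso, wedge, hτ, hH, ha, hb, hv, map_zero, map_smul, smul_eq_mul, zero_mul,
    zero_sub, Finset.sum_neg_distrib, sub_neg_eq_add, mul_assoc, ← Finset.mul_sum]
  ring

theorem IsT2.fderiv_qCheck_evolution (hT : S.IsT2 T2 U) (hU : IsOpen U)
    (hadm : ∀ t ∈ U, S.Admissible t) (hħ : ħ ≠ 0) (hm : ∑ p, ∑ i, m p i = 0)
    (hx : x ∈ S.phaseDomain U) (α : S.Times) (j : Fin S.g) :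
    fderiv ℂ (S.qCheck T2 j) x
        (S.evolution ħ m (fun t => ∑ i, α i * S.freeCoef ħ m T2 U i t) α x)
      = ∑ I, fderiv ℂ (S.isoTime T2 I) x.2.2 α
        * fderiv ℂ (S.HamIso ħ m I) (S.reduce m T2 x) (0, Pi.single j 1, 0) := by
  have h2 := hT.contDiffAt hU hadm hx.1
  have h0 := hT.ne_zero hadm hx.1
  -- this vector is mapped to the coordinate vector of `p̌_j`
  have h := Omega_evolution hU hadm hx (hT.differentiableAt_Ham_freeCoef hU hadm (ħ := ħ) hm hx) α
    0 (T2 x.2.2 • Pi.single j 1)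
  rw [hT.Omega_eq_OmegaIso hU hadm hħ hm hx, hT.OmegaIso_vertical hU hadm hx α rfl
    (a' := 0) (b' := Pi.single j 1)
    (fun k => by simp [fderiv_qCheck h2 (hT.contDiffAt_T1 hU hadm hx.1)])
    (fun k => by
      rw [fderiv_pCheck_vertical (h2.differentiableAt two_ne_zero) h0 hx.2.2, Pi.smul_apply,
        smul_eq_mul, inv_mul_cancel_left₀ h0])] at h
  have h := (mul_eq_zero.1 h).resolve_left hħ
  simp only [Pi.zero_apply, zero_mul, zero_sub, Pi.single_apply, mul_ite, mul_one, mul_zero,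
    Finset.sum_neg_distrib, Finset.sum_ite_eq', Finset.mem_univ, if_true] at h
  linear_combination -h

theorem IsT2.fderiv_pCheck_evolution (hT : S.IsT2 T2 U) (hU : IsOpen U)
    (hadm : ∀ t ∈ U, S.Admissible t) (hħ : ħ ≠ 0) (hm : ∑ p, ∑ i, m p i = 0)
    (hx : x ∈ S.phaseDomain U) (α : S.Times) (j : Fin S.g) :
    fderiv ℂ (S.pCheck m T2 j) x
        (S.evolution ħ m (fun t => ∑ i, α i * S.freeCoef ħ m T2 U i t) α x)
      = -∑ I, fderiv ℂ (S.isoTime T2 I) x.2.2 α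
        * fderiv ℂ (S.HamIso ħ m I) (S.reduce m T2 x) (Pi.single j 1, 0, 0) := by
  have h2 := hT.contDiffAt hU hadm hx.1
  have h0 := hT.ne_zero hadm hx.1
  -- the second component is chosen so that the vector is mapped to a horizontal one
  have h := Omega_evolution hU hadm hx (hT.differentiableAt_Ham_freeCoef hU hadm (ħ := ħ) hm hx) α
    ((T2 x.2.2)⁻¹ • Pi.single j 1)
    (fun k => -T2 x.2.2 * fderiv ℂ (S.pCheck m T2 k) x ((T2 x.2.2)⁻¹ • Pi.single j 1, 0, 0))
  rw [hT.Omega_eq_OmegaIso hU hadm hħ hm hx, hT.OmegaIso_vertical hU hadm hx α rfl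
    (a' := Pi.single j 1) (b' := 0)
    (fun k => by
      simp [fderiv_qCheck h2 (hT.contDiffAt_T1 hU hadm hx.1), mul_inv_cancel_left₀ h0])
    (fun k => by
      set w : Fin S.g → ℂ := fun k =>
        -T2 x.2.2 * fderiv ℂ (S.pCheck m T2 k) x ((T2 x.2.2)⁻¹ • Pi.single j 1, 0, 0) with hw
      have e : (((T2 x.2.2)⁻¹ • Pi.single j 1, w, 0) : S.Phase)
          = ((T2 x.2.2)⁻¹ • Pi.single j 1, 0, 0) + (0, w, 0) := by simp
      rw [e, map_add, fderiv_pCheck_vertical (h2.differentiableAt two_ne_zero) h0 hx.2.2, hw,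
        Pi.zero_apply]
      simp only [neg_mul, mul_neg, inv_mul_cancel_left₀ h0, add_neg_cancel])] at h
  have h := (mul_eq_zero.1 h).resolve_left hħ
  simp only [Pi.zero_apply, mul_zero, sub_zero, Pi.single_apply, ite_mul, one_mul, zero_mul,
    Finset.sum_ite_eq', Finset.mem_univ, if_true] at h
  linear_combination h

end PoleData
end Isomono
end

theorem mainTheorem2 (S : Isomono.PoleData) (ħ : ℂ) (hħ : ħ ≠ 0) (m : S.Mono)
    (hm : ∑ p, ∑ i, m p i = 0)
    (U : Set S.Times) (hU : IsOpen U) (hadm : ∀ t ∈ U, S.Admissible t)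
    (T2 : S.Times → ℂ) (hT2 : S.IsT2 T2 U) :
    Fintype.card S.IsoIdx = S.g ∧
    (∀ t ∈ U, ∀ I J : S.IsoIdx, DifferentiableAt ℂ (S.isoTime T2 J) t ∧
      fderiv ℂ (S.isoTime T2 J) t (S.isoVec (S.T1 T2 t) (T2 t) I) = if I = J then 1 else 0) ∧
    (∀ x ∈ S.phaseDomain U, ∃! H, S.IsHSolution ħ m x H) ∧
    ∃ c0 : S.TimeIdx → S.Times → ℂ,
      (∀ i, DifferentiableOn ℂ (c0 i) U) ∧
      ∀ x ∈ S.phaseDomain U,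
        (∀ i, DifferentiableAt ℂ (S.Ham ħ m (c0 i) (S.basisVec i)) x) ∧
        DifferentiableAt ℂ (S.reduce m T2) x ∧
        (∀ I, DifferentiableAt ℂ (S.HamIso ħ m I) (S.reduce m T2 x)) ∧
        (∀ u v : S.Phase, S.Omega ħ m c0 x u v = S.OmegaIso ħ m T2 x u v) ∧
        ∀ (α : S.Times) (j : Fin S.g),
          fderiv ℂ (S.qCheck T2 j) x
              (S.evolution ħ m (fun t => ∑ i, α i * c0 i t) α x)
            = ∑ I, fderiv ℂ (S.isoTime T2 I) x.2.2 α
                * fderiv ℂ (S.HamIso ħ m I) (S.reduce m T2 x) (0, Pi.single j 1, 0) ∧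
          fderiv ℂ (S.pCheck m T2 j) x
              (S.evolution ħ m (fun t => ∑ i, α i * c0 i t) α x)
            = -∑ I, fderiv ℂ (S.isoTime T2 I) x.2.2 α
                * fderiv ℂ (S.HamIso ħ m I) (S.reduce m T2 x) (Pi.single j 1, 0, 0) := by
  refine ⟨S.card_isoIdx, fun t ht I J =>
    ⟨(hT2.contDiffAt_isoTime hU hadm J ht).differentiableAt two_ne_zero,
      hT2.fderiv_isoTime_isoVec hU hadm ht I J⟩,
    fun x hx => S.existsUnique_isHSolution ħ m (S.mem_regular hadm hx),
    S.freeCoef ħ m T2 U, hT2.differentiableOn_freeCoef hU hadm hm, fun x hx =>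
    ⟨hT2.differentiableAt_Ham_freeCoef hU hadm hm hx, hT2.differentiableAt_reduce hU hadm hx,
      hT2.differentiableAt_HamIso hadm hx, hT2.Omega_eq_OmegaIso hU hadm hħ hm hx,
      fun α j => ⟨hT2.fderiv_qCheck_evolution hU hadm hħ hm hx α j,
        hT2.fderiv_pCheck_evolution hU hadm hħ hm hx α j⟩⟩⟩
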